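/- **Setting.** Let $s,\beta\ge 0$, $g\in\mathbb R$, $K\in\mathbb R$ and an integer $m\ge 2$ be fixed. For an integer $N\ge 1$ and $r\ge 0$ put $R=N^{-r}$, $|x|_R=\max\{|x|,R\}$, $x^\perp=(-x_2,x_1)$ and $$\mathbf a_N(x)=N^{s/2-1}\frac{x^\perp}{|x|_R^{1+s}}\qquad (x\in\mathbb R^2).$$ *Microscopic dynamics.* On $L^2_{\rm as}(\mathbb R^{2N})$, with domain in $H^2$, let $$H_{N,R}=\sum_{j=1}^N\Big(-\mathrm i\nabla_j+\beta\sum_{k\ne j}\mathbf a_N(x_j-x_k)\Big)^2+\frac g2N\sum_{j=1}^N\sum_{k\neq j}|\mathbf a_N(x_j-x_k)|^2 .$$ *Effective dynamics.* For functions $u_1,\dots,u_N$ on $\mathbb R^2$ put $\rho=\sum_j|u_j|^2$, $\rho_\nabla=\sum_j|\nabla u_j|^2$, $\rho_\Delta=\sum_j|\Delta u_j|^2$, $J=\sum_j\mathrm i(u_j\nabla\overline u_j-\overline u_j\nabla u_j)$, $\omega=\sum_j|u_j\rangle\langle u_j|$, $\mathbf a_N[\rho]=\mathbf a_N*\rho$,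 $\mathbf a_N^2[\rho]=|\mathbf a_N|^2*\rho$. The effective equation is $$\mathrm i\partial_tu_j=(-\mathrm i\nabla+\beta\mathbf a_N[\rho])^2u_j+gN\mathbf a_N^2[\rho]u_j-\big[\beta\mathbf a_N*(2\beta\mathbf a_N[\rho]\rho+J)\big]u_j,\qquad 1\le j\le N .$$ A solution on $[0,T]$ means $u_j\in C([0,T],H^m(\mathbb R^2))$ with $\{u_j(0)\}_{j=1}^N$ orthonormal in $L^2(\mathbb R^2)$, the equation holding in $L^2$. *Energies and counting functional.* Let $E_N(t)=\langle\Psi_N(t),H_{N,R}\Psi_N(t)\rangle$ and $$\mathcal E_R^{\rm af}[\omega]=\operatorname{Tr}\big[(-\mathrm i\nabla+\beta\mathbf a_N[\rho])^2\omega\big]+\frac g2N\operatorname{Tr}\big[\mathbf a_N^2[\rho]\,\omega\big].$$ Let $p_l=\sum_j|u_j(t)\rangle\langle u_j(t)|$ acting on the variable $x_l$, $q_l=1-p_l$, let $P_N^{(k)}$ be the sum of all products over $l=1,\dots,N$ of one factor $p_l$ or $q_l$ for each $l$ with exactly $k$ factors $q$, and $$\alpha_m(t)=\Big\langle\Psi_N(t),\sum_{k=0}^N\sqrt{k/N}\;P_N^{(k)}\,\Psi_N(t)\Big\rangle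 .$$ (The subscript in $\alpha_m$ denotes the weight $k\mapsto\sqrt{k/N}$, not the Sobolev exponent $m$.) **Lemma (control of the kinetic energy of excited particles).** Suppose $g\ge 12\beta^2$. There is a constant $C>0$ depending only on $s,\beta,g,m,K$ (in particular not on $N,R,r,T,t$ or on the solutions) such that the following holds for all $N\ge 1$, $r\ge 0$ and $T$. Let $u$ be a solution of the effective equation on $[0,T]$ and let $\Psi_N$ be the solution of $\mathrm i\partial_t\Psi_N=H_{N,R}\Psi_N$ on $[0,T]$, with $\Psi_N(t)\in H^2\cap L^2_{\rm as}(\mathbb R^{2N})$ and the equation holding in $L^2$, and with $$\Psi_N(0)=\bigwedge_{j=1}^Nu_j(0)=\frac1{\sqrt{N!}}\sum_{\sigma\in S_N}\operatorname{sgn}(\sigma)\prod_{j=1}^Nu_{\sigma(j)}(0,x_j).$$ Then at every $t\in[0,T]$ at which one of the following holds: 1. $s(1+2r)+\tfrac12r<\tfrac14$ and $\|\rho\|_2^2,\ \|\rho_\nabla\|_1,\ \|\rho_\Delta\|_1\le KN$; 2. $s<\tfrac12\big(1-\tfrac1m\big)$, $\ \|\rho\|_p,\|\rho_\nabla\|_p\le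 KN^{1/p}$ for all $1\le p\le m+1$, and $\|u_j\|_{H^m}\le K$ for all $j$; 3. $s<\tfrac12$, the bounds in 1 on $\rho,\rho_\nabla,\rho_\Delta$ hold, and $\|\rho\|_\infty,\|\rho_\nabla\|_\infty\le K$; the function $q_1\Psi_N(t)$ has a weak gradient $\nabla_1q_1\Psi_N(t)\in L^2$ in the variable $x_1$, and $$\|\nabla_1q_1\Psi_N(t)\|^2\le C\left(\frac{\big|E_N(t)-\mathcal E_R^{\rm af}[\omega(t)]\big|}{N}+\alpha_m(t)+\frac1{\sqrt N}\right).$$ -/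

import Mathlib

noncomputable section

namespace MagneticFermions

open MeasureTheory Set Filter Topology
open scoped ENNReal ContDiff ComplexConjugate

/-- The plane `ℝ²` with its Euclidean norm. -/
abbrev Plane : Type := EuclideanSpace ℝ (Fin 2)

/-- The configuration space `(ℝ²)^N = ℝ^{2N}`; its measure `volume` is Lebesgue measure. -/
abbrev Config (N : ℕ) : Type := Fin N → Plane

/-! ### Weak derivatives and Sobolev spaces -/

section Sobolev

variable {V : Type*} [NormedAddCommGroup V] [NormedSpace ℝ V] [MeasureSpace V]

/-- `g` is the weak derivative of `f` in the direction `v`: both are locally integrable and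
`∫ (∂_v φ) f = - ∫ φ g` for every real test function `φ ∈ C_c^∞`. -/
def HasWeakDeriv (v : V) (f g : V → ℂ) : Prop :=
  LocallyIntegrable f volume ∧ LocallyIntegrable g volume ∧
    ∀ φ : V → ℝ, ContDiff ℝ ∞ φ → HasCompactSupport φ →
      ∫ x, (fderiv ℝ φ x v) • f x = - ∫ x, φ x • g x

open Classical in
/-- The weak derivative of `f` in the direction `v` (unique up to null sets; the zero function if
there is none, which never happens for the functions to which it is applied below). -/
def weakDeriv (v : V) (f : V → ℂ) : V → ℂ :=
  if h : ∃ g, HasWeakDeriv v f g then h.choose else 0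

/-- `f ∈ H^k`: `f` and all its weak derivatives of order at most `k` are in `L²`. -/
def MemSobolev : ℕ → (V → ℂ) → Prop
  | 0, f => MemLp f 2 volume
  | k + 1, f => MemLp f 2 volume ∧ ∀ v : V, ∃ g, HasWeakDeriv v f g ∧ MemSobolev k g

/-- The magnetic momentum `-i ∂_v + A` in the direction `v`, with `A` a real function. -/
def magMomentum (v : V) (A : V → ℝ) (f : V → ℂ) : V → ℂ :=
  fun x => -Complex.I * weakDeriv v f x + (A x : ℂ) * f x

/-- `F : ℝ → L²` is differentiable at `t` relative to `[0, T]`, with derivative `F'`. -/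
def HasL2DerivOn (T : ℝ) (F : ℝ → V → ℂ) (F' : V → ℂ) (t : ℝ) : Prop :=
  Tendsto (fun τ => eLpNorm (fun x => ((τ - t)⁻¹ : ℝ) • (F τ x - F t x) - F' x) 2 volume)
    (𝓝[Icc 0 T \ {t}] t) (𝓝 0)

end Sobolev

/-- The unit vector of the `c`-th coordinate of the plane. -/
def dir (c : Fin 2) : Plane := EuclideanSpace.single c 1

/-- The unit vector of the `c`-th coordinate of the `j`-th particle. -/
def dirN {N : ℕ} (j : Fin N) (c : Fin 2) : Config N := Pi.single j (dir c)

/-- The square of the `H^k(ℝ²)` norm, `∑_{n ≤ k} ∑_{c₁,…,c_n} ‖∂_{c_n} ⋯ ∂_{c₁} f‖²`. -/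
def sobolevNormSq : ℕ → (Plane → ℂ) → ℝ≥0∞
  | 0, f => eLpNorm f 2 volume ^ 2
  | k + 1, f => eLpNorm f 2 volume ^ 2 + ∑ c : Fin 2, sobolevNormSq k (weakDeriv (dir c) f)

/-! ### The interaction and the many-body Hamiltonian -/

/-- `x^⊥ = (-x₂, x₁)`. -/
def perp (x : Plane) : Plane := !₂[-x 1, x 0]

/-- The vector potential `a_N(x) = N^{s/2-1} x^⊥ / |x|_R^{1+s}`, `|x|_R = max(|x|, R)`. -/
def vecPot (N : ℕ) (R s : ℝ) (x : Plane) : Plane :=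
  ((N : ℝ) ^ (s / 2 - 1) * ((max ‖x‖ R) ^ (1 + s))⁻¹) • perp x

/-- The vector potential `β ∑_{k ≠ j} a_N(x_j - x_k)` felt by particle `j`. -/
def manyBodyPot (N : ℕ) (R s β : ℝ) (j : Fin N) (x : Config N) : Plane :=
  β • ∑ k ∈ Finset.univ.erase j, vecPot N R s (x j - x k)

/-- The Hamiltonian
`H_{N,R} = ∑_j (-i∇_j + β ∑_{k≠j} a_N(x_j-x_k))² + (g/2) N ∑_j ∑_{k≠j} |a_N(x_j-x_k)|²`. -/
def hamiltonian (N : ℕ) (R s β g : ℝ) (Ψ : Config N → ℂ) : Config N → ℂ := fun x =>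
  (∑ j : Fin N, ∑ c : Fin 2,
      magMomentum (dirN j c) (fun y => manyBodyPot N R s β j y c)
        (magMomentum (dirN j c) (fun y => manyBodyPot N R s β j y c) Ψ) x)
    + ((g / 2 * N * ∑ j : Fin N, ∑ k ∈ Finset.univ.erase j, ‖vecPot N R s (x j - x k)‖ ^ 2 : ℝ) : ℂ)
      * Ψ x

/-- `Ψ` belongs to the antisymmetric functions (almost everywhere). -/
def Antisymmetric {N : ℕ} (Ψ : Config N → ℂ) : Prop :=
  ∀ σ : Equiv.Perm (Fin N), ∀ᵐ x : Config N,
    Ψ (fun j => x (σ j)) = ((Equiv.Perm.sign σ : ℤ) : ℂ) * Ψ x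

/-- `Ψ` is a (strong) solution on `[0, T]` of `i ∂_t Ψ = H_{N,R} Ψ` in `L²_as(ℝ^{2N})`;
`H²` is the domain of `H_{N,R}` when `R > 0`. -/
structure IsSchrodingerSolution (N : ℕ) (R s β g T : ℝ) (Ψ : ℝ → Config N → ℂ) : Prop where
  regular : ∀ t ∈ Icc 0 T, MemSobolev 2 (Ψ t)
  antisymm : ∀ t ∈ Icc 0 T, Antisymmetric (Ψ t)
  equation : ∀ t ∈ Icc 0 T,
    HasL2DerivOn T Ψ (fun x => -Complex.I * hamiltonian N R s β g (Ψ t) x) t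

/-- The Slater determinant `(N!)^{-1/2} ∑_σ sgn(σ) ∏_j u_{σ(j)}(x_j)`. -/
def slater {N : ℕ} (u : Fin N → Plane → ℂ) : Config N → ℂ := fun x =>
  ((Real.sqrt (N.factorial : ℝ))⁻¹ : ℝ) *
    ∑ σ : Equiv.Perm (Fin N), ((Equiv.Perm.sign σ : ℤ) : ℂ) * ∏ j, u (σ j) (x j)

/-- The many-body energy `⟨Ψ, H_{N,R} Ψ⟩`. -/
def manyBodyEnergy (N : ℕ) (R s β g : ℝ) (Ψ : Config N → ℂ) : ℝ :=
  (∫ x, conj (Ψ x) * hamiltonian N R s β g Ψ x).re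

/-! ### Orbitals, the effective equation and its energy -/

section Orbitals

variable {N : ℕ}

/-- `ρ = ∑_j |u_j|²`. -/
def density (u : Fin N → Plane → ℂ) (x : Plane) : ℝ := ∑ j, ‖u j x‖ ^ 2

/-- `ρ_∇ = ∑_j |∇u_j|²`. -/
def densityGrad (u : Fin N → Plane → ℂ) (x : Plane) : ℝ :=
  ∑ j, ∑ c : Fin 2, ‖weakDeriv (dir c) (u j) x‖ ^ 2

/-- `ρ_Δ = ∑_j |Δu_j|²`. -/
def densityLap (u : Fin N → Plane → ℂ) (x : Plane) : ℝ :=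
  ∑ j, ‖∑ c : Fin 2, weakDeriv (dir c) (weakDeriv (dir c) (u j)) x‖ ^ 2

/-- The current `J = ∑_j i (u_j ∇ū_j - ū_j ∇u_j)`; the expression is real. -/
def current (u : Fin N → Plane → ℂ) (x : Plane) : Plane :=
  WithLp.toLp 2 fun c => ∑ j,
    (Complex.I * (u j x * conj (weakDeriv (dir c) (u j) x)
      - conj (u j x) * weakDeriv (dir c) (u j) x)).re

/-- `a_N[ρ] = a_N ∗ ρ`. -/
def meanPot (R s : ℝ) (u : Fin N → Plane → ℂ) (x : Plane) : Plane :=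
  ∫ y, density u y • vecPot N R s (x - y)

/-- `a_N²[ρ] = |a_N|² ∗ ρ`. -/
def meanPotSq (R s : ℝ) (u : Fin N → Plane → ℂ) (x : Plane) : ℝ :=
  ∫ y, ‖vecPot N R s (x - y)‖ ^ 2 * density u y

/-- `β a_N ∗ (2β a_N[ρ] ρ + J)`, the convolution being with the scalar product of `ℝ²`. -/
def currentPot (R s β : ℝ) (u : Fin N → Plane → ℂ) (x : Plane) : ℝ :=
  β * ∫ y, inner ℝ (vecPot N R s (x - y))
    ((2 * β * density u y) • meanPot R s u y + current u y)

/-- The right-hand side of the effective equation,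
`(-i∇ + β a_N[ρ])² f + g N a_N²[ρ] f - [β a_N ∗ (2β a_N[ρ] ρ + J)] f`. -/
def hartreeOp (R s β g : ℝ) (u : Fin N → Plane → ℂ) (f : Plane → ℂ) : Plane → ℂ := fun x =>
  (∑ c : Fin 2, magMomentum (dir c) (fun y => β * meanPot R s u y c)
      (magMomentum (dir c) (fun y => β * meanPot R s u y c) f) x)
    + ((g * N * meanPotSq R s u x - currentPot R s β u x : ℝ) : ℂ) * f x

/-- `u = (u_j)` is a solution on `[0, T]` of the effective equation with orthonormal initial data,
with `u_j ∈ C([0, T], H^m)` (so that the equation holds in `L²` when `m ≥ 2`). -/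
structure IsEffectiveSolution (R s β g : ℝ) (m : ℕ) (T : ℝ) (u : ℝ → Fin N → Plane → ℂ) :
    Prop where
  orthonormal : ∀ i j, ∫ x, conj (u 0 i x) * u 0 j x = if i = j then 1 else 0
  regular : ∀ t ∈ Icc 0 T, ∀ j, MemSobolev m (u t j)
  continuous : ∀ t ∈ Icc 0 T, ∀ j,
    Tendsto (fun τ => sobolevNormSq m (fun x => u τ j x - u t j x)) (𝓝[Icc 0 T] t) (𝓝 0)
  equation : ∀ t ∈ Icc 0 T, ∀ j,
    HasL2DerivOn T (fun τ => u τ j) (fun x => -Complex.I * hartreeOp R s β g (u t) (u t j) x) t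

/-- The Hartree energy
`Tr[(-i∇ + β a_N[ρ])² ω] + (g/2) N Tr[a_N²[ρ] ω]`
`= ∑_j ∫ |(-i∇ + β a_N[ρ]) u_j|² + (g/2) N ∫ a_N²[ρ] ρ` of `ω = ∑_j |u_j⟩⟨u_j|`. -/
def hartreeEnergy (R s β g : ℝ) (u : Fin N → Plane → ℂ) : ℝ :=
  (∑ j, ∑ c : Fin 2, ∫ x, ‖magMomentum (dir c) (fun y => β * meanPot R s u y c) (u j) x‖ ^ 2)
    + g / 2 * N * ∫ x, meanPotSq R s u x * density u x

/-- `‖ρ‖₂² ≤ K N`, `‖ρ_∇‖₁ ≤ K N`, `‖ρ_Δ‖₁ ≤ K N`. -/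
structure BoundsH2 (K : ℝ) (u : Fin N → Plane → ℂ) : Prop where
  density : eLpNorm (density u) 2 volume ^ 2 ≤ ENNReal.ofReal (K * N)
  grad : eLpNorm (densityGrad u) 1 volume ≤ ENNReal.ofReal (K * N)
  lap : eLpNorm (densityLap u) 1 volume ≤ ENNReal.ofReal (K * N)

/-- `‖ρ‖_p, ‖ρ_∇‖_p ≤ K N^{1/p}` for `1 ≤ p ≤ m + 1`, and `‖u_j‖_{H^m} ≤ K`. -/
structure BoundsHm (K : ℝ) (m : ℕ) (u : Fin N → Plane → ℂ) : Prop where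
  density : ∀ p : ℝ, 1 ≤ p → p ≤ m + 1 →
    eLpNorm (density u) (ENNReal.ofReal p) volume ≤ ENNReal.ofReal (K * (N : ℝ) ^ (1 / p))
  grad : ∀ p : ℝ, 1 ≤ p → p ≤ m + 1 →
    eLpNorm (densityGrad u) (ENNReal.ofReal p) volume ≤ ENNReal.ofReal (K * (N : ℝ) ^ (1 / p))
  sobolev : ∀ j, sobolevNormSq m (u j) ≤ ENNReal.ofReal K ^ 2

/-- The bounds `BoundsH2` together with `‖ρ‖_∞, ‖ρ_∇‖_∞ ≤ K`. -/
structure BoundsHinfty (K : ℝ) (u : Fin N → Plane → ℂ) : Prop where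
  boundsH2 : BoundsH2 K u
  density : eLpNorm (density u) ⊤ volume ≤ ENNReal.ofReal K
  grad : eLpNorm (densityGrad u) ⊤ volume ≤ ENNReal.ofReal K

/-- The three sets of assumptions on the orbitals, each with its range of `s` and of the exponent
`r` in `R = N^{-r}`. -/
def Admissible (s r K : ℝ) (m : ℕ) (u : Fin N → Plane → ℂ) : Prop :=
  (s * (1 + 2 * r) + r / 2 < 1 / 4 ∧ BoundsH2 K u) ∨
  (s < 1 / 2 * (1 - 1 / (m : ℝ)) ∧ BoundsHm K m u) ∨
  (s < 1 / 2 ∧ BoundsHinfty K u)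

/-! ### Projectors and the counting functional -/

/-- `p_l`, the operator `∑_j |u_j⟩⟨u_j|` acting on the variable of particle `l`. -/
def pOp (u : Fin N → Plane → ℂ) (l : Fin N) (F : Config N → ℂ) : Config N → ℂ := fun x =>
  ∑ j, u j (x l) * ∫ y, conj (u j y) * F (Function.update x l y)

/-- `q_l = 1 - p_l`. -/
def qOp (u : Fin N → Plane → ℂ) (l : Fin N) (F : Config N → ℂ) : Config N → ℂ := fun x =>
  F x - pOp u l F x

/-- The product over all particles `l` of `q_l` (if `l ∈ S`) or `p_l` (if `l ∉ S`). -/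
def excitedOn (u : Fin N → Plane → ℂ) (S : Finset (Fin N)) (F : Config N → ℂ) : Config N → ℂ :=
  (List.finRange N).foldr (fun l G => if l ∈ S then qOp u l G else pOp u l G) F

/-- `P_N^{(k)}`, the sum of all such products with exactly `k` factors `q`. -/
def excitedProj (u : Fin N → Plane → ℂ) (k : ℕ) (F : Config N → ℂ) : Config N → ℂ := fun x =>
  ∑ S ∈ (Finset.univ : Finset (Fin N)).powersetCard k, excitedOn u S F x

/-- `m̂(ξ) = ∑_{k=0}^N (k/N)^ξ P_N^{(k)}`. -/
def weightOp (ξ : ℝ) (u : Fin N → Plane → ℂ) (F : Config N → ℂ) : Config N → ℂ := fun x =>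
  ∑ k ∈ Finset.range (N + 1), ((((k : ℝ) / N) ^ ξ : ℝ) : ℂ) * excitedProj u k F x

/-- `α_m = ⟨Ψ, m̂(1/2) Ψ⟩`. -/
def alphaM (u : Fin N → Plane → ℂ) (Ψ : Config N → ℂ) : ℝ :=
  (∫ x, conj (Ψ x) * weightOp (1 / 2) u Ψ x).re

end Orbitals

end MagneticFermions

end

open MeasureTheory MagneticFermions

noncomputable section

set_option linter.unusedSectionVars false

namespace MagneticFermions

open MeasureTheory Set Filter Topology
open scoped ENNReal NNReal ContDiff ComplexConjugate InnerProductSpace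

/-! ### The Hilbert space `L²` and its multiplication operators -/

/-! Write N = n + 1. By antisymmetry E_N / N is carried by particle 0: it is ∑_c ‖(-i∂_c + β ∑_l
a_c(x₀ - x_l))Ψ‖² + (g/2) ∑_l ⟨Ψ, κ(x₀ - x_l)Ψ⟩ with κ = N|a_N|². Split Ψ = p₀Ψ + q₀Ψ and put X =
-i∇p₀Ψ, Z = -i∇q₀Ψ, V = (a_N ∗ ρ)p₀Ψ, P = ∑_l a_N(x₀ - x_l)p₀Ψ, and Q likewise with q₀Ψ. Completing
a square (`norm_sq_kinetic_ge`) bounds the kinetic energy from below by ‖X + βV‖² + ¾‖Z‖² plus cross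
terms. These are controlled by η, the mean of √((k+1)/N) with k the number of excited particles
(`excitation`), and η ≤ α_m + 1/√N.

The terms are treated as follows. ‖X + βV‖² together with the mean repulsion is the expectation of a
one-body operator whose trace over the orbitals is the Hartree energy (`abs_re_inner_bOp_sub_le`).
Pairings with P - V are fluctuations around the mean field (`abs_re_sum_inner_bOp_p_sub_le`). Terms
linear in Z, and ⟨Z, P⟩, are integrated by parts onto the orbitals, because a_N and a_N ∗ ρ have no
divergence. What remains contains pairs of excited particles (`excitedPair`), which need not be
small: they cost at most 3β² `excitedPair` and are paid for by the g/4 `excitedPair` that the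
repulsion provides (`MeanField.interaction_ge`), hence g ≥ 12β². Finally ⟨Z, Q⟩ uses up ½‖Z‖², and
¼‖Z‖² is left.

The fermionic input is the Pauli principle `pauli`. Integrated over the position of a particle it
becomes the trace inequality `sum_norm_sq_mulOp_bOp_le`: a sum over all particles costs a single
integral against the density of the orbitals, not one for each particle. Smallness is distributed by
counting weights: a pair operator on particles 0 and l commutes with the number of excitations of
the others, so ((k+1)/N)^{1/4} can be inserted on one side and its inverse on the other, where a
projection q compensates it.

All that is needed of the singular potential is |a_N|⁴ ∗ ρ ≤ C/N³, which each of the three regimes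
supplies through Young's inequality (`exists_integral_pow_four_le`). The dynamics enters only
through conservation laws: the orbitals stay orthonormal and Ψ stays normalized. -/

/-- The Hilbert space `L²(X)`. -/
abbrev L2 (X : Type*) [MeasureSpace X] : Type _ := Lp ℂ 2 (volume : Measure X)

section L2Basics

variable {X : Type*} [MeasureSpace X]

theorem inner_L2 (F G : L2 X) : ⟪F, G⟫_ℂ = ∫ x, conj (F x) * G x := by
  rw [L2.inner_def]
  simp only [RCLike.inner_apply, mul_comm]

theorem norm_sq_L2 (F : L2 X) : ‖F‖ ^ 2 = ∫ x, ‖F x‖ ^ 2 := by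
  have h := inner_self_eq_norm_sq_to_K (𝕜 := ℂ) F
  rw [inner_L2] at h
  have h2 : ∀ x, conj (F x) * F x = ((‖F x‖ ^ 2 : ℝ) : ℂ) := fun x => by
    rw [mul_comm, Complex.mul_conj, Complex.normSq_eq_norm_sq]
  simp only [h2] at h
  rw [integral_complex_ofReal] at h
  have h3 : ((‖F‖ : ℂ)) ^ 2 = ((‖F‖ ^ 2 : ℝ) : ℂ) := by push_cast; rfl
  have h4 : (((∫ x, ‖F x‖ ^ 2 : ℝ)) : ℂ) = ((‖F‖ ^ 2 : ℝ) : ℂ) := by rw [h]; exact h3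
  exact (Complex.ofReal_injective h4).symm

theorem integrable_norm_sq_L2 (F : L2 X) : Integrable (fun x => ‖F x‖ ^ 2) :=
  (memLp_two_iff_integrable_sq_norm (Lp.aestronglyMeasurable F)).1 (Lp.memLp F)

theorem lintegral_enorm_sq_L2 (F : L2 X) : ∫⁻ x, ‖F x‖ₑ ^ 2 = ENNReal.ofReal (‖F‖ ^ 2) := by
  rw [norm_sq_L2, ofReal_integral_eq_lintegral_ofReal (integrable_norm_sq_L2 F)
    (Eventually.of_forall fun x => by positivity)]
  refine lintegral_congr fun x => ?_
  rw [ENNReal.ofReal_pow (norm_nonneg _), ofReal_norm]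

theorem integrable_conj_mul_L2 (F G : L2 X) : Integrable (fun x => conj (F x) * G x) := by
  have h := L2.integrable_inner (𝕜 := ℂ) F G
  simpa only [RCLike.inner_apply, mul_comm] using h

end L2Basics

section Multiplication

variable {X : Type*} [MeasureSpace X]

/-- Bounded measurable real functions, the functions by which we multiply in `L²`. -/
def IsMult (f : X → ℝ) : Prop := Measurable f ∧ ∃ C, ∀ x, |f x| ≤ C

theorem isMult_const (c : ℝ) : IsMult (fun _ : X => c) := ⟨measurable_const, |c|, fun _ => le_rfl⟩

theorem IsMult.add {f g : X → ℝ} (hf : IsMult f) (hg : IsMult g) : IsMult (fun x => f x + g x) := by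
  obtain ⟨hf, C, hC⟩ := hf
  obtain ⟨hg, D, hD⟩ := hg
  exact ⟨hf.add hg, C + D, fun x => (abs_add_le _ _).trans (add_le_add (hC x) (hD x))⟩

theorem IsMult.mul {f g : X → ℝ} (hf : IsMult f) (hg : IsMult g) : IsMult (fun x => f x * g x) := by
  obtain ⟨hf, C, hC⟩ := hf
  obtain ⟨hg, D, hD⟩ := hg
  exact ⟨hf.mul hg, C * D, fun x => by
    rw [abs_mul]
    exact mul_le_mul (hC x) (hD x) (abs_nonneg _) ((abs_nonneg _).trans (hC x))⟩

theorem IsMult.const_mul {f : X → ℝ} (hf : IsMult f) (c : ℝ) : IsMult (fun x => c * f x) :=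
  (isMult_const c).mul hf

theorem IsMult.sub {f g : X → ℝ} (hf : IsMult f) (hg : IsMult g) : IsMult (fun x => f x - g x) := by
  simpa [sub_eq_add_neg] using hf.add (hg.const_mul (-1))

theorem IsMult.sum {ι : Type*} (s : Finset ι) {f : ι → X → ℝ} (hf : ∀ i ∈ s, IsMult (f i)) :
    IsMult (fun x => ∑ i ∈ s, f i x) := by
  classical
  induction s using Finset.induction_on with
  | empty => simpa using isMult_const (X := X) 0
  | insert a s ha ih =>
    simp only [Finset.sum_insert ha]
    exact (hf a (by simp)).add (ih fun i hi => hf i (by simp [hi]))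

theorem IsMult.comp {Y : Type*} [MeasureSpace Y] {f : X → ℝ} (hf : IsMult f) {g : Y → X}
    (hg : Measurable g) : IsMult (fun y => f (g y)) :=
  ⟨hf.1.comp hg, hf.2.imp fun _ h y => h (g y)⟩

theorem IsMult.memLp {f : X → ℝ} (hf : IsMult f) {F : X → ℂ} (hF : MemLp F 2 volume) :
    MemLp (fun x => (f x : ℂ) * F x) 2 volume := by
  obtain ⟨hm, C, hC⟩ := hf
  refine hF.of_le_mul (c := C)
    ((Complex.measurable_ofReal.comp hm).aestronglyMeasurable.mul hF.1) ?_
  refine Eventually.of_forall fun x => ?_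
  rw [norm_mul, Complex.norm_real, Real.norm_eq_abs]
  exact mul_le_mul_of_nonneg_right (hC x) (norm_nonneg _)

open Classical in
/-- Multiplication by a bounded real function, as an operator on `L²`. -/
def mulOp (f : X → ℝ) : L2 X →L[ℂ] L2 X :=
  if hf : IsMult f then
    LinearMap.mkContinuous
      { toFun := fun F => (hf.memLp (Lp.memLp F)).toLp _
        map_add' := fun F G => by
          rw [← MemLp.toLp_add]
          refine MemLp.toLp_congr _ _ ?_
          filter_upwards [Lp.coeFn_add F G] with x hx
          simp only [hx, Pi.add_apply, mul_add]
        map_smul' := fun c F => by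
          rw [RingHom.id_apply, ← MemLp.toLp_const_smul]
          refine MemLp.toLp_congr _ _ ?_
          filter_upwards [Lp.coeFn_smul c F] with x hx
          simp only [hx, Pi.smul_apply, smul_eq_mul]
          ring }
      hf.2.choose fun F => by
        have hC := hf.2.choose_spec
        refine Lp.norm_le_mul_norm_of_ae_le_mul ?_
        simp only [LinearMap.coe_mk, AddHom.coe_mk]
        filter_upwards [MemLp.coeFn_toLp (hf.memLp (Lp.memLp F))] with x hx
        rw [hx, norm_mul, Complex.norm_real, Real.norm_eq_abs]
        exact mul_le_mul_of_nonneg_right (hC x) (norm_nonneg _)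
  else 0

theorem mulOp_coe {f : X → ℝ} (hf : IsMult f) (F : L2 X) :
    mulOp f F =ᵐ[volume] fun x => (f x : ℂ) * F x := by
  have : mulOp f F = (hf.memLp (Lp.memLp F)).toLp _ := by
    simp only [mulOp, dif_pos hf]
    rfl
  rw [this]
  exact MemLp.coeFn_toLp _

theorem mulOp_coe' {f : X → ℝ} (hf : IsMult f) (F : L2 X) {F' : X → ℂ} (h : F =ᵐ[volume] F') :
    mulOp f F =ᵐ[volume] fun x => (f x : ℂ) * F' x := by
  filter_upwards [mulOp_coe hf F, h] with x h1 h2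
  rw [h1, h2]

theorem mulOp_mul {f g : X → ℝ} (hf : IsMult f) (hg : IsMult g) (F : L2 X) :
    mulOp (fun x => f x * g x) F = mulOp f (mulOp g F) := by
  refine Lp.ext ?_
  filter_upwards [mulOp_coe (hf.mul hg) F, mulOp_coe' hf _ (mulOp_coe hg F)] with x h1 h2
  rw [h1, h2]
  push_cast
  ring

theorem mulOp_add {f g : X → ℝ} (hf : IsMult f) (hg : IsMult g) (F : L2 X) :
    mulOp (fun x => f x + g x) F = mulOp f F + mulOp g F := by
  refine Lp.ext ?_
  filter_upwards [mulOp_coe (hf.add hg) F, mulOp_coe hf F, mulOp_coe hg F,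
    Lp.coeFn_add (mulOp f F) (mulOp g F)] with x h1 h2 h3 h4
  rw [h1, h4, Pi.add_apply, h2, h3]
  push_cast
  ring

theorem mulOp_const (c : ℝ) (F : L2 X) : mulOp (fun _ => c) F = (c : ℂ) • F := by
  refine Lp.ext ?_
  filter_upwards [mulOp_coe (isMult_const c) F, Lp.coeFn_smul (c : ℂ) F] with x h1 h2
  rw [h1, h2]
  simp

theorem mulOp_const_mul {f : X → ℝ} (hf : IsMult f) (c : ℝ) (F : L2 X) :
    mulOp (fun x => c * f x) F = (c : ℂ) • mulOp f F := by
  rw [mulOp_mul (isMult_const c) hf, mulOp_const]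

theorem mulOp_sum {ι : Type*} (s : Finset ι) {f : ι → X → ℝ} (hf : ∀ i ∈ s, IsMult (f i))
    (F : L2 X) : mulOp (fun x => ∑ i ∈ s, f i x) F = ∑ i ∈ s, mulOp (f i) F := by
  classical
  induction s using Finset.induction_on with
  | empty => simp [mulOp_const]
  | insert a s ha ih =>
    simp only [Finset.sum_insert ha]
    rw [mulOp_add (hf a (by simp)) (IsMult.sum s fun i hi => hf i (by simp [hi])),
      ih fun i hi => hf i (by simp [hi])]

theorem inner_mulOp {f : X → ℝ} (hf : IsMult f) (F G : L2 X) :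
    ⟪F, mulOp f G⟫_ℂ = ∫ x, (f x : ℂ) * (conj (F x) * G x) := by
  rw [inner_L2]
  refine integral_congr_ae ?_
  filter_upwards [mulOp_coe hf G] with x h
  rw [h]
  ring

theorem inner_mulOp_left {f : X → ℝ} (hf : IsMult f) (F G : L2 X) :
    ⟪mulOp f F, G⟫_ℂ = ⟪F, mulOp f G⟫_ℂ := by
  rw [inner_mulOp hf, inner_L2]
  refine integral_congr_ae ?_
  filter_upwards [mulOp_coe hf F] with x h
  rw [h, map_mul, Complex.conj_ofReal]
  ring

theorem inner_mulOp_self {f : X → ℝ} (hf : IsMult f) (F : L2 X) :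
    ⟪F, mulOp f F⟫_ℂ = ((∫ x, f x * ‖F x‖ ^ 2 : ℝ) : ℂ) := by
  rw [inner_mulOp hf, ← integral_complex_ofReal]
  refine integral_congr_ae (Eventually.of_forall fun x => ?_)
  simp only
  rw [mul_comm (conj (F x)), Complex.mul_conj, Complex.normSq_eq_norm_sq]
  push_cast
  ring

theorem IsMult.integrable_mul_norm_sq {f : X → ℝ} (hf : IsMult f) (F : L2 X) :
    Integrable (fun x => f x * ‖F x‖ ^ 2) := by
  obtain ⟨hm, C, hC⟩ := hf
  exact (integrable_norm_sq_L2 F).bdd_mul (c := C) hm.aestronglyMeasurable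
    (Eventually.of_forall fun x => by simpa using hC x)

theorem norm_sq_mulOp {f : X → ℝ} (hf : IsMult f) (F : L2 X) :
    ‖mulOp f F‖ ^ 2 = ∫ x, f x ^ 2 * ‖F x‖ ^ 2 := by
  rw [norm_sq_L2]
  refine integral_congr_ae ?_
  filter_upwards [mulOp_coe hf F] with x h
  rw [h, norm_mul, Complex.norm_real, Real.norm_eq_abs, mul_pow, sq_abs]

theorem norm_mulOp_le {f : X → ℝ} (hf : IsMult f) {C : ℝ} (hC : ∀ x, |f x| ≤ C) (F : L2 X) :
    ‖mulOp f F‖ ≤ C * ‖F‖ := by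
  refine Lp.norm_le_mul_norm_of_ae_le_mul ?_
  filter_upwards [mulOp_coe hf F] with x hx
  rw [hx, norm_mul, Complex.norm_real, Real.norm_eq_abs]
  exact mul_le_mul_of_nonneg_right (hC x) (norm_nonneg _)

end Multiplication

/-! ### Translations, strong derivatives and weak derivatives -/

section Translation

variable {V : Type*} [NormedAddCommGroup V] [NormedSpace ℝ V] [FiniteDimensional ℝ V]
  [MeasureSpace V] [BorelSpace V] [(volume : Measure V).IsAddHaarMeasure]

/-- Translation `F ↦ F(· + a)` on `L²(V)`. -/
def trans (a : V) : L2 V →ₗᵢ[ℂ] L2 V :=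
  Lp.compMeasurePreservingₗᵢ ℂ (fun x => x + a) (measurePreserving_add_right volume a)

theorem trans_coe (a : V) (F : L2 V) : trans a F =ᵐ[volume] fun x => F (x + a) :=
  Lp.coeFn_compMeasurePreserving F (measurePreserving_add_right volume a)

theorem trans_coe' (a : V) (F : L2 V) {f : V → ℂ} (h : F =ᵐ[volume] f) :
    trans a F =ᵐ[volume] fun x => f (x + a) :=
  (trans_coe a F).trans
    ((measurePreserving_add_right volume a).quasiMeasurePreserving.ae_eq_comp h)

theorem trans_add (a b : V) (F : L2 V) : trans (a + b) F = trans a (trans b F) := by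
  refine Lp.ext ?_
  filter_upwards [trans_coe (a + b) F, trans_coe' a _ (trans_coe b F)] with x h1 h2
  rw [h1, h2, add_assoc]

@[simp] theorem trans_zero (F : L2 V) : trans (0 : V) F = F := by
  refine Lp.ext ?_
  filter_upwards [trans_coe (0 : V) F] with x h1
  rw [h1, add_zero]

theorem inner_trans_left (a : V) (F G : L2 V) : ⟪trans a F, G⟫_ℂ = ⟪F, trans (-a) G⟫_ℂ := by
  rw [← (trans (-a)).inner_map_map, ← trans_add, neg_add_cancel, trans_zero]

theorem continuous_trans (F : L2 V) : Continuous fun a : V => trans a F := by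
  let g : V → C(V, V) := fun a => ⟨fun x => x + a, by fun_prop⟩
  have hg : Continuous g := by
    refine ContinuousMap.continuous_of_continuous_uncurry _ ?_
    change Continuous fun p : V × V => p.2 + p.1
    fun_prop
  exact Continuous.compMeasurePreservingLp (f := fun _ => F) (g := g) continuous_const hg
    (fun a => measurePreserving_add_right volume a) (by simp)

/-- `F'` is the derivative of `F` in the direction `v` in the sense of `L²`. -/
def HasSD (v : V) (F F' : L2 V) : Prop := HasDerivAt (fun h : ℝ => trans (h • v) F) F' 0

theorem HasSD.unique {v : V} {F F₁ F₂ : L2 V} (h₁ : HasSD v F F₁) (h₂ : HasSD v F F₂) : F₁ = F₂ :=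
  HasDerivAt.unique h₁ h₂

theorem HasSD.add {v : V} {F F' G G' : L2 V} (hF : HasSD v F F') (hG : HasSD v G G') :
    HasSD v (F + G) (F' + G') := by
  have := HasDerivAt.fun_add hF hG
  simpa only [HasSD, map_add] using this

theorem HasSD.sub {v : V} {F F' G G' : L2 V} (hF : HasSD v F F') (hG : HasSD v G G') :
    HasSD v (F - G) (F' - G') := by
  have := HasDerivAt.fun_sub hF hG
  simpa only [HasSD, map_sub] using this

theorem HasSD.sum {ι : Type*} (s : Finset ι) {v : V} {F F' : ι → L2 V}
    (h : ∀ i ∈ s, HasSD v (F i) (F' i)) : HasSD v (∑ i ∈ s, F i) (∑ i ∈ s, F' i) := by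
  have := HasDerivAt.fun_sum (u := s) (x := (0 : ℝ)) (A := fun i (h : ℝ) => trans (h • v) (F i))
    (A' := F') h
  simpa only [HasSD, map_sum] using this

theorem HasSD.const_smul {v : V} {F F' : L2 V} (c : ℂ) (hF : HasSD v F F') :
    HasSD v (c • F) (c • F') := by
  have := HasDerivAt.fun_const_smul c hF
  simpa only [HasSD, map_smul] using this

/-- Integration by parts. -/
theorem HasSD.inner_eq {v : V} {F F' G G' : L2 V} (hF : HasSD v F F') (hG : HasSD v G G') :
    ⟪F', G⟫_ℂ = -⟪F, G'⟫_ℂ := by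
  -- The same function of h is differentiated twice: translating F, or, by unitarity, translating G
  -- backwards.
  have h1 : HasDerivAt (fun h : ℝ => ⟪trans (h • v) F, G⟫_ℂ) ⟪F', G⟫_ℂ 0 := by
    have := HasDerivAt.inner ℂ hF (hasDerivAt_const (0 : ℝ) G)
    simpa using this
  have h2 : HasDerivAt (fun h : ℝ => ⟪trans (h • v) F, G⟫_ℂ) (-⟪F, G'⟫_ℂ) 0 := by
    have hG' : HasDerivAt (fun h : ℝ => trans ((-h) • v) G) (-G') 0 := by
      have := HasDerivAt.scomp (h := fun h : ℝ => -h) (g₁ := fun h : ℝ => trans (h • v) G) (0 : ℝ)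
        (h' := -1) (g₁' := G') (by rw [neg_zero]; exact hG) (hasDerivAt_neg (0 : ℝ))
      simpa [Function.comp_def] using this
    have := HasDerivAt.inner ℂ (hasDerivAt_const (0 : ℝ) F) hG'
    simp only [neg_smul, inner_neg_right, zero_smul, neg_zero, inner_zero_left, add_zero] at this
    refine this.congr_of_eventuallyEq (Eventually.of_forall fun h => ?_)
    simp only [inner_trans_left]
  exact h1.unique h2

/-- The translation is put on the test function because f is only locally integrable. For parameters
near s all the supports lie in one compact set, on which a constant times ‖f‖ dominates. -/
theorem hasDerivAt_integral_test {f : V → ℂ} (hf : LocallyIntegrable f) {φ : V → ℝ}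
    (hφ : ContDiff ℝ ∞ φ) (hs : HasCompactSupport φ) (v : V) (s : ℝ) :
    HasDerivAt (fun s : ℝ => ∫ x, φ (x - s • v) • f x)
      (-∫ x, (fderiv ℝ φ (x - s • v) v) • f x) s := by
  have hφ1 : ContDiff ℝ 1 φ := hφ.of_le (by exact_mod_cast le_top)
  have hcd : Continuous fun x => fderiv ℝ φ x v := (hφ1.continuous_fderiv one_ne_zero).clm_apply continuous_const
  have hcs : HasCompactSupport fun x => fderiv ℝ φ x v := hs.fderiv_apply (𝕜 := ℝ) v
  obtain ⟨C, hC⟩ := hcd.bounded_above_of_compact_support hcs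
  have htr : ∀ (r : ℝ) (ψ : V → ℝ), Continuous ψ → HasCompactSupport ψ →
      Integrable fun x => ψ (x - r • v) • f x := by
    intro r ψ hψ hψs
    refine hf.integrable_smul_left_of_hasCompactSupport (by fun_prop) ?_
    exact hψs.comp_homeomorph (Homeomorph.subRight (r • v))
  set K : Set V := (fun p : V × ℝ => p.1 + p.2 • v) '' (tsupport φ ×ˢ Metric.closedBall s 1) with hK
  have hKc : IsCompact K :=
    (hs.isCompact.prod (isCompact_closedBall s 1)).image (by fun_prop)
  have hKm : MeasurableSet K := hKc.measurableSet
  rw [← integral_neg]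
  refine (hasDerivAt_integral_of_dominated_loc_of_deriv_le (F := fun r x => φ (x - r • v) • f x)
    (F' := fun r x => -(fderiv ℝ φ (x - r • v) v • f x))
    (bound := fun x => K.indicator (fun x => C * ‖f x‖) x)
    (Metric.ball_mem_nhds s one_pos)
    (Eventually.of_forall fun r => (htr r φ hφ.continuous hs).aestronglyMeasurable)
    (htr s φ hφ.continuous hs) (htr s _ hcd hcs).aestronglyMeasurable.neg ?_ ?_ ?_).2
  · refine Eventually.of_forall fun x r hr => ?_
    rw [norm_neg, norm_smul]
    by_cases hx : x ∈ K
    · rw [indicator_of_mem hx]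
      exact mul_le_mul_of_nonneg_right (hC _) (norm_nonneg _)
    · rw [indicator_of_notMem hx]
      have : x - r • v ∉ tsupport φ := fun h => hx
        ⟨(x - r • v, r), ⟨h, Metric.ball_subset_closedBall hr⟩, by simp⟩
      rw [fderiv_of_notMem_tsupport ℝ this]
      simp
  · rw [integrable_indicator_iff hKm]
    exact ((hf.integrableOn_isCompact hKc).norm).const_mul C
  · refine Eventually.of_forall fun x r _ => ?_
    have h1 : HasDerivAt (fun r : ℝ => x - r • v) (-v) r := by
      simpa using ((hasDerivAt_id r).smul_const v).const_sub x
    have h2 := ((hφ1.differentiable one_ne_zero).differentiableAt (x := x - r • v)).hasFDerivAt.comp_hasDerivAt r h1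
    have h3 := h2.smul_const (f x)
    simpa using h3

theorem memLp_test {φ : V → ℝ} (hφ : ContDiff ℝ ∞ φ) (hs : HasCompactSupport φ) :
    MemLp (fun x => (φ x : ℂ)) 2 volume := by
  refine Continuous.memLp_of_hasCompactSupport (by have := hφ.continuous; fun_prop) ?_
  exact hs.comp_left (g := fun r : ℝ => (r : ℂ)) (by simp)

theorem inner_test_trans {φ : V → ℝ} (hφ : ContDiff ℝ ∞ φ) (hs : HasCompactSupport φ) (a : V)
    (F : L2 V) : ⟪(memLp_test hφ hs).toLp _, trans a F⟫_ℂ = ∫ x, φ (x - a) • F x := by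
  rw [inner_L2]
  rw [← integral_add_right_eq_self (μ := volume) (fun x => φ (x - a) • F x) a]
  refine integral_congr_ae ?_
  filter_upwards [MemLp.coeFn_toLp (memLp_test hφ hs), trans_coe a F] with x h1 h2
  rw [h1, h2, Complex.conj_ofReal, add_sub_cancel_right]
  simp

theorem locallyIntegrable_L2 (F : L2 V) : LocallyIntegrable F volume :=
  (Lp.memLp F).locallyIntegrable (by norm_num)

theorem eq_zero_of_inner_test {F : L2 V} (h : ∀ φ : V → ℝ, ∀ (hφ : ContDiff ℝ ∞ φ)
    (hs : HasCompactSupport φ), ⟪(memLp_test hφ hs).toLp _, F⟫_ℂ = 0) : F = 0 := by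
  refine (Lp.eq_zero_iff_ae_eq_zero).2 (ae_eq_zero_of_integral_contDiff_smul_eq_zero
    (locallyIntegrable_L2 F) fun φ hφ hs => ?_)
  have := h φ hφ hs
  rw [← trans_zero F, inner_test_trans hφ hs] at this
  simpa using this

theorem HasWeakDeriv.congr {v : V} {f f' g g' : V → ℂ} (h : HasWeakDeriv v f g)
    (hf : f =ᵐ[volume] f') (hg : g =ᵐ[volume] g') : HasWeakDeriv v f' g' := by
  refine ⟨h.1.congr hf, h.2.1.congr hg, fun φ h1 h2 => ?_⟩
  have e1 : ∫ x, (fderiv ℝ φ x v) • f' x = ∫ x, (fderiv ℝ φ x v) • f x :=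
    integral_congr_ae (hf.mono fun x hx => by simp only [hx])
  have e2 : ∫ x, φ x • g' x = ∫ x, φ x • g x :=
    integral_congr_ae (hg.mono fun x hx => by simp only [hx])
  rw [e1, e2, h.2.2 φ h1 h2]

/-- Fundamental theorem of calculus along the translation group: the increment of F is the integral
of the translates of F', since both have the same derivative when paired with test functions. The
integrand is continuous in L², so the integral can be differentiated at 0. -/
theorem hasSD_of_hasWeakDeriv {v : V} {F F' : L2 V} (h : HasWeakDeriv v F F') : HasSD v F F' := by
  have hcont : Continuous fun s : ℝ => trans (s • v) F' :=
    (continuous_trans F').comp (by fun_prop)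
  have hder : ∀ r : ℝ, HasDerivAt (fun r : ℝ => ∫ s in (0 : ℝ)..r, trans (s • v) F')
      (trans (r • v) F') r := fun r =>
    intervalIntegral.integral_hasDerivAt_right (hcont.intervalIntegrable _ _)
      (hcont.stronglyMeasurableAtFilter _ _) hcont.continuousAt
  have key : ∀ r : ℝ, trans (r • v) F - F - ∫ s in (0 : ℝ)..r, trans (s • v) F' = 0 := by
    intro r
    refine eq_zero_of_inner_test fun φ hφ hs => ?_
    set Φ : L2 V := (memLp_test hφ hs).toLp _
    have hd : ∀ r : ℝ, HasDerivAt
        (fun r : ℝ => ⟪Φ, trans (r • v) F - F - ∫ s in (0 : ℝ)..r, trans (s • v) F'⟫_ℂ) 0 r := by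
      intro r
      have h1 : HasDerivAt (fun r : ℝ => ⟪Φ, trans (r • v) F⟫_ℂ) ⟪Φ, trans (r • v) F'⟫_ℂ r := by
        have := hasDerivAt_integral_test (locallyIntegrable_L2 F) hφ hs v r
        have h0 : ContDiff ℝ ∞ fun x => φ (x - r • v) := hφ.comp (by fun_prop)
        have h0s : HasCompactSupport fun x => φ (x - r • v) :=
          hs.comp_homeomorph (Homeomorph.subRight (r • v))
        have h2 := h.2.2 _ h0 h0s
        have h3 : ∀ x, fderiv ℝ (fun x => φ (x - r • v)) x v = fderiv ℝ φ (x - r • v) v := by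
          intro x
          rw [fderiv_comp_sub]
        simp only [h3] at h2
        rw [h2, neg_neg] at this
        simp only [Φ, inner_test_trans hφ hs]
        exact this
      have h2 : HasDerivAt (fun r : ℝ => ⟪Φ, ∫ s in (0 : ℝ)..r, trans (s • v) F'⟫_ℂ)
          ⟪Φ, trans (r • v) F'⟫_ℂ r := by
        have := HasDerivAt.inner ℂ (hasDerivAt_const r Φ) (hder r)
        simpa using this
      have h3 := (h1.sub_const ⟪Φ, F⟫_ℂ).fun_sub h2
      simp only [inner_sub_right]
      simpa using h3
    have := is_const_of_deriv_eq_zero (fun r => (hd r).differentiableAt) (fun r => (hd r).deriv) r 0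
    rw [this]
    simp
  have h0 := (hder 0).add_const F
  simp only [zero_smul, trans_zero] at h0
  refine HasDerivAt.congr_of_eventuallyEq h0 (Eventually.of_forall fun r => ?_)
  have := key r
  rw [sub_sub, sub_eq_zero] at this
  simp only [this]
  abel

theorem HasSD.hasWeakDeriv {v : V} {F F' : L2 V} (h : HasSD v F F') : HasWeakDeriv v F F' := by
  refine ⟨locallyIntegrable_L2 F, locallyIntegrable_L2 F', fun φ hφ hs => ?_⟩
  have h1 := hasDerivAt_integral_test (locallyIntegrable_L2 F) hφ hs v 0
  have h2 : HasDerivAt (fun r : ℝ => ⟪(memLp_test hφ hs).toLp _, trans (r • v) F⟫_ℂ)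
      ⟪(memLp_test hφ hs).toLp _, F'⟫_ℂ 0 := by
    have := HasDerivAt.inner ℂ (hasDerivAt_const (0 : ℝ) ((memLp_test hφ hs).toLp _)) h
    simpa using this
  simp only [inner_test_trans hφ hs] at h2
  have h3 := h1.unique h2
  rw [← trans_zero F', inner_test_trans hφ hs] at h3
  simp only [zero_smul, sub_zero] at h3
  rw [← h3, neg_neg]

theorem hasWeakDeriv_unique {v : V} {f g g' : V → ℂ} (h : HasWeakDeriv v f g)
    (h' : HasWeakDeriv v f g') : g =ᵐ[volume] g' := by
  refine ae_eq_of_integral_contDiff_smul_eq h.2.1 h'.2.1 fun φ h1 h2 => ?_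
  have := (h.2.2 φ h1 h2).symm.trans (h'.2.2 φ h1 h2)
  simpa using this

theorem HasWeakDeriv.weakDeriv_eq {v : V} {f g : V → ℂ} (h : HasWeakDeriv v f g) :
    weakDeriv v f =ᵐ[volume] g := by
  have hex : ∃ g, HasWeakDeriv v f g := ⟨g, h⟩
  rw [weakDeriv, dif_pos hex]
  exact hasWeakDeriv_unique hex.choose_spec h

theorem HasSD.weakDeriv_eq {v : V} {F F' : L2 V} (h : HasSD v F F') {f : V → ℂ}
    (hf : F =ᵐ[volume] f) : weakDeriv v f =ᵐ[volume] F' :=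
  (h.hasWeakDeriv.congr hf EventuallyEq.rfl).weakDeriv_eq

end Translation

/-! ### Derivative of a product with a Lipschitz function -/

section ProductRule

variable {V : Type*} [NormedAddCommGroup V] [NormedSpace ℝ V] [FiniteDimensional ℝ V]
  [MeasureSpace V] [BorelSpace V] [(volume : Measure V).IsAddHaarMeasure]

theorem trans_mulOp {A : V → ℝ} (hA : IsMult A) (a : V) (F : L2 V) :
    trans a (mulOp A F) = mulOp (fun x => A (x + a)) (trans a F) := by
  refine Lp.ext ?_
  filter_upwards [trans_coe' a _ (mulOp_coe hA F),
    mulOp_coe' (hA.comp (measurable_add_const a)) _ (trans_coe a F)] with x h1 h2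
  rw [h1, h2]

theorem isMult_lineDeriv {A : V → ℝ} {L : ℝ≥0} (hL : LipschitzWith L A) (v : V) :
    IsMult fun x => lineDeriv ℝ A x v :=
  ⟨measurable_lineDeriv hL.continuous, L * ‖v‖, fun _ => norm_lineDeriv_le_of_lipschitz ℝ hL⟩

/-- Leibniz rule for difference quotients. Those of A are bounded by the Lipschitz constant and
converge almost everywhere by Rademacher's theorem, so dominated convergence applies against F.
Those of F converge in L² and are multiplied by translates of A that converge uniformly. -/
theorem HasSD.mulOp {A : V → ℝ} (hA : IsMult A) {L : ℝ≥0} (hL : LipschitzWith L A) {v : V}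
    {F F' : L2 V} (h : HasSD v F F') :
    HasSD v (mulOp A F) (MagneticFermions.mulOp (fun x => lineDeriv ℝ A x v) F +
      MagneticFermions.mulOp A F') := by
  have hAt : ∀ t : ℝ, IsMult fun x => A (x + t • v) := fun t => hA.comp (measurable_add_const _)
  have hlip : ∀ (t : ℝ) (x : V), |A (x + t • v) - A x| ≤ |t| * (L * ‖v‖) := fun t x => by
    have := hL.dist_le_mul (x + t • v) x
    rw [Real.dist_eq, dist_eq_norm, add_sub_cancel_left, norm_smul, Real.norm_eq_abs] at this
    linarith
  have hsub : ∀ {f g : V → ℝ} (hf : IsMult f) (hg : IsMult g) (G : L2 V),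
      MagneticFermions.mulOp (fun x => f x - g x) G =
        MagneticFermions.mulOp f G - MagneticFermions.mulOp g G := by
    intro f g hf hg G
    have := mulOp_add (hf.sub hg) hg G
    simp only [sub_add_cancel] at this
    rw [this, add_sub_cancel_right]
  obtain ⟨C, hC⟩ := hA.2
  set A' : V → ℝ := fun x => lineDeriv ℝ A x v with hA'
  have hA'm : IsMult A' := isMult_lineDeriv hL v
  unfold HasSD at h ⊢
  rw [hasDerivAt_iff_tendsto_slope_zero] at h ⊢
  simp only [zero_add, zero_smul, trans_zero] at h ⊢
  have hsplit : ∀ t : ℝ, t⁻¹ • (trans (t • v) (MagneticFermions.mulOp A F) -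
      MagneticFermions.mulOp A F) =
      MagneticFermions.mulOp (fun x => t⁻¹ * (A (x + t • v) - A x)) F +
      MagneticFermions.mulOp (fun x => A (x + t • v)) (t⁻¹ • (trans (t • v) F - F)) := by
    intro t
    rw [trans_mulOp hA, mulOp_const_mul ((hAt t).sub hA), hsub (hAt t) hA]
    have e : ∀ G : L2 V, t⁻¹ • G = ((t⁻¹ : ℝ) : ℂ) • G := fun G => rfl
    rw [e, e, map_smul, map_sub, ← smul_add]
    congr 1
    abel
  simp only [hsplit]
  refine Tendsto.add ?_ ?_
  · rw [tendsto_iff_norm_sub_tendsto_zero]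
    have hq : ∀ t : ℝ, IsMult fun x => t⁻¹ * (A (x + t • v) - A x) := fun t =>
      ((hAt t).sub hA).const_mul _
    have hlim : Tendsto (fun t : ℝ => ∫ x, (t⁻¹ * (A (x + t • v) - A x) - A' x) ^ 2 * ‖F x‖ ^ 2)
        (𝓝[≠] 0) (𝓝 (∫ _ : V, (0 : ℝ))) := by
      refine tendsto_integral_filter_of_dominated_convergence
        (fun x => (2 * (L * ‖v‖)) ^ 2 * ‖F x‖ ^ 2) ?_ ?_ ((integrable_norm_sq_L2 F).const_mul _) ?_
      · refine Eventually.of_forall fun t => ?_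
        have hm : Measurable fun x => (t⁻¹ * (A (x + t • v) - A x) - A' x) ^ 2 :=
          ((hq t).sub hA'm).1.pow_const 2
        exact hm.aestronglyMeasurable.mul (integrable_norm_sq_L2 F).aestronglyMeasurable
      · refine eventually_nhdsWithin_of_forall fun t ht => Eventually.of_forall fun x => ?_
        rw [norm_mul, norm_pow, norm_pow, norm_norm]
        refine mul_le_mul_of_nonneg_right (pow_le_pow_left₀ (norm_nonneg _) ?_ 2) (by positivity)
        have h1 : ‖t⁻¹ * (A (x + t • v) - A x)‖ ≤ L * ‖v‖ := by
          rw [norm_mul, norm_inv, Real.norm_eq_abs, Real.norm_eq_abs]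
          have ht0 : 0 < |t| := abs_pos.2 ht
          rw [inv_mul_le_iff₀ ht0]
          exact hlip t x
        have h2 : ‖A' x‖ ≤ L * ‖v‖ := norm_lineDeriv_le_of_lipschitz ℝ hL
        exact (norm_sub_le _ _).trans (by linarith)
      · filter_upwards [hL.ae_lineDifferentiableAt (μ := volume) v] with x hx
        have := hx.hasLineDerivAt
        unfold HasLineDerivAt at this
        rw [hasDerivAt_iff_tendsto_slope_zero] at this
        simp only [zero_add, zero_smul, add_zero, smul_eq_mul] at this
        have h2 := ((this.sub_const (A' x)).pow 2).mul_const (‖F x‖ ^ 2)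
        simpa [hA'] using h2
    simp only [integral_zero] at hlim
    have h2 := hlim.sqrt
    rw [Real.sqrt_zero] at h2
    refine h2.congr fun t => ?_
    rw [← hsub (hq t) hA'm, ← norm_sq_mulOp ((hq t).sub hA'm), Real.sqrt_sq (norm_nonneg _)]
  · rw [tendsto_iff_norm_sub_tendsto_zero] at h ⊢
    have hb : Tendsto (fun t : ℝ => C * ‖t⁻¹ • (trans (t • v) F - F) - F'‖ +
        |t| * (L * ‖v‖) * ‖F'‖) (𝓝[≠] 0) (𝓝 0) := by
      have h0 : Tendsto (fun t : ℝ => |t| * (L * ‖v‖) * ‖F'‖) (𝓝[≠] 0) (𝓝 0) := by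
        have : Continuous fun t : ℝ => |t| * (L * ‖v‖) * ‖F'‖ := by fun_prop
        have h1 := this.tendsto 0
        simp only [abs_zero, zero_mul] at h1
        exact h1.mono_left nhdsWithin_le_nhds
      simpa using (h.const_mul C).add h0
    refine squeeze_zero (fun _ => norm_nonneg _) (fun t => ?_) hb
    have e : MagneticFermions.mulOp (fun x => A (x + t • v)) (t⁻¹ • (trans (t • v) F - F)) -
        MagneticFermions.mulOp A F' =
        MagneticFermions.mulOp (fun x => A (x + t • v)) (t⁻¹ • (trans (t • v) F - F) - F') +
        MagneticFermions.mulOp (fun x => A (x + t • v) - A x) F' := by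
      rw [hsub (hAt t) hA, map_sub]
      abel
    rw [e]
    refine (norm_add_le _ _).trans (add_le_add ?_ ?_)
    · exact norm_mulOp_le (hAt t) (fun x => hC _) _
    · exact norm_mulOp_le ((hAt t).sub hA) (fun x => hlip t x) _

end ProductRule

/-! ### Permutations of the particles, creation and annihilation of a particle -/

section Permutations

variable {N : ℕ}

theorem measurePreserving_perm (σ : Equiv.Perm (Fin N)) :
    MeasurePreserving (fun (x : Config N) (j : Fin N) => x (σ j)) volume volume := by
  have h := volume_measurePreserving_piCongrLeft (fun _ : Fin N => Plane) σ.symm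
  have e : (fun (x : Config N) (j : Fin N) => x (σ j)) =
      MeasurableEquiv.piCongrLeft (fun _ : Fin N => Plane) σ.symm := by
    funext x j
    have := Equiv.piCongrLeft_apply_apply (fun _ : Fin N => Plane) σ.symm x (σ j)
    rw [Equiv.symm_apply_apply] at this
    exact this.symm
  rw [e]
  exact h

/-- The permutation of variables `(perm σ F)(x) = F(x ∘ σ)`. -/
def perm (σ : Equiv.Perm (Fin N)) : L2 (Config N) →ₗᵢ[ℂ] L2 (Config N) :=
  Lp.compMeasurePreservingₗᵢ ℂ _ (measurePreserving_perm σ)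

theorem perm_coe (σ : Equiv.Perm (Fin N)) (F : L2 (Config N)) {f : Config N → ℂ}
    (h : F =ᵐ[volume] f) : perm σ F =ᵐ[volume] fun x => f (fun j => x (σ j)) :=
  (Lp.coeFn_compMeasurePreserving F (measurePreserving_perm σ)).trans
    ((measurePreserving_perm σ).quasiMeasurePreserving.ae_eq_comp h)

theorem perm_mul (σ τ : Equiv.Perm (Fin N)) (F : L2 (Config N)) :
    perm (σ * τ) F = perm σ (perm τ F) := by
  refine Lp.ext ?_
  filter_upwards [perm_coe (σ * τ) F EventuallyEq.rfl,
    perm_coe σ _ (perm_coe τ F EventuallyEq.rfl)] with x h1 h2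
  rw [h1, h2]
  rfl

@[simp] theorem perm_one (F : L2 (Config N)) : perm 1 F = F := by
  refine Lp.ext ?_
  filter_upwards [perm_coe 1 F EventuallyEq.rfl] with x h1
  rw [h1]
  rfl

@[simp] theorem perm_inv_perm (σ : Equiv.Perm (Fin N)) (F : L2 (Config N)) :
    perm σ⁻¹ (perm σ F) = F := by rw [← perm_mul, inv_mul_cancel, perm_one]

@[simp] theorem perm_swap_swap (i j : Fin N) (F : L2 (Config N)) :
    perm (Equiv.swap i j) (perm (Equiv.swap i j) F) = F := by
  rw [← perm_mul, Equiv.swap_mul_self, perm_one]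

theorem inner_perm_left (σ : Equiv.Perm (Fin N)) (F G : L2 (Config N)) :
    ⟪perm σ F, G⟫_ℂ = ⟪F, perm σ⁻¹ G⟫_ℂ := by
  rw [← (perm σ⁻¹).inner_map_map, perm_inv_perm]

theorem perm_mulOp {f : Config N → ℝ} (hf : IsMult f) (σ : Equiv.Perm (Fin N))
    (F : L2 (Config N)) :
    perm σ (mulOp f F) = mulOp (fun x => f (fun j => x (σ j))) (perm σ F) := by
  refine Lp.ext ?_
  filter_upwards [perm_coe σ _ (mulOp_coe hf F),
    mulOp_coe' (hf.comp (measurePreserving_perm σ).measurable) _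
      (perm_coe σ F EventuallyEq.rfl)] with x h1 h2
  rw [h1, h2]

/-- `F` is antisymmetric under exchange of the particles in `T`. -/
def AntisymOn (T : Set (Fin N)) (F : L2 (Config N)) : Prop :=
  ∀ i ∈ T, ∀ j ∈ T, i ≠ j → perm (Equiv.swap i j) F = -F

theorem AntisymOn.mono {T T' : Set (Fin N)} {F : L2 (Config N)} (h : AntisymOn T F)
    (hT : T' ⊆ T) : AntisymOn T' F := fun i hi j hj => h i (hT hi) j (hT hj)

end Permutations

/-! ### Tensor products with a one-particle function and partial inner products. -/

section Tensor

variable {n : ℕ}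

theorem cons_eq_piFinSuccAbove_symm :
    (fun z : Plane × Config n => (Fin.cons z.1 z.2 : Config (n + 1))) =
      (MeasurableEquiv.piFinSuccAbove (fun _ : Fin (n + 1) => Plane) 0).symm := by
  funext z j
  refine Fin.cases ?_ (fun i => ?_) j <;> rfl

theorem measurePreserving_cons : MeasurePreserving
    (fun z : Plane × Config n => (Fin.cons z.1 z.2 : Config (n + 1))) volume volume := by
  rw [cons_eq_piFinSuccAbove_symm]
  exact (volume_preserving_piFinSuccAbove (fun _ : Fin (n + 1) => Plane) 0).symm

theorem measurePreserving_uncons : MeasurePreserving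
    (fun x : Config (n + 1) => (x 0, fun j : Fin n => x j.succ)) volume volume :=
  volume_preserving_piFinSuccAbove (fun _ : Fin (n + 1) => Plane) 0

theorem measurableEmbedding_cons : MeasurableEmbedding
    (fun z : Plane × Config n => (Fin.cons z.1 z.2 : Config (n + 1))) := by
  rw [cons_eq_piFinSuccAbove_symm]
  exact (MeasurableEquiv.piFinSuccAbove (fun _ : Fin (n + 1) => Plane) 0).symm.measurableEmbedding

theorem integral_config_succ {E : Type*} [NormedAddCommGroup E] [NormedSpace ℝ E]
    (f : Config (n + 1) → E) :
    ∫ x, f x = ∫ z : Plane × Config n, f (Fin.cons z.1 z.2) :=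
  (measurePreserving_cons.integral_comp measurableEmbedding_cons f).symm

theorem lintegral_config_succ (f : Config (n + 1) → ℝ≥0∞) :
    ∫⁻ x, f x = ∫⁻ z : Plane × Config n, f (Fin.cons z.1 z.2) :=
  (measurePreserving_cons.lintegral_comp_emb measurableEmbedding_cons f).symm

theorem ae_config_succ {p : Config (n + 1) → Prop} (h : ∀ᵐ x, p x) :
    ∀ᵐ x' : Config n, ∀ᵐ y : Plane, p (Fin.cons y x') := by
  have h1 : ∀ᵐ z : Plane × Config n, p (Fin.cons z.1 z.2) :=
    measurePreserving_cons.quasiMeasurePreserving.ae h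
  have h2 : ∀ᵐ z : Config n × Plane, p (Fin.cons z.2 z.1) := by
    have := (Measure.measurePreserving_swap (μ := (volume : Measure (Config n)))
      (ν := (volume : Measure Plane))).quasiMeasurePreserving.ae h1
    exact this
  exact Measure.ae_ae_of_ae_prod h2

theorem memLp_tensor {b : Plane → ℂ} {g : Config n → ℂ} (hb : MemLp b 2 volume)
    (hg : MemLp g 2 volume) :
    MemLp (fun x : Config (n + 1) => b (x 0) * g (fun j => x j.succ)) 2 volume := by
  have h : MemLp (fun z : Plane × Config n => b z.1 * g z.2) 2 volume := by
    have hm : AEStronglyMeasurable (fun z : Plane × Config n => b z.1 * g z.2) volume :=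
      (hb.1.comp_fst).mul (hg.1.comp_snd)
    rw [memLp_two_iff_integrable_sq_norm hm]
    simp only [norm_mul, mul_pow]
    exact (hb.integrable_norm_pow two_ne_zero).mul_prod (hg.integrable_norm_pow two_ne_zero)
  exact h.comp_measurePreserving measurePreserving_uncons

theorem ae_eq_tensor {b b' : Plane → ℂ} {g g' : Config n → ℂ} (hb : b =ᵐ[volume] b')
    (hg : g =ᵐ[volume] g') :
    (fun x : Config (n + 1) => b (x 0) * g (fun j => x j.succ)) =ᵐ[volume]
      fun x : Config (n + 1) => b' (x 0) * g' (fun j => x j.succ) := by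
  have h1 : ∀ᵐ z : Plane × Config n, b z.1 = b' z.1 :=
    Measure.quasiMeasurePreserving_fst.ae hb
  have h2 : ∀ᵐ z : Plane × Config n, g z.2 = g' z.2 :=
    Measure.quasiMeasurePreserving_snd.ae hg
  have h3 := measurePreserving_uncons.quasiMeasurePreserving.ae (h1.and h2)
  filter_upwards [h3] with x hx
  rw [hx.1, hx.2]

theorem integral_tensor (b b' : L2 Plane) (g g' : L2 (Config n)) :
    ∫ x : Config (n + 1), conj (b (x 0) * g (fun j => x j.succ)) *
      (b' (x 0) * g' (fun j => x j.succ)) = ⟪b, b'⟫_ℂ * ⟪g, g'⟫_ℂ := by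
  rw [integral_config_succ, inner_L2, inner_L2, ← integral_prod_mul]
  refine integral_congr_ae (Eventually.of_forall fun z => ?_)
  simp only [Fin.cons_zero, Fin.cons_succ, map_mul]
  ring

/-- The tensor product `(b ⊗ G)(x) = b(x₀) G(x₁, …, x_n)`. -/
def tensor : L2 Plane →L[ℂ] L2 (Config n) →L[ℂ] L2 (Config (n + 1)) :=
  LinearMap.mkContinuous₂
    (LinearMap.mk₂ ℂ (fun b g => (memLp_tensor (Lp.memLp b) (Lp.memLp g)).toLp _)
      (fun b b' g => by
        rw [← MemLp.toLp_add]
        refine MemLp.toLp_congr _ _ ((ae_eq_tensor (Lp.coeFn_add b b') EventuallyEq.rfl).trans ?_)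
        exact Eventually.of_forall fun x => by simp [add_mul])
      (fun c b g => by
        rw [← MemLp.toLp_const_smul]
        refine MemLp.toLp_congr _ _ ((ae_eq_tensor (Lp.coeFn_smul c b) EventuallyEq.rfl).trans ?_)
        exact Eventually.of_forall fun x => by simp [mul_assoc])
      (fun b g g' => by
        rw [← MemLp.toLp_add]
        refine MemLp.toLp_congr _ _ ((ae_eq_tensor EventuallyEq.rfl (Lp.coeFn_add g g')).trans ?_)
        exact Eventually.of_forall fun x => by simp [mul_add])
      (fun c b g => by
        rw [← MemLp.toLp_const_smul]
        refine MemLp.toLp_congr _ _ ((ae_eq_tensor EventuallyEq.rfl (Lp.coeFn_smul c g)).trans ?_)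
        exact Eventually.of_forall fun x => by simp [mul_left_comm]))
    1 fun b g => by
      rw [one_mul, LinearMap.mk₂_apply]
      refine le_of_eq ?_
      have h : ‖(memLp_tensor (Lp.memLp b) (Lp.memLp g)).toLp _‖ ^ 2 = (‖b‖ * ‖g‖) ^ 2 := by
        have h1 := inner_self_eq_norm_sq_to_K (𝕜 := ℂ)
          ((memLp_tensor (Lp.memLp b) (Lp.memLp g)).toLp _)
        have h2 : ⟪(memLp_tensor (Lp.memLp b) (Lp.memLp g)).toLp _,
            (memLp_tensor (Lp.memLp b) (Lp.memLp g)).toLp _⟫_ℂ = ⟪b, b⟫_ℂ * ⟪g, g⟫_ℂ := by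
          rw [← integral_tensor, inner_L2]
          refine integral_congr_ae ?_
          filter_upwards [MemLp.coeFn_toLp (memLp_tensor (Lp.memLp b) (Lp.memLp g))] with x hx
          rw [hx]
        rw [h2, inner_self_eq_norm_sq_to_K, inner_self_eq_norm_sq_to_K, ← mul_pow] at h1
        have h3 : (((‖b‖ * ‖g‖) ^ 2 : ℝ) : ℂ) =
            ((‖(memLp_tensor (Lp.memLp b) (Lp.memLp g)).toLp _‖ ^ 2 : ℝ) : ℂ) := by
          push_cast
          exact h1
        exact (Complex.ofReal_injective h3).symm
      exact (pow_left_inj₀ (norm_nonneg _) (by positivity) two_ne_zero).1 h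

theorem tensor_coe (b : L2 Plane) (G : L2 (Config n)) {b' : Plane → ℂ} {g : Config n → ℂ}
    (hb : b =ᵐ[volume] b') (hg : G =ᵐ[volume] g) :
    tensor b G =ᵐ[volume] fun x => b' (x 0) * g (fun j => x j.succ) :=
  (MemLp.coeFn_toLp (memLp_tensor (Lp.memLp b) (Lp.memLp G))).trans (ae_eq_tensor hb hg)

theorem inner_tensor (b b' : L2 Plane) (g g' : L2 (Config n)) :
    ⟪tensor b g, tensor b' g'⟫_ℂ = ⟪b, b'⟫_ℂ * ⟪g, g'⟫_ℂ := by
  rw [← integral_tensor, inner_L2]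
  refine integral_congr_ae ?_
  filter_upwards [tensor_coe b g EventuallyEq.rfl EventuallyEq.rfl,
    tensor_coe b' g' EventuallyEq.rfl EventuallyEq.rfl] with x h1 h2
  rw [h1, h2]

theorem norm_tensor (b : L2 Plane) (g : L2 (Config n)) : ‖tensor b g‖ = ‖b‖ * ‖g‖ := by
  have h := inner_tensor b b g g
  rw [inner_self_eq_norm_sq_to_K, inner_self_eq_norm_sq_to_K, inner_self_eq_norm_sq_to_K,
    ← mul_pow] at h
  have h3 : ((‖tensor b g‖ ^ 2 : ℝ) : ℂ) = (((‖b‖ * ‖g‖) ^ 2 : ℝ) : ℂ) := by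
    push_cast
    exact h
  exact (pow_left_inj₀ (norm_nonneg _) (by positivity) two_ne_zero).1 (Complex.ofReal_injective h3)

/-- The partial inner product with `w` in the first variable. -/
def contr (w : L2 Plane) : L2 (Config (n + 1)) →L[ℂ] L2 (Config n) :=
  ContinuousLinearMap.adjoint (tensor w)

theorem inner_contr_right (w : L2 Plane) (G : L2 (Config n)) (F : L2 (Config (n + 1))) :
    ⟪G, contr w F⟫_ℂ = ⟪tensor w G, F⟫_ℂ :=
  ContinuousLinearMap.adjoint_inner_right _ _ _

theorem inner_contr_left (w : L2 Plane) (G : L2 (Config n)) (F : L2 (Config (n + 1))) :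
    ⟪contr w F, G⟫_ℂ = ⟪F, tensor w G⟫_ℂ :=
  ContinuousLinearMap.adjoint_inner_left _ _ _

theorem contr_tensor (w b : L2 Plane) (G : L2 (Config n)) :
    contr w (tensor b G) = ⟪w, b⟫_ℂ • G := by
  refine ext_inner_left ℂ fun H => ?_
  rw [inner_contr_right, inner_tensor, inner_smul_right]

theorem contr_sum_smul {ι : Type*} (s : Finset ι) (c : ι → ℂ) (w : ι → L2 Plane)
    (F : L2 (Config (n + 1))) :
    contr (∑ i ∈ s, c i • w i) F = ∑ i ∈ s, conj (c i) • contr (w i) F := by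
  refine ext_inner_left ℂ fun H => ?_
  rw [inner_contr_right, inner_sum]
  simp only [map_sum, map_smul, FunLike.coe_sum, Finset.sum_apply,
    FunLike.coe_smul, Pi.smul_apply, sum_inner, inner_smul_left, inner_smul_right,
    inner_contr_right]

/-- The adjoint is defined abstractly. Its integral formula is recovered by testing against
indicators of sets of finite measure and using Fubini's theorem. -/
theorem contr_coe (w : L2 Plane) (F : L2 (Config (n + 1))) {w' : Plane → ℂ}
    {f : Config (n + 1) → ℂ} (hw : w =ᵐ[volume] w') (hF : F =ᵐ[volume] f) :
    contr w F =ᵐ[volume] fun x' => ∫ y, conj (w' y) * f (Fin.cons y x') := by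
  have h0 : (fun x' : Config n => ∫ y, conj (w y) * F (Fin.cons y x')) =ᵐ[volume]
      fun x' => ∫ y, conj (w' y) * f (Fin.cons y x') := by
    filter_upwards [ae_config_succ hF] with x' hx'
    refine integral_congr_ae ?_
    filter_upwards [hw, hx'] with y h1 h2
    rw [h1, h2]
  refine EventuallyEq.trans ?_ h0
  have hint : ∀ s : Set (Config n), MeasurableSet s → volume s < ⊤ →
      Integrable (fun z : Plane × Config n => s.indicator (fun _ => (1 : ℂ)) z.2 *
        (conj (w z.1) * F (Fin.cons z.1 z.2))) := by
    intro s hs hsf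
    have h1 := integrable_conj_mul_L2
      (tensor w (indicatorConstLp 2 hs hsf.ne (1 : ℂ))) F
    have h2 := (measurePreserving_cons.integrable_comp_emb measurableEmbedding_cons).2 h1
    refine h2.congr ?_
    have h3 := tensor_coe w _ EventuallyEq.rfl
      (indicatorConstLp_coeFn (p := 2) (hs := hs) (hμs := hsf.ne) (c := (1 : ℂ)))
    have h4 := measurePreserving_cons.quasiMeasurePreserving.ae h3
    filter_upwards [h4] with z hz
    simp only [Function.comp_apply, hz, Fin.cons_zero, Fin.cons_succ, map_mul]
    have : conj (s.indicator (fun _ => (1 : ℂ)) z.2) = s.indicator (fun _ => (1 : ℂ)) z.2 := by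
      by_cases h : z.2 ∈ s <;> simp [h]
    rw [this]
    ring
  have hset : ∀ s : Set (Config n), MeasurableSet s → volume s < ⊤ →
      ∀ x' : Config n, ∫ y, s.indicator (fun _ => (1 : ℂ)) x' *
        (conj (w y) * F (Fin.cons y x')) =
        s.indicator (fun x' => ∫ y, conj (w y) * F (Fin.cons y x')) x' := by
    intro s hs hsf x'
    rw [integral_const_mul]
    by_cases h : x' ∈ s <;> simp [h]
  refine ae_eq_of_forall_setIntegral_eq_of_sigmaFinite (μ := volume) ?_ ?_ ?_
  · intro s hs hsf
    exact integrableOn_Lp_of_measure_ne_top _ (by norm_num) hsf.ne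
  · intro s hs hsf
    rw [← integrable_indicator_iff hs]
    have := (hint s hs hsf).integral_prod_right
    refine this.congr (Eventually.of_forall fun x' => ?_)
    exact hset s hs hsf x'
  · intro s hs hsf
    rw [← L2.inner_indicatorConstLp_one (𝕜 := ℂ) hs hsf.ne, inner_contr_right, inner_L2,
      integral_config_succ, ← integral_indicator hs]
    have e : ∫ z : Plane × Config n, conj (tensor w (indicatorConstLp 2 hs hsf.ne (1 : ℂ))
        (Fin.cons z.1 z.2)) * F (Fin.cons z.1 z.2) =
        ∫ z : Plane × Config n, s.indicator (fun _ => (1 : ℂ)) z.2 *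
        (conj (w z.1) * F (Fin.cons z.1 z.2)) := by
      refine integral_congr_ae ?_
      have h3 := tensor_coe w _ EventuallyEq.rfl
        (indicatorConstLp_coeFn (p := 2) (hs := hs) (hμs := hsf.ne) (c := (1 : ℂ)))
      have h4 := measurePreserving_cons.quasiMeasurePreserving.ae h3
      filter_upwards [h4] with z hz
      simp only [hz, Fin.cons_zero, Fin.cons_succ, map_mul]
      have : conj (s.indicator (fun _ => (1 : ℂ)) z.2) = s.indicator (fun _ => (1 : ℂ)) z.2 := by
        by_cases h : z.2 ∈ s <;> simp [h]
      rw [this]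
      ring
    rw [e]
    have := integral_prod_symm _ (hint s hs hsf)
    refine this.trans (integral_congr_ae (Eventually.of_forall fun x' => ?_))
    exact hset s hs hsf x'

end Tensor

/-! ### Operators of rank one acting on a particle, and the Pauli principle -/

section RankOne

variable {n : ℕ}

/-- The rank-one operator `|b⟩⟨w|` acting on the variable of particle `l`. -/
def kOp (l : Fin (n + 1)) (b w : L2 Plane) : L2 (Config (n + 1)) →L[ℂ] L2 (Config (n + 1)) :=
  (perm (Equiv.swap 0 l)).toContinuousLinearMap ∘L tensor b ∘L contr w ∘L
    (perm (Equiv.swap 0 l)).toContinuousLinearMap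

theorem kOp_apply (l : Fin (n + 1)) (b w : L2 Plane) (F : L2 (Config (n + 1))) :
    kOp l b w F = perm (Equiv.swap 0 l) (tensor b (contr w (perm (Equiv.swap 0 l) F))) := rfl

theorem kOp_zero_apply (b w : L2 Plane) (F : L2 (Config (n + 1))) :
    kOp 0 b w F = tensor b (contr w F) := by
  rw [kOp_apply, Equiv.swap_self]
  change perm 1 (tensor b (contr w (perm 1 F))) = _
  simp

theorem cons_comp_swap (l : Fin (n + 1)) (x : Config (n + 1)) (y : Plane) :
    (fun j => (Fin.cons y (fun k : Fin n => x (Equiv.swap 0 l k.succ)) : Config (n + 1))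
      (Equiv.swap 0 l j)) = Function.update x l y := by
  funext j
  by_cases hj : j = l
  · subst hj
    simp
  · rw [Function.update_of_ne hj]
    have h0 : Equiv.swap 0 l j ≠ 0 := by
      intro h
      exact hj ((Equiv.swap 0 l).injective (h.trans (Equiv.swap_apply_right 0 l).symm))
    obtain ⟨k, hk⟩ := Fin.exists_succ_eq.2 h0
    rw [← hk, Fin.cons_succ, hk, Equiv.swap_apply_self]

theorem kOp_coe (l : Fin (n + 1)) (b w : L2 Plane) (F : L2 (Config (n + 1))) {b' w' : Plane → ℂ}
    {f : Config (n + 1) → ℂ} (hb : b =ᵐ[volume] b') (hw : w =ᵐ[volume] w')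
    (hF : F =ᵐ[volume] f) : kOp l b w F =ᵐ[volume]
      fun x => b' (x l) * ∫ y, conj (w' y) * f (Function.update x l y) := by
  have h := perm_coe (Equiv.swap 0 l) _ (tensor_coe b _ hb
    (contr_coe w _ hw (perm_coe (Equiv.swap 0 l) F hF)))
  refine h.trans (Eventually.of_forall fun x => ?_)
  simp only [Equiv.swap_apply_left]
  congr 2
  funext y
  rw [← cons_comp_swap l x y]

theorem kOp_kOp_same (l : Fin (n + 1)) (b w b' w' : L2 Plane) (F : L2 (Config (n + 1))) :
    kOp l b w (kOp l b' w' F) = ⟪w, b'⟫_ℂ • kOp l b w' F := by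
  simp only [kOp_apply, perm_swap_swap, contr_tensor, map_smul]

theorem inner_kOp_left (l : Fin (n + 1)) (b w : L2 Plane) (F G : L2 (Config (n + 1))) :
    ⟪kOp l b w F, G⟫_ℂ = ⟪F, kOp l w b G⟫_ℂ := by
  simp only [kOp_apply]
  rw [inner_perm_left, Equiv.swap_inv, ← inner_contr_right, inner_contr_left, ← Equiv.swap_inv,
    ← inner_perm_left, Equiv.swap_inv]

theorem perm_kOp (σ : Equiv.Perm (Fin (n + 1))) (l : Fin (n + 1)) (b w : L2 Plane)
    (F : L2 (Config (n + 1))) : perm σ (kOp l b w F) = kOp (σ l) b w (perm σ F) := by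
  refine Lp.ext ?_
  filter_upwards [perm_coe σ _ (kOp_coe l b w F EventuallyEq.rfl EventuallyEq.rfl EventuallyEq.rfl),
    kOp_coe (σ l) b w _ EventuallyEq.rfl EventuallyEq.rfl
      (perm_coe σ F EventuallyEq.rfl)] with x h1 h2
  rw [h1, h2]
  congr 2
  funext y
  congr 2
  funext j
  by_cases hj : j = l
  · subst hj; simp
  · rw [Function.update_of_ne hj, Function.update_of_ne (σ.injective.ne hj)]

theorem kOp_succ_tensor (k : Fin (n + 1)) (b w b' : L2 Plane) (G : L2 (Config (n + 1))) :
    kOp k.succ b w (tensor b' G) = tensor b' (kOp k b w G) := by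
  refine Lp.ext ?_
  filter_upwards [kOp_coe k.succ b w _ EventuallyEq.rfl EventuallyEq.rfl
      (tensor_coe b' G EventuallyEq.rfl EventuallyEq.rfl),
    tensor_coe b' _ EventuallyEq.rfl
      (kOp_coe k b w G EventuallyEq.rfl EventuallyEq.rfl EventuallyEq.rfl)] with x h1 h2
  rw [h1, h2, mul_left_comm (b' (x 0)), ← integral_const_mul (b' (x 0))]
  congr 2
  funext y
  rw [Function.update_of_ne (Fin.succ_ne_zero k).symm, mul_left_comm]
  congr 3
  have : (fun j : Fin (n + 1) => Function.update x k.succ y j.succ) =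
      Function.update (fun j : Fin (n + 1) => x j.succ) k y := by
    funext j
    by_cases hj : j = k
    · subst hj; simp
    · rw [Function.update_of_ne hj, Function.update_of_ne ((Fin.succ_injective _).ne hj)]
  rw [this]

theorem contr_kOp_succ (k : Fin (n + 1)) (b w w' : L2 Plane) (F : L2 (Config (n + 2))) :
    contr w' (kOp k.succ b w F) = kOp k b w (contr w' F) := by
  refine ext_inner_left ℂ fun H => ?_
  rw [inner_contr_right, ← inner_kOp_left, kOp_succ_tensor, ← inner_kOp_left, inner_contr_right]

theorem kOp_comm {l m : Fin (n + 1)} (h : l ≠ m) (b w b' w' : L2 Plane)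
    (F : L2 (Config (n + 1))) : kOp l b w (kOp m b' w' F) = kOp m b' w' (kOp l b w F) := by
  -- For l = 0 the two operators act on different factors of the tensor product. Conjugation with
  -- the exchange of 0 and l gives the general case.
  have key : ∀ {n : ℕ} (m : Fin (n + 1)), m ≠ 0 → ∀ (b w b' w' : L2 Plane)
      (F : L2 (Config (n + 1))), kOp 0 b w (kOp m b' w' F) = kOp m b' w' (kOp 0 b w F) := by
    intro n m hm b w b' w' F
    cases n with
    | zero => exact absurd (Fin.fin_one_eq_zero m) hm
    | succ n =>
      obtain ⟨k, rfl⟩ := Fin.exists_succ_eq.2 hm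
      rw [kOp_zero_apply, kOp_zero_apply, contr_kOp_succ, kOp_succ_tensor]
  have hm : Equiv.swap 0 l m ≠ 0 := by
    intro h'
    exact h ((Equiv.swap 0 l).injective (h'.trans (Equiv.swap_apply_right 0 l).symm)).symm
  have := congrArg (perm (Equiv.swap 0 l)) (key _ hm b w b' w' (perm (Equiv.swap 0 l) F))
  simpa only [perm_kOp, Equiv.swap_apply_left, Equiv.swap_apply_self, perm_swap_swap] using this

theorem mulOp_kOp {f : Config (n + 1) → ℝ} (hf : IsMult f) {l : Fin (n + 1)}
    (h : ∀ x y, f (Function.update x l y) = f x) (b w : L2 Plane) (F : L2 (Config (n + 1))) :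
    mulOp f (kOp l b w F) = kOp l b w (mulOp f F) := by
  refine Lp.ext ?_
  filter_upwards [mulOp_coe' hf _
      (kOp_coe l b w F EventuallyEq.rfl EventuallyEq.rfl EventuallyEq.rfl),
    kOp_coe l b w _ EventuallyEq.rfl EventuallyEq.rfl (mulOp_coe hf F)] with x h1 h2
  rw [h1, h2]
  simp only [h]
  rw [mul_left_comm, ← integral_const_mul]
  congr 2
  funext y
  ring

theorem mulOp_eval_kOp {f : Plane → ℝ} (hf : IsMult f) (l : Fin (n + 1)) (b w : L2 Plane)
    (F : L2 (Config (n + 1))) :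
    mulOp (fun x : Config (n + 1) => f (x l)) (kOp l b w F) = kOp l (mulOp f b) w F := by
  refine Lp.ext ?_
  filter_upwards [mulOp_coe' (hf.comp (measurable_pi_apply l)) _
      (kOp_coe l b w F EventuallyEq.rfl EventuallyEq.rfl EventuallyEq.rfl),
    kOp_coe l _ w F (mulOp_coe hf b) EventuallyEq.rfl EventuallyEq.rfl] with x h1 h2
  rw [h1, h2]
  ring

theorem contr_mulOp {f : Config (n + 1) → ℝ} {g : Config n → ℝ} (hf : IsMult f) (hg : IsMult g)
    (h : ∀ y x', f (Fin.cons y x') = g x') (w : L2 Plane) (F : L2 (Config (n + 1))) :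
    contr w (mulOp f F) = mulOp g (contr w F) := by
  refine Lp.ext ?_
  filter_upwards [contr_coe w _ EventuallyEq.rfl (mulOp_coe hf F),
    mulOp_coe' hg _ (contr_coe w F EventuallyEq.rfl EventuallyEq.rfl)] with x h1 h2
  rw [h1, h2, ← integral_const_mul]
  congr 1
  funext y
  rw [h]
  ring

theorem kOp_add_left (l : Fin (n + 1)) (b b' w : L2 Plane) (F : L2 (Config (n + 1))) :
    kOp l (b + b') w F = kOp l b w F + kOp l b' w F := by
  simp [kOp_apply]

theorem kOp_smul_left (l : Fin (n + 1)) (c : ℂ) (b w : L2 Plane) (F : L2 (Config (n + 1))) :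
    kOp l (c • b) w F = c • kOp l b w F := by
  simp [kOp_apply]

/-- The variable of particle l in F is integrated out, so moving this particle moves b alone. Hence
`HasSD.kOp` needs regularity of b and none of F. -/
theorem trans_kOp (l : Fin (n + 1)) (c : Fin 2) (h : ℝ) (b w : L2 Plane)
    (F : L2 (Config (n + 1))) :
    trans (h • dirN l c) (kOp l b w F) = kOp l (trans (h • dir c) b) w F := by
  refine Lp.ext ?_
  filter_upwards [trans_coe' (h • dirN l c) _
      (kOp_coe l b w F EventuallyEq.rfl EventuallyEq.rfl EventuallyEq.rfl),
    kOp_coe l _ w F (trans_coe _ b) EventuallyEq.rfl EventuallyEq.rfl] with x h1 h2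
  rw [h1, h2]
  have e1 : (x + h • dirN l c) l = x l + h • dir c := by simp [dirN]
  have e2 : ∀ y, Function.update (x + h • dirN l c) l y = Function.update x l y := by
    intro y
    funext j
    by_cases hj : j = l
    · subst hj; simp
    · simp [Function.update_of_ne hj, dirN, Pi.single_eq_of_ne hj]
  simp only [e1, e2]

theorem HasSD.kOp {c : Fin 2} {b b' : L2 Plane} (h : HasSD (dir c) b b') (l : Fin (n + 1))
    (w : L2 Plane) (F : L2 (Config (n + 1))) :
    HasSD (dirN l c) (kOp l b w F) (kOp l b' w F) := by
  unfold HasSD at h ⊢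
  simp only [trans_kOp]
  simp only [kOp_apply]
  set G := contr w (perm (Equiv.swap 0 l) F)
  have h1 : HasDerivAt (fun t : ℝ => tensor (trans (t • dir c) b) G) (tensor b' G) 0 :=
    ((((tensor (n := n)).flip G).restrictScalars ℝ).hasFDerivAt).comp_hasDerivAt (0 : ℝ) h
  exact (((perm (Equiv.swap 0 l)).toContinuousLinearMap.restrictScalars ℝ).hasFDerivAt).comp_hasDerivAt
    (0 : ℝ) h1

theorem trans_perm (σ : Equiv.Perm (Fin (n + 1))) (a : Config (n + 1)) (F : L2 (Config (n + 1))) :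
    trans a (perm σ F) = perm σ (trans (fun j => a (σ j)) F) := by
  refine Lp.ext ?_
  filter_upwards [trans_coe' a _ (perm_coe σ F EventuallyEq.rfl),
    perm_coe σ _ (trans_coe (fun j => a (σ j)) F)] with x h1 h2
  rw [h1, h2]
  rfl

theorem HasSD.perm {l : Fin (n + 1)} {c : Fin 2} {F F' : L2 (Config (n + 1))}
    (h : HasSD (dirN l c) F F') (σ : Equiv.Perm (Fin (n + 1))) :
    HasSD (dirN (σ l) c) (MagneticFermions.perm σ F) (MagneticFermions.perm σ F') := by
  unfold HasSD at h ⊢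
  have e : ∀ t : ℝ, (fun j => (t • dirN (σ l) c) (σ j)) = t • dirN l c := by
    intro t
    funext j
    by_cases hj : j = l
    · subst hj; simp [dirN]
    · simp [dirN, Pi.single_eq_of_ne hj, Pi.single_eq_of_ne (σ.injective.ne hj)]
  simp only [trans_perm, e]
  exact (((MagneticFermions.perm σ).toContinuousLinearMap.restrictScalars ℝ).hasFDerivAt).comp_hasDerivAt
    (0 : ℝ) h

end RankOne

section Pauli

variable {n : ℕ}

theorem perm_swap_kOp_kOp {l m : Fin (n + 1)} (h : l ≠ m) (w : L2 Plane)
    (F : L2 (Config (n + 1))) :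
    perm (Equiv.swap l m) (kOp l w w (kOp m w w F)) = kOp l w w (kOp m w w F) := by
  have hc := kOp_coe l w w _ EventuallyEq.rfl EventuallyEq.rfl
    (kOp_coe m w w F EventuallyEq.rfl EventuallyEq.rfl EventuallyEq.rfl)
  refine Lp.ext ?_
  filter_upwards [hc, perm_coe (Equiv.swap l m) _ hc] with x h1 h2
  rw [h1, h2]
  simp only [Equiv.swap_apply_left, Function.update_of_ne h.symm, Equiv.swap_apply_right]
  have e : ∀ y z, Function.update (Function.update (fun j => x (Equiv.swap l m j)) l y) m z =
      Function.update (Function.update x l y) m z := by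
    intro y z
    funext j
    by_cases hm : j = m
    · subst hm; simp
    · by_cases hl : j = l
      · subst hl; simp [Function.update_of_ne h]
      · simp [Function.update_of_ne hm, Function.update_of_ne hl, Equiv.swap_apply_of_ne_of_ne hl hm]
  simp only [e]
  have pull : ∀ (c : ℂ) (I : Plane → ℂ), ∫ y, conj (w y) * (c * I y) =
      c * ∫ y, conj (w y) * I y := by
    intro c I
    rw [← integral_const_mul]
    congr 1
    funext y
    ring
  rw [pull, pull]
  ring

/-- Two fermions cannot occupy the same orbital: the function is symmetric in the two particles by
`perm_swap_kOp_kOp`, and antisymmetric because Φ is. -/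
theorem kOp_kOp_eq_zero {T : Set (Fin (n + 1))} {Φ : L2 (Config (n + 1))} (hΦ : AntisymOn T Φ)
    {l m : Fin (n + 1)} (hl : l ∈ T) (hm : m ∈ T) (h : l ≠ m) (w : L2 Plane) :
    kOp l w w (kOp m w w Φ) = 0 := by
  have h1 := perm_swap_kOp_kOp h w Φ
  rw [perm_kOp, perm_kOp, hΦ l hl m hm h, Equiv.swap_apply_left, Equiv.swap_apply_right,
    kOp_comm h.symm, map_neg, map_neg] at h1
  have h2 : (2 : ℂ) • kOp l w w (kOp m w w Φ) = 0 := by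
    rw [two_smul]
    nth_rewrite 1 [← h1]
    simp
  exact (smul_eq_zero.1 h2).resolve_left two_ne_zero

/-- The Pauli principle: the occupation numbers of an antisymmetric function are at most one. -/
theorem pauli (T : Finset (Fin (n + 1))) {Φ : L2 (Config (n + 1))} (hΦ : AntisymOn T Φ)
    (w : L2 Plane) :
    ∑ l ∈ T, ‖contr w (perm (Equiv.swap 0 l) Φ)‖ ^ 2 ≤ ‖w‖ ^ 2 * ‖Φ‖ ^ 2 := by
  -- With G the sum of the projections |w⟩⟨w| applied to Φ, one has s = ⟨Φ, G⟩, while ‖G‖² = ‖w‖² s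
  -- because the mixed terms vanish by `kOp_kOp_eq_zero`. Cauchy–Schwarz gives s² ≤ ‖Φ‖² ‖w‖² s.
  set s := ∑ l ∈ T, ‖contr w (perm (Equiv.swap 0 l) Φ)‖ ^ 2 with hs
  have hs0 : 0 ≤ s := Finset.sum_nonneg fun _ _ => by positivity
  set G := ∑ l ∈ T, kOp l w w Φ with hG
  have h1 : ⟪Φ, G⟫_ℂ = (s : ℂ) := by
    rw [hG, inner_sum, hs, Complex.ofReal_sum]
    refine Finset.sum_congr rfl fun l _ => ?_
    have e := inner_perm_left (Equiv.swap 0 l) Φ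
      (tensor w (contr w (perm (Equiv.swap 0 l) Φ)))
    rw [Equiv.swap_inv] at e
    rw [kOp_apply, ← e, ← inner_contr_left, inner_self_eq_norm_sq_to_K]
    push_cast
    rfl
  have hnk : ∀ l, ‖kOp l w w Φ‖ ^ 2 = ‖w‖ ^ 2 * ‖contr w (perm (Equiv.swap 0 l) Φ)‖ ^ 2 := by
    intro l
    rw [kOp_apply, (perm _).norm_map, norm_tensor, mul_pow]
  have h2 : ‖G‖ ^ 2 = ‖w‖ ^ 2 * s := by
    have h3 : ⟪G, G⟫_ℂ = ((‖w‖ ^ 2 * s : ℝ) : ℂ) := by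
      rw [hs, Finset.mul_sum, Complex.ofReal_sum]
      nth_rewrite 1 [hG]
      rw [sum_inner]
      refine Finset.sum_congr rfl fun l hl => ?_
      rw [hG, inner_sum, Finset.sum_eq_single_of_mem l hl]
      · rw [inner_self_eq_norm_sq_to_K, ← hnk]
        push_cast
        rfl
      · intro m hm hml
        rw [inner_kOp_left, kOp_kOp_eq_zero hΦ hl hm hml.symm, inner_zero_right]
    have h4 := inner_self_eq_norm_sq_to_K (𝕜 := ℂ) G
    rw [h3] at h4
    have h5 : ((‖w‖ ^ 2 * s : ℝ) : ℂ) = ((‖G‖ ^ 2 : ℝ) : ℂ) := by rw [h4]; push_cast; rfl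
    exact (Complex.ofReal_injective h5).symm
  have h3 : s ≤ ‖Φ‖ * ‖G‖ := by
    have := norm_inner_le_norm (𝕜 := ℂ) Φ G
    rwa [h1, Complex.norm_real, Real.norm_eq_abs, abs_of_nonneg hs0] at this
  have h4 : s ^ 2 ≤ ‖Φ‖ ^ 2 * (‖w‖ ^ 2 * s) := by
    rw [← h2, ← mul_pow]
    exact pow_le_pow_left₀ hs0 h3 2
  rcases hs0.eq_or_lt with h0 | h0
  · rw [← h0]; positivity
  · have : s * s ≤ (‖w‖ ^ 2 * ‖Φ‖ ^ 2) * s := by nlinarith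
    exact le_of_mul_le_mul_right this h0

end Pauli

/-! ### Families of orbitals -/

/-- In this direction the inequality needs no measurability. -/
theorem sum_lintegral_le {X ι : Type*} [MeasureSpace X] (s : Finset ι) (f : ι → X → ℝ≥0∞) :
    ∑ i ∈ s, ∫⁻ x, f i x ≤ ∫⁻ x, ∑ i ∈ s, f i x := by
  classical
  induction s using Finset.induction_on with
  | empty => simp
  | insert a s ha ih =>
    simp only [Finset.sum_insert ha]
    exact (add_le_add le_rfl ih).trans (le_lintegral_add _ _)

section Families

variable {n : ℕ} {ι : Type*} [Fintype ι]

/-- The operator `∑_j |b_j⟩⟨u_j|` acting on the variable of particle `l`. -/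
def bOp (u b : ι → L2 Plane) (l : Fin (n + 1)) : L2 (Config (n + 1)) →L[ℂ] L2 (Config (n + 1)) :=
  ∑ j, kOp l (b j) (u j)

theorem bOp_apply (u b : ι → L2 Plane) (l : Fin (n + 1)) (F : L2 (Config (n + 1))) :
    bOp u b l F = ∑ j, kOp l (b j) (u j) F := by
  simp [bOp]

theorem perm_bOp (u b : ι → L2 Plane) (σ : Equiv.Perm (Fin (n + 1))) (l : Fin (n + 1))
    (F : L2 (Config (n + 1))) : perm σ (bOp u b l F) = bOp u b (σ l) (perm σ F) := by
  simp [bOp_apply, perm_kOp]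

theorem AntisymOn.bOp {T : Set (Fin (n + 1))} {F : L2 (Config (n + 1))} (h : AntisymOn T F)
    {l : Fin (n + 1)} (hl : l ∉ T) (u b : ι → L2 Plane) :
    AntisymOn T (MagneticFermions.bOp u b l F) := by
  intro i hi j hj hij
  rw [perm_bOp, h i hi j hj hij, map_neg, Equiv.swap_apply_of_ne_of_ne]
  · rintro rfl; exact hl hi
  · rintro rfl; exact hl hj

theorem bOp_comm (u b u' b' : ι → L2 Plane) {l m : Fin (n + 1)} (h : l ≠ m)
    (F : L2 (Config (n + 1))) :
    bOp u b l (bOp u' b' m F) = bOp u' b' m (bOp u b l F) := by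
  simp only [bOp_apply, map_sum]
  rw [Finset.sum_comm]
  simp only [kOp_comm h]

theorem mulOp_bOp {f : Config (n + 1) → ℝ} (hf : IsMult f) {l : Fin (n + 1)}
    (h : ∀ x y, f (Function.update x l y) = f x) (u b : ι → L2 Plane) (F : L2 (Config (n + 1))) :
    mulOp f (bOp u b l F) = bOp u b l (mulOp f F) := by
  simp only [bOp_apply, map_sum, mulOp_kOp hf h]

theorem bOp_add (u b b' : ι → L2 Plane) (l : Fin (n + 1)) (F : L2 (Config (n + 1))) :
    bOp u (fun j => b j + b' j) l F = bOp u b l F + bOp u b' l F := by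
  simp only [bOp_apply, kOp_add_left, Finset.sum_add_distrib]

theorem bOp_smul (c : ℂ) (u b : ι → L2 Plane) (l : Fin (n + 1)) (F : L2 (Config (n + 1))) :
    bOp u (fun j => c • b j) l F = c • bOp u b l F := by
  simp only [bOp_apply, kOp_smul_left, Finset.smul_sum]

theorem mulOp_eval_bOp {f : Plane → ℝ} (hf : IsMult f) (u b : ι → L2 Plane) (l : Fin (n + 1))
    (F : L2 (Config (n + 1))) :
    mulOp (fun x : Config (n + 1) => f (x l)) (bOp u b l F) =
      bOp u (fun j => mulOp f (b j)) l F := by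
  simp only [bOp_apply, map_sum, mulOp_eval_kOp hf]

theorem HasSD.bOp {c : Fin 2} {u b b' : ι → L2 Plane} (h : ∀ j, HasSD (dir c) (b j) (b' j))
    (l : Fin (n + 1)) (F : L2 (Config (n + 1))) :
    HasSD (dirN l c) (MagneticFermions.bOp u b l F) (MagneticFermions.bOp u b' l F) := by
  simp only [bOp_apply]
  exact HasSD.sum _ fun j _ => (h j).kOp l _ _

variable {u : ι → L2 Plane} (hu : Orthonormal ℂ u)

include hu in
theorem bOp_bOp_same (b b' : ι → L2 Plane) (l : Fin (n + 1)) (F : L2 (Config (n + 1)))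
    (hb' : b' = u) : bOp u b l (bOp u b' l F) = bOp u b l F := by
  classical
  subst hb'
  simp only [bOp_apply, map_sum, kOp_kOp_same]
  refine Finset.sum_congr rfl fun j _ => ?_
  simp only [orthonormal_iff_ite.1 hu]
  simp

theorem inner_bOp_self_left (l : Fin (n + 1)) (F G : L2 (Config (n + 1))) :
    ⟪bOp u u l F, G⟫_ℂ = ⟪F, bOp u u l G⟫_ℂ := by
  simp only [bOp_apply, sum_inner, inner_sum, inner_kOp_left]

theorem comp_swap_eq_update (x : Config (n + 1)) {i j : Fin (n + 1)} :
    (fun k => x (Equiv.swap i j k)) = Function.update (Function.update x i (x j)) j (x i) := by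
  funext k
  by_cases hj : k = j
  · subst hj; simp
  · by_cases hi : k = i
    · subst hi; simp [Function.update_of_ne hj]
    · simp [Function.update_of_ne hj, Function.update_of_ne hi, Equiv.swap_apply_of_ne_of_ne hi hj]

include hu in
theorem norm_sq_sum_conj_smul (c : ι → ℂ) : ‖∑ j, conj (c j) • u j‖ ^ 2 = ∑ j, ‖c j‖ ^ 2 := by
  have h := hu.inner_sum (fun j => conj (c j)) (fun j => conj (c j)) Finset.univ
  rw [inner_self_eq_norm_sq_to_K] at h
  have h2 : ∑ j, conj (conj (c j)) * conj (c j) = ((∑ j, ‖c j‖ ^ 2 : ℝ) : ℂ) := by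
    push_cast
    refine Finset.sum_congr rfl fun j _ => ?_
    rw [Complex.conj_conj, Complex.mul_conj, Complex.normSq_eq_norm_sq]
    push_cast
    rfl
  rw [h2] at h
  have h3 : ((‖∑ j, conj (c j) • u j‖ ^ 2 : ℝ) : ℂ) = ((∑ j, ‖c j‖ ^ 2 : ℝ) : ℂ) := by
    push_cast at h ⊢
    exact h
  exact Complex.ofReal_injective h3

include hu in
/-- The trace inequality for antisymmetric functions, with a multiplier that depends on the
particle on which the operator acts and on the particles outside of `T`. -/
theorem sum_norm_sq_mulOp_bOp_le (T : Finset (Fin (n + 1))) {Φ : L2 (Config (n + 1))}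
    (hΦ : AntisymOn T Φ) (b : ι → L2 Plane) {g : Config (n + 1) → Plane → ℝ}
    (hgm : Measurable (Function.uncurry g)) {C : ℝ} (hgC : ∀ x y, |g x y| ≤ C)
    (hgT : ∀ l ∈ T, ∀ x z y, g (Function.update x l z) y = g x y)
    {v : Config (n + 1) → ℝ} (hv : IsMult v) (hv0 : ∀ x, 0 ≤ v x)
    (hle : ∀ x, ∫⁻ y, ‖g x y‖ₑ ^ 2 * ∑ j, ‖b j y‖ₑ ^ 2 ≤ ENNReal.ofReal (v x)) :
    ∑ l ∈ T, ‖mulOp (fun x => g x (x l)) (bOp u b l Φ)‖ ^ 2 ≤ ∫ x, v x * ‖Φ x‖ ^ 2 := by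
  have hgy : ∀ y, IsMult fun x => g x y := fun y =>
    ⟨hgm.comp (measurable_id.prodMk measurable_const), C, fun x => hgC x y⟩
  have hgl : ∀ l : Fin (n + 1), IsMult fun x : Config (n + 1) => g x (x l) := fun l =>
    ⟨hgm.comp (measurable_id.prodMk (measurable_pi_apply l)), C, fun x => hgC x _⟩
  -- the square of the norm of one term as an iterated integral
  have hterm : ∀ l ∈ T, ENNReal.ofReal (‖mulOp (fun x => g x (x l)) (bOp u b l Φ)‖ ^ 2) =
      ∫⁻ y, ENNReal.ofReal (‖contr (∑ j, conj (b j y) • u j)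
        (perm (Equiv.swap 0 l) (mulOp (fun x => g x y) Φ))‖ ^ 2) := by
    intro l hl
    set s := Equiv.swap 0 l with hs
    set c : ι → L2 (Config n) := fun j => contr (u j) (perm s Φ) with hc
    -- The multiplier does not see the position of l ∈ T, so the origin inserted there is a dummy
    -- value.
    set h : Config n → Plane → ℝ := fun x' y => g (fun j => (Fin.cons (0 : Plane) x' : Config (n + 1)) (s j)) y
      with hh
    have hgh : ∀ (z : Plane) (x' : Config n) (y : Plane),
        g (fun j => (Fin.cons z x' : Config (n + 1)) (s j)) y = h x' y := by
      intro z x' y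
      have : (fun j => (Fin.cons z x' : Config (n + 1)) (s j)) =
          Function.update (fun j => (Fin.cons (0 : Plane) x' : Config (n + 1)) (s j)) l z := by
        funext j
        by_cases hj : j = l
        · subst hj; simp [hs]
        · rw [Function.update_of_ne hj]
          have h0 : s j ≠ 0 := fun h0 =>
            hj (s.injective (h0.trans (Equiv.swap_apply_right 0 l).symm))
          obtain ⟨k, hk⟩ := Fin.exists_succ_eq.2 h0
          rw [← hk, Fin.cons_succ, Fin.cons_succ]
      rw [this, hgT l hl]
    have hhy : ∀ y, IsMult fun x' => h x' y := fun y =>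
      (hgy y).comp ((measurePreserving_perm s).measurable.comp
        (measurableEmbedding_cons.measurable.comp (measurable_const.prodMk measurable_id)))
    have hcoe : perm s (mulOp (fun x => g x (x l)) (bOp u b l Φ)) =ᵐ[volume]
        fun x => (g (fun j => x (s j)) (x 0) : ℂ) *
          ∑ j, b j (x 0) * c j (fun k => x k.succ) := by
      rw [perm_mulOp (hgl l), perm_bOp]
      have hsl : s l = 0 := Equiv.swap_apply_right 0 l
      simp only [hsl]
      refine mulOp_coe' ?_ _ ?_
      · have := (hgl l).comp (measurePreserving_perm s).measurable
        simpa only [hsl] using this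
      · rw [bOp_apply]
        refine (Lp.coeFn_fun_finsetSum _ _).trans ?_
        have hj : ∀ j, kOp 0 (b j) (u j) (perm s Φ) =ᵐ[volume]
            fun x => b j (x 0) * c j (fun k => x k.succ) := by
          intro j
          rw [kOp_zero_apply]
          exact tensor_coe _ _ EventuallyEq.rfl EventuallyEq.rfl
        filter_upwards [ae_all_iff.2 hj] with x hx
        simp only [hx]
    rw [← (perm s).norm_map, ← lintegral_enorm_sq_L2]
    rw [lintegral_congr_ae (hcoe.mono fun x hx => by rw [hx])]
    rw [lintegral_config_succ]
    simp only [Fin.cons_zero, Fin.cons_succ, hgh]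
    rw [Measure.volume_eq_prod, lintegral_prod]
    · refine lintegral_congr fun y => ?_
      have e : perm s (mulOp (fun x => g x y) Φ) =
          mulOp (fun x => g (fun j => x (s j)) y) (perm s Φ) := perm_mulOp (hgy y) s Φ
      rw [e, contr_mulOp ((hgy y).comp (measurePreserving_perm s).measurable) (hhy y)
        (fun z x' => hgh z x' y), contr_sum_smul, ← lintegral_enorm_sq_L2]
      refine lintegral_congr_ae ?_
      have h1 : (∑ j, conj (conj (b j y)) • contr (u j) (perm s Φ) : L2 (Config n)) =ᵐ[volume]
          fun x' => ∑ j, b j y * c j x' := by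
        refine (Lp.coeFn_fun_finsetSum _ _).trans ?_
        filter_upwards [ae_all_iff.2 fun j => Lp.coeFn_smul (conj (conj (b j y))) (c j)] with x' hx'
        refine Finset.sum_congr rfl fun j _ => ?_
        rw [hx' j, Pi.smul_apply, Complex.conj_conj, smul_eq_mul]
      filter_upwards [mulOp_coe' (hhy y) _ h1] with x' hx'
      rw [hx']
    · refine AEMeasurable.pow_const (AEStronglyMeasurable.enorm ?_) 2
      have hm : Measurable fun z : Plane × Config n => h z.2 z.1 := by
        refine hgm.comp (Measurable.prodMk ?_ measurable_fst)
        exact (measurePreserving_perm s).measurable.comp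
          (measurableEmbedding_cons.measurable.comp (measurable_const.prodMk measurable_snd))
      refine AEStronglyMeasurable.mul
        (Complex.measurable_ofReal.comp hm).aestronglyMeasurable ?_
      refine Finset.aestronglyMeasurable_fun_sum _ fun j _ => ?_
      exact (Lp.aestronglyMeasurable (b j)).comp_fst.mul (Lp.aestronglyMeasurable (c j)).comp_snd
  -- For fixed y the multiplier does not involve the particles of T, so antisymmetry in T survives
  -- and the Pauli principle applies for each y.
  have hAS : ∀ y, AntisymOn T (mulOp (fun x => g x y) Φ) := by
    intro y i hi j hj hij
    rw [perm_mulOp (hgy y), hΦ i hi j hj hij, map_neg]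
    have e : (fun x : Config (n + 1) => g (fun k => x (Equiv.swap i j k)) y) = fun x => g x y := by
      funext x
      rw [comp_swap_eq_update, hgT j hj, hgT i hi]
    rw [e]
  have hnorm : ∀ y, ENNReal.ofReal (‖mulOp (fun x => g x y) Φ‖ ^ 2) =
      ∫⁻ x, ‖g x y‖ₑ ^ 2 * ‖Φ x‖ₑ ^ 2 := by
    intro y
    rw [← lintegral_enorm_sq_L2]
    refine lintegral_congr_ae ?_
    filter_upwards [mulOp_coe (hgy y) Φ] with x hx
    rw [hx, enorm_mul, mul_pow]
    congr 2
    rw [← ofReal_norm, ← ofReal_norm, Complex.norm_real]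
  -- When the particle acted on sits at y, the operator ∑_j |b_j⟩⟨u_j| is the contraction with ∑_j
  -- conj(b_j(y)) u_j, of squared norm ∑_j |b_j(y)|² by orthonormality. The Pauli principle at y,
  -- integrated over y, and an exchange of integrals give the claim.
  have hmain : ENNReal.ofReal (∑ l ∈ T, ‖mulOp (fun x => g x (x l)) (bOp u b l Φ)‖ ^ 2) ≤
      ∫⁻ x, ENNReal.ofReal (v x) * ‖Φ x‖ₑ ^ 2 := by
    rw [ENNReal.ofReal_sum_of_nonneg fun _ _ => by positivity, Finset.sum_congr rfl hterm]
    refine (sum_lintegral_le T _).trans ?_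
    calc _ ≤ ∫⁻ y, (∑ j, ‖b j y‖ₑ ^ 2) * ∫⁻ x, ‖g x y‖ₑ ^ 2 * ‖Φ x‖ₑ ^ 2 := by
          refine lintegral_mono fun y => ?_
          rw [← ENNReal.ofReal_sum_of_nonneg fun _ _ => by positivity]
          refine (ENNReal.ofReal_le_ofReal (pauli T (hAS y) _)).trans ?_
          rw [norm_sq_sum_conj_smul hu, ENNReal.ofReal_mul (Finset.sum_nonneg fun _ _ => by positivity),
            hnorm, ENNReal.ofReal_sum_of_nonneg fun _ _ => by positivity]
          refine le_of_eq (congrArg (· * _) (Finset.sum_congr rfl fun j _ => ?_))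
          rw [ENNReal.ofReal_pow (norm_nonneg _), ofReal_norm]
      _ = ∫⁻ y, ∫⁻ x, (∑ j, ‖b j y‖ₑ ^ 2) * (‖g x y‖ₑ ^ 2 * ‖Φ x‖ₑ ^ 2) := by
          refine lintegral_congr fun y => ?_
          rw [lintegral_const_mul' _ _ (ENNReal.sum_ne_top.2 fun j _ => by simp)]
      _ = ∫⁻ x, ∫⁻ y, (∑ j, ‖b j y‖ₑ ^ 2) * (‖g x y‖ₑ ^ 2 * ‖Φ x‖ₑ ^ 2) := by
          refine lintegral_lintegral_swap ?_
          have h1 : AEMeasurable (fun z : Plane × Config (n + 1) => ∑ j, ‖b j z.1‖ₑ ^ 2)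
              (volume.prod volume) := by
            refine Finset.aemeasurable_fun_sum _ fun j _ => ?_
            exact ((Lp.aestronglyMeasurable (b j)).comp_fst.enorm).pow_const 2
          have h2 : AEMeasurable (fun z : Plane × Config (n + 1) => ‖g z.2 z.1‖ₑ ^ 2)
              (volume.prod volume) := by
            have : Measurable fun z : Plane × Config (n + 1) => g z.2 z.1 :=
              hgm.comp (measurable_snd.prodMk measurable_fst)
            exact (this.enorm.pow_const 2).aemeasurable
          have h3 : AEMeasurable (fun z : Plane × Config (n + 1) => ‖Φ z.2‖ₑ ^ 2)
              (volume.prod volume) :=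
            ((Lp.aestronglyMeasurable Φ).comp_snd.enorm).pow_const 2
          exact h1.mul (h2.mul h3)
      _ ≤ _ := by
          refine lintegral_mono fun x => ?_
          have : ∀ y, (∑ j, ‖b j y‖ₑ ^ 2) * (‖g x y‖ₑ ^ 2 * ‖Φ x‖ₑ ^ 2) =
              (‖g x y‖ₑ ^ 2 * ∑ j, ‖b j y‖ₑ ^ 2) * ‖Φ x‖ₑ ^ 2 := fun y => by ring
          simp only [this]
          rw [lintegral_mul_const' _ _ (by simp)]
          exact mul_le_mul_left (hle x) _
  have hrhs : ∫⁻ x, ENNReal.ofReal (v x) * ‖Φ x‖ₑ ^ 2 =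
      ENNReal.ofReal (∫ x, v x * ‖Φ x‖ ^ 2) := by
    rw [ofReal_integral_eq_lintegral_ofReal (hv.integrable_mul_norm_sq Φ)
      (Eventually.of_forall fun x => mul_nonneg (hv0 x) (by positivity))]
    refine lintegral_congr fun x => ?_
    rw [ENNReal.ofReal_mul (hv0 x), ENNReal.ofReal_pow (norm_nonneg _), ofReal_norm]
  rw [hrhs] at hmain
  exact (ENNReal.ofReal_le_ofReal_iff
    (integral_nonneg fun x => mul_nonneg (hv0 x) (by positivity))).1 hmain

end Families

/-! ### Commuting projections and their sectors -/

/-- A finite family of commuting orthogonal projections on a Hilbert space. -/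
structure CommProj (N : ℕ) (H : Type*) [NormedAddCommGroup H] [InnerProductSpace ℂ H] where
  p : Fin N → H →L[ℂ] H
  idem : ∀ l, p l * p l = p l
  comm : ∀ l m, p l * p m = p m * p l
  symm : ∀ l F G, ⟪p l F, G⟫_ℂ = ⟪F, p l G⟫_ℂ

namespace CommProj

variable {N : ℕ} {H : Type*} [NormedAddCommGroup H] [InnerProductSpace ℂ H] (pr : CommProj N H)

/-- The complementary projection. -/
def q (l : Fin N) : H →L[ℂ] H := 1 - pr.p l

/-- The factor of particle `l` in the projection on the configurations of excitations `S`. -/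
def factor (S : Finset (Fin N)) (l : Fin N) : H →L[ℂ] H := if l ∈ S then pr.q l else pr.p l

/-- The product over the particles of the list `L` of `q_l` (if `l ∈ S`) or `p_l` (if `l ∉ S`). -/
def listSector (L : List (Fin N)) (S : Finset (Fin N)) : H →L[ℂ] H := (L.map (pr.factor S)).prod

/-- The projection on the states whose excited particles are those of `S`. -/
def sector (S : Finset (Fin N)) : H →L[ℂ] H := pr.listSector (List.finRange N) S

theorem p_factor_comm (S : Finset (Fin N)) (m l : Fin N) :
    pr.p m * pr.factor S l = pr.factor S l * pr.p m := by
  unfold factor q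
  split_ifs
  · rw [mul_sub, sub_mul, pr.comm, one_mul, mul_one]
  · rw [pr.comm]

theorem factor_factor_comm (S : Finset (Fin N)) (m l : Fin N) :
    pr.factor S m * pr.factor S l = pr.factor S l * pr.factor S m := by
  nth_rewrite 1 [factor]
  nth_rewrite 3 [factor]
  unfold q
  split_ifs
  · rw [mul_sub, sub_mul, p_factor_comm, one_mul, mul_one]
  · rw [p_factor_comm]

theorem p_factor_same (S : Finset (Fin N)) (m : Fin N) :
    pr.p m * pr.factor S m = if m ∈ S then 0 else pr.factor S m := by
  unfold factor q
  split_ifs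
  · rw [mul_sub, mul_one, pr.idem, sub_self]
  · rw [pr.idem]

theorem p_listSector (S : Finset (Fin N)) (m : Fin N) (L : List (Fin N)) (hm : m ∈ L) :
    pr.p m * pr.listSector L S = if m ∈ S then 0 else pr.listSector L S := by
  induction L with
  | nil => simp at hm
  | cons a L ih =>
    have e : pr.listSector (a :: L) S = pr.factor S a * pr.listSector L S := by
      simp [listSector]
    rw [e, ← mul_assoc]
    by_cases h : m = a
    · subst h
      rw [p_factor_same]
      split_ifs <;> simp
    · rw [p_factor_comm, mul_assoc, ih ((List.mem_cons.1 hm).resolve_left h)]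
      split_ifs <;> simp

theorem p_sector (S : Finset (Fin N)) (m : Fin N) :
    pr.p m * pr.sector S = if m ∈ S then 0 else pr.sector S :=
  pr.p_listSector S m _ (List.mem_finRange m)

theorem factor_sector (S S' : Finset (Fin N)) (m : Fin N) :
    pr.factor S' m * pr.sector S = if (m ∈ S' ↔ m ∈ S) then pr.sector S else 0 := by
  unfold factor q
  split_ifs with h1 h2 h2
  · rw [sub_mul, one_mul, p_sector, if_pos (h2.1 h1), sub_zero]
  · have : m ∉ S := fun h => h2 ⟨fun _ => h, fun _ => h1⟩
    rw [sub_mul, one_mul, p_sector, if_neg this, sub_self]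
  · have : m ∉ S := fun h => h1 (h2.2 h)
    rw [p_sector, if_neg this]
  · have : m ∈ S := by by_contra h; exact h2 ⟨fun h' => absurd h' h1, fun h' => absurd h' h⟩
    rw [p_sector, if_pos this]

theorem sector_mul_sector (S S' : Finset (Fin N)) :
    pr.sector S' * pr.sector S = if S' = S then pr.sector S else 0 := by
  have key : ∀ L : List (Fin N), pr.listSector L S' * pr.sector S =
      if (∀ m ∈ L, (m ∈ S' ↔ m ∈ S)) then pr.sector S else 0 := by
    intro L
    induction L with
    | nil => simp [listSector]
    | cons a L ih =>
      have e : pr.listSector (a :: L) S' = pr.factor S' a * pr.listSector L S' := by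
        simp [listSector]
      rw [e, mul_assoc, ih]
      by_cases hL : ∀ m ∈ L, (m ∈ S' ↔ m ∈ S)
      · rw [if_pos hL, factor_sector]
        simp only [List.forall_mem_cons, and_iff_left hL]
      · rw [if_neg hL, mul_zero, if_neg]
        intro h
        exact hL (List.forall_mem_cons.1 h).2
  rw [sector, key]
  simp only [List.mem_finRange, true_implies, ← Finset.ext_iff]

/-- Expansion of ∏_l (q_l + p_l) = 1. Expanding a product of sums requires a commutative ring, which
is the subalgebra generated by the commuting p_l. -/
theorem sum_sector : ∑ S, pr.sector S = 1 := by
  let B := Algebra.adjoin ℂ (Set.range pr.p)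
  let _ : CommRing B :=
    { (inferInstance : Ring B) with
      mul_comm := (Algebra.isMulCommutative_adjoin ℂ (by
        rintro _ ⟨l, rfl⟩ _ ⟨m, rfl⟩
        exact pr.comm l m) : IsMulCommutative B).is_comm.comm }
  let e : Fin N → B := fun l => ⟨pr.p l, Algebra.subset_adjoin ⟨l, rfl⟩⟩
  have h1 : ∑ S : Finset (Fin N), ∏ l, (if l ∈ S then 1 - e l else e l) = 1 := by
    have h2 : ∏ l : Fin N, ((1 - e l) + e l) = 1 := by simp
    rw [Finset.prod_add, Finset.powerset_univ] at h2
    refine Eq.trans ?_ h2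
    refine Finset.sum_congr rfl fun S _ => ?_
    rw [Finset.prod_ite, Finset.filter_univ_mem]
    congr 1
    exact Finset.prod_congr (by ext; simp) fun _ _ => rfl
  have h3 := congrArg (Subalgebra.val B) h1
  rw [map_sum, map_one] at h3
  rw [← h3]
  refine Finset.sum_congr rfl fun S _ => ?_
  rw [Fin.prod_univ_def, map_list_prod, List.map_map, sector, listSector]
  congr 2
  funext l
  simp only [factor, Function.comp_apply]
  split_ifs <;> rfl

theorem inner_factor_left (S : Finset (Fin N)) (l : Fin N) (F G : H) :
    ⟪pr.factor S l F, G⟫_ℂ = ⟪F, pr.factor S l G⟫_ℂ := by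
  unfold factor q
  split_ifs
  · simp [← pr.symm]
  · exact pr.symm l F G

theorem factor_listSector_comm (S : Finset (Fin N)) (m : Fin N) (L : List (Fin N)) :
    pr.factor S m * pr.listSector L S = pr.listSector L S * pr.factor S m := by
  induction L with
  | nil => simp [listSector]
  | cons a L ih =>
    have e : pr.listSector (a :: L) S = pr.factor S a * pr.listSector L S := by simp [listSector]
    rw [e, ← mul_assoc, factor_factor_comm, mul_assoc, ih, mul_assoc]

theorem inner_sector_left (S : Finset (Fin N)) (F G : H) :
    ⟪pr.sector S F, G⟫_ℂ = ⟪F, pr.sector S G⟫_ℂ := by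
  have key : ∀ (L : List (Fin N)) (F G : H), ⟪pr.listSector L S F, G⟫_ℂ =
      ⟪F, pr.listSector L S G⟫_ℂ := by
    intro L
    induction L with
    | nil => simp [listSector]
    | cons a L ih =>
      intro F G
      have e : pr.listSector (a :: L) S = pr.factor S a * pr.listSector L S := by simp [listSector]
      nth_rewrite 2 [e]
      rw [factor_listSector_comm, e]
      change ⟪pr.factor S a (pr.listSector L S F), G⟫_ℂ = ⟪F, pr.listSector L S (pr.factor S a G)⟫_ℂ
      rw [inner_factor_left, ih]
  exact key _ F G

/-- The operator with the eigenvalue `d S` on the states whose excited particles are those of `S`,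
as a homomorphism of algebras in `d`. -/
def diag : (Finset (Fin N) → ℂ) →ₐ[ℂ] (H →L[ℂ] H) :=
  AlgHom.ofLinearMap
    { toFun := fun d => ∑ S, d S • pr.sector S
      map_add' := fun d e => by simp [add_smul, Finset.sum_add_distrib]
      map_smul' := fun c d => by simp [mul_smul, Finset.smul_sum] }
    (by simp [sum_sector])
    (fun d e => by
      simp only [LinearMap.coe_mk, AddHom.coe_mk, Finset.sum_mul, Finset.mul_sum,
        smul_mul_assoc, mul_smul_comm, sector_mul_sector]
      simp only [smul_ite, smul_zero, Finset.sum_ite_eq', Finset.mem_univ, if_true, Pi.mul_apply, smul_smul, mul_comm])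

theorem diag_def (d : Finset (Fin N) → ℂ) : pr.diag d = ∑ S, d S • pr.sector S := rfl

theorem diag_apply (d : Finset (Fin N) → ℂ) (F : H) :
    pr.diag d F = ∑ S, d S • pr.sector S F := by simp [diag_def]

theorem diag_mul_apply (d e : Finset (Fin N) → ℂ) (F : H) :
    pr.diag d (pr.diag e F) = pr.diag (fun S => d S * e S) F := by
  have := congrArg (fun A : H →L[ℂ] H => A F) (map_mul pr.diag d e)
  exact this.symm

theorem diag_notMem (l : Fin N) : pr.diag (fun S => if l ∈ S then 0 else 1) = pr.p l := by
  have h : pr.p l = pr.p l * ∑ S, pr.sector S := by rw [sum_sector, mul_one]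
  rw [h, Finset.mul_sum, diag_def]
  refine Finset.sum_congr rfl fun S _ => ?_
  rw [p_sector]
  split_ifs <;> simp

theorem diag_mem (l : Fin N) : pr.diag (fun S => if l ∈ S then 1 else 0) = pr.q l := by
  have h : (fun S : Finset (Fin N) => if l ∈ S then (1 : ℂ) else 0) =
      1 - fun S => if l ∈ S then 0 else 1 := by
    funext S
    by_cases h : l ∈ S <;> simp [h]
  rw [h, map_sub, map_one, diag_notMem, q]

theorem p_diag (l : Fin N) (d : Finset (Fin N) → ℂ) (F : H) :
    pr.p l (pr.diag d F) = pr.diag (fun S => if l ∈ S then 0 else d S) F := by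
  rw [← diag_notMem, diag_mul_apply]
  congr 2
  funext S
  split_ifs <;> simp

theorem q_diag (l : Fin N) (d : Finset (Fin N) → ℂ) (F : H) :
    pr.q l (pr.diag d F) = pr.diag (fun S => if l ∈ S then d S else 0) F := by
  rw [← diag_mem, diag_mul_apply]
  congr 2
  funext S
  split_ifs <;> simp

theorem diag_one_apply (F : H) : pr.diag (fun _ => 1) F = F := by
  have : pr.diag (fun _ => 1) = 1 := map_one pr.diag
  rw [this]
  rfl

theorem p_add_q (l : Fin N) (F : H) : pr.p l F + pr.q l F = F := by
  simp [q]

theorem q_apply (l : Fin N) (F : H) : pr.q l F = F - pr.p l F := by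
  simp [q]

theorem inner_diag_left (d : Finset (Fin N) → ℂ) (F G : H) :
    ⟪pr.diag d F, G⟫_ℂ = ⟪F, pr.diag (fun S => conj (d S)) G⟫_ℂ := by
  simp only [diag_apply, sum_inner, inner_sum, inner_smul_left, inner_smul_right,
    inner_sector_left]

/-- The weight of `F` on the sector `S`. -/
def wt (F : H) (S : Finset (Fin N)) : ℝ := ‖pr.sector S F‖ ^ 2

theorem wt_nonneg (F : H) (S : Finset (Fin N)) : 0 ≤ pr.wt F S := by unfold wt; positivity

theorem inner_sector_self (S : Finset (Fin N)) (F : H) :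
    ⟪F, pr.sector S F⟫_ℂ = (pr.wt F S : ℂ) := by
  have h : pr.sector S (pr.sector S F) = pr.sector S F := by
    have := congrArg (fun A : H →L[ℂ] H => A F) (pr.sector_mul_sector S S)
    simpa using this
  rw [← h, ← inner_sector_left, inner_self_eq_norm_sq_to_K, wt]
  push_cast
  rfl

theorem inner_diag_self (d : Finset (Fin N) → ℝ) (F : H) :
    ⟪F, pr.diag (fun S => (d S : ℂ)) F⟫_ℂ = ((∑ S, d S * pr.wt F S : ℝ) : ℂ) := by
  simp only [diag_apply, inner_sum, inner_smul_right, inner_sector_self]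
  push_cast
  rfl

theorem norm_sq_diag (d : Finset (Fin N) → ℝ) (F : H) :
    ‖pr.diag (fun S => (d S : ℂ)) F‖ ^ 2 = ∑ S, d S ^ 2 * pr.wt F S := by
  have h := inner_self_eq_norm_sq_to_K (𝕜 := ℂ) (pr.diag (fun S => (d S : ℂ)) F)
  rw [inner_diag_left, diag_mul_apply] at h
  have e : (fun S => conj (d S : ℂ) * (d S : ℂ)) = fun S => (((d S ^ 2 : ℝ)) : ℂ) := by
    funext S
    rw [Complex.conj_ofReal]
    push_cast
    ring
  rw [e, inner_diag_self] at h
  have h2 : ((∑ S, d S ^ 2 * pr.wt F S : ℝ) : ℂ) =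
      ((‖pr.diag (fun S => (d S : ℂ)) F‖ ^ 2 : ℝ) : ℂ) := by
    rw [h]; push_cast; rfl
  exact (Complex.ofReal_injective h2).symm

theorem norm_sq_eq_sum_wt (F : H) : ‖F‖ ^ 2 = ∑ S, pr.wt F S := by
  have := pr.norm_sq_diag (fun _ => 1) F
  simpa [diag_one_apply] using this

theorem norm_sq_q (l : Fin N) (F : H) :
    ‖pr.q l F‖ ^ 2 = ∑ S, (if l ∈ S then 1 else 0) * pr.wt F S := by
  have := pr.norm_sq_diag (fun S => if l ∈ S then 1 else 0) F
  have e : (fun S : Finset (Fin N) => (((if l ∈ S then (1 : ℝ) else 0) : ℝ) : ℂ)) =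
      fun S => if l ∈ S then (1 : ℂ) else 0 := by
    funext S; split_ifs <;> simp
  rw [e, diag_mem] at this
  rw [this]
  refine Finset.sum_congr rfl fun S _ => ?_
  split_ifs <;> simp

theorem diag_card_inter (T : Finset (Fin N)) :
    pr.diag (fun S => ((S ∩ T).card : ℂ)) = ∑ l ∈ T, pr.q l := by
  simp only [← diag_mem, ← map_sum]
  congr 1
  funext S
  rw [Finset.sum_apply, Finset.sum_ite_mem, Finset.inter_comm]
  simp

/-- By Lagrange interpolation at 0, …, N, any function of the number of excitations in T is a
polynomial in the number operator ∑_{l ∈ T} q_l, so it commutes with whatever that operator commutes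
with. -/
theorem commute_diag_card {M : H →L[ℂ] H} (T : Finset (Fin N))
    (hM : Commute M (∑ l ∈ T, pr.q l)) (w : ℕ → ℂ) :
    Commute M (pr.diag fun S => w (S ∩ T).card) := by
  let ν : Finset (Fin N) → ℂ := fun S => ((S ∩ T).card : ℂ)
  let P : Polynomial ℂ := Lagrange.interpolate (Finset.range (N + 1)) (fun k : ℕ => (k : ℂ)) w
  have hP : ∀ k ∈ Finset.range (N + 1), P.eval (k : ℂ) = w k := fun k hk =>
    Lagrange.eval_interpolate_at_node _ (fun a _ b _ h => Nat.cast_injective h) hk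
  have e : (fun S : Finset (Fin N) => w (S ∩ T).card) = Polynomial.aeval ν P := by
    funext S
    have h1 : (Polynomial.aeval ν P) S = P.eval (ν S) := by
      have := Polynomial.aeval_algHom_apply (Pi.evalAlgHom ℂ (fun _ : Finset (Fin N) => ℂ) S) ν P
      simp only [Pi.evalAlgHom_apply] at this
      rw [← this, Polynomial.coe_aeval_eq_eval]
    rw [h1, hP]
    rw [Finset.mem_range, Nat.lt_succ_iff]
    exact (Finset.card_le_univ _).trans (by simp)
  rw [e, ← Polynomial.aeval_algHom_apply, diag_card_inter]
  have : Polynomial.aeval (∑ l ∈ T, pr.q l) P ∈ Subalgebra.centralizer ℂ {M} := by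
    refine (Algebra.adjoin_le (S := Subalgebra.centralizer ℂ {M}) ?_)
      (Polynomial.aeval_mem_adjoin_singleton ℂ _)
    rintro _ rfl
    change _ ∈ Subalgebra.centralizer ℂ {M}
    rw [Subalgebra.mem_centralizer_iff]
    rintro _ rfl
    exact hM
  rw [Subalgebra.mem_centralizer_iff] at this
  exact this M rfl

end CommProj

/-! ### Weights depending on the number of excited particles -/

namespace CommProj

variable {N : ℕ} {H : Type*} [NormedAddCommGroup H] [InnerProductSpace ℂ H] (pr : CommProj N H)

/-- The function `d` of the number of excited particles among those of `T`. -/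
def cardOp (T : Finset (Fin N)) (d : ℕ → ℝ) : H →L[ℂ] H :=
  pr.diag fun S => ((d (S ∩ T).card : ℝ) : ℂ)

/-- The function `d (· - k)` of the number of excited particles. -/
def shiftOp (d : ℕ → ℝ) (k : ℕ) : H →L[ℂ] H := pr.diag fun S => ((d (S.card - k) : ℝ) : ℂ)

theorem shiftOp_eq_cardOp (d : ℕ → ℝ) (k : ℕ) :
    pr.shiftOp d k = pr.cardOp Finset.univ fun i => d (i - k) := by
  simp [shiftOp, cardOp]

theorem cardOp_comm {T : Finset (Fin N)} {M : H →L[ℂ] H} (hM : Commute M (∑ l ∈ T, pr.q l))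
    (d : ℕ → ℝ) (F : H) : M (pr.cardOp T d F) = pr.cardOp T d (M F) :=
  congrArg (fun A : H →L[ℂ] H => A F) (pr.commute_diag_card T hM fun k => ((d k : ℝ) : ℂ)).eq

theorem inner_cardOp_left (T : Finset (Fin N)) (d : ℕ → ℝ) (F G : H) :
    ⟪pr.cardOp T d F, G⟫_ℂ = ⟪F, pr.cardOp T d G⟫_ℂ := by
  simp [cardOp, inner_diag_left]

theorem cardOp_mul (T : Finset (Fin N)) (d e : ℕ → ℝ) (F : H) :
    pr.cardOp T d (pr.cardOp T e F) = pr.cardOp T (fun k => d k * e k) F := by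
  simp [cardOp, diag_mul_apply]

theorem cardOp_one (T : Finset (Fin N)) (F : H) : pr.cardOp T (fun _ => 1) F = F := by
  simp [cardOp, diag_one_apply]

theorem norm_sq_cardOp (T : Finset (Fin N)) (d : ℕ → ℝ) (F : H) :
    ‖pr.cardOp T d F‖ ^ 2 = ∑ S, d (S ∩ T).card ^ 2 * pr.wt F S :=
  pr.norm_sq_diag (fun S => d (S ∩ T).card) F

theorem norm_sq_shiftOp (d : ℕ → ℝ) (k : ℕ) (F : H) :
    ‖pr.shiftOp d k F‖ ^ 2 = ∑ S, d (S.card - k) ^ 2 * pr.wt F S :=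
  pr.norm_sq_diag (fun S => d (S.card - k)) F

/-- Lets a counting weight be traded between the two sides of a form: the side without excitation
receives the weight, the side with an excitation its inverse. -/
theorem inner_apply_eq_cardOp {T : Finset (Fin N)} {M : H →L[ℂ] H}
    (hM : Commute M (∑ l ∈ T, pr.q l)) {d : ℕ → ℝ} (hd : ∀ k, d k ≠ 0) (F G : H) :
    ⟪F, M G⟫_ℂ = ⟪pr.cardOp T d F, M (pr.cardOp T (fun k => (d k)⁻¹) G)⟫_ℂ := by
  rw [inner_cardOp_left, ← pr.cardOp_comm hM, cardOp_mul]
  simp only [mul_inv_cancel₀ (hd _), cardOp_one]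

theorem commute_p_sum_q (l : Fin N) (T : Finset (Fin N)) :
    Commute (pr.p l) (∑ m ∈ T, pr.q m) := by
  refine Commute.sum_right _ _ _ fun m _ => ?_
  unfold q
  exact (Commute.one_right _).sub_right (pr.comm l m)

theorem commute_q_sum_q (l : Fin N) (T : Finset (Fin N)) :
    Commute (pr.q l) (∑ m ∈ T, pr.q m) := by
  nth_rewrite 1 [q]
  exact (Commute.one_left _).sub_left (pr.commute_p_sum_q l T)

theorem p_cardOp (l : Fin N) (T : Finset (Fin N)) (d : ℕ → ℝ) (F : H) :
    pr.p l (pr.cardOp T d F) = pr.cardOp T d (pr.p l F) :=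
  pr.cardOp_comm (pr.commute_p_sum_q l T) d F

theorem q_cardOp (l : Fin N) (T : Finset (Fin N)) (d : ℕ → ℝ) (F : H) :
    pr.q l (pr.cardOp T d F) = pr.cardOp T d (pr.q l F) :=
  pr.cardOp_comm (pr.commute_q_sum_q l T) d F

/-- This and the next identities convert a count among the other particles into a count among all of
them, shifted by the number of projections q in front. Those projections force that many
excitations, so the truncated subtraction in `shiftOp` is a true one here. -/
theorem p_cardOp_erase (m : Fin N) (d : ℕ → ℝ) (F : H) :
    pr.p m (pr.cardOp (Finset.univ.erase m) d F) = pr.p m (pr.shiftOp d 0 F) := by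
  rw [cardOp, shiftOp, p_diag, p_diag]
  congr 2
  funext S
  split_ifs with h
  · rfl
  · rw [Finset.inter_erase, Finset.inter_univ, Finset.erase_eq_of_notMem h, Nat.sub_zero]

theorem q_cardOp_erase (m : Fin N) (d : ℕ → ℝ) (F : H) :
    pr.q m (pr.cardOp (Finset.univ.erase m) d F) = pr.q m (pr.shiftOp d 1 F) := by
  rw [cardOp, shiftOp, q_diag, q_diag]
  congr 2
  funext S
  split_ifs with h
  · rw [Finset.inter_erase, Finset.inter_univ, Finset.card_erase_of_mem h]
  · rfl

theorem p_p_cardOp_erase (m l : Fin N) (d : ℕ → ℝ) (F : H) :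
    pr.p m (pr.p l (pr.cardOp ((Finset.univ.erase m).erase l) d F)) =
      pr.p m (pr.p l (pr.shiftOp d 0 F)) := by
  rw [cardOp, shiftOp, p_diag, p_diag, p_diag, p_diag]
  congr 2
  funext S
  split_ifs with h h'
  · rfl
  · rfl
  · rw [Finset.inter_erase, Finset.inter_erase, Finset.inter_univ, Finset.erase_eq_of_notMem h,
      Finset.erase_eq_of_notMem h', Nat.sub_zero]

theorem p_q_cardOp_erase (m l : Fin N) (d : ℕ → ℝ) (F : H) :
    pr.p m (pr.q l (pr.cardOp ((Finset.univ.erase m).erase l) d F)) =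
      pr.p m (pr.q l (pr.shiftOp d 1 F)) := by
  rw [cardOp, shiftOp, q_diag, q_diag, p_diag, p_diag]
  congr 2
  funext S
  split_ifs with h h'
  · rfl
  · rw [Finset.inter_erase, Finset.inter_erase, Finset.inter_univ, Finset.erase_eq_of_notMem h,
      Finset.card_erase_of_mem h']
  · rfl

theorem q_p_cardOp_erase {m l : Fin N} (d : ℕ → ℝ) (F : H) :
    pr.q m (pr.p l (pr.cardOp ((Finset.univ.erase m).erase l) d F)) =
      pr.q m (pr.p l (pr.shiftOp d 1 F)) := by
  rw [cardOp, shiftOp, p_diag, p_diag, q_diag, q_diag]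
  congr 2
  funext S
  split_ifs with h h'
  · rfl
  · rw [Finset.inter_erase, Finset.inter_erase, Finset.inter_univ, Finset.erase_eq_of_notMem,
      Finset.card_erase_of_mem h]
    exact fun h2 => h' (Finset.mem_of_mem_erase h2)
  · rfl

theorem q_q_cardOp_erase {m l : Fin N} (hml : m ≠ l) (d : ℕ → ℝ) (F : H) :
    pr.q m (pr.q l (pr.cardOp ((Finset.univ.erase m).erase l) d F)) =
      pr.q m (pr.q l (pr.shiftOp d 2 F)) := by
  rw [cardOp, shiftOp, q_diag, q_diag, q_diag, q_diag]
  congr 2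
  funext S
  split_ifs with h h'
  · rw [Finset.inter_erase, Finset.inter_erase, Finset.inter_univ, Finset.card_erase_of_mem,
      Finset.card_erase_of_mem h, Nat.sub_sub]
    exact Finset.mem_erase.2 ⟨hml.symm, h'⟩
  · rfl
  · rfl

theorem sum_norm_sq_q (T : Finset (Fin N)) (F : H) :
    ∑ l ∈ T, ‖pr.q l F‖ ^ 2 = ∑ S, ((S ∩ T).card : ℝ) * pr.wt F S := by
  simp only [norm_sq_q]
  rw [Finset.sum_comm]
  refine Finset.sum_congr rfl fun S _ => ?_
  rw [← Finset.sum_mul, Finset.sum_ite_mem, Finset.inter_comm]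
  simp

theorem sum_norm_sq_q_eq_cardOp (T : Finset (Fin N)) (F : H) :
    ∑ l ∈ T, ‖pr.q l F‖ ^ 2 = ‖pr.cardOp T (fun k => √(k : ℝ)) F‖ ^ 2 := by
  rw [sum_norm_sq_q, norm_sq_cardOp]
  simp

theorem norm_p_add_norm_q (l : Fin N) (F : H) :
    ‖pr.p l F‖ ^ 2 + ‖pr.q l F‖ ^ 2 = ‖F‖ ^ 2 := by
  have h : ⟪pr.p l F, pr.q l F⟫_ℂ = 0 := by
    rw [pr.symm, q_apply, map_sub, ← mul_apply_eq_comp, pr.idem, sub_self,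
      inner_zero_right]
  have := norm_add_sq (𝕜 := ℂ) (pr.p l F) (pr.q l F)
  rw [p_add_q, h] at this
  simp at this
  linarith

theorem norm_p_le (l : Fin N) (F : H) : ‖pr.p l F‖ ^ 2 ≤ ‖F‖ ^ 2 := by
  have := pr.norm_p_add_norm_q l F
  nlinarith [sq_nonneg ‖pr.q l F‖]

/-- A form commuting with the number of excited particles of `T` is controlled by its bounds on
the eigenspaces of this number. -/
theorem norm_inner_le_of_sectors {T : Finset (Fin N)} {M : H →L[ℂ] H}
    (hM : Commute M (∑ l ∈ T, pr.q l)) (e : ℕ → ℝ) (F : H)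
    (hb : ∀ k, ‖⟪pr.cardOp T (Pi.single k 1) F, M (pr.cardOp T (Pi.single k 1) F)⟫_ℂ‖ ≤
      e k * ‖pr.cardOp T (Pi.single k 1) F‖ ^ 2) :
    ‖⟪F, M F⟫_ℂ‖ ≤ ∑ S, e (S ∩ T).card * pr.wt F S := by
  have hsum : ∑ k ∈ Finset.range (N + 1), pr.cardOp T (Pi.single k 1) F = F := by
    nth_rewrite 2 [← pr.diag_one_apply F]
    simp only [cardOp, ← sum_apply, ← map_sum]
    congr 2
    funext S
    have hc : (S ∩ T).card ∈ Finset.range (N + 1) := by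
      rw [Finset.mem_range, Nat.lt_succ_iff]
      exact (Finset.card_le_univ _).trans (by simp)
    rw [Finset.sum_apply, Finset.sum_eq_single_of_mem _ hc]
    · simp
    · intro b _ hb
      rw [Pi.single_eq_of_ne hb.symm, Complex.ofReal_zero]
  -- The spectral projection on k excitations is a self-adjoint idempotent commuting with M, so
  -- different sectors do not mix.
  have hdiag : ∀ k, ⟪F, M (pr.cardOp T (Pi.single k 1) F)⟫_ℂ =
      ⟪pr.cardOp T (Pi.single k 1) F, M (pr.cardOp T (Pi.single k 1) F)⟫_ℂ := by
    intro k
    rw [inner_cardOp_left, ← pr.cardOp_comm hM, cardOp_mul]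
    congr 4
    funext i
    by_cases h : i = k
    · subst h; simp
    · rw [Pi.single_eq_of_ne h, mul_zero]
  have h1 : ⟪F, M F⟫_ℂ = ∑ k ∈ Finset.range (N + 1),
      ⟪pr.cardOp T (Pi.single k 1) F, M (pr.cardOp T (Pi.single k 1) F)⟫_ℂ := by
    simp only [← hdiag, ← inner_sum, ← map_sum, hsum]
  rw [h1]
  refine (norm_sum_le _ _).trans ((Finset.sum_le_sum fun k _ => hb k).trans (le_of_eq ?_))
  simp only [norm_sq_cardOp, Finset.mul_sum]
  rw [Finset.sum_comm]
  refine Finset.sum_congr rfl fun S _ => ?_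
  have hc : (S ∩ T).card ∈ Finset.range (N + 1) := by
    rw [Finset.mem_range, Nat.lt_succ_iff]
    exact (Finset.card_le_univ _).trans (by simp)
  rw [Finset.sum_eq_single_of_mem _ hc]
  · simp
  · intro b _ hb
    rw [Pi.single_eq_of_ne hb.symm]
    simp

/-- The weight `((k + 1) / N)^{1/4}`. -/
def quarter (N : ℕ) (k : ℕ) : ℝ := √(√(((k : ℝ) + 1) / N))

theorem quarter_pos (hN : 0 < N) (k : ℕ) : 0 < quarter N k := by
  unfold quarter
  positivity

theorem quarter_sq (k : ℕ) : quarter N k ^ 2 = √(((k : ℝ) + 1) / N) := by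
  unfold quarter
  rw [Real.sq_sqrt (by positivity)]

/-- The expected value of `((k + 1) / N)^{1/2}`, `k` being the number of excited particles. -/
def excitation (F : H) : ℝ := ∑ S, √(((S.card : ℝ) + 1) / N) * pr.wt F S

theorem excitation_nonneg (F : H) : 0 ≤ pr.excitation F :=
  Finset.sum_nonneg fun S _ => mul_nonneg (Real.sqrt_nonneg _) (pr.wt_nonneg F S)

theorem norm_sq_shiftOp_quarter (F : H) :
    ‖pr.shiftOp (quarter N) 0 F‖ ^ 2 = pr.excitation F := by
  simp [norm_sq_shiftOp, quarter_sq, excitation]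

/-- For k ≥ 1 the inverse weight at k - 1, squared, is (k/N)^{-1/2}, and k (k/N)^{-1/2} = N
(k/N)^{1/2}: the number operator beats the inverse weight. For k = 0 the left side vanishes. -/
theorem card_mul_le (k : ℕ) (hN : 0 < N) :
    (k : ℝ) * ((quarter N (k - 1))⁻¹) ^ 2 ≤ N * √(((k : ℝ) + 1) / N) := by
  have hN' : (0 : ℝ) < N := by exact_mod_cast hN
  rcases Nat.eq_zero_or_pos k with rfl | hk
  · simp; positivity
  · have h1 : ((k - 1 : ℕ) : ℝ) + 1 = k := by
      rw [Nat.cast_sub hk]; simp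
    have hk' : (0 : ℝ) < k := by exact_mod_cast hk
    rw [inv_pow, quarter_sq, h1]
    have h2 : (k : ℝ) = N * (√((k : ℝ) / N) * √((k : ℝ) / N)) := by
      rw [Real.mul_self_sqrt (by positivity)]; field_simp
    have h3 : 0 < √((k : ℝ) / N) := by positivity
    calc (k : ℝ) * (√((k : ℝ) / N))⁻¹
        = N * (√((k : ℝ) / N) * √((k : ℝ) / N)) * (√((k : ℝ) / N))⁻¹ := by rw [← h2]
      _ = N * √((k : ℝ) / N) := by field_simp
      _ ≤ _ := by gcongr; linarith

theorem sum_norm_sq_q_shiftOp_le (hN : 0 < N) (F : H) :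
    ∑ l, ‖pr.q l (pr.shiftOp (fun k => (quarter N k)⁻¹) 1 F)‖ ^ 2 ≤ N * pr.excitation F := by
  have h : ∀ l, ‖pr.q l (pr.shiftOp (fun k => (quarter N k)⁻¹) 1 F)‖ ^ 2 =
      ∑ S, (if l ∈ S then 1 else 0) * ((quarter N (S.card - 1))⁻¹) ^ 2 * pr.wt F S := by
    intro l
    rw [shiftOp, q_diag]
    have := pr.norm_sq_diag (fun S => if l ∈ S then (quarter N (S.card - 1))⁻¹ else 0) F
    simp only [apply_ite Complex.ofReal, Complex.ofReal_zero] at this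
    rw [this]
    refine Finset.sum_congr rfl fun S _ => ?_
    split_ifs <;> simp
  simp only [h]
  rw [Finset.sum_comm, excitation, Finset.mul_sum]
  refine Finset.sum_le_sum fun S _ => ?_
  rw [← Finset.sum_mul, ← Finset.sum_mul, ← mul_assoc]
  refine mul_le_mul_of_nonneg_right ?_ (pr.wt_nonneg F S)
  have : ∑ l, (if l ∈ S then (1 : ℝ) else 0) = S.card := by simp
  rw [this]
  exact card_mul_le _ hN

/-- Once m is excited, |S| - 1 choices of l remain, while the weight is taken at |S| - 2; this is
`card_mul_le` for |S| - 1. -/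
theorem sum_norm_sq_q_q_shiftOp_le (hN : 0 < N) (m : Fin N) (F : H) :
    ∑ l ∈ Finset.univ.erase m,
      ‖pr.q m (pr.q l (pr.shiftOp (fun k => (quarter N k)⁻¹) 2 F))‖ ^ 2 ≤
      N * pr.excitation F := by
  have h : ∀ l, ‖pr.q m (pr.q l (pr.shiftOp (fun k => (quarter N k)⁻¹) 2 F))‖ ^ 2 =
      ∑ S, (if l ∈ S then 1 else 0) * ((if m ∈ S then 1 else 0) *
        ((quarter N (S.card - 2))⁻¹) ^ 2) * pr.wt F S := by
    intro l
    rw [shiftOp, q_diag, q_diag]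
    have := pr.norm_sq_diag
      (fun S => if m ∈ S then if l ∈ S then (quarter N (S.card - 2))⁻¹ else 0 else 0) F
    simp only [apply_ite Complex.ofReal, Complex.ofReal_zero] at this
    rw [this]
    refine Finset.sum_congr rfl fun S _ => ?_
    split_ifs <;> simp
  simp only [h]
  rw [Finset.sum_comm, excitation, Finset.mul_sum]
  refine Finset.sum_le_sum fun S _ => ?_
  rw [← Finset.sum_mul, ← Finset.sum_mul, ← mul_assoc (N : ℝ)]
  refine mul_le_mul_of_nonneg_right ?_ (pr.wt_nonneg F S)
  rw [Finset.sum_ite_mem, Finset.erase_inter, Finset.univ_inter]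
  split_ifs with hm
  · rw [Finset.sum_const, Finset.card_erase_of_mem hm, nsmul_eq_mul, mul_one, one_mul]
    have := card_mul_le (S.card - 1) hN
    rw [Nat.sub_sub] at this
    refine this.trans ?_
    gcongr
    exact Nat.sub_le _ _
  · simp; positivity

theorem sum_norm_sq_q_le (hN : 0 < N) (F : H) :
    ∑ l, ‖pr.q l F‖ ^ 2 ≤ N * pr.excitation F := by
  rw [sum_norm_sq_q, excitation, Finset.mul_sum]
  refine Finset.sum_le_sum fun S _ => ?_
  rw [← mul_assoc]
  refine mul_le_mul_of_nonneg_right ?_ (pr.wt_nonneg F S)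
  have hN' : (0 : ℝ) < N := by exact_mod_cast hN
  rw [Finset.inter_univ]
  have h1 : (S.card : ℝ) ≤ N := by
    exact_mod_cast (Finset.card_le_univ S).trans (by simp)
  have h2 : (S.card : ℝ) / N ≤ √(((S.card : ℝ) + 1) / N) := by
    refine Real.le_sqrt_of_sq_le ?_
    have h3 : (S.card : ℝ) / N ≤ 1 := (div_le_one hN').2 h1
    have h4 : 0 ≤ (S.card : ℝ) / N := by positivity
    calc ((S.card : ℝ) / N) ^ 2 ≤ (S.card : ℝ) / N := by nlinarith
      _ ≤ _ := by gcongr; linarith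
  calc (S.card : ℝ) = N * ((S.card : ℝ) / N) := by field_simp
    _ ≤ _ := by gcongr

end CommProj

/-! ### Projections on the orbitals, pair potentials and their mean fields -/

/-- Cauchy–Schwarz and Young's inequality, weighted by ν so that a sum of order ν and one of order
1/ν balance. The factor t is charged to B alone: with t = β this produces the β² that is later
compared with g. -/
theorem sum_norm_inner_le {H ι : Type*} [NormedAddCommGroup H] [InnerProductSpace ℂ H]
    (s : Finset ι) (F G : ι → H) {t A B ν : ℝ} (ht : 0 ≤ t) (hν : 0 < ν)
    (hF : ∑ i ∈ s, ‖F i‖ ^ 2 ≤ ν * A) (hG : ∑ i ∈ s, ‖G i‖ ^ 2 ≤ B / ν) :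
    t * ∑ i ∈ s, ‖⟪F i, G i⟫_ℂ‖ ≤ (A + t ^ 2 * B) / 2 := by
  have h1 : ∀ i ∈ s, t * ‖⟪F i, G i⟫_ℂ‖ ≤ (ν⁻¹ * ‖F i‖ ^ 2 + t ^ 2 * (ν * ‖G i‖ ^ 2)) / 2 := by
    intro i _
    have h2 : t * ‖⟪F i, G i⟫_ℂ‖ ≤ t * (‖F i‖ * ‖G i‖) :=
      mul_le_mul_of_nonneg_left (norm_inner_le_norm _ _) ht
    refine h2.trans ?_
    have h3 : 0 ≤ ν⁻¹ * (‖F i‖ - t * ν * ‖G i‖) ^ 2 := by positivity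
    have h4 : ν⁻¹ * (‖F i‖ - t * ν * ‖G i‖) ^ 2 = ν⁻¹ * ‖F i‖ ^ 2 + t ^ 2 * (ν * ‖G i‖ ^ 2)
        - 2 * (t * (‖F i‖ * ‖G i‖)) := by field_simp; ring
    linarith
  rw [Finset.mul_sum]
  refine (Finset.sum_le_sum h1).trans ?_
  rw [← Finset.sum_div, Finset.sum_add_distrib, ← Finset.mul_sum, ← Finset.mul_sum,
    ← Finset.mul_sum]
  have h5 : ν⁻¹ * ∑ i ∈ s, ‖F i‖ ^ 2 ≤ A := by
    rw [inv_mul_le_iff₀ hν]; exact hF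
  have h6 : ν * ∑ i ∈ s, ‖G i‖ ^ 2 ≤ B := by
    rw [le_div_iff₀ hν] at hG; linarith
  have h7 := mul_le_mul_of_nonneg_left h6 (sq_nonneg t)
  linarith

/-- The density `∑_j |u_j|²` of a family of orbitals. -/
def dens {ι : Type*} [Fintype ι] (u : ι → L2 Plane) (x : Plane) : ℝ := ∑ j, ‖u j x‖ ^ 2

/-- The convolution `γ ∗ ρ` with the density of a family of orbitals. -/
def convDens {ι : Type*} [Fintype ι] (u : ι → L2 Plane) (γ : Plane → ℝ) (x : Plane) : ℝ :=
  ∫ y, γ (x - y) * dens u y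

section Conv

variable {ι : Type*} [Fintype ι] (u : ι → L2 Plane)

theorem dens_nonneg (x : Plane) : 0 ≤ dens u x := by unfold dens; positivity

theorem integrable_dens : Integrable (dens u) :=
  integrable_finsetSum _ fun j _ => integrable_norm_sq_L2 (u j)

theorem measurable_dens : Measurable (dens u) := by
  unfold dens
  exact Finset.measurable_sum _ fun j _ =>
    ((Lp.stronglyMeasurable (u j)).measurable.norm.pow_const 2)

theorem integrable_conv {γ : Plane → ℝ} (hγ : IsMult γ) (x : Plane) :
    Integrable fun y => γ (x - y) * dens u y := by
  obtain ⟨hm, C, hC⟩ := hγ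
  exact (integrable_dens u).bdd_mul (hm.comp (measurable_const.sub measurable_id)).aestronglyMeasurable
    (Eventually.of_forall fun y => by rw [Real.norm_eq_abs]; exact hC _)

theorem isMult_convDens {γ : Plane → ℝ} (hγ : IsMult γ) : IsMult (convDens u γ) := by
  refine ⟨?_, ?_⟩
  · unfold convDens
    refine StronglyMeasurable.measurable ?_
    refine StronglyMeasurable.integral_prod_right (f := fun x y => γ (x - y) * dens u y) ?_
    refine Measurable.stronglyMeasurable ?_
    exact (hγ.1.comp (measurable_fst.sub measurable_snd)).mul
      ((measurable_dens u).comp measurable_snd)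
  · obtain ⟨C, hC⟩ := hγ.2
    refine ⟨C * ∫ y, dens u y, fun x => ?_⟩
    rw [← Real.norm_eq_abs, ← integral_const_mul]
    refine norm_integral_le_of_norm_le ((integrable_dens u).const_mul C)
      (Eventually.of_forall fun y => ?_)
    rw [norm_mul, Real.norm_eq_abs, Real.norm_eq_abs, abs_of_nonneg (dens_nonneg u y)]
    exact mul_le_mul_of_nonneg_right (hC _) (dens_nonneg u y)

theorem lintegral_conv_sq {γ : Plane → ℝ} (hγ : IsMult γ) (x : Plane) :
    ∫⁻ y, ‖γ (x - y)‖ₑ ^ 2 * ∑ j, ‖u j y‖ₑ ^ 2 =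
      ENNReal.ofReal (convDens u (fun z => γ z ^ 2) x) := by
  have hγ2 : IsMult fun z => γ z ^ 2 := by simpa only [sq] using hγ.mul hγ
  rw [convDens, ofReal_integral_eq_lintegral_ofReal (integrable_conv u hγ2 x)]
  · refine lintegral_congr fun y => ?_
    rw [ENNReal.ofReal_mul (sq_nonneg _), dens, ENNReal.ofReal_sum_of_nonneg (fun _ _ => sq_nonneg _)]
    congr 1
    · rw [Real.enorm_eq_ofReal_abs, ← ENNReal.ofReal_pow (abs_nonneg _), sq_abs]
    · refine Finset.sum_congr rfl fun j _ => ?_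
      rw [ENNReal.ofReal_pow (norm_nonneg _), ofReal_norm]
  · exact Eventually.of_forall fun y => mul_nonneg (sq_nonneg _) (dens_nonneg u y)

end Conv

section AntisymClosure

variable {N : ℕ} {T : Set (Fin N)} {F G : L2 (Config N)}

theorem AntisymOn.add (hF : AntisymOn T F) (hG : AntisymOn T G) : AntisymOn T (F + G) := by
  intro i hi j hj hij
  rw [map_add, hF i hi j hj hij, hG i hi j hj hij, neg_add]

theorem AntisymOn.neg (hF : AntisymOn T F) : AntisymOn T (-F) := by
  intro i hi j hj hij
  rw [map_neg, hF i hi j hj hij]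

theorem AntisymOn.sub (hF : AntisymOn T F) (hG : AntisymOn T G) : AntisymOn T (F - G) := by
  rw [sub_eq_add_neg]
  exact hF.add hG.neg

end AntisymClosure

section Orbitals

variable {n : ℕ} {u : Fin (n + 1) → L2 Plane} (hu : Orthonormal ℂ u)

/-- The commuting projections `p_l` of a family of orbitals. -/
def proj : CommProj (n + 1) (L2 (Config (n + 1))) where
  p := bOp u u
  idem l := ContinuousLinearMap.ext fun F => bOp_bOp_same hu u u l F rfl
  comm l m := by
    by_cases h : l = m
    · rw [h]
    · exact ContinuousLinearMap.ext fun F => bOp_comm u u u u h F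
  symm l F G := inner_bOp_self_left l F G

theorem proj_p (l : Fin (n + 1)) : (proj hu).p l = bOp u u l := rfl

theorem perm_q (σ : Equiv.Perm (Fin (n + 1))) (l : Fin (n + 1)) (F : L2 (Config (n + 1))) :
    perm σ ((proj hu).q l F) = (proj hu).q (σ l) (perm σ F) := by
  rw [CommProj.q_apply, CommProj.q_apply, map_sub, proj_p, perm_bOp, proj_p]

theorem perm_cardOp (σ : Equiv.Perm (Fin (n + 1))) (T : Finset (Fin (n + 1)))
    (hσ : ∀ l, l ∈ T ↔ σ l ∈ T) (d : ℕ → ℝ) (F : L2 (Config (n + 1))) :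
    perm σ ((proj hu).cardOp T d F) = (proj hu).cardOp T d (perm σ F) := by
  have h : Commute (perm σ).toContinuousLinearMap (∑ l ∈ T, (proj hu).q l) := by
    ext1 F
    simp only [mul_apply_eq_comp, LinearIsometry.coe_toContinuousLinearMap, sum_apply, map_sum,
      perm_q]
    exact Finset.sum_equiv σ (fun l => hσ l) fun l _ => rfl
  exact (proj hu).cardOp_comm h d F

theorem AntisymOn.cardOp {T : Set (Fin (n + 1))} {F : L2 (Config (n + 1))} (hF : AntisymOn T F)
    (T' : Finset (Fin (n + 1))) (hT : T ⊆ T') (d : ℕ → ℝ) :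
    AntisymOn T ((proj hu).cardOp T' d F) := by
  intro i hi j hj hij
  rw [perm_cardOp, hF i hi j hj hij, map_neg]
  intro l
  have hi' := hT hi
  have hj' := hT hj
  rw [Finset.mem_coe] at hi' hj'
  rcases eq_or_ne l i with rfl | h1
  · simp [hi', hj']
  rcases eq_or_ne l j with rfl | h2
  · simp [hi', hj']
  rw [Equiv.swap_apply_of_ne_of_ne h1 h2]

theorem AntisymOn.shiftOp {T : Set (Fin (n + 1))} {F : L2 (Config (n + 1))} (hF : AntisymOn T F)
    (d : ℕ → ℝ) (k : ℕ) : AntisymOn T ((proj hu).shiftOp d k F) := by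
  rw [CommProj.shiftOp_eq_cardOp]
  exact hF.cardOp hu _ (by simp) _

theorem norm_q_eq {F : L2 (Config (n + 1))} (hF : AntisymOn univ F) (l m : Fin (n + 1)) :
    ‖(proj hu).q l F‖ = ‖(proj hu).q m F‖ := by
  rcases eq_or_ne l m with rfl | h
  · rfl
  rw [← (perm (Equiv.swap l m)).norm_map ((proj hu).q l F), perm_q, Equiv.swap_apply_left,
    hF l trivial m trivial h, map_neg, norm_neg]

theorem sum_norm_sq_q_eq {F : L2 (Config (n + 1))} (hF : AntisymOn univ F) (m : Fin (n + 1)) :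
    ∑ l, ‖(proj hu).q l F‖ ^ 2 = (n + 1 : ℝ) * ‖(proj hu).q m F‖ ^ 2 := by
  simp [norm_q_eq hu hF _ m]

/-- The multiplication by `γ(x_0 - x_l)`. -/
def pairOp (γ : Plane → ℝ) (l : Fin (n + 1)) : L2 (Config (n + 1)) →L[ℂ] L2 (Config (n + 1)) :=
  mulOp fun x => γ (x 0 - x l)

/-- The multiplication by `v(x_0)`. -/
def meanOp (v : Plane → ℝ) : L2 (Config (n + 1)) →L[ℂ] L2 (Config (n + 1)) :=
  mulOp fun x => v (x 0)

theorem IsMult.pair {γ : Plane → ℝ} (hγ : IsMult γ) (l : Fin (n + 1)) :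
    IsMult fun x : Config (n + 1) => γ (x 0 - x l) :=
  hγ.comp ((measurable_pi_apply 0).sub (measurable_pi_apply l))

theorem IsMult.eval {v : Plane → ℝ} (hv : IsMult v) : IsMult fun x : Config (n + 1) => v (x 0) :=
  hv.comp (measurable_pi_apply 0)

theorem commute_pairOp_p {γ : Plane → ℝ} (hγ : IsMult γ) {l m : Fin (n + 1)} (h0 : m ≠ 0)
    (hl : m ≠ l) : Commute (pairOp γ l) ((proj hu).p m) := by
  refine ContinuousLinearMap.ext fun F => mulOp_bOp (hγ.pair l) (fun x y => ?_) u u F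
  rw [Function.update_of_ne h0.symm, Function.update_of_ne hl.symm]

theorem commute_meanOp_p {v : Plane → ℝ} (hv : IsMult v) {m : Fin (n + 1)} (h0 : m ≠ 0) :
    Commute (meanOp v) ((proj hu).p m) := by
  refine ContinuousLinearMap.ext fun F => mulOp_bOp hv.eval (fun x y => ?_) u u F
  rw [Function.update_of_ne h0.symm]

theorem commute_sum_q {M : L2 (Config (n + 1)) →L[ℂ] L2 (Config (n + 1))}
    {T : Finset (Fin (n + 1))} (h : ∀ m ∈ T, Commute M ((proj hu).p m)) :
    Commute M (∑ m ∈ T, (proj hu).q m) :=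
  Commute.sum_right _ _ _ fun m hm => (Commute.one_right _).sub_right (h m hm)

theorem commute_pairOp_sum_q {γ : Plane → ℝ} (hγ : IsMult γ) (l : Fin (n + 1)) :
    Commute (pairOp γ l) (∑ m ∈ (Finset.univ.erase 0).erase l, (proj hu).q m) :=
  commute_sum_q hu fun m hm => by
    simp only [Finset.mem_erase, Finset.mem_univ, and_true] at hm
    exact commute_pairOp_p hu hγ hm.2 hm.1

theorem commute_bOp_p (y : Fin (n + 1) → L2 Plane) {m : Fin (n + 1)} (h0 : m ≠ 0) :
    Commute (bOp u y 0) ((proj hu).p m) :=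
  ContinuousLinearMap.ext fun F => bOp_comm u y u u h0.symm F

theorem commute_bOp_q (y : Fin (n + 1) → L2 Plane) {m : Fin (n + 1)} (h0 : m ≠ 0) :
    Commute (bOp u y 0) ((proj hu).q m) :=
  (Commute.one_right _).sub_right (commute_bOp_p hu y h0)

theorem bOp_cardOp (y : Fin (n + 1) → L2 Plane) {T : Finset (Fin (n + 1))} (hT : 0 ∉ T)
    (d : ℕ → ℝ) (F : L2 (Config (n + 1))) :
    bOp u y 0 ((proj hu).cardOp T d F) = (proj hu).cardOp T d (bOp u y 0 F) :=
  (proj hu).cardOp_comm (commute_sum_q hu fun _ hm =>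
    commute_bOp_p hu y fun h => hT (h ▸ hm)) d F

theorem bOp_p_zero (y : Fin (n + 1) → L2 Plane) (F : L2 (Config (n + 1))) :
    bOp u y 0 ((proj hu).p 0 F) = bOp u y 0 F :=
  bOp_bOp_same hu y u 0 F rfl

theorem bOp_cardOp_erase (y : Fin (n + 1) → L2 Plane) (d : ℕ → ℝ) (F : L2 (Config (n + 1))) :
    bOp u y 0 ((proj hu).cardOp (Finset.univ.erase 0) d F) =
      bOp u y 0 ((proj hu).shiftOp d 0 F) := by
  rw [← bOp_p_zero hu, CommProj.p_cardOp_erase, bOp_p_zero hu]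

/-- Trace inequality with multiplier γ(x₀ - y) and b = u. Each single term is already bounded by the
right side; antisymmetry lets the same quantity bound their sum. -/
theorem sum_norm_sq_pairOp_p_le {γ : Plane → ℝ} (hγ : IsMult γ) {F : L2 (Config (n + 1))}
    (hF : AntisymOn {l | l ≠ 0} F) :
    ∑ l ∈ Finset.univ.erase 0, ‖pairOp γ l ((proj hu).p l F)‖ ^ 2 ≤
      ∫ x, convDens u (fun z => γ z ^ 2) (x 0) * ‖F x‖ ^ 2 := by
  have hγ2 : IsMult fun z => γ z ^ 2 := by simpa only [sq] using hγ.mul hγ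
  obtain ⟨C, hC⟩ := hγ.2
  refine sum_norm_sq_mulOp_bOp_le hu (Finset.univ.erase 0) (hF.mono ?_) u
    (g := fun x y => γ (x 0 - y)) ?_ (fun x y => hC _) ?_ (isMult_convDens u hγ2).eval ?_ ?_
  · intro l hl
    simpa using hl
  · exact hγ.1.comp (((measurable_pi_apply 0).comp measurable_fst).sub measurable_snd)
  · intro l hl x z y
    rw [Function.update_of_ne]
    exact (Finset.ne_of_mem_erase hl).symm
  · exact fun x => integral_nonneg fun y => mul_nonneg (sq_nonneg _) (dens_nonneg u y)
  · exact fun x => (lintegral_conv_sq u hγ _).le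

/-- A pair potential whose square, averaged with the density of the orbitals, is at most `c`. -/
structure PairPot (u : Fin (n + 1) → L2 Plane) (γ : Plane → ℝ) (c : ℝ) : Prop where
  mult : IsMult γ
  even : ∀ x, |γ (-x)| = |γ x|
  conv_le : ∀ x, convDens u (fun z => γ z ^ 2) x ≤ c

variable {γ : Plane → ℝ} {c : ℝ} (hγ : PairPot u γ c)

include hγ

theorem PairPot.mult_sq : IsMult fun z => γ z ^ 2 := by simpa only [sq] using hγ.mult.mul hγ.mult

theorem PairPot.integral_le (F : L2 (Config (n + 1))) :
    ∫ x, convDens u (fun z => γ z ^ 2) (x 0) * ‖F x‖ ^ 2 ≤ c * ‖F‖ ^ 2 := by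
  rw [norm_sq_L2, ← integral_const_mul]
  refine integral_mono ((isMult_convDens u hγ.mult_sq).eval.integrable_mul_norm_sq F)
    ((integrable_norm_sq_L2 F).const_mul c) fun x => ?_
  exact mul_le_mul_of_nonneg_right (hγ.conv_le _) (sq_nonneg _)

theorem PairPot.sum_norm_sq_p_le {F : L2 (Config (n + 1))} (hF : AntisymOn {l | l ≠ 0} F) :
    ∑ l ∈ Finset.univ.erase 0, ‖pairOp γ l ((proj hu).p l F)‖ ^ 2 ≤ c * ‖F‖ ^ 2 :=
  (sum_norm_sq_pairOp_p_le hu hγ.mult hF).trans (hγ.integral_le F)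

theorem norm_pairOp_even (l : Fin (n + 1)) (F : L2 (Config (n + 1))) :
    ‖pairOp γ l (perm (Equiv.swap 0 l) F)‖ = ‖pairOp γ l F‖ := by
  have h : pairOp γ l (perm (Equiv.swap 0 l) F) =
      perm (Equiv.swap 0 l) (mulOp (fun x : Config (n + 1) => γ (-(x 0 - x l))) F) := by
    have hm : IsMult fun x : Config (n + 1) => γ (-(x 0 - x l)) :=
      hγ.mult.comp (((measurable_pi_apply 0).sub (measurable_pi_apply l)).neg)
    rw [perm_mulOp hm, pairOp]
    simp
  rw [h, LinearIsometry.norm_map]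
  have hm : IsMult fun x : Config (n + 1) => γ (-(x 0 - x l)) :=
    hγ.mult.comp (((measurable_pi_apply 0).sub (measurable_pi_apply l)).neg)
  have := norm_sq_mulOp hm F
  have h2 := norm_sq_mulOp (hγ.mult.pair l) F
  have h3 : ‖mulOp (fun x : Config (n + 1) => γ (-(x 0 - x l))) F‖ ^ 2 = ‖pairOp γ l F‖ ^ 2 := by
    rw [this, pairOp, h2]
    congr 1
    funext x
    rw [← sq_abs, hγ.even, sq_abs]
  exact (pow_left_inj₀ (norm_nonneg _) (norm_nonneg _) two_ne_zero).1 h3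

/-- The exchange of 0 and l swaps the roles of p and q, and the norm only sees |γ|, which is even.
-/
theorem norm_pairOp_p_q {F : L2 (Config (n + 1))} (hF : AntisymOn univ F) {l : Fin (n + 1)}
    (hl : l ≠ 0) : ‖pairOp γ l ((proj hu).p 0 ((proj hu).q l F))‖ =
      ‖pairOp γ l ((proj hu).q 0 ((proj hu).p l F))‖ := by
  rw [← norm_pairOp_even hγ, proj_p, perm_bOp, perm_q hu, hF 0 trivial l trivial hl.symm,
    Equiv.swap_apply_left, Equiv.swap_apply_right, map_neg, map_neg, map_neg, norm_neg]
  have : (proj hu).p l ((proj hu).q 0 F) = (proj hu).q 0 ((proj hu).p l F) := by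
    rw [CommProj.q_apply, CommProj.q_apply, map_sub]
    congr 1
    exact congrArg (fun A : L2 (Config (n + 1)) →L[ℂ] _ => A F) ((proj hu).comm l 0)
  rw [← proj_p hu, this]

theorem PairPot.sum_norm_sq_q_p_le {F : L2 (Config (n + 1))} (hF : AntisymOn univ F) :
    ∑ l ∈ Finset.univ.erase 0, ‖pairOp γ l ((proj hu).q 0 ((proj hu).p l F))‖ ^ 2 ≤
      c * ‖(proj hu).q 0 F‖ ^ 2 := by
  have hF' : AntisymOn {l | l ≠ 0} F := hF.mono (subset_univ _)
  have hq : AntisymOn {l | l ≠ 0} ((proj hu).q 0 F) := by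
    rw [CommProj.q_apply]
    exact hF'.sub (hF'.bOp (by simp) u u)
  refine le_trans (le_of_eq ?_) (hγ.sum_norm_sq_p_le hu hq)
  refine Finset.sum_congr rfl fun l _ => ?_
  congr 3
  rw [CommProj.q_apply, CommProj.q_apply, map_sub]
  congr 1
  exact congrArg (fun A : L2 (Config (n + 1)) →L[ℂ] _ => A F) ((proj hu).comm 0 l)

theorem PairPot.sum_norm_sq_p_q_le {F : L2 (Config (n + 1))} (hF : AntisymOn univ F) :
    ∑ l ∈ Finset.univ.erase 0, ‖pairOp γ l ((proj hu).p 0 ((proj hu).q l F))‖ ^ 2 ≤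
      c * ‖(proj hu).q 0 F‖ ^ 2 := by
  refine le_trans (le_of_eq ?_) (hγ.sum_norm_sq_q_p_le hu hF)
  refine Finset.sum_congr rfl fun l hl => ?_
  rw [norm_pairOp_p_q hu hγ hF (Finset.ne_of_mem_erase hl)]

omit hγ

include hu in
-- By antisymmetry all n + 1 particles contribute equally to the trace inequality with multiplier 1,
-- so a single one carries the fraction 1/(n + 1) of ∑_j ‖y_j‖².
theorem norm_sq_bOp_le {y : Fin (n + 1) → L2 Plane} {C : ℝ}
    (hy : ∑ j, ‖y j‖ ^ 2 ≤ C * (n + 1)) {F : L2 (Config (n + 1))} (hF : AntisymOn univ F) :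
    ‖bOp u y 0 F‖ ^ 2 ≤ C * ‖F‖ ^ 2 := by
  have hall : ∀ l, ‖bOp u y l F‖ = ‖bOp u y 0 F‖ := by
    intro l
    rcases eq_or_ne l 0 with rfl | h
    · rfl
    rw [← (perm (Equiv.swap l 0)).norm_map (bOp u y l F), perm_bOp, Equiv.swap_apply_left,
      hF l trivial 0 trivial h, map_neg, norm_neg]
  have key := sum_norm_sq_mulOp_bOp_le hu Finset.univ (Φ := F) (hF.mono (subset_univ _)) y
    (g := fun _ _ => 1) measurable_const (C := 1) (fun x y => by simp)
    (fun l _ x z y => rfl) (v := fun _ => C * (n + 1)) (isMult_const _) (fun x => ?_) (fun x => ?_)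
  · rw [integral_const_mul, ← norm_sq_L2] at key
    simp only [mulOp_const, Complex.ofReal_one, one_smul, hall, Finset.sum_const,
      Finset.card_univ, Fintype.card_fin, nsmul_eq_mul] at key
    push_cast at key
    have : (0 : ℝ) < n + 1 := by positivity
    nlinarith
  · exact le_trans (by positivity) hy
  · simp only [enorm_one, one_pow, one_mul]
    rw [lintegral_finsetSum]
    · simp only [lintegral_enorm_sq_L2]
      rw [← ENNReal.ofReal_sum_of_nonneg (fun _ _ => sq_nonneg _)]
      exact ENNReal.ofReal_le_ofReal hy
    · exact fun j _ => ((Lp.stronglyMeasurable (y j)).measurable.enorm.pow_const 2)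

/-- The sum is the squared norm of the square root of a number operator. This root counts particles
other than 0, hence passes through an operator on particle 0 and lands on F. -/
theorem sum_norm_sq_q_bOp_le {y : Fin (n + 1) → L2 Plane} {C : ℝ}
    (hy : ∑ j, ‖y j‖ ^ 2 ≤ C * (n + 1)) {F : L2 (Config (n + 1))} (hF : AntisymOn univ F) :
    ∑ l ∈ Finset.univ.erase 0, ‖(proj hu).q l (bOp u y 0 F)‖ ^ 2 ≤
      C * ∑ l, ‖(proj hu).q l F‖ ^ 2 := by
  rw [CommProj.sum_norm_sq_q_eq_cardOp, CommProj.sum_norm_sq_q_eq_cardOp, ← bOp_cardOp hu y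
    (Finset.notMem_erase _ _), bOp_cardOp_erase hu y, CommProj.shiftOp_eq_cardOp]
  exact norm_sq_bOp_le hu hy (hF.cardOp hu _ (by simp) _)

theorem sum_norm_sq_p_le (F : L2 (Config (n + 1))) :
    ∑ l ∈ Finset.univ.erase 0, ‖(proj hu).p l F‖ ^ 2 ≤ (n + 1 : ℝ) * ‖F‖ ^ 2 := by
  refine (Finset.sum_le_sum fun l _ => (proj hu).norm_p_le l F).trans ?_
  rw [Finset.sum_const, nsmul_eq_mul]
  refine mul_le_mul_of_nonneg_right ?_ (sq_nonneg _)
  rw [Finset.card_erase_of_mem (Finset.mem_univ _)]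
  simp

/-- The difference of the mean field of `γ` and of the interaction by `γ` with the particles in
the orbitals. -/
def fluct (γ : Plane → ℝ) : L2 (Config (n + 1)) →L[ℂ] L2 (Config (n + 1)) :=
  meanOp (convDens u γ) -
    ∑ l ∈ Finset.univ.erase 0, (proj hu).p l * pairOp γ l * (proj hu).p l

theorem inner_fluct (γ : Plane → ℝ) (F G : L2 (Config (n + 1))) :
    ⟪F, fluct hu γ G⟫_ℂ = ⟪F, meanOp (convDens u γ) G⟫_ℂ -
      ∑ l ∈ Finset.univ.erase 0, ⟪(proj hu).p l F, pairOp γ l ((proj hu).p l G)⟫_ℂ := by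
  simp only [fluct, sub_apply, inner_sub_right, sum_apply, inner_sum, mul_apply_eq_comp,
    (proj hu).symm]

theorem inner_fluct_left {γ : Plane → ℝ} (hγ : IsMult γ) (F G : L2 (Config (n + 1))) :
    ⟪fluct hu γ F, G⟫_ℂ = ⟪F, fluct hu γ G⟫_ℂ := by
  rw [inner_fluct, fluct, sub_apply, inner_sub_left, sum_apply, sum_inner, meanOp,
    inner_mulOp_left (isMult_convDens u hγ).eval]
  congr 1
  refine Finset.sum_congr rfl fun l _ => ?_
  rw [mul_apply_eq_comp, mul_apply_eq_comp, (proj hu).symm, pairOp,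
    inner_mulOp_left (hγ.pair l)]

theorem fluct_add_smul {γ δ : Plane → ℝ} (hγ : IsMult γ) (hδ : IsMult δ) (a b d : ℝ) :
    fluct hu (fun x => a * γ x + b * δ x + d) =
      (a : ℂ) • fluct hu γ + (b : ℂ) • fluct hu δ + (d : ℂ) • fluct hu fun _ => 1 := by
  have h1 : convDens u (fun x => a * γ x + b * δ x + d) = fun x =>
      a * convDens u γ x + b * convDens u δ x + d * convDens u (fun _ => 1) x := by
    funext x
    have i1 := integrable_conv u hγ x
    have i2 := integrable_conv u hδ x
    have i3 := integrable_conv u (isMult_const 1) x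
    simp only [convDens]
    rw [← integral_const_mul, ← integral_const_mul, ← integral_const_mul,
      ← integral_add (i1.const_mul a) (i2.const_mul b), ← integral_add _ (i3.const_mul d)]
    · congr 1
      funext y
      ring
    · exact (i1.const_mul a).add (i2.const_mul b)
  have mul3 : ∀ {f g : Config (n + 1) → ℝ} (_ : IsMult f) (_ : IsMult g)
      {e : Config (n + 1) → ℝ} (_ : IsMult e),
      mulOp (fun x => a * f x + b * g x + d * e x) =
      (a : ℂ) • mulOp f + (b : ℂ) • mulOp g + (d : ℂ) • mulOp e := by
    intro f g hf hg e he
    ext1 F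
    rw [mulOp_add ((hf.const_mul a).add (hg.const_mul b)) (he.const_mul d),
      mulOp_add (hf.const_mul a) (hg.const_mul b), mulOp_const_mul hf, mulOp_const_mul hg,
      mulOp_const_mul he]
    rfl
  have h2 : meanOp (n := n) (convDens u (fun x => a * γ x + b * δ x + d)) =
      (a : ℂ) • meanOp (convDens u γ) + (b : ℂ) • meanOp (convDens u δ) +
        (d : ℂ) • meanOp (convDens u fun _ => 1) := by
    rw [h1]
    exact mul3 (isMult_convDens u hγ).eval (isMult_convDens u hδ).eval
      (isMult_convDens u (isMult_const 1)).eval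
  have h3 : ∀ l, pairOp (n := n) (fun x => a * γ x + b * δ x + d) l =
      (a : ℂ) • pairOp γ l + (b : ℂ) • pairOp δ l + (d : ℂ) • pairOp (fun _ => 1) l := by
    intro l
    have := mul3 (hγ.pair l) (hδ.pair l) (isMult_const 1)
    simp only [mul_one] at this
    exact this
  simp only [fluct, h2, h3, mul_add, add_mul, mul_smul_comm, smul_mul_assoc,
    Finset.sum_add_distrib, ← Finset.smul_sum, smul_sub]
  abel

/-- On squares, positivity is exactly the trace inequality: the interaction with the particles in
the orbitals never exceeds the mean field. -/
theorem re_inner_fluct_sq_nonneg {γ : Plane → ℝ} (hγ : IsMult γ) {F : L2 (Config (n + 1))}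
    (hF : AntisymOn {l | l ≠ 0} F) : 0 ≤ (⟪F, fluct hu (fun x => γ x ^ 2) F⟫_ℂ).re := by
  have hγ2 : IsMult fun z => γ z ^ 2 := by simpa only [sq] using hγ.mul hγ
  rw [inner_fluct, meanOp, inner_mulOp_self (isMult_convDens u hγ2).eval, Complex.sub_re,
    Complex.ofReal_re, Complex.re_sum, sub_nonneg]
  refine le_trans (le_of_eq ?_) (sum_norm_sq_pairOp_p_le hu hγ hF)
  refine Finset.sum_congr rfl fun l _ => ?_
  rw [pairOp, inner_mulOp_self (hγ2.pair l), Complex.ofReal_re, pairOp,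
    norm_sq_mulOp (hγ.pair l)]

include hu in
theorem convDens_one (x : Plane) : convDens u (fun _ => 1) x = n + 1 := by
  simp only [convDens, one_mul, dens]
  rw [integral_finsetSum _ fun j _ => integrable_norm_sq_L2 (u j)]
  simp only [← norm_sq_L2, hu.1]
  simp

/-- The mean field of 1 is n + 1 while only n particles are projected, so the excess is one plus the
number of excitations among them. -/
theorem re_inner_fluct_one (F : L2 (Config (n + 1))) :
    (⟪F, fluct hu (fun _ => 1) F⟫_ℂ).re =
      ‖F‖ ^ 2 + ∑ l ∈ Finset.univ.erase 0, ‖(proj hu).q l F‖ ^ 2 := by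
  have h1 : meanOp (n := n) (convDens u fun _ => 1) F = ((n + 1 : ℝ) : ℂ) • F := by
    have : convDens u (fun _ => 1) = fun _ => (n + 1 : ℝ) := funext (convDens_one hu)
    rw [meanOp, this, mulOp_const]
  have h2 : ∀ l, pairOp (n := n) (fun _ => 1) l ((proj hu).p l F) = (proj hu).p l F := by
    intro l
    rw [pairOp, mulOp_const, Complex.ofReal_one, one_smul]
  have h3 : ∀ G : L2 (Config (n + 1)), ⟪G, G⟫_ℂ = ((‖G‖ ^ 2 : ℝ) : ℂ) := fun G => by
    rw [inner_self_eq_norm_sq_to_K]; push_cast; rfl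
  rw [inner_fluct, h1, inner_smul_right]
  simp only [h2, h3]
  rw [← Complex.ofReal_mul, ← Complex.ofReal_sum, ← Complex.ofReal_sub, Complex.ofReal_re]
  have h4 : ∀ l, ‖(proj hu).p l F‖ ^ 2 = ‖F‖ ^ 2 - ‖(proj hu).q l F‖ ^ 2 := fun l => by
    have := (proj hu).norm_p_add_norm_q l F
    linarith
  simp only [h4, Finset.sum_sub_distrib, Finset.sum_const,
    Finset.card_erase_of_mem (Finset.mem_univ (0 : Fin (n + 1)))]
  simp
  ring

/-- The compression by p_l on both sides is what makes the l-th summand commute with p_l; the pair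
operator alone does not. -/
theorem commute_fluct_p {γ : Plane → ℝ} (hγ : IsMult γ) {m : Fin (n + 1)} (h0 : m ≠ 0) :
    Commute (fluct hu γ) ((proj hu).p m) := by
  unfold fluct
  refine (commute_meanOp_p hu (isMult_convDens u hγ) h0).sub_left (Commute.sum_left _ _ _ ?_)
  intro l _
  by_cases h : m = l
  · subst h
    change _ * _ = _ * _
    rw [mul_assoc, (proj hu).idem, ← mul_assoc, ← mul_assoc, (proj hu).idem]
  · exact (Commute.mul_left ((proj hu).comm l m) (commute_pairOp_p hu hγ h0 h)).mul_left
      ((proj hu).comm l m)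

theorem sector_q (T : Finset (Fin (n + 1))) (k : ℕ) (F : L2 (Config (n + 1))) :
    ∑ l ∈ T, ‖(proj hu).q l ((proj hu).cardOp T (Pi.single k 1) F)‖ ^ 2 =
      k * ‖(proj hu).cardOp T (Pi.single k 1) F‖ ^ 2 := by
  rw [CommProj.sum_norm_sq_q_eq_cardOp, CommProj.cardOp_mul, CommProj.norm_sq_cardOp,
    CommProj.norm_sq_cardOp, Finset.mul_sum]
  refine Finset.sum_congr rfl fun S _ => ?_
  by_cases h : (S ∩ T).card = k
  · rw [h]; simp
  · simp [Pi.single_eq_of_ne h]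

/-- The factor √(M(k + 1)) is chosen so that both terms become multiples of √((k + 1)/M). -/
theorem half_sector_le {c k : ℝ} {M : ℝ} (hM : 0 < M) (hk : 0 ≤ k) :
    (√(M * (k + 1)) * (c / M) + (√(M * (k + 1)))⁻¹ * (k + 1)) / 2 =
      (c + 1) / 2 * √((k + 1) / M) := by
  have h1 : √(M * (k + 1)) = M * √((k + 1) / M) := by
    rw [show M * (k + 1) = M ^ 2 * ((k + 1) / M) by field_simp, Real.sqrt_mul (by positivity),
      Real.sqrt_sq hM.le]
  have h3 : 0 < √((k + 1) / M) := by positivity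
  have h4 : k + 1 = M * (√((k + 1) / M) * √((k + 1) / M)) := by
    rw [Real.mul_self_sqrt (by positivity)]; field_simp
  rw [h1]
  generalize √((k + 1) / M) = z at *
  rw [h4]
  field_simp

/-- A discriminant argument. Positivity on the square of √a γ ± 1/√a gives 2|⟨γ⟩| ≤ a⟨γ²⟩ + a⁻¹⟨1⟩
for the expectations of the fluctuation. With k excitations among the particles l ≠ 0, ⟨γ²⟩ is at
most c/N and ⟨1⟩ equals k + 1, per unit of squared norm, and a = √(N(k + 1)) balances the two. Since
`fluct` preserves the number of these excitations, the estimate may be made sector by sector. -/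
theorem PairPot.norm_inner_fluct_le {γ : Plane → ℝ} {c : ℝ} (hγ : PairPot u γ (c / (n + 1)))
    {F : L2 (Config (n + 1))} (hF : AntisymOn {l | l ≠ 0} F) :
    ‖⟪F, fluct hu γ F⟫_ℂ‖ ≤
      (c + 1) / 2 * ‖(proj hu).cardOp (Finset.univ.erase 0) (CommProj.quarter (n + 1)) F‖ ^ 2 := by
  have hN : (0 : ℝ) < n + 1 := by positivity
  have hcomm : Commute (fluct hu γ) (∑ m ∈ Finset.univ.erase 0, (proj hu).q m) :=
    commute_sum_q hu fun m hm => commute_fluct_p hu hγ.mult (Finset.ne_of_mem_erase hm)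
  refine ((proj hu).norm_inner_le_of_sectors hcomm
    (fun k => (c + 1) / 2 * √(((k : ℝ) + 1) / (n + 1))) F fun k => ?_).trans (le_of_eq ?_)
  · set G := (proj hu).cardOp (Finset.univ.erase 0) (Pi.single k 1) F with hG
    have hGa : AntisymOn {l | l ≠ 0} G := hF.cardOp hu _ (fun l hl => by simpa using hl) _
    have hreal : ⟪G, fluct hu γ G⟫_ℂ = (((⟪G, fluct hu γ G⟫_ℂ).re : ℝ) : ℂ) := by
      refine (Complex.conj_eq_iff_re.1 ?_).symm
      rw [inner_conj_symm, inner_fluct_left hu hγ.mult]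
    have hone : (⟪G, fluct hu (fun _ => 1) G⟫_ℂ).re = (k + 1) * ‖G‖ ^ 2 := by
      rw [re_inner_fluct_one, hG, sector_q]
      ring
    have hsq : (⟪G, fluct hu (fun x => γ x ^ 2) G⟫_ℂ).re ≤ c / (n + 1) * ‖G‖ ^ 2 := by
      refine le_trans ?_ (hγ.integral_le G)
      rw [inner_fluct, meanOp, inner_mulOp_self (isMult_convDens u hγ.mult_sq).eval,
        Complex.sub_re, Complex.ofReal_re, Complex.re_sum, sub_le_self_iff]
      refine Finset.sum_nonneg fun l _ => ?_
      rw [pairOp, inner_mulOp_self (hγ.mult_sq.pair l), Complex.ofReal_re]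
      exact integral_nonneg fun x => by positivity
    have hpos : ∀ ε : ℝ, ε ^ 2 = 1 → 0 ≤ √((n + 1) * ((k : ℝ) + 1)) *
        (⟪G, fluct hu (fun x => γ x ^ 2) G⟫_ℂ).re + 2 * ε * (⟪G, fluct hu γ G⟫_ℂ).re +
        -- The two signs ε = ±1 bound the fluctuation of γ from below and from above.
        (√((n + 1) * ((k : ℝ) + 1)))⁻¹ * (⟪G, fluct hu (fun _ => 1) G⟫_ℂ).re := by
      intro ε hε
      set a := √((n + 1) * ((k : ℝ) + 1)) with ha
      have ha0 : 0 < a := by positivity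
      have hδ : IsMult fun x => √a * γ x + ε * (√a)⁻¹ :=
        (hγ.mult.const_mul _).add (isMult_const _)
      have := re_inner_fluct_sq_nonneg hu hδ hGa
      have e : (fun x => (√a * γ x + ε * (√a)⁻¹) ^ 2) =
          fun x => a * γ x ^ 2 + (2 * ε) * γ x + a⁻¹ := by
        funext x
        have hs : √a ^ 2 = a := Real.sq_sqrt ha0.le
        have hs0 : √a ≠ 0 := by positivity
        have hi : √a * (√a)⁻¹ = 1 := mul_inv_cancel₀ hs0
        have hi2 : ((√a)⁻¹) ^ 2 = a⁻¹ := by rw [inv_pow, hs]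
        calc (√a * γ x + ε * (√a)⁻¹) ^ 2 = √a ^ 2 * γ x ^ 2 + 2 * ε * γ x * (√a * (√a)⁻¹)
            + ε ^ 2 * ((√a)⁻¹) ^ 2 := by ring
          _ = _ := by rw [hs, hi, hi2, hε]; ring
      rw [e, fluct_add_smul hu hγ.mult_sq hγ.mult] at this
      simp only [add_apply, smul_apply, inner_add_right, inner_smul_right, Complex.add_re,
        Complex.re_ofReal_mul] at this
      exact this
    rw [hreal, Complex.norm_real, Real.norm_eq_abs]
    have h1 := hpos 1 (by norm_num)
    have h2 := hpos (-1) (by norm_num)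
    have h3 := half_sector_le (c := c) hN (Nat.cast_nonneg k)
    have h4 : √((n + 1) * ((k : ℝ) + 1)) * (⟪G, fluct hu (fun x => γ x ^ 2) G⟫_ℂ).re ≤
        √((n + 1) * ((k : ℝ) + 1)) * (c / (n + 1) * ‖G‖ ^ 2) :=
      mul_le_mul_of_nonneg_left hsq (Real.sqrt_nonneg _)
    rw [hone] at h1 h2
    beta_reduce
    rw [← h3, abs_le]
    constructor <;> nlinarith
  · rw [CommProj.norm_sq_cardOp, Finset.mul_sum]
    refine Finset.sum_congr rfl fun S _ => ?_
    rw [CommProj.quarter_sq]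
    push_cast
    ring

end Orbitals

/-! ### Estimates of pair terms -/

section PairTerms

variable {n : ℕ} {u : Fin (n + 1) → L2 Plane} (hu : Orthonormal ℂ u)

/-- The state reweighted by `((k + 1) / N)^{1/4}`. -/
def upState (Ψ : L2 (Config (n + 1))) : L2 (Config (n + 1)) :=
  (proj hu).shiftOp (CommProj.quarter (n + 1)) 0 Ψ

/-- The state reweighted by `((k + 1 - i) / N)^{-1/4}`. -/
def downState (i : ℕ) (Ψ : L2 (Config (n + 1))) : L2 (Config (n + 1)) :=
  (proj hu).shiftOp (fun k => (CommProj.quarter (n + 1) k)⁻¹) i Ψ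

theorem p_comm (l m : Fin (n + 1)) (F : L2 (Config (n + 1))) :
    (proj hu).p l ((proj hu).p m F) = (proj hu).p m ((proj hu).p l F) :=
  congrArg (fun A : L2 (Config (n + 1)) →L[ℂ] _ => A F) ((proj hu).comm l m)

theorem q_p_comm (l m : Fin (n + 1)) (F : L2 (Config (n + 1))) :
    (proj hu).q l ((proj hu).p m F) = (proj hu).p m ((proj hu).q l F) := by
  rw [CommProj.q_apply, CommProj.q_apply, map_sub, p_comm]

theorem q_q_comm (l m : Fin (n + 1)) (F : L2 (Config (n + 1))) :
    (proj hu).q l ((proj hu).q m F) = (proj hu).q m ((proj hu).q l F) := by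
  rw [CommProj.q_apply, CommProj.q_apply (pr := proj hu) l F, map_sub, q_p_comm]

theorem bOp_p (y : Fin (n + 1) → L2 Plane) {l : Fin (n + 1)} (hl : l ≠ 0)
    (F : L2 (Config (n + 1))) : bOp u y 0 ((proj hu).p l F) = (proj hu).p l (bOp u y 0 F) :=
  congrArg (fun A : L2 (Config (n + 1)) →L[ℂ] _ => A F) (commute_bOp_p hu y hl).eq

theorem bOp_q (y : Fin (n + 1) → L2 Plane) {l : Fin (n + 1)} (hl : l ≠ 0)
    (F : L2 (Config (n + 1))) : bOp u y 0 ((proj hu).q l F) = (proj hu).q l (bOp u y 0 F) :=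
  congrArg (fun A : L2 (Config (n + 1)) →L[ℂ] _ => A F) (commute_bOp_q hu y hl).eq

theorem cardOp_p_bOp (y : Fin (n + 1) → L2 Plane) {l : Fin (n + 1)} (hl : l ≠ 0) (d : ℕ → ℝ)
    (F : L2 (Config (n + 1))) :
    (proj hu).cardOp ((Finset.univ.erase 0).erase l) d ((proj hu).p l (bOp u y 0 F)) =
      (proj hu).p l (bOp u y 0 ((proj hu).shiftOp d 0 F)) := by
  rw [← CommProj.p_cardOp, ← bOp_cardOp hu y (by simp), ← bOp_p hu y hl, ← bOp_p_zero hu,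
    CommProj.p_p_cardOp_erase, bOp_p_zero hu, bOp_p hu y hl]

theorem cardOp_q_bOp (y : Fin (n + 1) → L2 Plane) {l : Fin (n + 1)} (hl : l ≠ 0) (d : ℕ → ℝ)
    (F : L2 (Config (n + 1))) :
    (proj hu).cardOp ((Finset.univ.erase 0).erase l) d ((proj hu).q l (bOp u y 0 F)) =
      (proj hu).q l (bOp u y 0 ((proj hu).shiftOp d 1 F)) := by
  rw [← CommProj.q_cardOp, ← bOp_cardOp hu y (by simp), ← bOp_q hu y hl, ← bOp_p_zero hu,
    CommProj.p_q_cardOp_erase, bOp_p_zero hu, bOp_q hu y hl]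

theorem quarter_ne_zero (k : ℕ) : CommProj.quarter (n + 1) k ≠ 0 :=
  (CommProj.quarter_pos n.succ_pos k).ne'

/-- Multiplication by γ(x₀ - x_l) leaves the excitations of all other particles alone, so weights in
their number move across it. In `inner_pairOp_down` the weight and its inverse change sides. -/
theorem inner_pairOp_up {γ : Plane → ℝ} (hγ : IsMult γ) (l : Fin (n + 1))
    (F G : L2 (Config (n + 1))) :
    ⟪F, pairOp γ l G⟫_ℂ = ⟪(proj hu).cardOp ((Finset.univ.erase 0).erase l)
      (CommProj.quarter (n + 1)) F, pairOp γ l ((proj hu).cardOp ((Finset.univ.erase 0).erase l)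
        (fun k => (CommProj.quarter (n + 1) k)⁻¹) G)⟫_ℂ :=
  (proj hu).inner_apply_eq_cardOp (commute_pairOp_sum_q hu hγ l) quarter_ne_zero F G

theorem inner_pairOp_down {γ : Plane → ℝ} (hγ : IsMult γ) (l : Fin (n + 1))
    (F G : L2 (Config (n + 1))) :
    ⟪F, pairOp γ l G⟫_ℂ = ⟪(proj hu).cardOp ((Finset.univ.erase 0).erase l)
      (fun k => (CommProj.quarter (n + 1) k)⁻¹) F,
        pairOp γ l ((proj hu).cardOp ((Finset.univ.erase 0).erase l)
        (CommProj.quarter (n + 1)) G)⟫_ℂ := by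
  have := (proj hu).inner_apply_eq_cardOp (commute_pairOp_sum_q hu hγ l)
    (fun k => inv_ne_zero (quarter_ne_zero (n := n) k)) F G
  simpa only [inv_inv] using this

variable {y : Fin (n + 1) → L2 Plane} {C : ℝ} (hy : ∑ j, ‖y j‖ ^ 2 ≤ C * (n + 1))
  {γ : Plane → ℝ} {c : ℝ} (hγ : PairPot u γ (c / (n + 1))) (hc : 0 ≤ c)
  {Ψ : L2 (Config (n + 1))} (hΨ : AntisymOn univ Ψ)

theorem norm_sq_upState : ‖upState hu Ψ‖ ^ 2 = (proj hu).excitation Ψ :=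
  (proj hu).norm_sq_shiftOp_quarter Ψ

include hΨ

theorem antisymOn_upState : AntisymOn univ (upState hu Ψ) := hΨ.shiftOp hu _ _

theorem antisymOn_downState (i : ℕ) : AntisymOn univ (downState hu i Ψ) := hΨ.shiftOp hu _ _

theorem norm_sq_q_downState_le : ‖(proj hu).q 0 (downState hu 1 Ψ)‖ ^ 2 ≤
    (proj hu).excitation Ψ := by
  have h1 := sum_norm_sq_q_eq hu (antisymOn_downState hu hΨ 1) 0
  have h2 := (proj hu).sum_norm_sq_q_shiftOp_le n.succ_pos Ψ
  rw [← downState, h1] at h2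
  push_cast at h2
  exact le_of_mul_le_mul_left h2 (by positivity)

theorem norm_sq_q_le : ‖(proj hu).q 0 Ψ‖ ^ 2 ≤ (proj hu).excitation Ψ := by
  have h1 := sum_norm_sq_q_eq hu hΨ 0
  have h2 := (proj hu).sum_norm_sq_q_le n.succ_pos Ψ
  rw [h1] at h2
  push_cast at h2
  exact le_of_mul_le_mul_left h2 (by positivity)

omit hΨ in
include hy in
theorem coeff_nonneg : 0 ≤ C := by
  have h : 0 ≤ C * (n + 1 : ℝ) := le_trans (by positivity) hy
  have h2 : (0 : ℝ) < n + 1 := by positivity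
  exact nonneg_of_mul_nonneg_left h h2

include hy

theorem norm_sq_bOp_upState_le : ‖bOp u y 0 (upState hu Ψ)‖ ^ 2 ≤
    C * (proj hu).excitation Ψ := by
  rw [← norm_sq_upState]
  exact norm_sq_bOp_le hu hy (antisymOn_upState hu hΨ)

theorem sum_p_bOp_upState_le : ∑ l ∈ Finset.univ.erase 0,
    ‖(proj hu).p l (bOp u y 0 (upState hu Ψ))‖ ^ 2 ≤
      (n + 1 : ℝ) * (C * (proj hu).excitation Ψ) :=
  (sum_norm_sq_p_le hu _).trans
    (mul_le_mul_of_nonneg_left (norm_sq_bOp_upState_le hu hy hΨ) (by positivity))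

theorem sum_q_bOp_downState_le : ∑ l ∈ Finset.univ.erase 0,
    ‖(proj hu).q l (bOp u y 0 (downState hu 1 Ψ))‖ ^ 2 ≤
      (n + 1 : ℝ) * (C * (proj hu).excitation Ψ) := by
  refine (sum_norm_sq_q_bOp_le hu hy (antisymOn_downState hu hΨ 1)).trans ?_
  have h2 := (proj hu).sum_norm_sq_q_shiftOp_le n.succ_pos Ψ
  push_cast at h2
  rw [← downState] at h2
  have := mul_le_mul_of_nonneg_left h2 (coeff_nonneg hy)
  linarith

theorem sum_q_bOp_le : ∑ l ∈ Finset.univ.erase 0, ‖(proj hu).q l (bOp u y 0 Ψ)‖ ^ 2 ≤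
    (n + 1 : ℝ) * (C * (proj hu).excitation Ψ) := by
  refine (sum_norm_sq_q_bOp_le hu hy hΨ).trans ?_
  have h2 := (proj hu).sum_norm_sq_q_le n.succ_pos Ψ
  push_cast at h2
  have := mul_le_mul_of_nonneg_left h2 (coeff_nonneg hy)
  linarith

include hγ hc

omit hy in
theorem sum_pairOp_p_q_le {F : L2 (Config (n + 1))} (hF : AntisymOn univ F)
    (hq : ‖(proj hu).q 0 F‖ ^ 2 ≤ (proj hu).excitation Ψ) :
    ∑ l ∈ Finset.univ.erase 0, ‖pairOp γ l ((proj hu).p 0 ((proj hu).q l F))‖ ^ 2 ≤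
      c * (proj hu).excitation Ψ / (n + 1) := by
  refine (hγ.sum_norm_sq_p_q_le hu hF).trans ?_
  rw [mul_div_right_comm]
  exact mul_le_mul_of_nonneg_left hq (by positivity)

omit hy in
theorem sum_pairOp_q_p_le {F : L2 (Config (n + 1))} (hF : AntisymOn univ F)
    (hq : ‖(proj hu).q 0 F‖ ^ 2 ≤ (proj hu).excitation Ψ) :
    ∑ l ∈ Finset.univ.erase 0, ‖pairOp γ l ((proj hu).q 0 ((proj hu).p l F))‖ ^ 2 ≤
      c * (proj hu).excitation Ψ / (n + 1) := by
  refine (hγ.sum_norm_sq_q_p_le hu hF).trans ?_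
  rw [mul_div_right_comm]
  exact mul_le_mul_of_nonneg_left hq (by positivity)

theorem sum_pairOp_p_bOp_le : ∑ l ∈ Finset.univ.erase 0,
    ‖pairOp γ l ((proj hu).p l (bOp u y 0 (upState hu Ψ)))‖ ^ 2 ≤
      c * (C * (proj hu).excitation Ψ) / (n + 1) := by
  have h : AntisymOn {l | l ≠ 0} (bOp u y 0 (upState hu Ψ)) :=
    ((antisymOn_upState hu hΨ).mono (subset_univ _)).bOp (by simp) u y
  refine (hγ.sum_norm_sq_p_le hu h).trans ?_
  rw [mul_div_right_comm]
  exact mul_le_mul_of_nonneg_left (norm_sq_bOp_upState_le hu hy hΨ) (by positivity)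

/-- Only the right factor contains an excitation: the weight goes to the left and its inverse to the
right, where q_l compensates it. The left sum counts the particles trivially and is of order N; the
factor N is regained on the right from the trace inequality and the bound c/N. -/
theorem sum_inner_p_bOp_p_q_le : ∑ l ∈ Finset.univ.erase 0,
    ‖⟪(proj hu).p l (bOp u y 0 Ψ), pairOp γ l ((proj hu).p 0 ((proj hu).q l Ψ))⟫_ℂ‖ ≤
      (C + c) / 2 * (proj hu).excitation Ψ := by
  have key := sum_norm_inner_le (Finset.univ.erase 0)
    (fun l => (proj hu).p l (bOp u y 0 (upState hu Ψ)))
    (fun l => pairOp γ l ((proj hu).p 0 ((proj hu).q l (downState hu 1 Ψ)))) zero_le_one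
    (by positivity) (sum_p_bOp_upState_le hu hy hΨ)
    (sum_pairOp_p_q_le hu hγ hc hΨ (antisymOn_downState hu hΨ 1) (norm_sq_q_downState_le hu hΨ))
  rw [one_mul] at key
  refine le_trans (le_of_eq ?_) (key.trans (le_of_eq (by ring)))
  refine Finset.sum_congr rfl fun l hl => ?_
  rw [inner_pairOp_up hu hγ.mult, cardOp_p_bOp hu y (Finset.ne_of_mem_erase hl),
    ← CommProj.p_cardOp, ← CommProj.q_cardOp, CommProj.p_q_cardOp_erase, upState, downState]

/-- Here the excitation is on the left, so the inverse weight goes there. -/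
theorem sum_inner_q_bOp_p_p_le : ∑ l ∈ Finset.univ.erase 0,
    ‖⟪(proj hu).q l (bOp u y 0 Ψ), pairOp γ l ((proj hu).p l ((proj hu).p 0 Ψ))⟫_ℂ‖ ≤
      (C + c) / 2 * (proj hu).excitation Ψ := by
  have hp : AntisymOn {l | l ≠ 0} ((proj hu).p 0 (upState hu Ψ)) :=
    ((antisymOn_upState hu hΨ).mono (subset_univ _)).bOp (by simp) u u
  have h2 : ∑ l ∈ Finset.univ.erase 0,
      ‖pairOp γ l ((proj hu).p l ((proj hu).p 0 (upState hu Ψ)))‖ ^ 2 ≤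
      c * (proj hu).excitation Ψ / (n + 1) := by
    refine (hγ.sum_norm_sq_p_le hu hp).trans ?_
    rw [mul_div_right_comm, ← norm_sq_upState]
    exact mul_le_mul_of_nonneg_left ((proj hu).norm_p_le _ _) (by positivity)
  have key := sum_norm_inner_le (Finset.univ.erase 0)
    (fun l => (proj hu).q l (bOp u y 0 (downState hu 1 Ψ)))
    (fun l => pairOp γ l ((proj hu).p l ((proj hu).p 0 (upState hu Ψ)))) zero_le_one
    (by positivity) (sum_q_bOp_downState_le hu hy hΨ) h2
  rw [one_mul] at key
  refine le_trans (le_of_eq ?_) (key.trans (le_of_eq (by ring)))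
  refine Finset.sum_congr rfl fun l hl => ?_
  rw [inner_pairOp_down hu hγ.mult, cardOp_q_bOp hu y (Finset.ne_of_mem_erase hl),
    ← CommProj.p_cardOp, ← CommProj.p_cardOp, p_comm, CommProj.p_p_cardOp_erase, p_comm,
    upState, downState]

/-- Both factors contain an excitation, so both are small without any reweighting. -/
theorem sum_inner_q_bOp_p_q_le : ∑ l ∈ Finset.univ.erase 0,
    ‖⟪(proj hu).q l (bOp u y 0 Ψ), pairOp γ l ((proj hu).p 0 ((proj hu).q l Ψ))⟫_ℂ‖ ≤
      (C + c) / 2 * (proj hu).excitation Ψ := by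
  have key := sum_norm_inner_le (Finset.univ.erase 0)
    (fun l => (proj hu).q l (bOp u y 0 Ψ))
    (fun l => pairOp γ l ((proj hu).p 0 ((proj hu).q l Ψ))) zero_le_one
    (by positivity) (sum_q_bOp_le hu hy hΨ)
    (sum_pairOp_p_q_le hu hγ hc hΨ hΨ (norm_sq_q_le hu hΨ))
  rw [one_mul] at key
  exact key.trans (le_of_eq (by ring))

theorem sum_inner_p_bOp_q_p_le : ∑ l ∈ Finset.univ.erase 0,
    ‖⟪(proj hu).p l (bOp u y 0 Ψ), pairOp γ l ((proj hu).q 0 ((proj hu).p l Ψ))⟫_ℂ‖ ≤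
      (C + c) / 2 * (proj hu).excitation Ψ := by
  have key := sum_norm_inner_le (Finset.univ.erase 0)
    (fun l => (proj hu).p l (bOp u y 0 (upState hu Ψ)))
    (fun l => pairOp γ l ((proj hu).q 0 ((proj hu).p l (downState hu 1 Ψ)))) zero_le_one
    (by positivity) (sum_p_bOp_upState_le hu hy hΨ)
    (sum_pairOp_q_p_le hu hγ hc hΨ (antisymOn_downState hu hΨ 1) (norm_sq_q_downState_le hu hΨ))
  rw [one_mul] at key
  refine le_trans (le_of_eq ?_) (key.trans (le_of_eq (by ring)))
  refine Finset.sum_congr rfl fun l hl => ?_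
  rw [inner_pairOp_up hu hγ.mult, cardOp_p_bOp hu y (Finset.ne_of_mem_erase hl),
    ← CommProj.q_cardOp, ← CommProj.p_cardOp, CommProj.q_p_cardOp_erase, upState, downState]

/-- The potential is moved to the left factor, where p_l allows the trace inequality. The two
excitations on the right carry the inverse weight shifted by two, and their sum over l is of order N
times the excitation. -/
theorem sum_inner_p_bOp_q_q_le : ∑ l ∈ Finset.univ.erase 0,
    ‖⟪(proj hu).p l (bOp u y 0 Ψ), pairOp γ l ((proj hu).q 0 ((proj hu).q l Ψ))⟫_ℂ‖ ≤
      (1 + c * C) / 2 * (proj hu).excitation Ψ := by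
  have h1 := (proj hu).sum_norm_sq_q_q_shiftOp_le n.succ_pos 0 Ψ
  push_cast at h1
  rw [← downState] at h1
  have key := sum_norm_inner_le (Finset.univ.erase 0)
    (fun l => (proj hu).q 0 ((proj hu).q l (downState hu 2 Ψ)))
    (fun l => pairOp γ l ((proj hu).p l (bOp u y 0 (upState hu Ψ)))) zero_le_one
    (by positivity) h1 (sum_pairOp_p_bOp_le hu hy hγ hc hΨ)
  rw [one_mul] at key
  refine le_trans (le_of_eq ?_) (key.trans (le_of_eq (by ring)))
  refine Finset.sum_congr rfl fun l hl => ?_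
  rw [inner_pairOp_up hu hγ.mult, cardOp_p_bOp hu y (Finset.ne_of_mem_erase hl),
    ← CommProj.q_cardOp, ← CommProj.q_cardOp,
    CommProj.q_q_cardOp_erase _ (Finset.ne_of_mem_erase hl).symm, ← upState, ← downState,
    pairOp, ← inner_mulOp_left (hγ.mult.pair l), norm_inner_symm]

theorem sum_inner_q_bOp_q_p_le : ∑ l ∈ Finset.univ.erase 0,
    ‖⟪(proj hu).q l (bOp u y 0 Ψ), pairOp γ l ((proj hu).q 0 ((proj hu).p l Ψ))⟫_ℂ‖ ≤
      (C + c) / 2 * (proj hu).excitation Ψ := by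
  have key := sum_norm_inner_le (Finset.univ.erase 0)
    (fun l => (proj hu).q l (bOp u y 0 Ψ))
    (fun l => pairOp γ l ((proj hu).q 0 ((proj hu).p l Ψ))) zero_le_one
    (by positivity) (sum_q_bOp_le hu hy hΨ)
    (sum_pairOp_q_p_le hu hγ hc hΨ hΨ (norm_sq_q_le hu hΨ))
  rw [one_mul] at key
  exact key.trans (le_of_eq (by ring))

omit hy hγ hc hΨ

/-- The interaction energy of a pair of excited particles, for the potential `γ²`, in units of
`1 / N`. -/
def excitedPair (γ : Plane → ℝ) (Ψ : L2 (Config (n + 1))) : ℝ :=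
  (n + 1) * ∑ l ∈ Finset.univ.erase 0, ‖pairOp γ l ((proj hu).q 0 ((proj hu).q l Ψ))‖ ^ 2

include hy hΨ

/-- No p_l is left to average the potential, so the interaction of the two excited particles is not
estimated but kept, with the factor t² that the repulsion must dominate. -/
theorem sum_inner_q_bOp_q_q_le {t : ℝ} (ht : 0 ≤ t) : t * ∑ l ∈ Finset.univ.erase 0,
    ‖⟪(proj hu).q l (bOp u y 0 Ψ), pairOp γ l ((proj hu).q 0 ((proj hu).q l Ψ))⟫_ℂ‖ ≤
      (C * (proj hu).excitation Ψ + t ^ 2 * excitedPair hu γ Ψ) / 2 := by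
  refine sum_norm_inner_le (Finset.univ.erase 0)
    (fun l => (proj hu).q l (bOp u y 0 Ψ))
    (fun l => pairOp γ l ((proj hu).q 0 ((proj hu).q l Ψ))) ht
    (by positivity) (sum_q_bOp_le hu hy hΨ) (le_of_eq ?_)
  rw [excitedPair]
  field_simp

omit hy hΨ in
theorem inner_pairOp_split (l : Fin (n + 1)) (F G : L2 (Config (n + 1))) :
    ⟪F, pairOp γ l G⟫_ℂ =
      ⟪(proj hu).p l F, pairOp γ l ((proj hu).p l G)⟫_ℂ +
      ⟪(proj hu).p l F, pairOp γ l ((proj hu).q l G)⟫_ℂ +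
      ⟪(proj hu).q l F, pairOp γ l ((proj hu).p l G)⟫_ℂ +
      ⟪(proj hu).q l F, pairOp γ l ((proj hu).q l G)⟫_ℂ := by
  nth_rewrite 1 [← (proj hu).p_add_q l F, ← (proj hu).p_add_q l G]
  rw [map_add, inner_add_left, inner_add_right, inner_add_right]
  ring

include hγ hc

theorem norm_sum_inner_bOp_q_le {t : ℝ} (ht : 0 ≤ t) :
    t * ‖∑ l ∈ Finset.univ.erase 0, ⟪bOp u y 0 Ψ, pairOp γ l ((proj hu).q 0 Ψ)⟫_ℂ‖ ≤
      t * (C + c + (1 + c * C) / 2) * (proj hu).excitation Ψ +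
        (C * (proj hu).excitation Ψ + t ^ 2 * excitedPair hu γ Ψ) / 2 := by
  have h1 := sum_inner_p_bOp_q_p_le hu hy hγ hc hΨ
  have h2 := sum_inner_p_bOp_q_q_le hu hy hγ hc hΨ
  have h3 := sum_inner_q_bOp_q_p_le hu hy hγ hc hΨ
  have h4 := sum_inner_q_bOp_q_q_le hu (γ := γ) hy hΨ ht
  have h5 : ‖∑ l ∈ Finset.univ.erase 0, ⟪bOp u y 0 Ψ, pairOp γ l ((proj hu).q 0 Ψ)⟫_ℂ‖ ≤
      ∑ l ∈ Finset.univ.erase 0,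
        ‖⟪(proj hu).p l (bOp u y 0 Ψ), pairOp γ l ((proj hu).q 0 ((proj hu).p l Ψ))⟫_ℂ‖ +
      ∑ l ∈ Finset.univ.erase 0,
        ‖⟪(proj hu).p l (bOp u y 0 Ψ), pairOp γ l ((proj hu).q 0 ((proj hu).q l Ψ))⟫_ℂ‖ +
      ∑ l ∈ Finset.univ.erase 0,
        ‖⟪(proj hu).q l (bOp u y 0 Ψ), pairOp γ l ((proj hu).q 0 ((proj hu).p l Ψ))⟫_ℂ‖ +
      ∑ l ∈ Finset.univ.erase 0,
        ‖⟪(proj hu).q l (bOp u y 0 Ψ), pairOp γ l ((proj hu).q 0 ((proj hu).q l Ψ))⟫_ℂ‖ := by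
    simp only [← Finset.sum_add_distrib]
    refine norm_sum_le_of_le _ fun l _ => ?_
    rw [inner_pairOp_split hu, ← q_p_comm, q_q_comm]
    exact (norm_add_le _ _).trans (add_le_add_left ((norm_add_le _ _).trans
      (add_le_add_left (norm_add_le _ _) _)) _)
  have h6 := mul_le_mul_of_nonneg_left h5 ht
  have h7 := mul_le_mul_of_nonneg_left (add_le_add (add_le_add h1 h2) h3) ht
  linarith

/-- After inserting p_l + q_l on both sides, the part with p_l twice differs from the mean field by
`fluct`, and the other three parts contain an excitation. The bound on `fluct` is one on a quadratic
form; it is polarized through the families y ± u, whose total size is given by the parallelogram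
law. Polarizing with ± only yields the real part. -/
theorem abs_re_sum_inner_bOp_p_sub_le :
    |(∑ l ∈ Finset.univ.erase 0, ⟪bOp u y 0 Ψ, pairOp γ l ((proj hu).p 0 Ψ)⟫_ℂ).re -
      (⟪bOp u y 0 Ψ, meanOp (convDens u γ) ((proj hu).p 0 Ψ)⟫_ℂ).re| ≤
      ((c + 1) / 2 * (C + 1) + 3 / 2 * (C + c)) * (proj hu).excitation Ψ := by
  have h1 := sum_inner_p_bOp_p_q_le hu hy hγ hc hΨ
  have h2 := sum_inner_q_bOp_p_p_le hu hy hγ hc hΨ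
  have h3 := sum_inner_q_bOp_p_q_le hu hy hγ hc hΨ
  have hΨ' : AntisymOn {l | l ≠ 0} Ψ := hΨ.mono (subset_univ _)
  have hsplit : (∑ l ∈ Finset.univ.erase 0, ⟪bOp u y 0 Ψ, pairOp γ l ((proj hu).p 0 Ψ)⟫_ℂ) -
      ⟪bOp u y 0 Ψ, meanOp (convDens u γ) ((proj hu).p 0 Ψ)⟫_ℂ =
      -⟪bOp u y 0 Ψ, fluct hu γ ((proj hu).p 0 Ψ)⟫_ℂ +
      (∑ l ∈ Finset.univ.erase 0,
        ⟪(proj hu).p l (bOp u y 0 Ψ), pairOp γ l ((proj hu).p 0 ((proj hu).q l Ψ))⟫_ℂ +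
      ∑ l ∈ Finset.univ.erase 0,
        ⟪(proj hu).q l (bOp u y 0 Ψ), pairOp γ l ((proj hu).p l ((proj hu).p 0 Ψ))⟫_ℂ +
      ∑ l ∈ Finset.univ.erase 0,
        ⟪(proj hu).q l (bOp u y 0 Ψ), pairOp γ l ((proj hu).p 0 ((proj hu).q l Ψ))⟫_ℂ) := by
    rw [inner_fluct]
    simp only [inner_pairOp_split hu _ (bOp u y 0 Ψ), Finset.sum_add_distrib, q_p_comm]
    ring
  have hform : ∀ z : Fin (n + 1) → L2 Plane, ∑ j, ‖z j‖ ^ 2 ≤ 2 * (C + 1) * (n + 1) →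
      ‖⟪bOp u z 0 Ψ, fluct hu γ (bOp u z 0 Ψ)⟫_ℂ‖ ≤
        (c + 1) / 2 * (2 * (C + 1) * (proj hu).excitation Ψ) := by
    intro z hz
    refine (hγ.norm_inner_fluct_le hu (hΨ'.bOp (by simp) u z)).trans ?_
    rw [← bOp_cardOp hu z (Finset.notMem_erase _ _), bOp_cardOp_erase, ← upState]
    exact mul_le_mul_of_nonneg_left (norm_sq_bOp_upState_le hu hz hΨ) (by linarith)
  have hpar : ∑ j, ‖y j + u j‖ ^ 2 + ∑ j, ‖y j - u j‖ ^ 2 ≤ 2 * (C + 1) * (n + 1) := by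
    rw [← Finset.sum_add_distrib]
    have : ∀ j, ‖y j + u j‖ ^ 2 + ‖y j - u j‖ ^ 2 = 2 * ‖y j‖ ^ 2 + 2 := fun j => by
      have := parallelogram_law_with_norm ℂ (y j) (u j)
      rw [hu.1 j] at this
      nlinarith
    simp only [this, Finset.sum_add_distrib, ← Finset.mul_sum]
    simp
    linarith
  have hplus := hform (fun j => y j + u j)
    (le_trans (le_add_of_nonneg_right (by positivity)) hpar)
  have hminus := hform (fun j => y j - u j)
    (le_trans (le_add_of_nonneg_left (by positivity)) hpar)
  have eplus : bOp u (fun j => y j + u j) 0 Ψ = bOp u y 0 Ψ + (proj hu).p 0 Ψ := bOp_add u y u 0 Ψ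
  have eminus : bOp u (fun j => y j - u j) 0 Ψ = bOp u y 0 Ψ - (proj hu).p 0 Ψ := by
    rw [eq_sub_iff_add_eq, proj_p, ← bOp_add]
    simp
  rw [eplus] at hplus
  rw [eminus] at hminus
  have hpol : 4 * (⟪bOp u y 0 Ψ, fluct hu γ ((proj hu).p 0 Ψ)⟫_ℂ).re =
      (⟪bOp u y 0 Ψ + (proj hu).p 0 Ψ, fluct hu γ (bOp u y 0 Ψ + (proj hu).p 0 Ψ)⟫_ℂ).re -
      (⟪bOp u y 0 Ψ - (proj hu).p 0 Ψ, fluct hu γ (bOp u y 0 Ψ - (proj hu).p 0 Ψ)⟫_ℂ).re := by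
    have hsym : (⟪(proj hu).p 0 Ψ, fluct hu γ (bOp u y 0 Ψ)⟫_ℂ).re =
        (⟪bOp u y 0 Ψ, fluct hu γ ((proj hu).p 0 Ψ)⟫_ℂ).re := by
      rw [← inner_fluct_left hu hγ.mult, ← inner_conj_symm, Complex.conj_re]
    simp only [map_add, map_sub, inner_add_left, inner_add_right, inner_sub_left, inner_sub_right,
      Complex.add_re, Complex.sub_re, hsym]
    ring
  have hfl : |(⟪bOp u y 0 Ψ, fluct hu γ ((proj hu).p 0 Ψ)⟫_ℂ).re| ≤
      (c + 1) / 2 * (C + 1) * (proj hu).excitation Ψ := by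
    have h8 := abs_le.1 ((Complex.abs_re_le_norm _).trans hplus)
    have h9 := abs_le.1 ((Complex.abs_re_le_norm _).trans hminus)
    rw [abs_le]
    constructor <;> nlinarith
  rw [← Complex.sub_re, hsplit, Complex.add_re, Complex.neg_re]
  refine (abs_add_le _ _).trans ?_
  rw [abs_neg, add_mul]
  refine add_le_add hfl ((Complex.abs_re_le_norm _).trans ?_)
  refine (norm_add₃_le).trans ?_
  have n1 := (norm_sum_le (Finset.univ.erase 0) fun l => ⟪(proj hu).p l (bOp u y 0 Ψ),
    pairOp γ l ((proj hu).p 0 ((proj hu).q l Ψ))⟫_ℂ).trans h1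
  have n2 := (norm_sum_le (Finset.univ.erase 0) fun l => ⟪(proj hu).q l (bOp u y 0 Ψ),
    pairOp γ l ((proj hu).p l ((proj hu).p 0 Ψ))⟫_ℂ).trans h2
  have n3 := (norm_sum_le (Finset.univ.erase 0) fun l => ⟪(proj hu).q l (bOp u y 0 Ψ),
    pairOp γ l ((proj hu).p 0 ((proj hu).q l Ψ))⟫_ℂ).trans h3
  linarith

end PairTerms

/-! ### Momenta and one-body energies -/

section Momentum

variable {V : Type*} [NormedAddCommGroup V] [NormedSpace ℝ V] [FiniteDimensional ℝ V]
  [MeasureSpace V] [BorelSpace V] [(volume : Measure V).IsAddHaarMeasure]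

/-- `F'` is the momentum `-i ∂_v F`. -/
def HasMom (v : V) (F F' : L2 V) : Prop := HasSD v F (Complex.I • F')

theorem HasSD.hasMom {v : V} {F F' : L2 V} (h : HasSD v F F') : HasMom v F (-Complex.I • F') := by
  unfold HasMom
  rw [smul_smul]
  simpa using h

theorem HasMom.unique {v : V} {F F₁ F₂ : L2 V} (h₁ : HasMom v F F₁) (h₂ : HasMom v F F₂) :
    F₁ = F₂ := by
  have := HasSD.unique h₁ h₂
  exact smul_right_injective _ Complex.I_ne_zero this

theorem HasMom.add {v : V} {F F' G G' : L2 V} (hF : HasMom v F F') (hG : HasMom v G G') :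
    HasMom v (F + G) (F' + G') := by
  unfold HasMom
  rw [smul_add]
  exact HasSD.add hF hG

theorem HasMom.sub {v : V} {F F' G G' : L2 V} (hF : HasMom v F F') (hG : HasMom v G G') :
    HasMom v (F - G) (F' - G') := by
  unfold HasMom
  rw [smul_sub]
  exact HasSD.sub hF hG

theorem HasMom.const_smul {v : V} {F F' : L2 V} (c : ℂ) (hF : HasMom v F F') :
    HasMom v (c • F) (c • F') := by
  unfold HasMom
  rw [smul_comm]
  exact HasSD.const_smul c hF

theorem HasMom.inner_eq {v : V} {F F' G G' : L2 V} (hF : HasMom v F F') (hG : HasMom v G G') :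
    ⟪F', G⟫_ℂ = ⟪F, G'⟫_ℂ := by
  have h := HasSD.inner_eq hF hG
  rw [inner_smul_left, inner_smul_right, Complex.conj_I, neg_mul, neg_inj] at h
  exact mul_left_cancel₀ Complex.I_ne_zero h

theorem HasMom.mulOp {A : V → ℝ} (hA : IsMult A) {L : ℝ≥0} (hL : LipschitzWith L A) {v : V}
    {F F' : L2 V} (h : HasMom v F F') :
    HasMom v (mulOp A F) (-Complex.I • MagneticFermions.mulOp (fun x => lineDeriv ℝ A x v) F +
      MagneticFermions.mulOp A F') := by
  have := HasSD.mulOp hA hL h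
  unfold HasMom
  rw [smul_add, smul_smul, mul_neg, Complex.I_mul_I, neg_neg, one_smul, ← map_smul]
  exact this

/-- Integration by parts against a vector field without divergence. -/
theorem sum_inner_mom_mulOp {ι : Type*} [Fintype ι] {v : ι → V} {A : ι → V → ℝ}
    (hA : ∀ c, IsMult (A c)) (hL : ∀ c, ∃ L, LipschitzWith L (A c))
    (hdiv : ∀ᵐ x, ∑ c, lineDeriv ℝ (A c) x (v c) = 0) {F G : L2 V} {F' G' : ι → L2 V}
    (hF : ∀ c, HasMom (v c) F (F' c)) (hG : ∀ c, HasMom (v c) G (G' c)) :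
    ∑ c, ⟪F' c, MagneticFermions.mulOp (A c) G⟫_ℂ =
      ∑ c, ⟪MagneticFermions.mulOp (A c) F, G' c⟫_ℂ := by
  choose L hL using hL
  have h1 : ∀ c, ⟪F' c, MagneticFermions.mulOp (A c) G⟫_ℂ =
      ⟪F, -Complex.I • MagneticFermions.mulOp (fun x => lineDeriv ℝ (A c) x (v c)) G⟫_ℂ +
        ⟪MagneticFermions.mulOp (A c) F, G' c⟫_ℂ := by
    intro c
    rw [(hF c).inner_eq ((hG c).mulOp (hA c) (hL c)), inner_add_right, inner_mulOp_left (hA c)]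
  -- The terms in which the derivative falls on the field add up to its divergence.
  have h2 : ∑ c, MagneticFermions.mulOp (fun x => lineDeriv ℝ (A c) x (v c)) G = 0 := by
    rw [← mulOp_sum _ fun c _ => isMult_lineDeriv (hL c) (v c)]
    have hm : IsMult fun x => ∑ c, lineDeriv ℝ (A c) x (v c) :=
      IsMult.sum _ fun c _ => isMult_lineDeriv (hL c) (v c)
    rw [Lp.ext_iff]
    filter_upwards [mulOp_coe hm G, hdiv, Lp.coeFn_zero ℂ 2 (volume : Measure V)] with x h3 h4 h5
    rw [h3, h4, h5]
    simp
  simp only [h1, Finset.sum_add_distrib]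
  rw [← inner_sum, ← Finset.smul_sum, h2, smul_zero, inner_zero_right, zero_add]

/-- The magnetic kinetic energy as a quadratic form. -/
theorem sum_norm_sq_mom {ι : Type*} [Fintype ι] {v : ι → V} {A : ι → V → ℝ}
    (hA : ∀ c, IsMult (A c)) {F : L2 V} {F₁ F₂ : ι → L2 V}
    (h₁ : ∀ c, HasMom (v c) F (F₁ c)) (h₂ : ∀ c, HasMom (v c) (F₁ c) (F₂ c)) (b : ℝ) :
    ∑ c, ‖F₁ c + (b : ℂ) • MagneticFermions.mulOp (A c) F‖ ^ 2 =
      (⟪F, ∑ c, (F₂ c + (2 * b : ℂ) • MagneticFermions.mulOp (A c) (F₁ c) +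
        (b ^ 2 : ℂ) • MagneticFermions.mulOp (A c) (MagneticFermions.mulOp (A c) F))⟫_ℂ).re := by
  rw [inner_sum, Complex.re_sum]
  refine Finset.sum_congr rfl fun c _ => ?_
  have e1 : ‖F₁ c‖ ^ 2 = (⟪F, F₂ c⟫_ℂ).re := by
    rw [← (h₁ c).inner_eq (h₂ c), inner_self_eq_norm_sq_to_K]
    norm_cast
  have e2 : ‖MagneticFermions.mulOp (A c) F‖ ^ 2 =
      (⟪F, MagneticFermions.mulOp (A c) (MagneticFermions.mulOp (A c) F)⟫_ℂ).re := by
    rw [← inner_mulOp_left (hA c), inner_self_eq_norm_sq_to_K]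
    norm_cast
  -- Only the real part is claimed, so the momentum may stand on either side of the field and no
  -- condition on the divergence is needed.
  have e3 : (⟪F₁ c, MagneticFermions.mulOp (A c) F⟫_ℂ).re =
      (⟪F, MagneticFermions.mulOp (A c) (F₁ c)⟫_ℂ).re := by
    rw [← inner_conj_symm, Complex.conj_re, inner_mulOp_left (hA c)]
  rw [norm_add_sq (𝕜 := ℂ), norm_smul, mul_pow, e1, e2, inner_smul_right, inner_add_right,
    inner_add_right, inner_smul_right, inner_smul_right]
  simp only [Complex.add_re, RCLike.re_to_complex, Complex.norm_real, Real.norm_eq_abs, sq_abs]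
  rw [Complex.re_ofReal_mul, e3]
  have e4 : (2 * b : ℂ) = ((2 * b : ℝ) : ℂ) := by push_cast; rfl
  have e5 : (b ^ 2 : ℂ) = ((b ^ 2 : ℝ) : ℂ) := by push_cast; rfl
  rw [e4, e5, Complex.re_ofReal_mul, Complex.re_ofReal_mul]
  ring

end Momentum

section OneBody

variable {n : ℕ} {u : Fin (n + 1) → L2 Plane} (hu : Orthonormal ℂ u)

theorem HasMom.bOp {ι : Type*} [Fintype ι] {c : Fin 2} {w b b' : ι → L2 Plane}
    (h : ∀ j, HasMom (dir c) (b j) (b' j)) (l : Fin (n + 1)) (F : L2 (Config (n + 1))) :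
    HasMom (dirN l c) (bOp w b l F) (MagneticFermions.bOp w b' l F) := by
  have := HasSD.bOp (u := w) h l F
  unfold HasMom
  rw [← bOp_smul]
  exact this

theorem sum_wt_quarter_univ (C : ℝ) (Ψ : L2 (Config (n + 1))) :
    ∑ S, C * (n + 1 : ℝ) * √(((S.card : ℝ) + 1) / (n + 1)) * (proj hu).wt Ψ S =
      (n + 1 : ℝ) * (C * (proj hu).excitation Ψ) := by
  rw [CommProj.excitation, Finset.mul_sum, Finset.mul_sum]
  refine Finset.sum_congr rfl fun S _ => ?_
  push_cast
  ring

set_option maxHeartbeats 800000 in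
/-- A one-body operator is, in the state `Ψ`, close to its average over the orbitals. -/
theorem abs_re_inner_bOp_sub_le {h : Fin (n + 1) → L2 Plane} {C : ℝ}
    (hh : ∑ j, ‖h j‖ ^ 2 ≤ C * (n + 1)) {Ψ : L2 (Config (n + 1))} (hΨ : AntisymOn univ Ψ) :
    |(n + 1 : ℝ) * (⟪(proj hu).p 0 Ψ, bOp u h 0 Ψ⟫_ℂ).re -
      (∑ j, ⟪u j, h j⟫_ℂ).re * ‖Ψ‖ ^ 2| ≤
      (n + 1 : ℝ) * ((1 + C) / 2 * (proj hu).excitation Ψ) := by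
  have hN : (0 : ℝ) < n + 1 := by positivity
  let M : L2 (Config (n + 1)) →L[ℂ] L2 (Config (n + 1)) :=
    (∑ j, ⟪u j, h j⟫_ℂ) • 1 - ((n + 1 : ℝ) : ℂ) • ((proj hu).p 0 * bOp u h 0)
  have hMi : ∀ F, ⟪F, M F⟫_ℂ = (∑ j, ⟪u j, h j⟫_ℂ) * ((‖F‖ ^ 2 : ℝ) : ℂ) -
      ((n + 1 : ℝ) : ℂ) * ⟪(proj hu).p 0 F, bOp u h 0 F⟫_ℂ := by
    intro F
    have h3 : ⟪F, F⟫_ℂ = ((‖F‖ ^ 2 : ℝ) : ℂ) := by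
      rw [inner_self_eq_norm_sq_to_K]; push_cast; rfl
    simp only [M, sub_apply, smul_apply, inner_sub_right, inner_smul_right,
      mul_apply_eq_comp, one_apply_eq_self, h3, (proj hu).symm]
  have hM : Commute M (∑ m ∈ Finset.univ, (proj hu).q m) := by
    refine commute_sum_q hu fun m _ => ?_
    refine ((Commute.one_left _).smul_left _).sub_left (Commute.smul_left ?_ _)
    by_cases h0 : m = 0
    · subst h0
      refine ContinuousLinearMap.ext fun F => ?_
      simp only [mul_apply_eq_comp]
      rw [bOp_p_zero hu]
      exact (congrArg (fun A : L2 (Config (n + 1)) →L[ℂ] _ => A (bOp u h 0 F))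
        ((proj hu).idem 0)).symm
    · exact Commute.mul_left ((proj hu).comm 0 m) (commute_bOp_p hu h h0)
  have key := (proj hu).norm_inner_le_of_sectors hM
    (fun k => (1 + C) / 2 * (n + 1 : ℝ) * √(((k : ℝ) + 1) / (n + 1))) Ψ fun k => ?_
  · simp only [Finset.inter_univ] at key
    rw [sum_wt_quarter_univ hu, hMi] at key
    have := (Complex.abs_re_le_norm _).trans key
    rw [Complex.sub_re, Complex.re_ofReal_mul, Complex.re_mul_ofReal, abs_sub_comm] at this
    exact this
  · set G := (proj hu).cardOp Finset.univ (Pi.single k 1) Ψ with hG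
    have hGa : AntisymOn univ G := hΨ.cardOp hu _ (by simp) _
    -- In a state with exactly k excitations, by antisymmetry, each particle is excited with
    -- probability k/(n + 1).
    have hq : (n + 1 : ℝ) * ‖(proj hu).q 0 G‖ ^ 2 = k * ‖G‖ ^ 2 := by
      rw [← sum_norm_sq_q_eq hu hGa, hG, sector_q]
    have hp := (proj hu).norm_p_add_norm_q 0 G
    -- The phase ζ turns the form into its modulus, so a bound on one real part suffices.
    obtain ⟨ζ, hζ, hz⟩ := RCLike.exists_norm_eq_mul_self (K := ℂ) ⟪G, M G⟫_ℂ
    set w := √(((k : ℝ) + 1) / (n + 1)) with hw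
    have hw0 : 0 < w := by positivity
    have hw2 : (n + 1 : ℝ) * w ^ 2 = k + 1 := by
      rw [hw, Real.sq_sqrt (by positivity)]; field_simp
    have hre : ‖⟪G, M G⟫_ℂ‖ = (ζ * ∑ j, ⟪u j, h j⟫_ℂ).re * ‖G‖ ^ 2 -
        (n + 1) * (ζ * ⟪(proj hu).p 0 G, bOp u h 0 G⟫_ℂ).re := by
      have e : ((‖⟪G, M G⟫_ℂ‖ : ℝ) : ℂ) = (ζ * ∑ j, ⟪u j, h j⟫_ℂ) * ((‖G‖ ^ 2 : ℝ) : ℂ) -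
        ((n + 1 : ℝ) : ℂ) * (ζ * ⟪(proj hu).p 0 G, bOp u h 0 G⟫_ℂ) := by
        have := hz
        rw [hMi] at this ⊢
        refine Eq.trans this ?_
        ring
      have := congrArg Complex.re e
      rwa [Complex.ofReal_re, Complex.sub_re, Complex.re_mul_ofReal, Complex.re_ofReal_mul] at this
    have hlin : bOp u (fun j => (((w⁻¹ : ℝ)) : ℂ) • u j + (-ζ) • h j) 0 G =
        ((w⁻¹ : ℝ) : ℂ) • (proj hu).p 0 G + (-ζ) • bOp u h 0 G := by
      rw [bOp_add, bOp_smul, bOp_smul, proj_p]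
    have hexp : ∀ {H : Type} [NormedAddCommGroup H] [InnerProductSpace ℂ H] (x z : H),
        ‖((w⁻¹ : ℝ) : ℂ) • x + (-ζ) • z‖ ^ 2 =
          w⁻¹ ^ 2 * ‖x‖ ^ 2 - 2 * w⁻¹ * (ζ * ⟪x, z⟫_ℂ).re + ‖z‖ ^ 2 := by
      intro H _ _ x z
      rw [norm_add_sq (𝕜 := ℂ), norm_smul, norm_smul, norm_neg, hζ, inner_smul_left,
        inner_smul_right, Complex.conj_ofReal, RCLike.re_to_complex, Complex.re_ofReal_mul,
        neg_mul, Complex.neg_re, Complex.norm_real, Real.norm_eq_abs, mul_pow, sq_abs]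
      ring
    -- The trace inequality for the family w⁻¹u_j - ζh_j bounds the cross term with the wanted sign.
    -- Since ‖p₀G‖² = (1 - k/(n + 1))‖G‖², the leading w⁻²‖G‖² cancels and w⁻²k/(n + 1) + C remains;
    -- multiplied by w, both parts are of order w for w = √((k + 1)/(n + 1)).
    have hsum : ∑ j, ‖(((w⁻¹ : ℝ)) : ℂ) • u j + (-ζ) • h j‖ ^ 2 ≤
        (w⁻¹ ^ 2 - 2 * w⁻¹ * ((ζ * ∑ j, ⟪u j, h j⟫_ℂ).re / (n + 1)) + C) * (n + 1) := by
      simp only [hexp, hu.1, Finset.sum_add_distrib, Finset.sum_sub_distrib]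
      rw [← Finset.mul_sum, ← Finset.mul_sum, ← Complex.re_sum, ← Finset.mul_sum]
      simp only [one_pow, Finset.sum_const, Finset.card_univ, Fintype.card_fin, nsmul_eq_mul]
      push_cast
      have : (w⁻¹ ^ 2 - 2 * w⁻¹ * ((ζ * ∑ j, ⟪u j, h j⟫_ℂ).re / (n + 1)) + C) * (n + 1) =
        w⁻¹ ^ 2 * (n + 1) - 2 * w⁻¹ * (ζ * ∑ j, ⟪u j, h j⟫_ℂ).re + C * (n + 1) := by
        field_simp
      rw [this]
      linarith
    have hmain := norm_sq_bOp_le hu hsum hGa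
    rw [hlin, hexp] at hmain
    rw [hre]
    have e3 : (n + 1 : ℝ) * ((w⁻¹ ^ 2 - 2 * w⁻¹ * ((ζ * ∑ j, ⟪u j, h j⟫_ℂ).re / (n + 1)) + C) *
        ‖G‖ ^ 2) = w⁻¹ ^ 2 * ((n + 1) * ‖G‖ ^ 2) -
          2 * w⁻¹ * ((ζ * ∑ j, ⟪u j, h j⟫_ℂ).re * ‖G‖ ^ 2) + C * (n + 1) * ‖G‖ ^ 2 := by
      field_simp
    have h4 := mul_le_mul_of_nonneg_left hmain hN.le
    rw [e3] at h4
    have hp2 : (n + 1 : ℝ) * ‖(proj hu).p 0 G‖ ^ 2 = (n + 1) * ‖G‖ ^ 2 - k * ‖G‖ ^ 2 := by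
      rw [← hq, ← hp]; ring
    have h5 : 2 * w⁻¹ * ((ζ * ∑ j, ⟪u j, h j⟫_ℂ).re * ‖G‖ ^ 2 -
        (n + 1) * (ζ * ⟪(proj hu).p 0 G, bOp u h 0 G⟫_ℂ).re) ≤
        w⁻¹ ^ 2 * (k * ‖G‖ ^ 2) + C * (n + 1) * ‖G‖ ^ 2 := by
      have h6 : (n + 1 : ℝ) * (w⁻¹ ^ 2 * ‖(proj hu).p 0 G‖ ^ 2) =
          w⁻¹ ^ 2 * ((n + 1) * ‖G‖ ^ 2) - w⁻¹ ^ 2 * (k * ‖G‖ ^ 2) := by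
        rw [mul_left_comm, hp2]; ring
      have h7 : 0 ≤ (n + 1 : ℝ) * ‖bOp u h 0 G‖ ^ 2 := by positivity
      rw [mul_add, mul_sub, h6, mul_left_comm (n + 1 : ℝ)] at h4
      rw [mul_sub]
      linarith
    have h8 := mul_le_mul_of_nonneg_left h5 hw0.le
    have e9 : w * (2 * w⁻¹ * ((ζ * ∑ j, ⟪u j, h j⟫_ℂ).re * ‖G‖ ^ 2 -
        (n + 1) * (ζ * ⟪(proj hu).p 0 G, bOp u h 0 G⟫_ℂ).re)) =
        2 * ((ζ * ∑ j, ⟪u j, h j⟫_ℂ).re * ‖G‖ ^ 2 -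
        (n + 1) * (ζ * ⟪(proj hu).p 0 G, bOp u h 0 G⟫_ℂ).re) := by
      field_simp
    have e10 : w * (w⁻¹ ^ 2 * (k * ‖G‖ ^ 2)) ≤ (n + 1) * w * ‖G‖ ^ 2 := by
      have : w * (w⁻¹ ^ 2 * (k * ‖G‖ ^ 2)) = w⁻¹ * k * ‖G‖ ^ 2 := by field_simp
      rw [this]
      refine mul_le_mul_of_nonneg_right ?_ (sq_nonneg _)
      rw [inv_mul_le_iff₀ hw0]
      nlinarith
    rw [e9, mul_add] at h8
    linarith

/-- The weighting argument for the identity operator: q₀ on the right absorbs the inverse weight,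
and the orbital factor carries the weight. -/
theorem norm_inner_bOp_q_le {y : Fin (n + 1) → L2 Plane} {C : ℝ}
    (hy : ∑ j, ‖y j‖ ^ 2 ≤ C * (n + 1)) {Ψ : L2 (Config (n + 1))} (hΨ : AntisymOn univ Ψ) :
    ‖⟪bOp u y 0 Ψ, (proj hu).q 0 Ψ⟫_ℂ‖ ≤ (C + 1) / 2 * (proj hu).excitation Ψ := by
  have h := (proj hu).inner_apply_eq_cardOp (T := Finset.univ.erase 0)
    (M := (1 : L2 (Config (n + 1)) →L[ℂ] L2 (Config (n + 1)))) (Commute.one_left _)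
    (quarter_ne_zero (n := n)) (bOp u y 0 Ψ) ((proj hu).q 0 Ψ)
  simp only [one_apply_eq_self] at h
  rw [← bOp_cardOp hu y (Finset.notMem_erase _ _), bOp_cardOp_erase, ← upState,
    ← CommProj.q_cardOp, CommProj.q_cardOp_erase, ← downState] at h
  rw [h]
  refine (norm_inner_le_norm _ _).trans ?_
  have h1 := norm_sq_bOp_upState_le hu hy hΨ
  have h2 := norm_sq_q_downState_le hu hΨ
  nlinarith [sq_nonneg (‖bOp u y 0 (upState hu Ψ)‖ - ‖(proj hu).q 0 (downState hu 1 Ψ)‖)]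

end OneBody

/-! ### Interaction terms of the kinetic energy -/

theorem re_inner_symm {H : Type*} [NormedAddCommGroup H] [InnerProductSpace ℂ H] (x y : H) :
    (⟪x, y⟫_ℂ).re = (⟪y, x⟫_ℂ).re := by
  rw [← inner_conj_symm, Complex.conj_re]

/-- A lower bound for a kinetic energy, by completing a square. -/
theorem norm_sq_kinetic_ge {H : Type*} [NormedAddCommGroup H] [InnerProductSpace ℂ H]
    (X V Z P Q : H) (b : ℝ) :
    ‖X + (b : ℂ) • V‖ ^ 2 + 3 / 4 * ‖Z‖ ^ 2
      + 2 * b * ((⟪X + (b : ℂ) • V, P⟫_ℂ).re - (⟪X + (b : ℂ) • V, V⟫_ℂ).re)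
      + 2 * b * (⟪X + (b : ℂ) • V, Q⟫_ℂ).re
      + ((⟪X + (b : ℂ) • V, Z⟫_ℂ).re + (⟪Z, X⟫_ℂ).re)
      + b * (⟪Z, P⟫_ℂ).re + b * (⟪Z, Q⟫_ℂ).re ≤
    ‖X + Z + (b : ℂ) • (P + Q)‖ ^ 2 := by
  have hn : ∀ x : H, ‖x‖ ^ 2 = (⟪x, x⟫_ℂ).re := fun x => by
    rw [inner_self_eq_norm_sq_to_K]; norm_cast
  -- The difference of the two sides is exactly this square. The product of Z with V cancels, which
  -- is why Z is paired once with X + bV and once with X alone.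
  have h := sq_nonneg ‖((1 / 2 : ℝ) : ℂ) • Z + (b : ℂ) • (P + Q - V)‖
  rw [hn] at h
  rw [hn, hn, hn]
  simp only [inner_add_left, inner_add_right, inner_sub_left, inner_sub_right, inner_smul_left,
    inner_smul_right, Complex.conj_ofReal, Complex.add_re, Complex.sub_re, Complex.re_ofReal_mul]
    at h ⊢
  rw [re_inner_symm V X, re_inner_symm Z X, re_inner_symm P X, re_inner_symm Q X] at *
  rw [re_inner_symm Z V, re_inner_symm P V, re_inner_symm Q V] at *
  rw [re_inner_symm P Z, re_inner_symm Q Z, re_inner_symm Q P] at *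
  nlinarith

theorem norm_sq_sum_le {H ι : Type*} [NormedAddCommGroup H] (s : Finset ι) (f : ι → H) :
    ‖∑ i ∈ s, f i‖ ^ 2 ≤ s.card * ∑ i ∈ s, ‖f i‖ ^ 2 :=
  (pow_le_pow_left₀ (norm_nonneg _) (norm_sum_le s f) 2).trans sq_sum_le_card_mul_sum_sq

theorem norm_sq_add_le {H : Type*} [NormedAddCommGroup H] (x y : H) :
    ‖x + y‖ ^ 2 ≤ 2 * ‖x‖ ^ 2 + 2 * ‖y‖ ^ 2 := by
  have h := norm_add_le x y
  nlinarith [sq_nonneg (‖x‖ - ‖y‖), norm_nonneg (x + y), norm_nonneg x, norm_nonneg y]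

theorem half_norm_sq_sub_le {H : Type*} [NormedAddCommGroup H] (x y : H) :
    1 / 2 * ‖y‖ ^ 2 - ‖x‖ ^ 2 ≤ ‖x + y‖ ^ 2 := by
  have h := norm_sq_add_le (x + y) (-x)
  rw [add_neg_cancel_comm, norm_neg] at h
  linarith

section Families

variable {ι : Type*} [Fintype ι] {x y : ι → L2 Plane} {A B M : ℝ}

theorem sum_norm_sq_add_le (hx : ∑ j, ‖x j‖ ^ 2 ≤ A * M) (hy : ∑ j, ‖y j‖ ^ 2 ≤ B * M) :
    ∑ j, ‖x j + y j‖ ^ 2 ≤ (2 * A + 2 * B) * M := by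
  refine (Finset.sum_le_sum fun j _ => norm_sq_add_le (x j) (y j)).trans ?_
  rw [Finset.sum_add_distrib, ← Finset.mul_sum, ← Finset.mul_sum]
  linarith

theorem sum_norm_sq_smul_le (r : ℝ) (hx : ∑ j, ‖x j‖ ^ 2 ≤ A * M) :
    ∑ j, ‖(r : ℂ) • x j‖ ^ 2 ≤ r ^ 2 * A * M := by
  simp only [norm_smul, mul_pow, Complex.norm_real, Real.norm_eq_abs, sq_abs]
  rw [← Finset.mul_sum, mul_assoc]
  exact mul_le_mul_of_nonneg_left hx (sq_nonneg r)

theorem sum_norm_sq_mulOp_le {v : Plane → ℝ} (hv : IsMult v) {C : ℝ} (hC : ∀ z, |v z| ≤ C)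
    (hx : ∑ j, ‖x j‖ ^ 2 ≤ A * M) : ∑ j, ‖mulOp v (x j)‖ ^ 2 ≤ C ^ 2 * A * M := by
  have h : ∀ j, ‖mulOp v (x j)‖ ^ 2 ≤ C ^ 2 * ‖x j‖ ^ 2 := fun j => by
    rw [← mul_pow]
    exact pow_le_pow_left₀ (norm_nonneg _) (norm_mulOp_le hv hC _) 2
  refine (Finset.sum_le_sum fun j _ => h j).trans ?_
  rw [← Finset.mul_sum, mul_assoc]
  exact mul_le_mul_of_nonneg_left hx (sq_nonneg C)

end Families

/-! ### Fields on the configuration space induced by fields on the plane. -/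

section ConfigFields

variable {n : ℕ}

/-- Preimages of null sets under surjective linear maps are null, and x ↦ x₀ - x_l is surjective
when l ≠ 0. -/
theorem ae_pair {p : Plane → Prop} (hm : MeasurableSet {z | p z}) (h : ∀ᵐ z, p z)
    {l : Fin (n + 1)} (hl : l ≠ 0) : ∀ᵐ x : Config (n + 1), p (x 0 - x l) := by
  let D : Config (n + 1) →ₗ[ℝ] Plane := LinearMap.proj (R := ℝ) (φ := fun _ : Fin (n + 1) => Plane) 0 -
    LinearMap.proj (R := ℝ) (φ := fun _ : Fin (n + 1) => Plane) l
  have hD : Function.Surjective D := fun z => ⟨Pi.single 0 z, by simp [D, hl]⟩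
  exact (ae_comp_linearMap_mem_iff D (volume : Measure (Config (n + 1)))
    (volume : Measure Plane) hD hm).2 h

theorem ae_eval {p : Plane → Prop} (hm : MeasurableSet {z | p z}) (h : ∀ᵐ z, p z)
    (l : Fin (n + 1)) : ∀ᵐ x : Config (n + 1), p (x l) := by
  let D : Config (n + 1) →ₗ[ℝ] Plane := LinearMap.proj l
  have hD : Function.Surjective D := fun z => ⟨Pi.single l z, by simp [D]⟩
  exact (ae_comp_linearMap_mem_iff D (volume : Measure (Config (n + 1)))
    (volume : Measure Plane) hD hm).2 h

theorem lineDeriv_pair (a : Plane → ℝ) {l : Fin (n + 1)} (hl : l ≠ 0) (x : Config (n + 1))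
    (c : Fin 2) : lineDeriv ℝ (fun x : Config (n + 1) => a (x 0 - x l)) x (dirN 0 c) =
      lineDeriv ℝ a (x 0 - x l) (dir c) := by
  unfold lineDeriv
  congr 1
  funext t
  simp only [dirN, Pi.add_apply, Pi.smul_apply, Pi.single_eq_same, Pi.single_eq_of_ne hl,
    smul_zero, add_zero, add_sub_right_comm]

theorem lineDeriv_eval (a : Plane → ℝ) (l : Fin (n + 1)) (x : Config (n + 1))
    (c : Fin 2) : lineDeriv ℝ (fun x : Config (n + 1) => a (x l)) x (dirN l c) =
      lineDeriv ℝ a (x l) (dir c) := by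
  unfold lineDeriv
  congr 1
  funext t
  simp [dirN]

theorem lipschitz_pair {a : Plane → ℝ} (h : ∃ L, LipschitzWith L a) (l : Fin (n + 1)) :
    ∃ L, LipschitzWith L fun x : Config (n + 1) => a (x 0 - x l) := by
  obtain ⟨L, hL⟩ := h
  let D : Config (n + 1) →L[ℝ] Plane :=
    ContinuousLinearMap.proj (R := ℝ) (φ := fun _ : Fin (n + 1) => Plane) 0 -
      ContinuousLinearMap.proj (R := ℝ) (φ := fun _ : Fin (n + 1) => Plane) l
  exact ⟨_, hL.comp D.lipschitz⟩

theorem lipschitz_eval {a : Plane → ℝ} (h : ∃ L, LipschitzWith L a) (l : Fin (n + 1)) :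
    ∃ L, LipschitzWith L fun x : Config (n + 1) => a (x l) := by
  obtain ⟨L, hL⟩ := h
  let D : Config (n + 1) →L[ℝ] Plane :=
    ContinuousLinearMap.proj (R := ℝ) (φ := fun _ : Fin (n + 1) => Plane) l
  exact ⟨_, hL.comp D.lipschitz⟩

theorem measurableSet_div {a : Fin 2 → Plane → ℝ} (h : ∀ c, ∃ L, LipschitzWith L (a c)) :
    MeasurableSet {z | ∑ c, lineDeriv ℝ (a c) z (dir c) = 0} := by
  refine measurableSet_eq_fun (Finset.measurable_sum _ fun c _ => ?_) measurable_const
  obtain ⟨L, hL⟩ := h c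
  exact measurable_lineDeriv hL.continuous

end ConfigFields

/-- The data of the mean-field problem: the vector potential `a`, the potential `κ = N |a|²`, and
the first and second momenta of the orbitals. -/
structure MeanField {n : ℕ} (C : ℝ) (u : Fin (n + 1) → L2 Plane) (a : Fin 2 → Plane → ℝ)
    (κ : Plane → ℝ) (u₁ u₂ : Fin 2 → Fin (n + 1) → L2 Plane) : Prop where
  pot : ∀ c, PairPot u (a c) (C / (n + 1))
  pot_sq : PairPot u κ (C / (n + 1))
  sq_eq : ∀ x, κ x = (n + 1) * ∑ c, a c x ^ 2
  lip : ∀ c, ∃ L, LipschitzWith L (a c)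
  div : ∀ᵐ x, ∑ c, lineDeriv ℝ (a c) x (dir c) = 0
  mean_lip : ∀ c, ∃ L, LipschitzWith L (convDens u (a c))
  mean_div : ∀ᵐ x, ∑ c, lineDeriv ℝ (convDens u (a c)) x (dir c) = 0
  mean_le : ∀ c x, |convDens u (a c) x| ≤ C
  mean_sq_le : ∀ x, |convDens u κ x| ≤ C
  mom₁ : ∀ c j, HasMom (dir c) (u j) (u₁ c j)
  mom₂ : ∀ c j, HasMom (dir c) (u₁ c j) (u₂ c j)
  sum₁ : ∀ c, ∑ j, ‖u₁ c j‖ ^ 2 ≤ C * (n + 1)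
  sum₂ : ∑ j, ‖∑ c, u₂ c j‖ ^ 2 ≤ C * (n + 1)

section Main

variable {n : ℕ} {C b g : ℝ} {u : Fin (n + 1) → L2 Plane} {a : Fin 2 → Plane → ℝ}
  {κ : Plane → ℝ} {u₁ u₂ : Fin 2 → Fin (n + 1) → L2 Plane}
  (hu : Orthonormal ℂ u) (h : MeanField C u a κ u₁ u₂) (hC : 0 ≤ C)
  {Ψ : L2 (Config (n + 1))} (hΨ : AntisymOn univ Ψ)

include hu in
theorem sum_norm_sq_orbitals : ∑ j, ‖u j‖ ^ 2 ≤ 1 * (n + 1 : ℝ) := by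
  simp [hu.1]

include h

theorem MeanField.isMult_mean (c : Fin 2) : IsMult (convDens u (a c)) :=
  isMult_convDens u (h.pot c).mult

theorem MeanField.isMult_mean_sq : IsMult (convDens u κ) := isMult_convDens u h.pot_sq.mult

theorem MeanField.sum_inner_pair {l : Fin (n + 1)} (hl : l ≠ 0) {F G : L2 (Config (n + 1))}
    {F' G' : Fin 2 → L2 (Config (n + 1))} (hF : ∀ c, HasMom (dirN 0 c) F (F' c))
    (hG : ∀ c, HasMom (dirN 0 c) G (G' c)) :
    ∑ c, ⟪F' c, pairOp (a c) l G⟫_ℂ = ∑ c, ⟪pairOp (a c) l F, G' c⟫_ℂ := by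
  refine sum_inner_mom_mulOp (fun c => (h.pot c).mult.pair l) (fun c => lipschitz_pair (h.lip c) l)
    ?_ hF hG
  simp only [lineDeriv_pair _ hl]
  exact ae_pair (measurableSet_div h.lip) h.div hl

theorem MeanField.sum_inner_mean {F G : L2 (Config (n + 1))}
    {F' G' : Fin 2 → L2 (Config (n + 1))} (hF : ∀ c, HasMom (dirN 0 c) F (F' c))
    (hG : ∀ c, HasMom (dirN 0 c) G (G' c)) :
    ∑ c, ⟪F' c, meanOp (convDens u (a c)) G⟫_ℂ = ∑ c, ⟪meanOp (convDens u (a c)) F, G' c⟫_ℂ := by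
  refine sum_inner_mom_mulOp (fun c => (h.isMult_mean c).eval)
    (fun c => lipschitz_eval (h.mean_lip c) 0) ?_ hF hG
  simp only [lineDeriv_eval]
  exact ae_eval (measurableSet_div h.mean_lip) h.mean_div 0

/-- The sum over l is split by p_l + q_l and squared at the price of a factor n + 1. The first half
is small by the trace inequality; the second, with its factor n + 1, is `excitedPair`. -/
theorem MeanField.norm_sq_sum_pairOp_q_le (hC : 0 ≤ C) (hΨ : AntisymOn univ Ψ) (c : Fin 2) :
    ‖∑ l ∈ Finset.univ.erase 0, pairOp (a c) l ((proj hu).q 0 Ψ)‖ ^ 2 ≤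
      2 * excitedPair hu (a c) Ψ + 2 * C * (proj hu).excitation Ψ := by
  have e : ∑ l ∈ Finset.univ.erase 0, pairOp (a c) l ((proj hu).q 0 Ψ) =
      ∑ l ∈ Finset.univ.erase 0, pairOp (a c) l ((proj hu).q 0 ((proj hu).p l Ψ)) +
      ∑ l ∈ Finset.univ.erase 0, pairOp (a c) l ((proj hu).q 0 ((proj hu).q l Ψ)) := by
    rw [← Finset.sum_add_distrib]
    refine Finset.sum_congr rfl fun l _ => ?_
    rw [← map_add, ← map_add, CommProj.p_add_q]
  have hcard : (((Finset.univ : Finset (Fin (n + 1))).erase 0).card : ℝ) ≤ n + 1 := by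
    rw [Finset.card_erase_of_mem (Finset.mem_univ _)]; simp
  rw [e]
  refine (norm_sq_add_le _ _).trans ?_
  have h1 := (norm_sq_sum_le (Finset.univ.erase 0)
    fun l => pairOp (a c) l ((proj hu).q 0 ((proj hu).p l Ψ))).trans
      (mul_le_mul_of_nonneg_right hcard (Finset.sum_nonneg fun _ _ => sq_nonneg _))
  have h2 := (norm_sq_sum_le (Finset.univ.erase 0)
    fun l => pairOp (a c) l ((proj hu).q 0 ((proj hu).q l Ψ))).trans
      (mul_le_mul_of_nonneg_right hcard (Finset.sum_nonneg fun _ _ => sq_nonneg _))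
  have h3 := sum_pairOp_q_p_le hu (h.pot c) hC hΨ hΨ (norm_sq_q_le hu hΨ)
  have h4 : (n + 1 : ℝ) * ∑ l ∈ Finset.univ.erase 0,
      ‖pairOp (a c) l ((proj hu).q 0 ((proj hu).p l Ψ))‖ ^ 2 ≤ C * (proj hu).excitation Ψ := by
    rw [le_div_iff₀ (by positivity)] at h3
    linarith
  rw [excitedPair]
  linarith

theorem MeanField.inner_pairOp_sq (l : Fin (n + 1)) (F : L2 (Config (n + 1))) :
    (⟪F, pairOp κ l F⟫_ℂ).re = (n + 1) * ∑ c, ‖pairOp (a c) l F‖ ^ 2 := by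
  have hm : ∀ c, IsMult fun x : Config (n + 1) => a c (x 0 - x l) ^ 2 := fun c =>
    (h.pot c).mult_sq.pair l
  have e : (fun x : Config (n + 1) => κ (x 0 - x l)) =
      fun x => (n + 1 : ℝ) * ∑ c, a c (x 0 - x l) ^ 2 := funext fun x => h.sq_eq _
  rw [pairOp, e, mulOp_const_mul (IsMult.sum _ fun c _ => hm c), mulOp_sum _ fun c _ => hm c,
    inner_smul_right, Complex.re_ofReal_mul, inner_sum, Complex.re_sum]
  congr 1
  refine Finset.sum_congr rfl fun c _ => ?_
  rw [inner_mulOp_self (hm c), Complex.ofReal_re, pairOp, norm_sq_mulOp ((h.pot c).mult.pair l)]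

include hC hΨ in
-- Ψ is split into its four parts F = pp, s = pq, t = qp, r = qq with respect to particles 0 and l.
-- The part F gives the mean field up to a fluctuation, and its products with the others are of the
-- order of the excitation. As κ = N|a|², the rest is a sum of squares: half of the square of r is
-- kept, while s and t are removed by the trace inequality. The half that is kept pays for the
-- excited pairs in the kinetic energy.
theorem MeanField.interaction_ge :
    (⟪(proj hu).p 0 Ψ, meanOp (convDens u κ) ((proj hu).p 0 Ψ)⟫_ℂ).re +
      1 / 2 * ∑ c, excitedPair hu (a c) Ψ ≤
    ∑ l ∈ Finset.univ.erase 0, (⟪Ψ, pairOp κ l Ψ⟫_ℂ).re +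
      ((C + 1) / 2 + 3 * (1 + C) + 8 * C) * (proj hu).excitation Ψ := by
  have hy := sum_norm_sq_orbitals hu
  have h1 := sum_inner_p_bOp_p_q_le hu hy h.pot_sq hC hΨ
  have h2 := sum_inner_p_bOp_q_p_le hu hy h.pot_sq hC hΨ
  have h3 := sum_inner_p_bOp_q_q_le hu hy h.pot_sq hC hΨ
  rw [← proj_p hu] at h1 h2 h3
  have hfl : (⟪(proj hu).p 0 Ψ, fluct hu κ ((proj hu).p 0 Ψ)⟫_ℂ).re ≤
      (C + 1) / 2 * (proj hu).excitation Ψ := by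
    have hΨ' : AntisymOn {l | l ≠ 0} Ψ := hΨ.mono (subset_univ _)
    refine (Complex.re_le_norm _).trans
      ((h.pot_sq.norm_inner_fluct_le hu (hΨ'.bOp (by simp) u u)).trans ?_)
    rw [← bOp_cardOp hu u (Finset.notMem_erase _ _), bOp_cardOp_erase, ← upState]
    have := norm_sq_bOp_upState_le hu hy hΨ
    rw [one_mul] at this
    exact mul_le_mul_of_nonneg_left this (by linarith)
  rw [inner_fluct, Complex.sub_re, Complex.re_sum] at hfl
  have hterm : ∀ l,
      (⟪(proj hu).p l ((proj hu).p 0 Ψ), pairOp κ l ((proj hu).p l ((proj hu).p 0 Ψ))⟫_ℂ).re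
      - 2 * ‖⟪(proj hu).p l ((proj hu).p 0 Ψ),
          pairOp κ l ((proj hu).p 0 ((proj hu).q l Ψ))⟫_ℂ‖
      - 2 * ‖⟪(proj hu).p l ((proj hu).p 0 Ψ),
          pairOp κ l ((proj hu).q 0 ((proj hu).p l Ψ))⟫_ℂ‖
      - 2 * ‖⟪(proj hu).p l ((proj hu).p 0 Ψ),
          pairOp κ l ((proj hu).q 0 ((proj hu).q l Ψ))⟫_ℂ‖
      + (n + 1) * ∑ c, (1 / 2 * ‖pairOp (a c) l ((proj hu).q 0 ((proj hu).q l Ψ))‖ ^ 2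
        - 2 * ‖pairOp (a c) l ((proj hu).p 0 ((proj hu).q l Ψ))‖ ^ 2
        - 2 * ‖pairOp (a c) l ((proj hu).q 0 ((proj hu).p l Ψ))‖ ^ 2) ≤
      (⟪Ψ, pairOp κ l Ψ⟫_ℂ).re := by
    intro l
    set F := (proj hu).p l ((proj hu).p 0 Ψ) with hF
    set s := (proj hu).p 0 ((proj hu).q l Ψ) with hs
    set t := (proj hu).q 0 ((proj hu).p l Ψ) with ht
    set r := (proj hu).q 0 ((proj hu).q l Ψ) with hr
    have hdec : Ψ = F + (s + t + r) := by
      have e1 : F + s = (proj hu).p 0 Ψ := by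
        rw [hF, hs, ← q_p_comm, CommProj.p_add_q]
      have e2 : t + r = (proj hu).q 0 Ψ := by rw [ht, hr, ← map_add, CommProj.p_add_q]
      calc Ψ = (proj hu).p 0 Ψ + (proj hu).q 0 Ψ := ((proj hu).p_add_q 0 Ψ).symm
        _ = (F + s) + (t + r) := by rw [e1, e2]
        _ = _ := by abel
    have hre : (⟪Ψ, pairOp κ l Ψ⟫_ℂ).re = (⟪F, pairOp κ l F⟫_ℂ).re
        + 2 * (⟪F, pairOp κ l s⟫_ℂ).re + 2 * (⟪F, pairOp κ l t⟫_ℂ).re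
        + 2 * (⟪F, pairOp κ l r⟫_ℂ).re + (⟪s + t + r, pairOp κ l (s + t + r)⟫_ℂ).re := by
      have hsym : (⟪s + t + r, pairOp κ l F⟫_ℂ).re = (⟪F, pairOp κ l (s + t + r)⟫_ℂ).re := by
        rw [re_inner_symm, pairOp, inner_mulOp_left (h.pot_sq.mult.pair l)]
      nth_rewrite 1 2 [hdec]
      rw [map_add, inner_add_left, inner_add_right, inner_add_right, Complex.add_re,
        Complex.add_re, Complex.add_re, hsym]
      have e3 : (⟪F, pairOp κ l (s + t + r)⟫_ℂ).re = (⟪F, pairOp κ l s⟫_ℂ).re +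
          (⟪F, pairOp κ l t⟫_ℂ).re + (⟪F, pairOp κ l r⟫_ℂ).re := by
        rw [map_add, map_add, inner_add_right, inner_add_right, Complex.add_re, Complex.add_re]
      rw [e3]
      ring
    rw [hre, h.inner_pairOp_sq l (s + t + r)]
    have b1 := neg_le_of_abs_le (Complex.abs_re_le_norm ⟪F, pairOp κ l s⟫_ℂ)
    have b2 := neg_le_of_abs_le (Complex.abs_re_le_norm ⟪F, pairOp κ l t⟫_ℂ)
    have b3 := neg_le_of_abs_le (Complex.abs_re_le_norm ⟪F, pairOp κ l r⟫_ℂ)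
    have b4 : (n + 1 : ℝ) * ∑ c, (1 / 2 * ‖pairOp (a c) l r‖ ^ 2
        - 2 * ‖pairOp (a c) l s‖ ^ 2 - 2 * ‖pairOp (a c) l t‖ ^ 2) ≤
        (n + 1) * ∑ c, ‖pairOp (a c) l (s + t + r)‖ ^ 2 := by
      refine mul_le_mul_of_nonneg_left (Finset.sum_le_sum fun c _ => ?_) (by positivity)
      rw [map_add, map_add]
      have b5 := half_norm_sq_sub_le (pairOp (a c) l s + pairOp (a c) l t) (pairOp (a c) l r)
      have b6 := norm_sq_add_le (pairOp (a c) l s) (pairOp (a c) l t)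
      linarith
    linarith
  have hsum := Finset.sum_le_sum fun l (_ : l ∈ Finset.univ.erase (0 : Fin (n + 1))) => hterm l
  simp only [Finset.sum_add_distrib, Finset.sum_sub_distrib, ← Finset.mul_sum] at hsum
  rw [Finset.sum_comm (s := Finset.univ.erase (0 : Fin (n + 1)))
      (f := fun l c => ‖pairOp (a c) l ((proj hu).q 0 ((proj hu).q l Ψ))‖ ^ 2),
    Finset.sum_comm (s := Finset.univ.erase (0 : Fin (n + 1)))
      (f := fun l c => ‖pairOp (a c) l ((proj hu).p 0 ((proj hu).q l Ψ))‖ ^ 2),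
    Finset.sum_comm (s := Finset.univ.erase (0 : Fin (n + 1)))
      (f := fun l c => ‖pairOp (a c) l ((proj hu).q 0 ((proj hu).p l Ψ))‖ ^ 2)] at hsum
  have hN : (0 : ℝ) < n + 1 := by positivity
  have hs1 : (n + 1 : ℝ) * ∑ c, ∑ l ∈ Finset.univ.erase 0,
      ‖pairOp (a c) l ((proj hu).p 0 ((proj hu).q l Ψ))‖ ^ 2 ≤
        2 * (C * (proj hu).excitation Ψ) := by
    have := Finset.sum_le_sum fun c (_ : c ∈ (Finset.univ : Finset (Fin 2))) =>
      sum_pairOp_p_q_le hu (h.pot c) hC hΨ hΨ (norm_sq_q_le hu hΨ)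
    refine (mul_le_mul_of_nonneg_left this hN.le).trans (le_of_eq ?_)
    simp
    field_simp
  have hs2 : (n + 1 : ℝ) * ∑ c, ∑ l ∈ Finset.univ.erase 0,
      ‖pairOp (a c) l ((proj hu).q 0 ((proj hu).p l Ψ))‖ ^ 2 ≤
        2 * (C * (proj hu).excitation Ψ) := by
    have := Finset.sum_le_sum fun c (_ : c ∈ (Finset.univ : Finset (Fin 2))) =>
      sum_pairOp_q_p_le hu (h.pot c) hC hΨ hΨ (norm_sq_q_le hu hΨ)
    refine (mul_le_mul_of_nonneg_left this hN.le).trans (le_of_eq ?_)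
    simp
    field_simp
  simp only [excitedPair, ← Finset.mul_sum]
  nlinarith

end Main

/-! ### Lower bound of the energy -/

/-- The numerical combination of the estimates of the terms of the energy. -/
theorem energy_combination {b g C η k₁ k₂ k₃ k₄ m d e w I J : ℝ} (hb : 0 ≤ b)
    (hg : 12 * b ^ 2 ≤ g) {X Y Z A B A' B' B'' D D' K : Fin 2 → ℝ} (hX : ∀ c, 0 ≤ X c)
    (hkin : ∀ c, Y c + 3 / 4 * Z c + 2 * b * (A c - A' c) + 2 * b * B c + (D c + D' c) +
      b * B' c + b * B'' c ≤ K c)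
    (t2a : ∀ c, -(k₁ * η) ≤ A c - A' c)
    (t2b : ∀ c, -(b * k₂ * η + (m * η + b ^ 2 * X c) / 2) ≤ b * B c)
    (t3 : -(d * η) ≤ ∑ c, (D c + D' c))
    {L : Fin 2 → ℝ} (t4c : ∀ c, -(b * k₃ * η + (C * η + b ^ 2 * X c) / 2) ≤ b * L c)
    (t4 : ∑ c, B' c = ∑ c, L c)
    (t5 : ∀ c, -(1 / 2 * Z c + 1 / 2 * b ^ 2 * (2 * X c + 2 * C * η)) ≤ b * B'' c)
    (t1 : e - w * η ≤ ∑ c, Y c + g / 2 * J) (hint : J + 1 / 2 * ∑ c, X c ≤ I + k₄ * η) :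
    1 / 4 * ∑ c, Z c ≤ ∑ c, K c + g / 2 * I - e +
      (4 * b * k₁ + 4 * b * k₂ + 2 * m + d + 2 * b * k₃ + C + 2 * b ^ 2 * C +
        g / 2 * k₄ + w) * η := by
  have hg0 : 0 ≤ g := le_trans (by positivity) hg
  have hint' := mul_le_mul_of_nonneg_left hint (by linarith : 0 ≤ g / 2)
  -- For each c the excited pairs cost b² X from twice `t2b`, b² X / 2 from `t4c` and b² X from
  -- `t5`, hence at most 3 b² X. The repulsion yields g/2 times 1/2.
  have hgap : ∀ c, 3 * b ^ 2 * X c ≤ g / 4 * X c :=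
    fun c => mul_le_mul_of_nonneg_right (by linarith) (hX c)
  have hb2 : ∀ c, 0 ≤ b ^ 2 * X c := fun c => mul_nonneg (sq_nonneg b) (hX c)
  have t2a' := fun c => mul_le_mul_of_nonneg_left (t2a c) (by linarith : 0 ≤ 2 * b)
  simp only [Fin.sum_univ_two] at t3 t4 t1 hint' ⊢
  have t4' : b * B' 0 + b * B' 1 = b * L 0 + b * L 1 := by
    rw [← mul_add, ← mul_add, t4]
  linarith [hkin 0, hkin 1, t2a' 0, t2a' 1, t2b 0, t2b 1, t4c 0, t4c 1, t5 0, t5 1, hgap 0,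
    hgap 1, hb2 0, hb2 1]

theorem div_sub_le_of_neg_le {M e w η r : ℝ} (hM : 0 < M) (h : -(M * (w * η)) ≤ M * r - e) :
    e / M - w * η ≤ r := by
  rw [sub_le_iff_le_add, div_le_iff₀ hM]
  linarith

theorem neg_half_sq_le {z q b x y : ℝ} (h1 : q ^ 2 ≤ x) (h2 : b * -(z * q) ≤ y) :
    -(1 / 2 * z ^ 2 + 1 / 2 * b ^ 2 * x) ≤ y := by
  have h3 := sq_nonneg (z - b * q)
  have h4 := mul_le_mul_of_nonneg_left h1 (sq_nonneg b)
  nlinarith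

section Main

variable {n : ℕ} {C b g : ℝ} {u : Fin (n + 1) → L2 Plane} {a : Fin 2 → Plane → ℝ}
  {κ : Plane → ℝ} {u₁ u₂ : Fin 2 → Fin (n + 1) → L2 Plane}
  (hu : Orthonormal ℂ u) (h : MeanField C u a κ u₁ u₂) (hC : 0 ≤ C)
  {Ψ : L2 (Config (n + 1))} (hΨ : AntisymOn univ Ψ)

/-- The magnetic momenta of the orbitals. -/
def magOrbital (b : ℝ) (u : Fin (n + 1) → L2 Plane) (a : Fin 2 → Plane → ℝ)
    (u₁ : Fin 2 → Fin (n + 1) → L2 Plane) (c : Fin 2) (j : Fin (n + 1)) : L2 Plane :=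
  u₁ c j + (b : ℂ) • mulOp (convDens u (a c)) (u j)

/-- The bound of the magnetic momenta of the orbitals. -/
def magConst (b C : ℝ) : ℝ := 2 * C + 2 * (b ^ 2 * (C ^ 2 * 1))

/-- The mean-field Hamiltonian, without its exchange term, applied to the orbitals. -/
def meanHam (b g : ℝ) (u : Fin (n + 1) → L2 Plane) (a : Fin 2 → Plane → ℝ) (κ : Plane → ℝ)
    (u₁ u₂ : Fin 2 → Fin (n + 1) → L2 Plane) (j : Fin (n + 1)) : L2 Plane :=
  ((∑ c, u₂ c j) + (((2 * b : ℝ) : ℂ) • mulOp (convDens u (a 0)) (u₁ 0 j) +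
    ((2 * b : ℝ) : ℂ) • mulOp (convDens u (a 1)) (u₁ 1 j))) +
  ((((b ^ 2 : ℝ) : ℂ) • mulOp (convDens u (a 0)) (mulOp (convDens u (a 0)) (u j)) +
    ((b ^ 2 : ℝ) : ℂ) • mulOp (convDens u (a 1)) (mulOp (convDens u (a 1)) (u j))) +
      ((g / 2 : ℝ) : ℂ) • mulOp (convDens u κ) (u j))

/-- The bound of the mean-field Hamiltonian applied to the orbitals. -/
def meanHamConst (b g C : ℝ) : ℝ :=
  2 * (2 * C + 2 * (2 * ((2 * b) ^ 2 * (C ^ 2 * C)) + 2 * ((2 * b) ^ 2 * (C ^ 2 * C)))) +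
  2 * (2 * (2 * ((b ^ 2) ^ 2 * (C ^ 2 * (C ^ 2 * 1))) +
    2 * ((b ^ 2) ^ 2 * (C ^ 2 * (C ^ 2 * 1)))) + 2 * ((g / 2) ^ 2 * (C ^ 2 * 1)))

/-- The coefficients of the terms linear in the momentum of the excited particles. -/
def driftOrbital (b : ℝ) (u : Fin (n + 1) → L2 Plane) (a : Fin 2 → Plane → ℝ)
    (u₁ u₂ : Fin 2 → Fin (n + 1) → L2 Plane) (j : Fin (n + 1)) : L2 Plane :=
  ((2 : ℝ) : ℂ) • (∑ c, u₂ c j) + ((b : ℂ) • mulOp (convDens u (a 0)) (u₁ 0 j) +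
    (b : ℂ) • mulOp (convDens u (a 1)) (u₁ 1 j))

/-- The bound of these coefficients. -/
def driftConst (b C : ℝ) : ℝ :=
  2 * (2 ^ 2 * C) + 2 * (2 * (b ^ 2 * (C ^ 2 * C)) + 2 * (b ^ 2 * (C ^ 2 * C)))

/-- The constant of the lower bound of the many-body energy. -/
def energyConst (b g C : ℝ) : ℝ :=
  4 * b * ((C + 1) / 2 * (magConst b C + 1) + 3 / 2 * (magConst b C + C)) +
  4 * b * (magConst b C + C + (1 + C * magConst b C) / 2) + 2 * magConst b C +
  (driftConst b C + 1) / 2 + 2 * b * (C + C + (1 + C * C) / 2) + C + 2 * b ^ 2 * C +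
  g / 2 * ((C + 1) / 2 + 3 * (1 + C) + 8 * C) + (1 + meanHamConst b g C) / 2

theorem excitedPair_nonneg (γ : Plane → ℝ) (Ψ : L2 (Config (n + 1))) :
    0 ≤ excitedPair hu γ Ψ :=
  mul_nonneg (by positivity) (Finset.sum_nonneg fun _ _ => sq_nonneg _)

theorem bOp_sum {ι : Type*} (s : Finset ι) (w : Fin (n + 1) → L2 Plane)
    (y : ι → Fin (n + 1) → L2 Plane) (l : Fin (n + 1)) (F : L2 (Config (n + 1))) :
    bOp w (fun j => ∑ c ∈ s, y c j) l F = ∑ c ∈ s, bOp w (y c) l F := by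
  classical
  induction s using Finset.induction_on with
  | empty =>
    have := bOp_smul (0 : ℂ) w (fun _ => 0) l F
    simpa using this
  | insert i s hi ih => simp only [Finset.sum_insert hi, bOp_add, ih]

include h

omit h in
theorem meanOp_bOp {v : Plane → ℝ} (hv : IsMult v) (y : Fin (n + 1) → L2 Plane)
    (F : L2 (Config (n + 1))) :
    meanOp v (bOp u y 0 F) = bOp u (fun j => mulOp v (y j)) 0 F :=
  mulOp_eval_bOp hv u y 0 F

include hu in
theorem MeanField.sum_magOrbital_le (c : Fin 2) :
    ∑ j, ‖magOrbital b u a u₁ c j‖ ^ 2 ≤ magConst b C * (n + 1) :=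
  sum_norm_sq_add_le (h.sum₁ c) (sum_norm_sq_smul_le b
    (sum_norm_sq_mulOp_le (h.isMult_mean c) (h.mean_le c) (sum_norm_sq_orbitals hu)))

include hu in
theorem MeanField.sum_meanHam_le :
    ∑ j, ‖meanHam b g u a κ u₁ u₂ j‖ ^ 2 ≤ meanHamConst b g C * (n + 1) := by
  have hA := fun c => sum_norm_sq_smul_le (2 * b)
    (sum_norm_sq_mulOp_le (h.isMult_mean c) (h.mean_le c) (h.sum₁ c))
  have hB := fun c => sum_norm_sq_smul_le (b ^ 2)
    (sum_norm_sq_mulOp_le (h.isMult_mean c) (h.mean_le c)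
      (sum_norm_sq_mulOp_le (h.isMult_mean c) (h.mean_le c) (sum_norm_sq_orbitals hu)))
  exact sum_norm_sq_add_le (sum_norm_sq_add_le h.sum₂ (sum_norm_sq_add_le (hA 0) (hA 1)))
    (sum_norm_sq_add_le (sum_norm_sq_add_le (hB 0) (hB 1))
      (sum_norm_sq_smul_le (g / 2)
        (sum_norm_sq_mulOp_le h.isMult_mean_sq h.mean_sq_le (sum_norm_sq_orbitals hu))))

theorem MeanField.sum_driftOrbital_le :
    ∑ j, ‖driftOrbital b u a u₁ u₂ j‖ ^ 2 ≤ driftConst b C * (n + 1) := by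
  have hA := fun c => sum_norm_sq_smul_le b
    (sum_norm_sq_mulOp_le (h.isMult_mean c) (h.mean_le c) (h.sum₁ c))
  exact sum_norm_sq_add_le (sum_norm_sq_smul_le 2 h.sum₂) (sum_norm_sq_add_le (hA 0) (hA 1))

theorem MeanField.bOp_magOrbital (c : Fin 2) :
    bOp u (magOrbital b u a u₁ c) 0 Ψ =
      bOp u (u₁ c) 0 Ψ + (b : ℂ) • meanOp (convDens u (a c)) ((proj hu).p 0 Ψ) := by
  rw [proj_p, meanOp_bOp (h.isMult_mean c), ← bOp_smul, ← bOp_add]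
  rfl

theorem MeanField.bOp_meanHam :
    bOp u (meanHam b g u a κ u₁ u₂) 0 Ψ =
      ∑ c, (bOp u (u₂ c) 0 Ψ + (2 * b : ℂ) • meanOp (convDens u (a c)) (bOp u (u₁ c) 0 Ψ) +
        (b ^ 2 : ℂ) • meanOp (convDens u (a c)) (meanOp (convDens u (a c)) ((proj hu).p 0 Ψ))) +
      ((g / 2 : ℝ) : ℂ) • meanOp (convDens u κ) ((proj hu).p 0 Ψ) := by
  unfold meanHam
  simp only [bOp_add, bOp_smul, bOp_sum]
  simp only [proj_p, meanOp_bOp (h.isMult_mean _), meanOp_bOp h.isMult_mean_sq, Fin.sum_univ_two]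
  push_cast
  abel

theorem MeanField.bOp_driftOrbital :
    bOp u (driftOrbital b u a u₁ u₂) 0 Ψ =
      ∑ c, ((2 : ℂ) • bOp u (u₂ c) 0 Ψ +
        (b : ℂ) • meanOp (convDens u (a c)) (bOp u (u₁ c) 0 Ψ)) := by
  unfold driftOrbital
  simp only [bOp_add, bOp_smul, bOp_sum]
  simp only [meanOp_bOp (h.isMult_mean _), Fin.sum_univ_two, smul_add]
  push_cast
  abel

/-- With g/2 where the effective equation has g, and without exchange term, `meanHam` has the
Hartree energy itself as its trace over the orbitals; the repulsion is not counted twice. -/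
theorem MeanField.orbital_energy :
    ∑ j, ∑ c, ‖magOrbital b u a u₁ c j‖ ^ 2 +
      g / 2 * ∑ j, (⟪u j, mulOp (convDens u κ) (u j)⟫_ℂ).re =
      (∑ j, ⟪u j, meanHam b g u a κ u₁ u₂ j⟫_ℂ).re := by
  rw [Complex.re_sum, Finset.mul_sum, ← Finset.sum_add_distrib]
  refine Finset.sum_congr rfl fun j _ => ?_
  have key := sum_norm_sq_mom (A := fun c => convDens u (a c)) (fun c => h.isMult_mean c)
    (fun c => h.mom₁ c j) (fun c => h.mom₂ c j) b
  have e : meanHam b g u a κ u₁ u₂ j =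
      ∑ c, (u₂ c j + (2 * b : ℂ) • mulOp (convDens u (a c)) (u₁ c j) +
        (b ^ 2 : ℂ) • mulOp (convDens u (a c)) (mulOp (convDens u (a c)) (u j))) +
      ((g / 2 : ℝ) : ℂ) • mulOp (convDens u κ) (u j) := by
    simp only [meanHam, Fin.sum_univ_two]
    push_cast
    abel
  rw [e, inner_add_right, Complex.add_re, ← key, inner_smul_right, Complex.re_ofReal_mul]
  rfl

theorem MeanField.state_energy :
    ∑ c, ‖bOp u (magOrbital b u a u₁ c) 0 Ψ‖ ^ 2 +
      g / 2 * (⟪(proj hu).p 0 Ψ, meanOp (convDens u κ) ((proj hu).p 0 Ψ)⟫_ℂ).re =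
      (⟪(proj hu).p 0 Ψ, bOp u (meanHam b g u a κ u₁ u₂) 0 Ψ⟫_ℂ).re := by
  have key := sum_norm_sq_mom (v := dirN (0 : Fin (n + 1)))
    (A := fun c (x : Config (n + 1)) => convDens u (a c) (x 0))
    (fun c => (h.isMult_mean c).eval)
    (fun c => HasMom.bOp (w := u) (fun j => h.mom₁ c j) 0 Ψ)
    (fun c => HasMom.bOp (w := u) (fun j => h.mom₂ c j) 0 Ψ) b
  rw [h.bOp_meanHam hu, inner_add_right, Complex.add_re, inner_smul_right, Complex.re_ofReal_mul]
  simp only [h.bOp_magOrbital hu]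
  congr 1

include hC hΨ in
-- Every derivative of q₀Ψ is moved onto the orbitals: directly in the terms with the first momenta,
-- and through the absence of divergence in the term with the mean potential. What remains is the
-- product of q₀Ψ with an operator of rank one per orbital, which `norm_inner_bOp_q_le` controls.
theorem MeanField.drift_ge {Z : Fin 2 → L2 (Config (n + 1))}
    (hZ : ∀ c, HasMom (dirN 0 c) ((proj hu).q 0 Ψ) (Z c)) :
    -((driftConst b C + 1) / 2 * (proj hu).excitation Ψ) ≤
      ∑ c, ((⟪bOp u (magOrbital b u a u₁ c) 0 Ψ, Z c⟫_ℂ).re +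
        (⟪Z c, bOp u (u₁ c) 0 Ψ⟫_ℂ).re) := by
  have hP : ∀ c, HasMom (dirN 0 c) ((proj hu).p 0 Ψ) (bOp u (u₁ c) 0 Ψ) := fun c =>
    HasMom.bOp (w := u) (fun j => h.mom₁ c j) 0 Ψ
  have hX : ∀ c, HasMom (dirN 0 c) (bOp u (u₁ c) 0 Ψ) (bOp u (u₂ c) 0 Ψ) := fun c =>
    HasMom.bOp (w := u) (fun j => h.mom₂ c j) 0 Ψ
  have e1 := h.sum_inner_mean hP hZ
  have e2 : ∑ c, ((⟪bOp u (magOrbital b u a u₁ c) 0 Ψ, Z c⟫_ℂ).re +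
        (⟪Z c, bOp u (u₁ c) 0 Ψ⟫_ℂ).re) =
      (⟪bOp u (driftOrbital b u a u₁ u₂) 0 Ψ, (proj hu).q 0 Ψ⟫_ℂ).re := by
    rw [h.bOp_driftOrbital, sum_inner, Complex.re_sum]
    have e3 : ∀ c, (⟪bOp u (magOrbital b u a u₁ c) 0 Ψ, Z c⟫_ℂ).re +
        (⟪Z c, bOp u (u₁ c) 0 Ψ⟫_ℂ).re = 2 * (⟪bOp u (u₂ c) 0 Ψ, (proj hu).q 0 Ψ⟫_ℂ).re +
          b * (⟪meanOp (convDens u (a c)) ((proj hu).p 0 Ψ), Z c⟫_ℂ).re := fun c => by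
      rw [h.bOp_magOrbital hu, inner_add_left, inner_smul_left, Complex.conj_ofReal,
        Complex.add_re, Complex.re_ofReal_mul, re_inner_symm (Z c), (hX c).inner_eq (hZ c)]
      ring
    have e4 : ∀ c, (⟪(2 : ℂ) • bOp u (u₂ c) 0 Ψ +
        (b : ℂ) • meanOp (convDens u (a c)) (bOp u (u₁ c) 0 Ψ), (proj hu).q 0 Ψ⟫_ℂ).re =
        2 * (⟪bOp u (u₂ c) 0 Ψ, (proj hu).q 0 Ψ⟫_ℂ).re +
        b * (⟪bOp u (u₁ c) 0 Ψ, meanOp (convDens u (a c)) ((proj hu).q 0 Ψ)⟫_ℂ).re := fun c => by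
      have : (2 : ℂ) = ((2 : ℝ) : ℂ) := by push_cast; rfl
      rw [inner_add_left, inner_smul_left, inner_smul_left, Complex.conj_ofReal, this,
        Complex.conj_ofReal, Complex.add_re, Complex.re_ofReal_mul, Complex.re_ofReal_mul, meanOp,
        inner_mulOp_left (h.isMult_mean c).eval]
    simp only [e3, e4, Finset.sum_add_distrib, ← Finset.mul_sum, ← Complex.re_sum, ← e1]
  rw [e2]
  exact neg_le_of_abs_le ((Complex.abs_re_le_norm _).trans
    (norm_inner_bOp_q_le hu h.sum_driftOrbital_le hΨ))

set_option maxHeartbeats 1000000 in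
include hC hΨ in
/-- The energy per particle above the energy of the orbitals controls the kinetic energy of the
excited particles. -/
theorem MeanField.excited_kinetic_le (hb : 0 ≤ b) (hg : 12 * b ^ 2 ≤ g) (hnorm : ‖Ψ‖ = 1)
    {Ψ₁ : Fin 2 → L2 (Config (n + 1))} (hΨ₁ : ∀ c, HasMom (dirN 0 c) Ψ (Ψ₁ c)) :
    1 / 4 * ∑ c, ‖Ψ₁ c - bOp u (u₁ c) 0 Ψ‖ ^ 2 ≤
      ∑ c, ‖Ψ₁ c + (b : ℂ) • ∑ l ∈ Finset.univ.erase 0, pairOp (a c) l Ψ‖ ^ 2 +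
      g / 2 * ∑ l ∈ Finset.univ.erase 0, (⟪Ψ, pairOp κ l Ψ⟫_ℂ).re -
      (∑ j, ∑ c, ‖magOrbital b u a u₁ c j‖ ^ 2 +
        g / 2 * ∑ j, (⟪u j, mulOp (convDens u κ) (u j)⟫_ℂ).re) / (n + 1) +
      energyConst b g C * (proj hu).excitation Ψ := by
  have hN : (0 : ℝ) < n + 1 := by positivity
  set η := (proj hu).excitation Ψ with hη
  set X : Fin 2 → L2 (Config (n + 1)) := fun c => bOp u (u₁ c) 0 Ψ with hXdef
  set Z : Fin 2 → L2 (Config (n + 1)) := fun c => Ψ₁ c - X c with hZdef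
  set Y : Fin 2 → L2 (Config (n + 1)) := fun c => bOp u (magOrbital b u a u₁ c) 0 Ψ with hYdef
  set AP : Fin 2 → L2 (Config (n + 1)) := fun c =>
    ∑ l ∈ Finset.univ.erase 0, pairOp (a c) l ((proj hu).p 0 Ψ) with hAP
  set AQ : Fin 2 → L2 (Config (n + 1)) := fun c =>
    ∑ l ∈ Finset.univ.erase 0, pairOp (a c) l ((proj hu).q 0 Ψ) with hAQ
  have hP : ∀ c, HasMom (dirN 0 c) ((proj hu).p 0 Ψ) (X c) := fun c =>
    HasMom.bOp (w := u) (fun j => h.mom₁ c j) 0 Ψ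
  have hZ : ∀ c, HasMom (dirN 0 c) ((proj hu).q 0 Ψ) (Z c) := fun c => by
    rw [CommProj.q_apply]
    exact (hΨ₁ c).sub (hP c)
  have hkin : ∀ c, ‖Y c‖ ^ 2 + 3 / 4 * ‖Z c‖ ^ 2 + 2 * b * ((⟪Y c, AP c⟫_ℂ).re -
      (⟪Y c, meanOp (convDens u (a c)) ((proj hu).p 0 Ψ)⟫_ℂ).re) + 2 * b * (⟪Y c, AQ c⟫_ℂ).re +
      ((⟪Y c, Z c⟫_ℂ).re + (⟪Z c, X c⟫_ℂ).re) + b * (⟪Z c, AP c⟫_ℂ).re +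
      b * (⟪Z c, AQ c⟫_ℂ).re ≤
      ‖Ψ₁ c + (b : ℂ) • ∑ l ∈ Finset.univ.erase 0, pairOp (a c) l Ψ‖ ^ 2 := by
    intro c
    have := norm_sq_kinetic_ge (X c) (meanOp (convDens u (a c)) ((proj hu).p 0 Ψ)) (Z c) (AP c)
      (AQ c) b
    have e1 : X c + Z c = Ψ₁ c := by simp [hZdef]
    have e2 : AP c + AQ c = ∑ l ∈ Finset.univ.erase 0, pairOp (a c) l Ψ := by
      simp only [hAP, hAQ, ← Finset.sum_add_distrib, ← map_add, CommProj.p_add_q]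
    rw [e1, e2, ← h.bOp_magOrbital hu] at this
    exact this
  have hm := fun c => h.sum_magOrbital_le (b := b) hu c
  have t2a : ∀ c, -(((C + 1) / 2 * (magConst b C + 1) + 3 / 2 * (magConst b C + C)) * η) ≤
      (⟪Y c, AP c⟫_ℂ).re - (⟪Y c, meanOp (convDens u (a c)) ((proj hu).p 0 Ψ)⟫_ℂ).re := by
    intro c
    have := neg_le_of_abs_le (abs_re_sum_inner_bOp_p_sub_le hu (hm c) (h.pot c) hC hΨ)
    rwa [← inner_sum] at this
  -- The estimate is used with t = b, so that the excited pairs appear with b².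
  have t2b : ∀ c, -(b * (magConst b C + C + (1 + C * magConst b C) / 2) * η +
      (magConst b C * η + b ^ 2 * excitedPair hu (a c) Ψ) / 2) ≤ b * (⟪Y c, AQ c⟫_ℂ).re := by
    intro c
    have h1 := norm_sum_inner_bOp_q_le hu (hm c) (h.pot c) hC hΨ hb
    rw [← inner_sum] at h1
    have h2 := mul_le_mul_of_nonneg_left
      (neg_le_of_abs_le (Complex.abs_re_le_norm ⟪Y c, AQ c⟫_ℂ)) hb
    linarith
  have t3 := h.drift_ge (b := b) hu hC hΨ hZ
  have t4c : ∀ c, -(b * (C + C + (1 + C * C) / 2) * η +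
      (C * η + b ^ 2 * excitedPair hu (a c) Ψ) / 2) ≤ b * (⟪X c, AQ c⟫_ℂ).re := by
    intro c
    have h1 := norm_sum_inner_bOp_q_le hu (h.sum₁ c) (h.pot c) hC hΨ hb
    rw [← inner_sum] at h1
    have h2 := mul_le_mul_of_nonneg_left
      (neg_le_of_abs_le (Complex.abs_re_le_norm ⟪X c, AQ c⟫_ℂ)) hb
    linarith
  -- Since a is free of divergence, the derivative moves from q₀Ψ to p₀Ψ, and no bound on Z is
  -- needed for this term.
  have t4 : ∑ c, (⟪Z c, AP c⟫_ℂ).re = ∑ c, (⟪X c, AQ c⟫_ℂ).re := by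
    simp only [hAP, hAQ, inner_sum, Complex.re_sum]
    rw [Finset.sum_comm, Finset.sum_comm (s := (Finset.univ : Finset (Fin 2)))]
    refine Finset.sum_congr rfl fun l hl => ?_
    rw [← Complex.re_sum, h.sum_inner_pair (Finset.ne_of_mem_erase hl) hZ hP, Complex.re_sum]
    exact Finset.sum_congr rfl fun c _ => re_inner_symm _ _
  -- The only cross term in which both Z and q₀Ψ survive; it takes 1/2 of the available 3/4 of ‖Z‖².
  have t5 : ∀ c, -(1 / 2 * ‖Z c‖ ^ 2 + 1 / 2 * b ^ 2 *
      (2 * excitedPair hu (a c) Ψ + 2 * C * η)) ≤ b * (⟪Z c, AQ c⟫_ℂ).re := by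
    intro c
    have h1 := h.norm_sq_sum_pairOp_q_le hu hC hΨ c
    have h2 := mul_le_mul_of_nonneg_left
      (neg_le_of_abs_le ((Complex.abs_re_le_norm ⟪Z c, AQ c⟫_ℂ).trans
        (norm_inner_le_norm (𝕜 := ℂ) (Z c) (AQ c)))) hb
    exact neg_half_sq_le h1 h2
  have hone := h.orbital_energy (b := b) (g := g)
  have hstate := h.state_energy (b := b) (g := g) hu (Ψ := Ψ)
  -- Comparison of the energy of particle 0 in the orbitals with the Hartree energy per particle.
  -- Only the lower bound is used.
  have ht1 := (abs_le.1 (abs_re_inner_bOp_sub_le hu (h.sum_meanHam_le (b := b) (g := g) hu) hΨ)).1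
  rw [hnorm, one_pow, mul_one, ← hone] at ht1
  have ht1' : (∑ j, ∑ c, ‖magOrbital b u a u₁ c j‖ ^ 2 +
        g / 2 * ∑ j, (⟪u j, mulOp (convDens u κ) (u j)⟫_ℂ).re) / (n + 1) -
        (1 + meanHamConst b g C) / 2 * η ≤
      (⟪(proj hu).p 0 Ψ, bOp u (meanHam b g u a κ u₁ u₂) 0 Ψ⟫_ℂ).re := by
    exact div_sub_le_of_neg_le hN ht1
  have hint := h.interaction_ge hu hC hΨ
  refine energy_combination hb hg (X := fun c => excitedPair hu (a c) Ψ)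
    (fun c => excitedPair_nonneg hu (a c) Ψ) (η := η) hkin t2a t2b t3 t4c t4 t5 ?_ hint
  rw [hstate]
  exact ht1'

end Main

/-! ### The regularized vector potential -/

section Size

theorem norm_perp (x : Plane) : ‖perp x‖ = ‖x‖ := by
  rw [EuclideanSpace.norm_eq, EuclideanSpace.norm_eq]
  simp [perp, Fin.sum_univ_two, add_comm]

theorem norm_vecPot (N : ℕ) {R : ℝ} (hR : 0 < R) (s : ℝ) (x : Plane) :
    ‖vecPot N R s x‖ = (N : ℝ) ^ (s / 2 - 1) * ((max ‖x‖ R) ^ (1 + s))⁻¹ * ‖x‖ := by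
  have hm : 0 < max ‖x‖ R := lt_max_of_lt_right hR
  rw [vecPot, norm_smul, norm_perp, Real.norm_of_nonneg (by positivity)]

theorem norm_vecPot_le (N : ℕ) {R : ℝ} (hR : 0 < R) (s : ℝ) (x : Plane) :
    ‖vecPot N R s x‖ ≤ (N : ℝ) ^ (s / 2 - 1) * ((max ‖x‖ R) ^ s)⁻¹ := by
  have hm : 0 < max ‖x‖ R := lt_max_of_lt_right hR
  rw [norm_vecPot N hR, mul_assoc]
  refine mul_le_mul_of_nonneg_left ?_ (by positivity)
  rw [Real.rpow_add hm, Real.rpow_one, mul_inv, mul_comm, ← mul_assoc]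
  have h1 : ‖x‖ * (max ‖x‖ R)⁻¹ ≤ 1 := by
    rw [← div_eq_mul_inv]
    exact (div_le_one hm).2 (le_max_left _ _)
  have h2 : 0 ≤ ((max ‖x‖ R) ^ s)⁻¹ := by positivity
  nlinarith

theorem vecPot_zero (N : ℕ) (R s : ℝ) : vecPot N R s 0 = 0 := by
  have : perp 0 = 0 := by
    rw [← norm_eq_zero, norm_perp, norm_zero]
  rw [vecPot, this, smul_zero]

theorem pow_four_vecPot_le {N : ℕ} (hN : 0 < N) {R : ℝ} (hR : 0 < R) (s : ℝ) (x : Plane) :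
    (N : ℝ) ^ 4 * ‖vecPot N R s x‖ ^ 4 ≤ (√N / max ‖x‖ R) ^ (4 * s) := by
  have hm : 0 < max ‖x‖ R := lt_max_of_lt_right hR
  have hN' : (0 : ℝ) < N := by exact_mod_cast hN
  have h1 := pow_le_pow_left₀ (norm_nonneg _) (norm_vecPot_le N hR s x) 4
  have h2 : (N : ℝ) ^ 4 * ((N : ℝ) ^ (s / 2 - 1) * ((max ‖x‖ R) ^ s)⁻¹) ^ 4 =
      (√N / max ‖x‖ R) ^ (4 * s) := by
    rw [Real.div_rpow (Real.sqrt_nonneg _) hm.le, Real.sqrt_eq_rpow, ← Real.rpow_mul hN'.le,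
      mul_pow, inv_pow, ← Real.rpow_natCast (max ‖x‖ R ^ s) 4, ← Real.rpow_mul hm.le,
      ← Real.rpow_natCast ((N : ℝ) ^ (s / 2 - 1)) 4, ← Real.rpow_mul hN'.le,
      ← Real.rpow_natCast (N : ℝ) 4, ← mul_assoc, ← Real.rpow_add hN', div_eq_mul_inv]
    congr 2
    · push_cast; ring
    · push_cast; rw [mul_comm]
  rw [← h2]
  exact mul_le_mul_of_nonneg_left h1 (by positivity)

/-- Inside the ball of radius √N, Young's inequality separates the singularity from the density;
outside, the quotient √N/‖x‖ is at most 1 and the density alone remains. The cutoff R is dropped, so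
the bound is uniform in it. -/
theorem pow_four_vecPot_mul_le {N : ℕ} (hN : 0 < N) {R : ℝ} (hR : 0 < R) {s p q : ℝ} (hs : 0 ≤ s)
    (hpq : p.HolderConjugate q) (x : Plane) {ρ : ℝ} (hρ : 0 ≤ ρ) :
    (N : ℝ) ^ 4 * ‖vecPot N R s x‖ ^ 4 * ρ ≤
      (Metric.ball (0 : Plane) (√N)).indicator (fun z => (√N / ‖z‖) ^ (4 * s * q)) x +
        ρ ^ p + ρ := by
  have hN' : (0 : ℝ) < N := by exact_mod_cast hN
  have hi : 0 ≤ (Metric.ball (0 : Plane) (√N)).indicator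
      (fun z => (√N / ‖z‖) ^ (4 * s * q)) x := indicator_nonneg (fun z _ => by positivity) x
  have hρp : 0 ≤ ρ ^ p := by positivity
  -- At the origin the quotient √N/‖x‖ takes the junk value 0, but there a_N vanishes.
  rcases eq_or_ne x 0 with rfl | hx
  · rw [vecPot_zero, norm_zero]
    simp only [ne_eq, OfNat.ofNat_ne_zero, not_false_eq_true, zero_pow, mul_zero, zero_mul]
    linarith
  have hx' : 0 < ‖x‖ := norm_pos_iff.2 hx
  have hm : 0 < max ‖x‖ R := lt_max_of_lt_right hR
  have h1 := mul_le_mul_of_nonneg_right (pow_four_vecPot_le hN hR s x) hρ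
  have h2 : (√N / max ‖x‖ R) ^ (4 * s) ≤ (√N / ‖x‖) ^ (4 * s) := by
    gcongr
    exact le_max_left _ _
  have h3 := mul_le_mul_of_nonneg_right h2 hρ
  refine (h1.trans h3).trans ?_
  by_cases hb : x ∈ Metric.ball (0 : Plane) (√N)
  · rw [indicator_of_mem hb]
    have hy := Real.young_inequality_of_nonneg (a := (√N / ‖x‖) ^ (4 * s)) (b := ρ)
      (by positivity) hρ hpq.symm
    rw [← Real.rpow_mul (by positivity)] at hy
    have h4 : ρ ^ p / p ≤ ρ ^ p := div_le_self hρp hpq.lt.le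
    have h5 : (√N / ‖x‖) ^ (4 * s * q) / q ≤ (√N / ‖x‖) ^ (4 * s * q) :=
      div_le_self (by positivity) hpq.symm.lt.le
    linarith
  · rw [mem_ball_zero_iff, not_lt] at hb
    have h4 : (√N / ‖x‖) ^ (4 * s) ≤ 1 :=
      Real.rpow_le_one (by positivity) ((div_le_one hx').2 hb) (by positivity)
    have h5 := mul_le_mul_of_nonneg_right h4 hρ
    linarith

theorem integrableOn_ball_rpow {q : ℝ} (hq : q < 2) (M : ℝ) :
    IntegrableOn (fun z : Plane => (M / ‖z‖) ^ q) (Metric.ball 0 M) := by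
  by_cases hM : M < 0
  · rw [Metric.ball_eq_empty.2 hM.le]
    exact integrableOn_empty
  push Not at hM
  refine integrableOn_ball_of_norm_le_rpow (α := q) (C := M ^ q) (by simp) (by simpa using hq) ?_ ?_
  · refine Eventually.of_forall fun z => ?_
    rw [Real.norm_of_nonneg (by positivity), Real.div_rpow hM (norm_nonneg _),
      Real.rpow_neg (norm_nonneg _), div_eq_mul_inv]
  · exact ((measurable_const.div measurable_norm).pow_const q).aestronglyMeasurable

theorem integral_ball_rpow (q : ℝ) {M : ℝ} (hM : 0 < M) :
    ∫ z in Metric.ball (0 : Plane) M, (M / ‖z‖) ^ q =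
      M ^ 2 * ∫ z in Metric.ball (0 : Plane) 1, (1 / ‖z‖) ^ q := by
  have h := Measure.setIntegral_comp_smul_of_pos (volume : Measure Plane)
    (fun z : Plane => (M / ‖z‖) ^ q) (Metric.ball 0 1) hM
  rw [smul_unitBall_of_pos hM] at h
  have e : ∀ z : Plane, (M / ‖M • z‖) ^ q = (1 / ‖z‖) ^ q := fun z => by
    rw [norm_smul, Real.norm_of_nonneg hM.le, div_mul_eq_div_div, div_self hM.ne']
  simp only [e, smul_eq_mul] at h
  rw [h]
  simp
  field_simp

/-- The interaction of the square of `|a_N|²` with the density. -/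
theorem exists_integral_pow_four_le {s p : ℝ} (hs : 0 ≤ s) (hp : 1 < p)
    (hsp : s < 1 / 2 * (1 - 1 / p)) : ∃ c : ℝ, 0 ≤ c ∧ ∀ (N : ℕ), 0 < N → ∀ (R : ℝ), 0 < R →
      ∀ (ρ : Plane → ℝ) (D : ℝ), (∀ x, 0 ≤ ρ x) → Integrable ρ → ∫ x, ρ x = N →
        Integrable (fun x => ρ x ^ p) → ∫ x, ρ x ^ p ≤ D * N →
        ∀ x, ∫ y, ‖vecPot N R s (x - y)‖ ^ 4 * ρ y ≤ (c + D + 1) / (N : ℝ) ^ 3 := by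
  let q := p.conjExponent
  have hpq : p.HolderConjugate q := Real.HolderConjugate.conjExponent hp
  -- As 1/q = 1 - 1/p, the condition on s says exactly that |z|^{-4sq} is integrable near 0 in the
  -- plane.
  have hq : 4 * s * q < 2 := by
    have h1 : 1 - 1 / p = q⁻¹ := by
      have := hpq.inv_add_inv_eq_one
      rw [one_div]; linarith
    rw [h1] at hsp
    have hq0 : 0 < q := hpq.symm.pos
    have : s * q < 1 / 2 := by
      calc s * q < 1 / 2 * q⁻¹ * q := mul_lt_mul_of_pos_right hsp hq0
        _ = 1 / 2 := by field_simp
    linarith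
  refine ⟨∫ z in Metric.ball (0 : Plane) 1, (1 / ‖z‖) ^ (4 * s * q),
    integral_nonneg fun z => by positivity, ?_⟩
  intro N hN R hR ρ D hρ hint hρN hintp hD x
  have hN' : (0 : ℝ) < N := by exact_mod_cast hN
  set f : Plane → ℝ := (Metric.ball (0 : Plane) (√N)).indicator
    (fun z => (√N / ‖z‖) ^ (4 * s * q)) with hf
  have hfi : Integrable f := (integrable_indicator_iff Metric.isOpen_ball.measurableSet).2
    (integrableOn_ball_rpow hq _)
  have hfx : Integrable fun y => f (x - y) := hfi.comp_sub_left x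
  have h1 : ∫ y, (N : ℝ) ^ 4 * ‖vecPot N R s (x - y)‖ ^ 4 * ρ y ≤
      ∫ y, (f (x - y) + ρ y ^ p + ρ y) := by
    refine integral_mono_of_nonneg (Eventually.of_forall fun y => ?_) ((hfx.add hintp).add hint)
      (Eventually.of_forall fun y => pow_four_vecPot_mul_le hN hR hs hpq (x - y) (hρ y))
    exact mul_nonneg (by positivity) (hρ y)
  -- By scaling, the ball of radius √N contributes N times the integral over the unit ball, so all
  -- three terms are of order N.
  have h2 : ∫ y, (f (x - y) + ρ y ^ p + ρ y) =
      N * (∫ z in Metric.ball (0 : Plane) 1, (1 / ‖z‖) ^ (4 * s * q)) + (∫ y, ρ y ^ p) + N := by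
    rw [integral_add (f := fun y => f (x - y) + ρ y ^ p) (hfx.add hintp) hint,
      integral_add hfx hintp, hρN, integral_sub_left_eq_self f volume x, hf,
      integral_indicator Metric.isOpen_ball.measurableSet, integral_ball_rpow _ (by positivity),
      Real.sq_sqrt hN'.le]
  rw [h2] at h1
  simp only [mul_assoc] at h1
  rw [integral_const_mul] at h1
  rw [le_div_iff₀ (by positivity)]
  have h3 : (N : ℝ) * ((∫ y, ‖vecPot N R s (x - y)‖ ^ 4 * ρ y) * (N : ℝ) ^ 3) ≤
      N * ((∫ z in Metric.ball (0 : Plane) 1, (1 / ‖z‖) ^ (4 * (s * q))) + D + 1) := by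
    nlinarith
  have h4 := le_of_mul_le_mul_left h3 hN'
  simpa only [mul_assoc] using h4

end Size

/-! ### Lipschitz bounds for the vector potential, and the vanishing of its divergence. -/

section Regularity

/-- Real functions on the plane with a Lipschitz bound. -/
def IsLip (f : Plane → ℝ) : Prop := ∃ L : ℝ, 0 ≤ L ∧ ∀ x y, |f x - f y| ≤ L * ‖x - y‖

theorem IsLip.lipschitz {f : Plane → ℝ} (h : IsLip f) : ∃ L, LipschitzWith L f := by
  obtain ⟨L, hL, h⟩ := h
  refine ⟨⟨L, hL⟩, LipschitzWith.of_dist_le_mul fun x y => ?_⟩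
  rw [Real.dist_eq, dist_eq_norm]
  exact h x y

theorem IsLip.mul {f g : Plane → ℝ} (hf : IsLip f) (hg : IsLip g) {A B : ℝ}
    (hA : ∀ x, |f x| ≤ A) (hB : ∀ x, |g x| ≤ B) : IsLip fun x => f x * g x := by
  obtain ⟨L, hL, hf⟩ := hf
  obtain ⟨M, hM, hg⟩ := hg
  have hA0 : 0 ≤ A := (abs_nonneg _).trans (hA 0)
  have hB0 : 0 ≤ B := (abs_nonneg _).trans (hB 0)
  refine ⟨L * B + A * M, by positivity, fun x y => ?_⟩
  have e : f x * g x - f y * g y = (f x - f y) * g x + f y * (g x - g y) := by ring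
  rw [e]
  refine (abs_add_le _ _).trans ?_
  rw [abs_mul, abs_mul, add_mul]
  refine add_le_add ?_ ?_
  · calc |f x - f y| * |g x| ≤ (L * ‖x - y‖) * B :=
        mul_le_mul (hf x y) (hB x) (abs_nonneg _) (by positivity)
      _ = _ := by ring
  · calc |f y| * |g x - g y| ≤ A * (M * ‖x - y‖) :=
        mul_le_mul (hA y) (hg x y) (abs_nonneg _) hA0
      _ = _ := by ring

theorem IsLip.const_mul {f : Plane → ℝ} (hf : IsLip f) (k : ℝ) : IsLip fun x => k * f x := by
  obtain ⟨L, hL, hf⟩ := hf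
  refine ⟨|k| * L, by positivity, fun x y => ?_⟩
  rw [← mul_sub, abs_mul, mul_assoc]
  exact mul_le_mul_of_nonneg_left (hf x y) (abs_nonneg k)

theorem abs_max_sub_max_norm (x y : Plane) (R : ℝ) : |max ‖x‖ R - max ‖y‖ R| ≤ ‖x - y‖ := by
  refine (abs_max_sub_max_le_max _ _ _ _).trans ?_
  rw [sub_self, abs_zero]
  exact max_le (abs_norm_sub_norm_le x y) (norm_nonneg _)

variable {R : ℝ} (hR : 0 < R)

include hR

theorem abs_inv_max_le (x : Plane) : |(max ‖x‖ R)⁻¹| ≤ R⁻¹ := by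
  have hm : 0 < max ‖x‖ R := lt_max_of_lt_right hR
  rw [abs_of_pos (by positivity)]
  exact inv_anti₀ hR (le_max_right _ _)

theorem isLip_inv_max : IsLip fun x => (max ‖x‖ R)⁻¹ := by
  refine ⟨R⁻¹ * R⁻¹, by positivity, fun x y => ?_⟩
  have hx : 0 < max ‖x‖ R := lt_max_of_lt_right hR
  have hy : 0 < max ‖y‖ R := lt_max_of_lt_right hR
  rw [inv_sub_inv hx.ne' hy.ne', abs_div, div_eq_inv_mul, abs_mul, mul_inv, abs_sub_comm]
  have h1 := abs_inv_max_le hR x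
  have h2 := abs_inv_max_le hR y
  rw [abs_inv] at h1 h2
  exact mul_le_mul (mul_le_mul h1 h2 (by positivity) (by positivity))
    (abs_max_sub_max_norm x y R) (abs_nonneg _) (by positivity)

theorem abs_max_rpow_neg_le {s : ℝ} (hs : 0 ≤ s) (x : Plane) :
    |(max ‖x‖ R) ^ (-s)| ≤ R ^ (-s) := by
  have hm : 0 < max ‖x‖ R := lt_max_of_lt_right hR
  rw [abs_of_pos (by positivity)]
  exact Real.rpow_le_rpow_of_nonpos hR (le_max_right _ _) (by linarith)

theorem isLip_max_rpow_neg {s : ℝ} (hs : 0 ≤ s) : IsLip fun x => (max ‖x‖ R) ^ (-s) := by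
  refine ⟨s * R ^ (-s - 1), by positivity, fun x y => ?_⟩
  have key := Convex.norm_image_sub_le_of_norm_hasDerivWithin_le (s := Ici R)
    (f := fun r : ℝ => r ^ (-s)) (f' := fun r : ℝ => -s * r ^ (-s - 1)) (C := s * R ^ (-s - 1))
    (x := max ‖y‖ R) (y := max ‖x‖ R) (fun r hr => ?_) (fun r hr => ?_) (convex_Ici R)
    (mem_Ici.2 (le_max_right _ _)) (mem_Ici.2 (le_max_right _ _))
  · rw [Real.norm_eq_abs, Real.norm_eq_abs] at key
    exact key.trans (mul_le_mul_of_nonneg_left (abs_max_sub_max_norm x y R) (by positivity))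
  · have hr0 : r ≠ 0 := (hR.trans_le hr).ne'
    exact (Real.hasDerivAt_rpow_const (Or.inl hr0)).hasDerivWithinAt
  · have hr0 : 0 < r := hR.trans_le hr
    rw [norm_mul, norm_neg, Real.norm_of_nonneg hs, Real.norm_of_nonneg (by positivity)]
    exact mul_le_mul_of_nonneg_left
      (Real.rpow_le_rpow_of_nonpos hR hr (by linarith)) hs

omit hR in
theorem abs_perp_le (x : Plane) (c : Fin 2) : |perp x c| ≤ ‖x‖ := by
  rw [← norm_perp, ← Real.norm_eq_abs]
  exact PiLp.norm_apply_le _ _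

omit hR in
theorem perp_sub (x y : Plane) : perp (x - y) = perp x - perp y := by
  ext c
  fin_cases c
  · simp [perp]; ring_nf
  · simp [perp]

theorem abs_perp_mul_inv_le (x : Plane) (c : Fin 2) : |perp x c * (max ‖x‖ R)⁻¹| ≤ 1 := by
  have hm : 0 < max ‖x‖ R := lt_max_of_lt_right hR
  rw [abs_mul, abs_inv, abs_of_pos hm, ← div_eq_mul_inv]
  exact (div_le_one hm).2 ((abs_perp_le x c).trans (le_max_left _ _))

theorem isLip_perp_mul_inv (c : Fin 2) : IsLip fun x => perp x c * (max ‖x‖ R)⁻¹ := by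
  refine ⟨2 * R⁻¹, by positivity, fun x y => ?_⟩
  have hx : 0 < max ‖x‖ R := lt_max_of_lt_right hR
  have hy : 0 < max ‖y‖ R := lt_max_of_lt_right hR
  -- The unbounded factor y^⊥ is kept together with its inverse maximum, whose product with it is at
  -- most 1.
  have e : perp x c * (max ‖x‖ R)⁻¹ - perp y c * (max ‖y‖ R)⁻¹ =
      perp (x - y) c * (max ‖x‖ R)⁻¹ +
        (perp y c * (max ‖y‖ R)⁻¹) * ((max ‖y‖ R - max ‖x‖ R) * (max ‖x‖ R)⁻¹) := by
    have : perp (x - y) c = perp x c - perp y c := by rw [perp_sub]; rfl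
    rw [this]
    field_simp
    ring
  rw [e]
  refine (abs_add_le _ _).trans ?_
  have h1 : |perp (x - y) c * (max ‖x‖ R)⁻¹| ≤ ‖x - y‖ * R⁻¹ := by
    rw [abs_mul]
    exact mul_le_mul (abs_perp_le _ c) (abs_inv_max_le hR x) (abs_nonneg _) (norm_nonneg _)
  have h2 : |(perp y c * (max ‖y‖ R)⁻¹) * ((max ‖y‖ R - max ‖x‖ R) * (max ‖x‖ R)⁻¹)| ≤
      1 * (‖x - y‖ * R⁻¹) := by
    rw [abs_mul, abs_mul (max ‖y‖ R - max ‖x‖ R)]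
    refine mul_le_mul (abs_perp_mul_inv_le hR y c) ?_ (by positivity) zero_le_one
    refine mul_le_mul ?_ (abs_inv_max_le hR x) (abs_nonneg _) (norm_nonneg _)
    rw [abs_sub_comm]
    exact abs_max_sub_max_norm x y R
  linarith

theorem vecPot_apply (N : ℕ) (s : ℝ) (x : Plane) (c : Fin 2) :
    vecPot N R s x c = (N : ℝ) ^ (s / 2 - 1) *
      ((perp x c * (max ‖x‖ R)⁻¹) * (max ‖x‖ R) ^ (-s)) := by
  have hm : 0 < max ‖x‖ R := lt_max_of_lt_right hR
  rw [vecPot, PiLp.smul_apply, smul_eq_mul, Real.rpow_add hm, Real.rpow_one, mul_inv,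
    Real.rpow_neg hm.le]
  ring

theorem isLip_vecPot (N : ℕ) {s : ℝ} (hs : 0 ≤ s) (c : Fin 2) :
    IsLip fun x => vecPot N R s x c := by
  simp only [vecPot_apply hR]
  exact ((isLip_perp_mul_inv hR c).mul (isLip_max_rpow_neg hR hs) (fun x => abs_perp_mul_inv_le hR x c)
    (fun x => abs_max_rpow_neg_le hR hs x)).const_mul _

theorem isMult_vecPot (N : ℕ) {s : ℝ} (hs : 0 ≤ s) (c : Fin 2) :
    IsMult fun x => vecPot N R s x c := by
  refine ⟨?_, (N : ℝ) ^ (s / 2 - 1) * (1 * R ^ (-s)), fun x => ?_⟩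
  · obtain ⟨L, hL⟩ := (isLip_vecPot hR N hs c).lipschitz
    exact hL.continuous.measurable
  · beta_reduce
    rw [vecPot_apply hR, abs_mul, abs_mul, abs_of_nonneg (Real.rpow_nonneg (Nat.cast_nonneg N) _)]
    refine mul_le_mul_of_nonneg_left ?_ (by positivity)
    exact mul_le_mul (abs_perp_mul_inv_le hR x c) (abs_max_rpow_neg_le hR hs x) (abs_nonneg _)
      zero_le_one

omit hR in
theorem norm_sq_vecPot (N : ℕ) (R s : ℝ) (x : Plane) :
    ‖vecPot N R s x‖ ^ 2 = ∑ c, vecPot N R s x c ^ 2 := by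
  rw [EuclideanSpace.norm_sq_eq]
  simp

omit hR in
theorem perp_neg (x : Plane) : perp (-x) = -perp x := by
  ext c
  fin_cases c <;> simp [perp]

omit hR in
theorem vecPot_neg (N : ℕ) (R s : ℝ) (x : Plane) : vecPot N R s (-x) = -vecPot N R s x := by
  rw [vecPot, vecPot, norm_neg, perp_neg, smul_neg]

omit hR in
theorem norm_add_smul_perp (x : Plane) (t : ℝ) : ‖x + t • perp x‖ = ‖x + (-t) • perp x‖ := by
  rw [EuclideanSpace.norm_eq, EuclideanSpace.norm_eq]
  congr 1
  simp [perp, Fin.sum_univ_two]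
  ring_nf

/-- A radial function has no derivative in the direction `x^⊥`. -/
theorem vecPot_div (N : ℕ) {s : ℝ} (hs : 0 ≤ s) :
    ∀ᵐ x, ∑ c, lineDeriv ℝ (fun x => vecPot N R s x c) x (dir c) = 0 := by
  set φ : Plane → ℝ := fun x => (max ‖x‖ R)⁻¹ * (max ‖x‖ R) ^ (-s) with hφ
  have hlip : IsLip φ := (isLip_inv_max hR).mul (isLip_max_rpow_neg hR hs)
    (fun x => abs_inv_max_le hR x) (fun x => abs_max_rpow_neg_le hR hs x)
  obtain ⟨L, hL⟩ := hlip.lipschitz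
  filter_upwards [hL.ae_differentiableAt] with x hx
  set k : ℝ := (N : ℝ) ^ (s / 2 - 1) with hk
  have hv : ∀ c, (fun x => vecPot N R s x c) = fun x => k * (perp x c * φ x) := fun c => by
    funext y
    rw [vecPot_apply hR, hφ]
    ring
  have hline : ∀ v : Plane, HasDerivAt (fun t : ℝ => φ (x + t • v)) (fderiv ℝ φ x v) 0 := fun v =>
    hx.hasFDerivAt.hasLineDerivAt v
  -- Along the first axis the first component of x^⊥ is constant, so the derivative falls on the
  -- radial factor only; the same holds for the second axis.
  have h0 : lineDeriv ℝ (fun x => vecPot N R s x 0) x (dir 0) =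
      k * (-(x 1) * fderiv ℝ φ x (dir 0)) := by
    rw [hv]
    refine HasDerivAt.deriv ?_
    refine ((HasDerivAt.const_mul (-(x 1)) (hline (dir 0))).const_mul k).congr_of_eventuallyEq ?_
    refine Eventually.of_forall fun t => ?_
    simp [perp, dir]
  have h1 : lineDeriv ℝ (fun x => vecPot N R s x 1) x (dir 1) =
      k * (x 0 * fderiv ℝ φ x (dir 1)) := by
    rw [hv]
    refine HasDerivAt.deriv ?_
    refine ((HasDerivAt.const_mul (x 0) (hline (dir 1))).const_mul k).congr_of_eventuallyEq ?_
    refine Eventually.of_forall fun t => ?_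
    simp [perp, dir]
  -- Since ‖x + t x^⊥‖ is even in t, this derivative of the radial function φ equals its own
  -- opposite.
  have hrot : fderiv ℝ φ x (perp x) = 0 := by
    have d1 := hline (perp x)
    have d2 : HasDerivAt (fun t : ℝ => φ (x + t • perp x)) (-(fderiv ℝ φ x (perp x))) 0 := by
      have e : (fun t : ℝ => φ (x + t • perp x)) = fun t : ℝ => φ (x + (-t) • perp x) := by
        funext t
        simp only [hφ, norm_add_smul_perp x t]
      rw [e]
      have := HasDerivAt.scomp (h := fun t : ℝ => -t) (h' := -1) (0 : ℝ)
        (g₁ := fun t : ℝ => φ (x + t • perp x)) (g₁' := fderiv ℝ φ x (perp x))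
        (by simpa using d1) (hasDerivAt_neg (0 : ℝ))
      simpa [Function.comp_def] using this
    have := d1.unique d2
    linarith
  have hdec : perp x = (-(x 1)) • dir 0 + x 0 • dir 1 := by
    ext c
    fin_cases c <;> simp [perp, dir]
  rw [hdec, map_add, map_smul, map_smul, smul_eq_mul, smul_eq_mul] at hrot
  rw [Fin.sum_univ_two, h0, h1, ← mul_add, hrot, mul_zero]

end Regularity

section MeanRegularity

variable {ι : Type*} [Fintype ι] (u : ι → L2 Plane)

theorem isLip_convDens {γ : Plane → ℝ} (hγ : IsMult γ) (hl : IsLip γ) : IsLip (convDens u γ) := by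
  obtain ⟨L, hL, hl⟩ := hl
  refine ⟨L * ∫ y, dens u y,
    mul_nonneg hL (integral_nonneg fun y => dens_nonneg u y), fun x z => ?_⟩
  rw [convDens, convDens, ← integral_sub (integrable_conv u hγ x) (integrable_conv u hγ z),
    ← Real.norm_eq_abs, mul_right_comm, ← integral_const_mul]
  refine norm_integral_le_of_norm_le ((integrable_dens u).const_mul _)
    (Eventually.of_forall fun y => ?_)
  rw [← sub_mul, norm_mul, Real.norm_eq_abs, Real.norm_eq_abs, abs_of_nonneg (dens_nonneg u y)]
  refine mul_le_mul_of_nonneg_right ?_ (dens_nonneg u y)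
  have := hl (x - y) (z - y)
  rwa [sub_sub_sub_cancel_right] at this

/-- Differentiation under the integral: the translates of γ are differentiable for almost every y by
Rademacher's theorem, and the Lipschitz constant times the density dominates. -/
theorem lineDeriv_convDens {γ : Plane → ℝ} (hγ : IsMult γ) (hl : IsLip γ) (x v : Plane) :
    lineDeriv ℝ (convDens u γ) x v = ∫ y, lineDeriv ℝ γ (x - y) v * dens u y := by
  obtain ⟨L, hL⟩ := hl.lipschitz
  have hd : ∀ᵐ y, DifferentiableAt ℝ γ (x - y) :=
    (volume.measurePreserving_sub_left x).quasiMeasurePreserving.ae hL.ae_differentiableAt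
  have key := hasDerivAt_integral_of_dominated_loc_of_lip (μ := (volume : Measure Plane))
    (F := fun (t : ℝ) (y : Plane) => γ (x + t • v - y) * dens u y) (x₀ := (0 : ℝ)) (s := univ)
    (F' := fun y => lineDeriv ℝ γ (x - y) v * dens u y)
    (bound := fun y => L * ‖v‖ * dens u y) univ_mem ?_ ?_ ?_ ?_ ?_ ?_
  · exact key.2.deriv
  · exact Eventually.of_forall fun t => (integrable_conv u hγ _).aestronglyMeasurable
  · simpa using integrable_conv u hγ x
  · exact (((isMult_lineDeriv hL v).1.comp (measurable_const.sub measurable_id)).mul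
      (measurable_dens u)).aestronglyMeasurable
  · refine Eventually.of_forall fun y => ?_
    refine LipschitzWith.lipschitzOnWith (LipschitzWith.of_dist_le_mul fun t r => ?_)
    rw [Real.coe_nnabs, Real.dist_eq, ← sub_mul, abs_mul, abs_mul,
      abs_of_nonneg (by positivity : 0 ≤ L * ‖v‖), mul_right_comm]
    refine mul_le_mul_of_nonneg_right ?_ (abs_nonneg _)
    have := hL.dist_le_mul (x + t • v - y) (x + r • v - y)
    rw [Real.dist_eq] at this
    refine this.trans (le_of_eq ?_)
    rw [dist_eq_norm, Real.dist_eq, sub_sub_sub_cancel_right, add_sub_add_left_eq_sub, ← sub_smul,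
      norm_smul, Real.norm_eq_abs]
    ring
  · exact (integrable_dens u).const_mul _
  · filter_upwards [hd] with y hy
    have h1 := hy.hasFDerivAt.hasLineDerivAt v
    have h2 : HasDerivAt (fun t : ℝ => γ (x + t • v - y)) (lineDeriv ℝ γ (x - y) v) 0 := by
      rw [h1.lineDeriv]
      have e : (fun t : ℝ => γ (x + t • v - y)) = fun t : ℝ => γ (x - y + t • v) := by
        funext t
        congr 1
        abel
      rw [e]
      exact h1
    exact h2.mul_const _

theorem convDens_div {a : Fin 2 → Plane → ℝ} (ha : ∀ c, IsMult (a c)) (hl : ∀ c, IsLip (a c))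
    (hdiv : ∀ᵐ x, ∑ c, lineDeriv ℝ (a c) x (dir c) = 0) (x : Plane) :
    ∑ c, lineDeriv ℝ (convDens u (a c)) x (dir c) = 0 := by
  simp only [lineDeriv_convDens u (ha _) (hl _)]
  rw [← integral_finsetSum]
  · refine integral_eq_zero_of_ae ?_
    have hd : ∀ᵐ y, ∑ c, lineDeriv ℝ (a c) (x - y) (dir c) = 0 :=
      (volume.measurePreserving_sub_left x).quasiMeasurePreserving.ae hdiv
    filter_upwards [hd] with y hy
    rw [← Finset.sum_mul, hy, zero_mul]
    rfl
  · intro c _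
    obtain ⟨L, hL⟩ := (hl c).lipschitz
    exact integrable_conv u (isMult_lineDeriv hL (dir c)) x

end MeanRegularity

/-! ### The mean field of the vector potential -/

section ConvBounds

variable {ι : Type*} [Fintype ι] (u : ι → L2 Plane)

theorem convDens_mono {γ δ : Plane → ℝ} (hγ : IsMult γ) (hδ : IsMult δ) (h : ∀ z, γ z ≤ δ z)
    (x : Plane) : convDens u γ x ≤ convDens u δ x :=
  integral_mono (integrable_conv u hγ x) (integrable_conv u hδ x) fun y =>
    mul_le_mul_of_nonneg_right (h _) (dens_nonneg u y)

theorem convDens_const_mul (r : ℝ) (γ : Plane → ℝ) (x : Plane) :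
    convDens u (fun z => r * γ z) x = r * convDens u γ x := by
  simp only [convDens, mul_assoc, integral_const_mul]

theorem convDens_add {γ δ : Plane → ℝ} (hγ : IsMult γ) (hδ : IsMult δ) (x : Plane) :
    convDens u (fun z => γ z + δ z) x = convDens u γ x + convDens u δ x := by
  simp only [convDens, add_mul]
  exact integral_add (integrable_conv u hγ x) (integrable_conv u hδ x)

theorem abs_convDens_le {γ δ : Plane → ℝ} (hγ : IsMult γ) (hδ : IsMult δ) (h : ∀ z, |γ z| ≤ δ z)
    (x : Plane) : |convDens u γ x| ≤ convDens u δ x := by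
  refine abs_le.2 ⟨?_, convDens_mono u hγ hδ (fun z => (le_abs_self _).trans (h z)) x⟩
  have h1 := convDens_mono u (hδ.const_mul (-1)) hγ
    (fun z => by linarith [neg_abs_le (γ z), h z]) x
  rw [convDens_const_mul] at h1
  linarith

end ConvBounds

section VectorPotential

variable {n : ℕ} {u : Fin (n + 1) → L2 Plane} {R s C C' : ℝ}
  {u₁ u₂ : Fin 2 → Fin (n + 1) → L2 Plane}

theorem isMult_norm_sq_vecPot (N : ℕ) (hR : 0 < R) (hs : 0 ≤ s) :
    IsMult fun z => ‖vecPot N R s z‖ ^ 2 := by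
  simp only [norm_sq_vecPot]
  simp only [sq]
  exact IsMult.sum _ fun c _ => (isMult_vecPot hR N hs c).mul (isMult_vecPot hR N hs c)

theorem abs_vecPot_le (N : ℕ) (R s : ℝ) (x : Plane) (c : Fin 2) :
    |vecPot N R s x c| ≤ ‖vecPot N R s x‖ := by
  rw [← Real.norm_eq_abs]
  exact PiLp.norm_apply_le _ _

/-- The fourth power controls the lower ones because the density has total mass N: 2|a|² ≤ N²|a|⁴ +
N⁻² and 2|a| ≤ N|a|² + N⁻¹. Hence |a|² ∗ ρ ≤ (C + 1)/N and |a| ∗ ρ ≤ C + 1, so C' ≥ C + 1 serves all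
the bounds at once. -/
theorem meanField_vecPot (hu : Orthonormal ℂ u) (hR : 0 < R) (hs : 0 ≤ s)
    (h4 : ∀ x, ∫ y, ‖vecPot (n + 1) R s (x - y)‖ ^ 4 * dens u y ≤ C / ((n + 1 : ℕ) : ℝ) ^ 3)
    (hC : 0 ≤ C) (hC' : C + 1 ≤ C')
    (mom₁ : ∀ c j, HasMom (dir c) (u j) (u₁ c j))
    (mom₂ : ∀ c j, HasMom (dir c) (u₁ c j) (u₂ c j))
    (sum₁ : ∀ c, ∑ j, ‖u₁ c j‖ ^ 2 ≤ C' * (n + 1))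
    (sum₂ : ∑ j, ‖∑ c, u₂ c j‖ ^ 2 ≤ C' * (n + 1)) :
    MeanField C' u (fun c x => vecPot (n + 1) R s x c)
      (fun x => (n + 1) * ‖vecPot (n + 1) R s x‖ ^ 2) u₁ u₂ := by
  have hM : (0 : ℝ) < n + 1 := by positivity
  have hm := isMult_norm_sq_vecPot (n + 1) hR hs
  have hmc := isMult_vecPot hR (n + 1) hs
  have hone := convDens_one hu
  have h4' : ∀ x, convDens u (fun z => (‖vecPot (n + 1) R s z‖ ^ 2) ^ 2) x ≤ C / (n + 1) ^ 3 := by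
    intro x
    have := h4 x
    simp only [convDens, ← pow_mul]
    push_cast at this
    exact this
  have hm4 : IsMult fun z => (‖vecPot (n + 1) R s z‖ ^ 2) ^ 2 := by
    simpa only [sq] using hm.mul hm
  have h2 : ∀ x, convDens u (fun z => ‖vecPot (n + 1) R s z‖ ^ 2) x ≤ (C + 1) / (n + 1) := by
    intro x
    have h := convDens_mono u (hm.const_mul 2)
      ((hm4.const_mul ((n + 1 : ℝ) ^ 2)).add (isMult_const (((n + 1 : ℝ) ^ 2)⁻¹ * 1)))
      (fun z => by
        have := sq_nonneg ((n + 1 : ℝ) * ‖vecPot (n + 1) R s z‖ ^ 2 - (n + 1 : ℝ)⁻¹)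
        have e : (n + 1 : ℝ) * (n + 1 : ℝ)⁻¹ = 1 := mul_inv_cancel₀ hM.ne'
        rw [mul_one, ← inv_pow]
        nlinarith) x
    rw [convDens_const_mul, convDens_add u (hm4.const_mul _) (isMult_const _), convDens_const_mul,
      convDens_const_mul, hone] at h
    have h5 := mul_le_mul_of_nonneg_left (h4' x) (by positivity : (0 : ℝ) ≤ (n + 1) ^ 2)
    have e1 : (n + 1 : ℝ) ^ 2 * (C / (n + 1) ^ 3) = C / (n + 1) := by field_simp
    have e2 : ((n + 1 : ℝ) ^ 2)⁻¹ * (n + 1) = 1 / (n + 1) := by field_simp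
    rw [e1] at h5
    rw [e2] at h
    rw [add_div]
    have : 0 ≤ C / (n + 1) := by positivity
    have : (0 : ℝ) ≤ 1 / (n + 1) := by positivity
    linarith
  have hC1 : (C + 1) / (n + 1) ≤ C' / (n + 1) := by gcongr
  have h1 : ∀ c x, |convDens u (fun z => vecPot (n + 1) R s z c) x| ≤ C' := by
    intro c x
    refine (abs_convDens_le u (hmc c)
      (((hm.const_mul (n + 1 : ℝ)).add (isMult_const ((n + 1 : ℝ)⁻¹ * 1))).const_mul (1 / 2))
      (fun z => ?_) x).trans ?_
    · refine (abs_vecPot_le _ _ _ _ _).trans ?_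
      have := sq_nonneg ((n + 1 : ℝ) * ‖vecPot (n + 1) R s z‖ - 1)
      have e : (n + 1 : ℝ) * (n + 1 : ℝ)⁻¹ = 1 := mul_inv_cancel₀ hM.ne'
      have hi : (0 : ℝ) < (n + 1 : ℝ)⁻¹ := by positivity
      have h3 := mul_nonneg hi.le this
      have e3 : (n + 1 : ℝ)⁻¹ * ((n + 1 : ℝ) * ‖vecPot (n + 1) R s z‖ - 1) ^ 2 =
          (n + 1) * ‖vecPot (n + 1) R s z‖ ^ 2 - 2 * ‖vecPot (n + 1) R s z‖ + (n + 1 : ℝ)⁻¹ := by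
        field_simp
        ring
      linarith
    · rw [convDens_const_mul, convDens_add u (hm.const_mul _) (isMult_const _), convDens_const_mul,
        convDens_const_mul, hone, inv_mul_cancel₀ hM.ne']
      have := mul_le_mul_of_nonneg_left (h2 x) hM.le
      rw [mul_div_cancel₀ _ hM.ne'] at this
      linarith
  refine ⟨fun c => ⟨hmc c, fun x => ?_, fun x => ?_⟩, ⟨hm.const_mul _, fun x => ?_, fun x => ?_⟩,
    fun x => ?_, fun c => (isLip_vecPot hR _ hs c).lipschitz, vecPot_div hR _ hs,
    fun c => (isLip_convDens u (hmc c) (isLip_vecPot hR _ hs c)).lipschitz,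
    Eventually.of_forall (convDens_div u hmc (fun c => isLip_vecPot hR _ hs c) (vecPot_div hR _ hs)),
    h1, fun x => ?_, mom₁, mom₂, sum₁, sum₂⟩
  · rw [vecPot_neg, PiLp.neg_apply, abs_neg]
  · refine (convDens_mono u (by simpa only [sq] using (hmc c).mul (hmc c)) hm (fun z => ?_) x).trans
      ((h2 x).trans hC1)
    rw [← sq_abs]
    exact pow_le_pow_left₀ (abs_nonneg _) (abs_vecPot_le _ _ _ _ _) 2
  · rw [vecPot_neg, norm_neg]
  · simp only [mul_pow _ (‖vecPot (n + 1) R s _‖ ^ 2)]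
    rw [convDens_const_mul]
    have h5 := mul_le_mul_of_nonneg_left (h4' x) (by positivity : (0 : ℝ) ≤ (n + 1) ^ 2)
    have e1 : (n + 1 : ℝ) ^ 2 * (C / (n + 1) ^ 3) = C / (n + 1) := by field_simp
    rw [e1] at h5
    refine h5.trans (le_trans ?_ hC1)
    gcongr
    linarith
  · rw [norm_sq_vecPot]
  · refine (abs_convDens_le u (hm.const_mul _) (hm.const_mul _)
      (fun z => (abs_of_nonneg (by positivity)).le) x).trans ?_
    rw [convDens_const_mul]
    have := mul_le_mul_of_nonneg_left (h2 x) hM.le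
    rw [mul_div_cancel₀ _ hM.ne'] at this
    linarith

end VectorPotential

/-! ### Sobolev functions and the Hamiltonian -/

section SobolevBasics

variable {V : Type*} [NormedAddCommGroup V] [NormedSpace ℝ V] [MeasureSpace V]

theorem MemSobolev.memLp {k : ℕ} {f : V → ℂ} (h : MemSobolev k f) : MemLp f 2 volume := by
  cases k with
  | zero => exact h
  | succ k => exact h.1

theorem MemSobolev.of_succ {k : ℕ} {f : V → ℂ} (h : MemSobolev (k + 1) f) : MemSobolev k f := by
  induction k generalizing f with
  | zero => exact h.1
  | succ k ih =>
    refine ⟨h.1, fun v => ?_⟩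
    obtain ⟨g, hg, hgk⟩ := h.2 v
    exact ⟨g, hg, ih hgk⟩

theorem MemSobolev.mono {k m : ℕ} (hkm : k ≤ m) {f : V → ℂ} (h : MemSobolev m f) :
    MemSobolev k f := by
  induction m, hkm using Nat.le_induction with
  | base => exact h
  | succ m _ ih => exact ih h.of_succ

end SobolevBasics

section Bridge

variable {V : Type*} [NormedAddCommGroup V] [NormedSpace ℝ V] [FiniteDimensional ℝ V]
  [MeasureSpace V] [BorelSpace V] [(volume : Measure V).IsAddHaarMeasure]

theorem MemSobolev.congr {k : ℕ} {f g : V → ℂ} (h : MemSobolev k f) (hfg : f =ᵐ[volume] g) :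
    MemSobolev k g := by
  cases k with
  | zero => exact MemLp.ae_eq hfg h
  | succ k =>
    refine ⟨h.1.ae_eq hfg, fun v => ?_⟩
    obtain ⟨f', hf', hk⟩ := h.2 v
    exact ⟨f', hf'.congr hfg EventuallyEq.rfl, hk⟩

theorem MemSobolev.exists_hasSD {k : ℕ} {f : V → ℂ} (h : MemSobolev (k + 1) f) {F : L2 V}
    (hF : F =ᵐ[volume] f) (v : V) : ∃ F' : L2 V, HasSD v F F' ∧ MemSobolev k F' := by
  obtain ⟨f', hf', hk⟩ := h.2 v
  refine ⟨hk.memLp.toLp f', ?_, hk.congr hk.memLp.coeFn_toLp.symm⟩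
  exact hasSD_of_hasWeakDeriv (hf'.congr hF.symm hk.memLp.coeFn_toLp.symm)

theorem MemSobolev.exists_hasMom {f : V → ℂ} (h : MemSobolev 2 f) {F : L2 V}
    (hF : F =ᵐ[volume] f) (v : V) : ∃ F₁ F₂ : L2 V, HasMom v F F₁ ∧ HasMom v F₁ F₂ := by
  obtain ⟨F', hF', hk⟩ := h.exists_hasSD hF v
  obtain ⟨F'', hF'', -⟩ := hk.exists_hasSD EventuallyEq.rfl v
  exact ⟨_, _, hF'.hasMom, hF''.hasMom.const_smul _⟩

theorem HasMom.weakDeriv_eq {v : V} {F F₁ : L2 V} (h : HasMom v F F₁) {f : V → ℂ}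
    (hF : F =ᵐ[volume] f) : weakDeriv v f =ᵐ[volume] fun x => Complex.I * F₁ x := by
  refine (HasSD.weakDeriv_eq h hF).trans ?_
  filter_upwards [Lp.coeFn_smul Complex.I F₁] with x hx
  rw [hx]
  rfl

theorem HasMom.magMomentum {v : V} {F F₁ : L2 V} (h : HasMom v F F₁) {f : V → ℂ}
    (hF : F =ᵐ[volume] f) {A : V → ℝ} (hA : IsMult A) :
    ⇑(F₁ + MagneticFermions.mulOp A F) =ᵐ[volume] MagneticFermions.magMomentum v A f := by
  filter_upwards [Lp.coeFn_add F₁ (MagneticFermions.mulOp A F), mulOp_coe' hA F hF,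
    h.weakDeriv_eq hF] with x h1 h2 h3
  rw [h1, Pi.add_apply, h2, MagneticFermions.magMomentum, h3, ← mul_assoc, neg_mul,
    Complex.I_mul_I, neg_neg, one_mul]

/-- The square of a magnetic momentum. -/
theorem exists_magMomentum_sq {v : V} {F F₁ F₂ : L2 V} (h₁ : HasMom v F F₁) (h₂ : HasMom v F₁ F₂)
    {f : V → ℂ} (hF : F =ᵐ[volume] f) {A : V → ℝ} (hA : IsMult A)
    (hL : ∃ L, LipschitzWith L A) : ∃ H : L2 V,
      H =ᵐ[volume] magMomentum v A (magMomentum v A f) ∧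
      ∀ G G₁ : L2 V, HasMom v G G₁ → ⟪G, H⟫_ℂ = ⟪G₁ + mulOp A G, F₁ + mulOp A F⟫_ℂ := by
  obtain ⟨L, hL⟩ := hL
  have hm := h₂.add (h₁.mulOp hA hL)
  refine ⟨_, HasMom.magMomentum hm (HasMom.magMomentum h₁ hF hA) hA, fun G G₁ hG => ?_⟩
  rw [inner_add_right, ← hG.inner_eq hm, ← inner_mulOp_left hA, ← inner_add_left]

end Bridge

section LipschitzSums

theorem exists_lipschitz_sum {X ι : Type*} [PseudoMetricSpace X] (s : Finset ι) {f : ι → X → ℝ}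
    (h : ∀ i ∈ s, ∃ L, LipschitzWith L (f i)) : ∃ L, LipschitzWith L fun x => ∑ i ∈ s, f i x := by
  classical
  induction s using Finset.induction_on with
  | empty => exact ⟨0, by simp⟩
  | insert a s ha ih =>
    obtain ⟨L, hL⟩ := h a (by simp)
    obtain ⟨M, hM⟩ := ih fun i hi => h i (by simp [hi])
    exact ⟨L + M, by simpa only [Finset.sum_insert ha] using hL.add hM⟩

theorem exists_lipschitz_const_mul {X : Type*} [PseudoMetricSpace X] (b : ℝ) {f : X → ℝ}
    (h : ∃ L, LipschitzWith L f) : ∃ L, LipschitzWith L fun x => b * f x := by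
  obtain ⟨L, hL⟩ := h
  exact ⟨_, (lipschitzWith_smul b).comp hL⟩

end LipschitzSums

/-! ### The Hamiltonian on H² and its quadratic form. -/

section Hamiltonian

variable {n : ℕ} {R s β g : ℝ}

theorem IsMult.pair' {γ : Plane → ℝ} (hγ : IsMult γ) (j k : Fin (n + 1)) :
    IsMult fun x : Config (n + 1) => γ (x j - x k) :=
  hγ.comp ((measurable_pi_apply j).sub (measurable_pi_apply k))

theorem lipschitz_sub_apply {a : Plane → ℝ} (h : ∃ L, LipschitzWith L a) (j k : Fin (n + 1)) :
    ∃ L, LipschitzWith L fun x : Config (n + 1) => a (x j - x k) := by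
  obtain ⟨L, hL⟩ := h
  let D : Config (n + 1) →L[ℝ] Plane :=
    ContinuousLinearMap.proj (R := ℝ) (φ := fun _ : Fin (n + 1) => Plane) j -
      ContinuousLinearMap.proj (R := ℝ) (φ := fun _ : Fin (n + 1) => Plane) k
  exact ⟨_, hL.comp D.lipschitz⟩

theorem manyBodyPot_apply (N : ℕ) (R s β : ℝ) (j : Fin N) (x : Config N) (c : Fin 2) :
    manyBodyPot N R s β j x c = β * ∑ k ∈ Finset.univ.erase j, vecPot N R s (x j - x k) c := by
  simp [manyBodyPot]

theorem isMult_manyBodyPot (hR : 0 < R) (hs : 0 ≤ s) (j : Fin (n + 1)) (c : Fin 2) :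
    IsMult fun x => manyBodyPot (n + 1) R s β j x c := by
  simp only [manyBodyPot_apply]
  exact (IsMult.sum _ fun k _ => (isMult_vecPot hR _ hs c).pair' j k).const_mul β

theorem lipschitz_manyBodyPot (hR : 0 < R) (hs : 0 ≤ s) (j : Fin (n + 1)) (c : Fin 2) :
    ∃ L, LipschitzWith L fun x => manyBodyPot (n + 1) R s β j x c := by
  simp only [manyBodyPot_apply]
  exact exists_lipschitz_const_mul β (exists_lipschitz_sum _ fun k _ =>
    lipschitz_sub_apply (isLip_vecPot hR _ hs c).lipschitz j k)

/-- The repulsive two-body potential of the Hamiltonian. -/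
def pairEnergy (N : ℕ) (R s g : ℝ) (x : Config N) : ℝ :=
  g / 2 * N * ∑ j : Fin N, ∑ k ∈ Finset.univ.erase j, ‖vecPot N R s (x j - x k)‖ ^ 2

theorem isMult_pairEnergy (hR : 0 < R) (hs : 0 ≤ s) : IsMult (pairEnergy (n + 1) R s g) :=
  (IsMult.sum _ fun j _ => IsMult.sum _ fun k _ =>
    (isMult_norm_sq_vecPot (n + 1) hR hs).pair' j k).const_mul _

theorem coeFn_sum_ae {X ι : Type*} [MeasureSpace X] (s : Finset ι) {F : ι → L2 X}
    {f : ι → X → ℂ} (h : ∀ i ∈ s, F i =ᵐ[volume] f i) :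
    ⇑(∑ i ∈ s, F i) =ᵐ[volume] fun x => ∑ i ∈ s, f i x := by
  classical
  induction s using Finset.induction_on with
  | empty => exact Lp.coeFn_zero ℂ 2 volume
  | insert a s ha ih =>
    rw [Finset.sum_insert ha]
    filter_upwards [Lp.coeFn_add (F a) (∑ i ∈ s, F i), h a (by simp),
      ih fun i hi => h i (by simp [hi])] with x h1 h2 h3
    rw [h1, Pi.add_apply, h2, h3, Finset.sum_insert ha]

/-- For R > 0 the potentials are bounded and Lipschitz, so H² is mapped into L² and each magnetic
momentum can be moved once to the other side of the form. -/
theorem exists_hamiltonian (hR : 0 < R) (hs : 0 ≤ s) {Ψ : Config (n + 1) → ℂ}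
    {F : L2 (Config (n + 1))} (hF : F =ᵐ[volume] Ψ)
    {F₁ F₂ : Fin (n + 1) → Fin 2 → L2 (Config (n + 1))}
    (h₁ : ∀ j c, HasMom (dirN j c) F (F₁ j c)) (h₂ : ∀ j c, HasMom (dirN j c) (F₁ j c) (F₂ j c)) :
    ∃ H : L2 (Config (n + 1)), H =ᵐ[volume] hamiltonian (n + 1) R s β g Ψ ∧
      ⟪F, H⟫_ℂ = ∑ j, ∑ c, ⟪F₁ j c + mulOp (fun x => manyBodyPot (n + 1) R s β j x c) F,
        F₁ j c + mulOp (fun x => manyBodyPot (n + 1) R s β j x c) F⟫_ℂ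
        + ⟪F, mulOp (pairEnergy (n + 1) R s g) F⟫_ℂ := by
  choose H hH hin using fun j c => exists_magMomentum_sq (h₁ j c) (h₂ j c) hF
    (isMult_manyBodyPot (β := β) hR hs j c) (lipschitz_manyBodyPot hR hs j c)
  refine ⟨∑ j, ∑ c, H j c + mulOp (pairEnergy (n + 1) R s g) F, ?_, ?_⟩
  · filter_upwards [Lp.coeFn_add (∑ j, ∑ c, H j c) (mulOp (pairEnergy (n + 1) R s g) F),
      coeFn_sum_ae Finset.univ fun j _ => coeFn_sum_ae Finset.univ fun c _ => hH j c,
      mulOp_coe' (isMult_pairEnergy (g := g) hR hs) F hF] with x h1 h2 h3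
    rw [h1, Pi.add_apply, h2, h3]
    rfl
  · simp only [inner_add_right, inner_sum]
    congr 1
    refine Finset.sum_congr rfl fun j _ => Finset.sum_congr rfl fun c _ => ?_
    rw [hin j c F _ (h₁ j c), inner_add_right]

end Hamiltonian

/-! ### The many-body and the Hartree energy -/

theorem inner_L2_of_ae {X : Type*} [MeasureSpace X] {F G : L2 X} {f g : X → ℂ}
    (hF : F =ᵐ[volume] f) (hG : G =ᵐ[volume] g) : ⟪F, G⟫_ℂ = ∫ x, conj (f x) * g x := by
  rw [inner_L2]
  refine integral_congr_ae ?_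
  filter_upwards [hF, hG] with x h1 h2
  rw [h1, h2]

theorem norm_sq_L2_of_ae {X : Type*} [MeasureSpace X] {F : L2 X} {f : X → ℂ}
    (hF : F =ᵐ[volume] f) : ‖F‖ ^ 2 = ∫ x, ‖f x‖ ^ 2 := by
  rw [norm_sq_L2]
  refine integral_congr_ae ?_
  filter_upwards [hF] with x h1
  rw [h1]

theorem re_inner_self {H : Type*} [NormedAddCommGroup H] [InnerProductSpace ℂ H] (x : H) :
    (⟪x, x⟫_ℂ).re = ‖x‖ ^ 2 := by
  rw [inner_self_eq_norm_sq_to_K]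
  norm_cast

section ManyBody

variable {n : ℕ} {R s β g : ℝ}

theorem sum_erase_swap {M : Type*} [AddCommMonoid M] (j : Fin (n + 1)) (f : Fin (n + 1) → M) :
    ∑ k ∈ Finset.univ.erase 0, f (Equiv.swap 0 j k) = ∑ k ∈ Finset.univ.erase j, f k := by
  refine Finset.sum_bij' (fun k _ => Equiv.swap 0 j k) (fun k _ => Equiv.swap 0 j k) ?_ ?_ ?_ ?_ ?_
  · intro k hk
    rw [Finset.mem_erase] at hk ⊢
    refine ⟨fun h => hk.1 ?_, Finset.mem_univ _⟩
    have := congrArg (Equiv.swap 0 j) h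
    simpa using this
  · intro k hk
    rw [Finset.mem_erase] at hk ⊢
    refine ⟨fun h => hk.1 ?_, Finset.mem_univ _⟩
    have := congrArg (Equiv.swap 0 j) h
    simpa using this
  · intro k _; simp
  · intro k _; simp
  · intro k _; rfl

theorem manyBodyPot_swap (j : Fin (n + 1)) (c : Fin 2) (x : Config (n + 1)) :
    manyBodyPot (n + 1) R s β 0 (fun k => x (Equiv.swap 0 j k)) c =
      manyBodyPot (n + 1) R s β j x c := by
  rw [manyBodyPot_apply, manyBodyPot_apply, ← sum_erase_swap j]
  simp

variable {F : L2 (Config (n + 1))} (hF : AntisymOn univ F)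

include hF

/-- The exchange of 0 and j sends F to -F and carries the magnetic momentum of one particle to that
of the other. -/
theorem norm_kinetic_eq (hR : 0 < R) (hs : 0 ≤ s) {c : Fin 2} {F₀ F₁ : L2 (Config (n + 1))}
    (j : Fin (n + 1)) (h₀ : HasMom (dirN 0 c) F F₀) (h₁ : HasMom (dirN j c) F F₁) :
    ‖F₁ + mulOp (fun x => manyBodyPot (n + 1) R s β j x c) F‖ =
      ‖F₀ + mulOp (fun x => manyBodyPot (n + 1) R s β 0 x c) F‖ := by
  rcases eq_or_ne j 0 with rfl | hj
  · rw [h₀.unique h₁]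
  have hperm : perm (Equiv.swap 0 j) F = -F := hF 0 (mem_univ _) j (mem_univ _) hj.symm
  have h2 : HasMom (dirN j c) (-F) (perm (Equiv.swap 0 j) F₀) := by
    have := HasSD.perm h₀ (Equiv.swap 0 j)
    rw [Equiv.swap_apply_left, hperm, map_smul] at this
    exact this
  have h3 : F₁ = -perm (Equiv.swap 0 j) F₀ := by
    have := h2.const_smul (-1)
    rw [neg_one_smul, neg_one_smul, neg_neg] at this
    exact h₁.unique this
  have h4 := perm_mulOp (isMult_manyBodyPot (β := β) hR hs 0 c) (Equiv.swap 0 j) F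
  simp only [manyBodyPot_swap] at h4
  rw [hperm, map_neg] at h4
  rw [h3, ← neg_eq_iff_eq_neg.2 h4, ← neg_add, norm_neg, ← map_add, LinearIsometry.norm_map]

theorem inner_pair_eq (hR : 0 < R) (hs : 0 ≤ s) (j : Fin (n + 1)) :
    ⟪F, mulOp (fun x => ∑ k ∈ Finset.univ.erase j, ‖vecPot (n + 1) R s (x j - x k)‖ ^ 2) F⟫_ℂ =
    ⟪F, mulOp (fun x => ∑ k ∈ Finset.univ.erase 0, ‖vecPot (n + 1) R s (x 0 - x k)‖ ^ 2) F⟫_ℂ := by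
  rcases eq_or_ne j 0 with rfl | hj
  · rfl
  have hperm : perm (Equiv.swap 0 j) F = -F := hF 0 (mem_univ _) j (mem_univ _) hj.symm
  have hm : IsMult fun x : Config (n + 1) =>
      ∑ k ∈ Finset.univ.erase 0, ‖vecPot (n + 1) R s (x 0 - x k)‖ ^ 2 :=
    IsMult.sum _ fun k _ => (isMult_norm_sq_vecPot (n + 1) hR hs).pair' 0 k
  have h4 := perm_mulOp hm (Equiv.swap 0 j) F
  have e : ∀ x : Config (n + 1), ∑ k ∈ Finset.univ.erase 0,
      ‖vecPot (n + 1) R s (x (Equiv.swap 0 j 0) - x (Equiv.swap 0 j k))‖ ^ 2 =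
      ∑ k ∈ Finset.univ.erase j, ‖vecPot (n + 1) R s (x j - x k)‖ ^ 2 := fun x => by
    rw [← sum_erase_swap j]
    simp
  simp only [e] at h4
  symm
  rw [← (perm (Equiv.swap 0 j)).inner_map_map F, h4, hperm, map_neg, inner_neg_neg]

/-- All particles contribute equally by antisymmetry, so the energy is n + 1 times that of particle
0. -/
theorem manyBodyEnergy_eq (hR : 0 < R) (hs : 0 ≤ s) {Ψ : Config (n + 1) → ℂ}
    (hΨ : F =ᵐ[volume] Ψ) (hreg : MemSobolev 2 Ψ) {Ψ₁ : Fin 2 → L2 (Config (n + 1))}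
    (h : ∀ c, HasMom (dirN 0 c) F (Ψ₁ c)) :
    manyBodyEnergy (n + 1) R s β g Ψ = (n + 1) *
      (∑ c, ‖Ψ₁ c + (β : ℂ) • ∑ l ∈ Finset.univ.erase 0, pairOp (fun x => vecPot (n + 1) R s x c) l F‖ ^ 2
        + g / 2 * ∑ l ∈ Finset.univ.erase 0,
          (⟪F, pairOp (fun x => (n + 1) * ‖vecPot (n + 1) R s x‖ ^ 2) l F⟫_ℂ).re) := by
  choose F₁ F₂ h₁ h₂ using fun j c => hreg.exists_hasMom hΨ (dirN j c)
  obtain ⟨H, hH, hin⟩ := exists_hamiltonian (β := β) (g := g) hR hs hΨ h₁ h₂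
  have hp := isMult_norm_sq_vecPot (n + 1) hR hs
  rw [manyBodyEnergy, ← inner_L2_of_ae hΨ hH, hin, Complex.add_re]
  simp only [Complex.re_sum, re_inner_self]
  have hk : ∀ j, ∑ c, ‖F₁ j c + mulOp (fun x => manyBodyPot (n + 1) R s β j x c) F‖ ^ 2 =
      ∑ c, ‖Ψ₁ c + (β : ℂ) •
        ∑ l ∈ Finset.univ.erase 0, pairOp (fun x => vecPot (n + 1) R s x c) l F‖ ^ 2 := fun j => by
    refine Finset.sum_congr rfl fun c _ => ?_
    rw [norm_kinetic_eq hF hR hs j (h c) (h₁ j c)]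
    simp only [manyBodyPot_apply]
    rw [mulOp_const_mul (IsMult.sum _ fun k _ => (isMult_vecPot hR _ hs c).pair' 0 k),
      mulOp_sum _ fun k _ => (isMult_vecPot hR _ hs c).pair' 0 k]
    rfl
  have hw : (⟪F, mulOp (pairEnergy (n + 1) R s g) F⟫_ℂ).re = (n + 1) * (g / 2 *
      ∑ l ∈ Finset.univ.erase 0,
        (⟪F, pairOp (fun x => (n + 1) * ‖vecPot (n + 1) R s x‖ ^ 2) l F⟫_ℂ).re) := by
    unfold pairEnergy
    rw [mulOp_const_mul (IsMult.sum _ fun j _ => IsMult.sum _ fun k _ => hp.pair' j k),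
      mulOp_sum _ fun j _ => IsMult.sum _ fun k _ => hp.pair' j k, inner_smul_right, inner_sum]
    simp only [inner_pair_eq hF hR hs]
    rw [mulOp_sum _ fun k _ => hp.pair' 0 k]
    simp only [pairOp]
    have e : ∀ l : Fin (n + 1), mulOp (fun x : Config (n + 1) => (n + 1 : ℝ) *
        ‖vecPot (n + 1) R s (x 0 - x l)‖ ^ 2) F = ((n + 1 : ℝ) : ℂ) •
        mulOp (fun x : Config (n + 1) => ‖vecPot (n + 1) R s (x 0 - x l)‖ ^ 2) F := fun l =>
      mulOp_const_mul (hp.pair' 0 l) _ _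
    simp only [e, inner_smul_right, inner_sum, Complex.re_ofReal_mul, Finset.sum_const,
      Finset.card_univ, Fintype.card_fin, nsmul_eq_mul, ← Finset.mul_sum]
    rw [← Complex.ofReal_natCast, Complex.re_ofReal_mul, Complex.re_sum]
    push_cast
    ring
  simp only [hk, hw, Finset.sum_const, Finset.card_univ, Fintype.card_fin, nsmul_eq_mul]
  push_cast
  ring

end ManyBody

section Hartree

variable {n : ℕ} {R s β g : ℝ} {u : Fin (n + 1) → Plane → ℂ} {U : Fin (n + 1) → L2 Plane}
  (hU : ∀ j, U j =ᵐ[volume] u j)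

include hU

theorem density_ae : dens U =ᵐ[volume] density u := by
  filter_upwards [ae_all_iff.2 hU] with x hx
  simp only [dens, density, hx]

theorem meanPot_apply (hR : 0 < R) (hs : 0 ≤ s) (x : Plane) (c : Fin 2) :
    meanPot R s u x c = convDens U (fun z => vecPot (n + 1) R s z c) x := by
  have e : meanPot R s u x = ∫ y, dens U y • vecPot (n + 1) R s (x - y) := by
    refine integral_congr_ae ?_
    filter_upwards [density_ae hU] with y hy
    rw [hy]
  have hi : Integrable fun y => dens U y • vecPot (n + 1) R s (x - y) := by
    refine Integrable.of_eval_piLp fun c => ?_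
    simp only [PiLp.smul_apply, smul_eq_mul]
    simpa only [mul_comm] using integrable_conv U (isMult_vecPot hR (n + 1) hs c) x
  rw [e, eval_integral_piLp (fun c => hi.eval_piLp c) c, convDens]
  simp only [PiLp.smul_apply, smul_eq_mul, mul_comm]

theorem meanPotSq_eq (x : Plane) :
    meanPotSq R s u x = convDens U (fun z => ‖vecPot (n + 1) R s z‖ ^ 2) x := by
  refine integral_congr_ae ?_
  filter_upwards [density_ae hU] with y hy
  rw [hy]

theorem hartreeEnergy_eq (hR : 0 < R) (hs : 0 ≤ s) {U₁ : Fin 2 → Fin (n + 1) → L2 Plane}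
    (h : ∀ c j, HasMom (dir c) (U j) (U₁ c j)) :
    hartreeEnergy R s β g u =
      ∑ j, ∑ c, ‖magOrbital β U (fun c x => vecPot (n + 1) R s x c) U₁ c j‖ ^ 2 +
      g / 2 * ∑ j, (⟪U j, mulOp (convDens U fun x => (n + 1) * ‖vecPot (n + 1) R s x‖ ^ 2)
        (U j)⟫_ℂ).re := by
  have hp := isMult_norm_sq_vecPot (n + 1) hR hs
  have hm := fun c => isMult_convDens U (isMult_vecPot hR (n + 1) hs c)
  have e : ∀ c, (fun y => β * meanPot R s u y c) =
      fun y => β * convDens U (fun z => vecPot (n + 1) R s z c) y := fun c => by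
    funext y
    rw [meanPot_apply hU hR hs]
  unfold hartreeEnergy
  congr 1
  · refine Finset.sum_congr rfl fun j _ => Finset.sum_congr rfl fun c _ => ?_
    rw [e c, ← norm_sq_L2_of_ae ((h c j).magMomentum (hU j) ((hm c).const_mul β)),
      mulOp_const_mul (hm c)]
    rfl
  · have e2 : ∀ j, (⟪U j, mulOp (convDens U fun x => (n + 1) * ‖vecPot (n + 1) R s x‖ ^ 2)
        (U j)⟫_ℂ).re = (n + 1) * ∫ x, convDens U (fun z => ‖vecPot (n + 1) R s z‖ ^ 2) x *
          ‖U j x‖ ^ 2 := fun j => by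
      rw [inner_mulOp_self (isMult_convDens U (hp.const_mul _)), Complex.ofReal_re,
        ← integral_const_mul]
      simp only [convDens_const_mul, mul_assoc]
    simp only [e2, ← Finset.mul_sum]
    rw [← integral_finsetSum _ fun j _ => (isMult_convDens U hp).integrable_mul_norm_sq (U j)]
    have e3 : ∫ x, meanPotSq R s u x * density u x =
        ∫ x, ∑ j, convDens U (fun z => ‖vecPot (n + 1) R s z‖ ^ 2) x * ‖U j x‖ ^ 2 := by
      refine integral_congr_ae ?_
      filter_upwards [density_ae hU] with x hx
      rw [← Finset.mul_sum, meanPotSq_eq hU, ← hx, dens]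
    rw [e3]
    push_cast
    ring

end Hartree

/-! ### The counting functional -/

section Counting

variable {n : ℕ} {u : Fin (n + 1) → Plane → ℂ} {U : Fin (n + 1) → L2 Plane}
  (hU : ∀ j, U j =ᵐ[volume] u j)

include hU

theorem bOp_ae (l : Fin (n + 1)) {F : L2 (Config (n + 1))} {f : Config (n + 1) → ℂ}
    (hF : F =ᵐ[volume] f) : bOp U U l F =ᵐ[volume] pOp u l f := by
  rw [bOp_apply]
  exact coeFn_sum_ae Finset.univ fun j _ => kOp_coe l (U j) (U j) F (hU j) (hU j) hF

variable (hO : Orthonormal ℂ U)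

theorem q_ae (l : Fin (n + 1)) {F : L2 (Config (n + 1))} {f : Config (n + 1) → ℂ}
    (hF : F =ᵐ[volume] f) : (proj hO).q l F =ᵐ[volume] qOp u l f := by
  rw [CommProj.q_apply, proj_p]
  filter_upwards [Lp.coeFn_sub F (bOp U U l F), hF, bOp_ae hU l hF] with x h1 h2 h3
  rw [h1, Pi.sub_apply, h2, h3, qOp]

theorem sector_ae (S : Finset (Fin (n + 1))) {F : L2 (Config (n + 1))} {f : Config (n + 1) → ℂ}
    (hF : F =ᵐ[volume] f) : (proj hO).sector S F =ᵐ[volume] excitedOn u S f := by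
  unfold CommProj.sector CommProj.listSector excitedOn
  induction List.finRange (n + 1) with
  | nil => simpa using hF
  | cons l L ih =>
    rw [List.map_cons, List.prod_cons, List.foldr_cons]
    unfold CommProj.factor
    split_ifs with hl
    · exact q_ae hU hO l ih
    · exact bOp_ae hU l ih

theorem weightOp_ae (ξ : ℝ) {F : L2 (Config (n + 1))} {f : Config (n + 1) → ℂ}
    (hF : F =ᵐ[volume] f) :
    (proj hO).diag (fun S => ((((S.card : ℝ) / (n + 1 : ℕ)) ^ ξ : ℝ) : ℂ)) F =ᵐ[volume]
      weightOp ξ u f := by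
  have h1 := coeFn_sum_ae (Finset.univ : Finset (Finset (Fin (n + 1))))
    (F := fun S => ((((S.card : ℝ) / (n + 1 : ℕ)) ^ ξ : ℝ) : ℂ) • (proj hO).sector S F)
    (f := fun S x => ((((S.card : ℝ) / (n + 1 : ℕ)) ^ ξ : ℝ) : ℂ) * excitedOn u S f x)
    (fun S _ => by
      filter_upwards [Lp.coeFn_smul ((((S.card : ℝ) / (n + 1 : ℕ)) ^ ξ : ℝ) : ℂ)
        ((proj hO).sector S F), sector_ae hU hO S hF] with x h2 h3
      rw [h2, Pi.smul_apply, h3, smul_eq_mul])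
  rw [CommProj.diag_apply]
  refine h1.trans (Eventually.of_forall fun x => ?_)
  simp only [weightOp, excitedProj, Finset.mul_sum]
  rw [← Finset.powerset_univ, ← Finset.sum_fiberwise_of_maps_to
    (t := Finset.range (n + 1 + 1)) (g := fun S : Finset (Fin (n + 1)) => S.card)]
  · refine Finset.sum_congr rfl fun k _ => ?_
    rw [Finset.powersetCard_eq_filter]
    refine Finset.sum_congr rfl fun S hS => ?_
    rw [(Finset.mem_filter.1 hS).2]
  · intro S _
    have := S.card_le_univ
    rw [Fintype.card_fin] at this
    exact Finset.mem_range.2 (by omega)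

theorem alphaM_eq {F : L2 (Config (n + 1))} {f : Config (n + 1) → ℂ} (hF : F =ᵐ[volume] f) :
    alphaM u f = ∑ S, √((S.card : ℝ) / (n + 1 : ℕ)) * (proj hO).wt F S := by
  rw [alphaM, ← inner_L2_of_ae hF (weightOp_ae hU hO (1 / 2) hF)]
  simp only [← Real.sqrt_eq_rpow]
  rw [CommProj.inner_diag_self, Complex.ofReal_re]

/-- Subadditivity of the square root, √((k + 1)/N) ≤ √(k/N) + 1/√N; the sector weights sum to 1.
This is the source of the 1/√N in the final bound. -/
theorem excitation_le {F : L2 (Config (n + 1))} {f : Config (n + 1) → ℂ} (hF : F =ᵐ[volume] f)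
    (hnorm : ‖F‖ = 1) :
    (proj hO).excitation F ≤ alphaM u f + 1 / √((n + 1 : ℕ) : ℝ) := by
  have h1 : 1 / √((n + 1 : ℕ) : ℝ) = ∑ S, 1 / √((n + 1 : ℕ) : ℝ) * (proj hO).wt F S := by
    rw [← Finset.mul_sum, ← CommProj.norm_sq_eq_sum_wt, hnorm]
    simp
  rw [alphaM_eq hU hO hF, h1, ← Finset.sum_add_distrib]
  refine Finset.sum_le_sum fun S _ => ?_
  rw [← add_mul]
  refine mul_le_mul_of_nonneg_right ?_ ((proj hO).wt_nonneg F S)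
  rw [add_div, ← Real.sqrt_one, ← Real.sqrt_div zero_le_one, Real.sqrt_one]
  simp only [Real.sqrt_eq_rpow]
  exact Real.rpow_add_le_add_rpow (by positivity) (by positivity) (by norm_num) (by norm_num)

end Counting

theorem antisymOn_of_antisymmetric {N : ℕ} {Ψ : Config N → ℂ} (h : Antisymmetric Ψ)
    {F : L2 (Config N)} (hF : F =ᵐ[volume] Ψ) : AntisymOn univ F := by
  intro i _ j _ hij
  refine Lp.ext ?_
  filter_upwards [perm_coe (Equiv.swap i j) F hF, h (Equiv.swap i j), Lp.coeFn_neg F, hF]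
    with x h1 h2 h3 h4
  rw [h1, h2, h3, Pi.neg_apply, h4, Equiv.Perm.sign_swap hij]
  simp

/-! ### Conservation laws and the Slater determinant -/

section Conservation

theorem HasL2DerivOn.hasDerivWithinAt {V : Type*} [NormedAddCommGroup V] [NormedSpace ℝ V]
    [MeasureSpace V] {T t : ℝ} (ht : t ∈ Icc 0 T) {F : ℝ → V → ℂ} {F' : V → ℂ}
    (h : HasL2DerivOn T F F' t) {X : ℝ → L2 V} (hX : ∀ τ ∈ Icc 0 T, X τ =ᵐ[volume] F τ)
    {X' : L2 V} (hX' : X' =ᵐ[volume] F') : HasDerivWithinAt X X' (Icc 0 T) t := by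
  rw [hasDerivWithinAt_iff_tendsto_slope, tendsto_iff_norm_sub_tendsto_zero]
  have h1 := (ENNReal.tendsto_toReal ENNReal.zero_ne_top).comp h
  rw [ENNReal.toReal_zero] at h1
  refine h1.congr' ?_
  filter_upwards [self_mem_nhdsWithin] with τ hτ
  rw [Lp.norm_def, Function.comp_apply]
  congr 1
  refine eLpNorm_congr_ae ?_
  have e : slope X t τ = ((τ - t)⁻¹ : ℝ) • (X τ - X t) := by
    rw [slope_def_module]
  rw [e]
  filter_upwards [Lp.coeFn_sub (((τ - t)⁻¹ : ℝ) • (X τ - X t)) X',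
    Lp.coeFn_smul ((τ - t)⁻¹ : ℝ) (X τ - X t), Lp.coeFn_sub (X τ) (X t), hX τ hτ.1, hX t ht, hX']
    with x h2 h3 h4 h5 h6 h7
  rw [h2, Pi.sub_apply, h3, Pi.smul_apply, h4, Pi.sub_apply, h5, h6, h7]

/-- The inner product of two solutions of a Schrödinger equation is conserved. -/
theorem inner_eq_of_schrodinger {H : Type*} [NormedAddCommGroup H] [InnerProductSpace ℂ H]
    {T : ℝ} {X Y X' Y' : ℝ → H}
    (hX : ∀ t ∈ Icc 0 T, HasDerivWithinAt X (-Complex.I • X' t) (Icc 0 T) t)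
    (hY : ∀ t ∈ Icc 0 T, HasDerivWithinAt Y (-Complex.I • Y' t) (Icc 0 T) t)
    (hXY : ∀ t ∈ Icc 0 T, ⟪X' t, Y t⟫_ℂ = ⟪X t, Y' t⟫_ℂ) :
    ∀ t ∈ Icc 0 T, ⟪X t, Y t⟫_ℂ = ⟪X 0, Y 0⟫_ℂ := by
  have hd : ∀ t ∈ Icc 0 T, HasDerivWithinAt (fun t => ⟪X t, Y t⟫_ℂ) 0 (Icc 0 T) t := by
    intro t ht
    have := (hX t ht).inner ℂ (hY t ht)
    rw [inner_smul_left, inner_smul_right, hXY t ht] at this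
    simpa using this
  refine constant_of_derivWithin_zero (fun t ht => (hd t ht).differentiableWithinAt) ?_
  intro t ht
  exact (hd t (Ico_subset_Icc_self ht)).derivWithin
    ((uniqueDiffOn_Icc (ht.1.trans_lt ht.2)) t (Ico_subset_Icc_self ht))

end Conservation

/-! ### Symmetry of the effective Hamiltonian. -/

section HartreeOperator

theorem isMult_conv {w : Plane → ℝ} (hw : Integrable w) {γ : Plane → ℝ} (hγ : IsMult γ)
    (hl : IsLip γ) : IsMult fun x => ∫ y, γ (x - y) * w y := by
  have hi : ∀ x, Integrable fun y => γ (x - y) * w y := fun x => by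
    obtain ⟨hm, C, hC⟩ := hγ
    exact hw.bdd_mul (hm.comp (measurable_const.sub measurable_id)).aestronglyMeasurable
      (Eventually.of_forall fun y => by rw [Real.norm_eq_abs]; exact hC _)
  constructor
  · obtain ⟨L, hL, hl⟩ := hl
    have key : IsLip fun x => ∫ y, γ (x - y) * w y := by
      refine ⟨L * ∫ y, ‖w y‖, mul_nonneg hL (integral_nonneg fun y => norm_nonneg _),
        fun x z => ?_⟩
      rw [← Real.norm_eq_abs, ← integral_sub (hi x) (hi z), mul_right_comm, ← integral_const_mul]
      refine norm_integral_le_of_norm_le (hw.norm.const_mul _) (Eventually.of_forall fun y => ?_)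
      rw [← sub_mul, norm_mul, Real.norm_eq_abs]
      refine mul_le_mul_of_nonneg_right ?_ (norm_nonneg _)
      have := hl (x - y) (z - y)
      rwa [sub_sub_sub_cancel_right] at this
    obtain ⟨M, hM⟩ := key.lipschitz
    exact hM.continuous.measurable
  · obtain ⟨C, hC⟩ := hγ.2
    refine ⟨C * ∫ y, ‖w y‖, fun x => ?_⟩
    rw [← Real.norm_eq_abs, ← integral_const_mul]
    refine norm_integral_le_of_norm_le (hw.norm.const_mul C) (Eventually.of_forall fun y => ?_)
    rw [norm_mul, Real.norm_eq_abs]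
    exact mul_le_mul_of_nonneg_right (hC _) (norm_nonneg _)

variable {n : ℕ} {R s β g : ℝ} {u : Fin (n + 1) → Plane → ℂ} {U : Fin (n + 1) → L2 Plane}
  (hU : ∀ j, U j =ᵐ[volume] u j)

include hU

theorem integrable_current {U₁ : Fin 2 → Fin (n + 1) → L2 Plane}
    (h : ∀ c j, HasMom (dir c) (U j) (U₁ c j)) (c : Fin 2) :
    Integrable fun x => current u x c := by
  have h1 : Integrable fun x => ∑ j, 2 * (Complex.I * (conj (U j x) * U₁ c j x)).im :=
    integrable_finsetSum _ fun j _ =>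
      (((integrable_conj_mul_L2 (U j) (U₁ c j)).const_mul Complex.I).im).const_mul 2
  refine h1.congr ?_
  have hw := ae_all_iff.2 fun j => (h c j).weakDeriv_eq (hU j)
  filter_upwards [ae_all_iff.2 hU, hw] with x hx hx1
  simp only [current]
  refine Finset.sum_congr rfl fun j _ => ?_
  rw [hx1 j, hx j]
  simp
  ring

theorem isMult_currentPot (hR : 0 < R) (hs : 0 ≤ s) {U₁ : Fin 2 → Fin (n + 1) → L2 Plane}
    (h : ∀ c j, HasMom (dir c) (U j) (U₁ c j)) : IsMult (currentPot R s β u) := by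
  set w : Fin 2 → Plane → ℝ := fun c y =>
    2 * β * density u y * meanPot R s u y c + current u y c with hw
  have hwi : ∀ c, Integrable (w c) := fun c => by
    refine Integrable.add ?_ (integrable_current hU h c)
    have h1 : Integrable fun y => convDens U (fun z => vecPot (n + 1) R s z c) y * dens U y := by
      obtain ⟨hm, C, hC⟩ := isMult_convDens U (isMult_vecPot hR (n + 1) hs c)
      exact (integrable_dens U).bdd_mul hm.aestronglyMeasurable
        (Eventually.of_forall fun y => by rw [Real.norm_eq_abs]; exact hC y)
    refine (h1.const_mul (2 * β)).congr ?_
    filter_upwards [density_ae hU] with y hy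
    rw [meanPot_apply hU hR hs, ← hy]
    ring
  have e : currentPot R s β u = fun x => β * ∑ c, ∫ y, vecPot (n + 1) R s (x - y) c * w c y := by
    funext x
    rw [currentPot, ← integral_finsetSum]
    · congr 2
      funext y
      simp only [PiLp.inner_apply, RCLike.inner_apply, conj_trivial, hw, PiLp.add_apply,
        PiLp.smul_apply, smul_eq_mul]
      exact Finset.sum_congr rfl fun c _ => mul_comm _ _
    · intro c _
      obtain ⟨hm, C, hC⟩ := isMult_vecPot hR (n + 1) hs c
      exact (hwi c).bdd_mul (hm.comp (measurable_const.sub measurable_id)).aestronglyMeasurable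
        (Eventually.of_forall fun y => by rw [Real.norm_eq_abs]; exact hC _)
  rw [e]
  exact (IsMult.sum _ fun c _ =>
    isMult_conv (hwi c) (isMult_vecPot hR (n + 1) hs c) (isLip_vecPot hR (n + 1) hs c)).const_mul β

/-- The effective Hamiltonian is symmetric on `H²`. -/
theorem exists_hartreeOp (hR : 0 < R) (hs : 0 ≤ s) {U₁ U₂ : Fin 2 → Fin (n + 1) → L2 Plane}
    (h₁ : ∀ c j, HasMom (dir c) (U j) (U₁ c j)) (h₂ : ∀ c j, HasMom (dir c) (U₁ c j) (U₂ c j)) :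
    ∃ H : Fin (n + 1) → L2 Plane, (∀ j, H j =ᵐ[volume] hartreeOp R s β g u (u j)) ∧
      ∀ i j, ⟪H i, U j⟫_ℂ = ⟪U i, H j⟫_ℂ := by
  have hm : ∀ c, IsMult fun y => β * meanPot R s u y c := fun c => by
    simp only [meanPot_apply hU hR hs]
    exact (isMult_convDens U (isMult_vecPot hR (n + 1) hs c)).const_mul β
  have hl : ∀ c, ∃ L, LipschitzWith L fun y => β * meanPot R s u y c := fun c => by
    simp only [meanPot_apply hU hR hs]
    exact exists_lipschitz_const_mul β
      (isLip_convDens U (isMult_vecPot hR (n + 1) hs c) (isLip_vecPot hR (n + 1) hs c)).lipschitz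
  have hV : IsMult fun x => g * (n + 1 : ℕ) * meanPotSq R s u x - currentPot R s β u x := by
    simp only [meanPotSq_eq hU]
    exact ((isMult_convDens U (isMult_norm_sq_vecPot (n + 1) hR hs)).const_mul _).sub
      (isMult_currentPot hU hR hs h₁)
  choose H hH hin using fun j c => exists_magMomentum_sq (h₁ c j) (h₂ c j) (hU j) (hm c) (hl c)
  refine ⟨fun j => ∑ c, H j c +
    mulOp (fun x => g * (n + 1 : ℕ) * meanPotSq R s u x - currentPot R s β u x) (U j),
    fun j => ?_, fun i j => ?_⟩
  · filter_upwards [Lp.coeFn_add (∑ c, H j c) (mulOp (fun x => g * (n + 1 : ℕ) *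
      meanPotSq R s u x - currentPot R s β u x) (U j)),
      coeFn_sum_ae Finset.univ fun c _ => hH j c, mulOp_coe' hV _ (hU j)] with x h3 h4 h5
    rw [h3, Pi.add_apply, h4, h5]
    rfl
  · rw [inner_add_left, inner_add_right, inner_mulOp_left hV, sum_inner, inner_sum]
    congr 1
    refine Finset.sum_congr rfl fun c _ => ?_
    rw [hin j c (U i) _ (h₁ c i), ← inner_conj_symm, hin i c (U j) _ (h₁ c j), inner_conj_symm]

end HartreeOperator

section Slater

/-- In the product of the two determinants, orthonormality leaves only equal permutations, and the
(n + 1)! remaining terms cancel the normalization. -/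
theorem norm_slater {n : ℕ} {u : Fin (n + 1) → Plane → ℂ} {U : Fin (n + 1) → L2 Plane}
    (hU : ∀ j, U j =ᵐ[volume] u j) (hO : Orthonormal ℂ U) {F : L2 (Config (n + 1))}
    (hF : F =ᵐ[volume] slater u) : ‖F‖ = 1 := by
  have hin : ∀ i j, ∫ x, conj (u i x) * u j x = if i = j then 1 else 0 := fun i j => by
    rw [← inner_L2_of_ae (hU i) (hU j)]
    exact orthonormal_iff_ite.1 hO i j
  have hii : ∀ i j, Integrable fun x => conj (u i x) * u j x := fun i j => by
    refine (integrable_conj_mul_L2 (U i) (U j)).congr ?_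
    filter_upwards [hU i, hU j] with x h1 h2
    rw [h1, h2]
  have hprod : ∀ σ τ : Equiv.Perm (Fin (n + 1)),
      ∫ x : Config (n + 1), ∏ j, (conj (u (σ j) (x j)) * u (τ j) (x j)) =
        if σ = τ then 1 else 0 := fun σ τ => by
    rw [integral_fintype_prod_volume_eq_prod (fun j x => conj (u (σ j) x) * u (τ j) x)]
    simp only [hin]
    split_ifs with h
    · simp [h]
    · obtain ⟨j, hj⟩ : ∃ j, σ j ≠ τ j := by
        by_contra! h'
        exact h (Equiv.ext h')
      exact Finset.prod_eq_zero (Finset.mem_univ j) (if_neg hj)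
  have hint : ∀ σ τ : Equiv.Perm (Fin (n + 1)), Integrable fun x : Config (n + 1) =>
      ∏ j, (conj (u (σ j) (x j)) * u (τ j) (x j)) := fun σ τ =>
    Integrable.fintype_prod (f := fun j x => conj (u (σ j) x) * u (τ j) x) fun j => hii _ _
  have e : ∀ x : Config (n + 1), conj (slater u x) * slater u x =
      (((n + 1).factorial : ℝ)⁻¹ : ℝ) * ∑ σ : Equiv.Perm (Fin (n + 1)),
        ∑ τ : Equiv.Perm (Fin (n + 1)), ((Equiv.Perm.sign σ : ℤ) : ℂ) *
          ((Equiv.Perm.sign τ : ℤ) : ℂ) * ∏ j, (conj (u (σ j) (x j)) * u (τ j) (x j)) := by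
    intro x
    have h1 : (((n + 1).factorial : ℝ)⁻¹ : ℝ) =
        (√((n + 1).factorial : ℝ))⁻¹ * (√((n + 1).factorial : ℝ))⁻¹ := by
      rw [← mul_inv, Real.mul_self_sqrt (by positivity)]
    rw [h1, slater]
    push_cast
    simp only [map_mul, map_sum, map_prod, Complex.conj_ofReal, Finset.prod_mul_distrib, map_inv₀,
      map_intCast]
    rw [mul_mul_mul_comm, Finset.sum_mul_sum]
    congr 1
    refine Finset.sum_congr rfl fun σ _ => Finset.sum_congr rfl fun τ _ => ?_
    ring
  have h2 : ⟪F, F⟫_ℂ = 1 := by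
    rw [inner_L2_of_ae hF hF]
    simp only [e]
    rw [integral_const_mul, integral_finsetSum _ fun σ _ => integrable_finsetSum _ fun τ _ =>
      (hint σ τ).const_mul _]
    simp only [integral_finsetSum _ fun τ _ => (hint _ τ).const_mul _, integral_const_mul, hprod]
    have h3 : ∀ σ : Equiv.Perm (Fin (n + 1)), ((Equiv.Perm.sign σ : ℤ) : ℂ) *
        ((Equiv.Perm.sign σ : ℤ) : ℂ) = 1 := fun σ => by
      rw [← Int.cast_mul, ← Units.val_mul, Int.units_mul_self]
      simp
    simp only [mul_ite, mul_one, mul_zero, Finset.sum_ite_eq, Finset.mem_univ, if_true, h3,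
      Finset.sum_const, Finset.card_univ, Fintype.card_perm, Fintype.card_fin, nsmul_eq_mul]
    have : (((n + 1).factorial : ℕ) : ℂ) ≠ 0 := by exact_mod_cast (n + 1).factorial_ne_zero
    push_cast
    field_simp
  have h3 := re_inner_self F
  rw [h2, Complex.one_re] at h3
  nlinarith [norm_nonneg F]

end Slater

/-! ### Norms of the densities -/

/-- The bounds on the orbitals used in the estimates of the energy. -/
structure OrbitalBounds {n : ℕ} (R s C : ℝ) (U : Fin (n + 1) → L2 Plane)
    (U₁ U₂ : Fin 2 → Fin (n + 1) → L2 Plane) : Prop where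
  pow_four : ∀ x, ∫ y, ‖vecPot (n + 1) R s (x - y)‖ ^ 4 * dens U y ≤ C / ((n + 1 : ℕ) : ℝ) ^ 3
  grad : ∀ c, ∑ j, ‖U₁ c j‖ ^ 2 ≤ C * (n + 1)
  lap : ∑ j, ‖∑ c, U₂ c j‖ ^ 2 ≤ C * (n + 1)

theorem OrbitalBounds.mono {n : ℕ} {R s C C' : ℝ} {U : Fin (n + 1) → L2 Plane}
    {U₁ U₂ : Fin 2 → Fin (n + 1) → L2 Plane} (h : OrbitalBounds R s C U U₁ U₂) (hC : C ≤ C') :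
    OrbitalBounds R s C' U U₁ U₂ := by
  refine ⟨fun x => (h.pow_four x).trans ?_, fun c => (h.grad c).trans ?_, h.lap.trans ?_⟩
  · gcongr
  · gcongr
  · gcongr

section Norms

theorem integrable_rpow_of_eLpNorm_le {f : Plane → ℝ} (hf : Measurable f) (hf0 : ∀ x, 0 ≤ f x)
    {p B : ℝ} (hp : 0 < p) (hB : 0 ≤ B)
    (h : eLpNorm f (ENNReal.ofReal p) volume ≤ ENNReal.ofReal B) :
    Integrable (fun x => f x ^ p) ∧ ∫ x, f x ^ p ≤ B ^ p := by
  have hp0 : ENNReal.ofReal p ≠ 0 := by simpa using hp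
  have hm : MemLp f (ENNReal.ofReal p) volume :=
    ⟨hf.aestronglyMeasurable, h.trans_lt ENNReal.ofReal_lt_top⟩
  have hi := hm.integrable_norm_rpow hp0 ENNReal.ofReal_ne_top
  rw [hm.eLpNorm_eq_integral_rpow_norm hp0 ENNReal.ofReal_ne_top] at h
  simp only [ENNReal.toReal_ofReal hp.le, Real.norm_of_nonneg (hf0 _)] at hi h
  refine ⟨hi, ?_⟩
  rw [ENNReal.ofReal_le_ofReal_iff hB] at h
  have h0 : 0 ≤ ∫ x, f x ^ p := integral_nonneg fun x => Real.rpow_nonneg (hf0 x) p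
  have := Real.rpow_le_rpow (by positivity) h hp.le
  rwa [← Real.rpow_mul h0, inv_mul_cancel₀ hp.ne', Real.rpow_one] at this

theorem integral_le_of_eLpNorm_one_le {f h : Plane → ℝ} (hf : Integrable f) (hf0 : ∀ x, 0 ≤ f x)
    (hfh : f =ᵐ[volume] h) {B : ℝ} (hB : 0 ≤ B) (hn : eLpNorm h 1 volume ≤ ENNReal.ofReal B) :
    ∫ x, f x ≤ B := by
  rw [← eLpNorm_congr_ae hfh, eLpNorm_one_eq_lintegral_enorm,
    ← ofReal_integral_norm_eq_lintegral_enorm hf, ENNReal.ofReal_le_ofReal_iff hB] at hn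
  simpa only [Real.norm_of_nonneg (hf0 _)] using hn

end Norms

section Densities

variable {n : ℕ} {u : Fin (n + 1) → Plane → ℂ} {U : Fin (n + 1) → L2 Plane}
  {U₁ U₂ : Fin 2 → Fin (n + 1) → L2 Plane} (hU : ∀ j, U j =ᵐ[volume] u j)
  (h₁ : ∀ c j, HasMom (dir c) (U j) (U₁ c j)) (h₂ : ∀ c j, HasMom (dir c) (U₁ c j) (U₂ c j))

include hU h₁

theorem sum_grad_le {B : ℝ} (hB : 0 ≤ B)
    (h : eLpNorm (densityGrad u) 1 volume ≤ ENNReal.ofReal B) (c : Fin 2) :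
    ∑ j, ‖U₁ c j‖ ^ 2 ≤ B := by
  have hi : ∀ j, Integrable fun x => ∑ c, ‖U₁ c j x‖ ^ 2 := fun j =>
    integrable_finsetSum _ fun c _ => integrable_norm_sq_L2 _
  have key := integral_le_of_eLpNorm_one_le (f := fun x => ∑ j, ∑ c, ‖U₁ c j x‖ ^ 2)
    (integrable_finsetSum _ fun j _ => hi j) (fun x => by positivity) (by
      filter_upwards [ae_all_iff.2 fun j => ae_all_iff.2 fun c => (h₁ c j).weakDeriv_eq (hU j)]
        with x hx
      simp [densityGrad, hx]) hB h
  rw [integral_finsetSum _ fun j _ => hi j] at key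
  simp only [integral_finsetSum _ fun c _ => integrable_norm_sq_L2 _, ← norm_sq_L2] at key
  refine le_trans (Finset.sum_le_sum fun j _ => ?_) key
  exact Finset.single_le_sum (f := fun c => ‖U₁ c j‖ ^ 2) (fun c _ => by positivity)
    (Finset.mem_univ c)

include h₂

theorem weakDeriv_weakDeriv_ae (c : Fin 2) (j : Fin (n + 1)) :
    weakDeriv (dir c) (weakDeriv (dir c) (u j)) =ᵐ[volume] fun x => -U₂ c j x := by
  have e : ⇑(Complex.I • U₁ c j) =ᵐ[volume] weakDeriv (dir c) (u j) := by
    filter_upwards [Lp.coeFn_smul Complex.I (U₁ c j), (h₁ c j).weakDeriv_eq (hU j)] with x h3 h4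
    rw [h3, h4, Pi.smul_apply, smul_eq_mul]
  filter_upwards [((h₂ c j).const_smul Complex.I).weakDeriv_eq e,
    Lp.coeFn_smul Complex.I (U₂ c j)] with x h3 h4
  rw [h3, h4, Pi.smul_apply, smul_eq_mul, ← mul_assoc, Complex.I_mul_I, neg_one_mul]

theorem sum_lap_le {B : ℝ} (hB : 0 ≤ B)
    (h : eLpNorm (densityLap u) 1 volume ≤ ENNReal.ofReal B) :
    ∑ j, ‖∑ c, U₂ c j‖ ^ 2 ≤ B := by
  have key := integral_le_of_eLpNorm_one_le (f := fun x => ∑ j, ‖(∑ c, U₂ c j : L2 Plane) x‖ ^ 2)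
    (integrable_finsetSum _ fun j _ => integrable_norm_sq_L2 _) (fun x => by positivity) (by
      filter_upwards [ae_all_iff.2 fun j => ae_all_iff.2 fun c =>
        weakDeriv_weakDeriv_ae hU h₁ h₂ c j, ae_all_iff.2 fun j =>
        coeFn_sum_ae Finset.univ (F := fun c => U₂ c j) fun c _ => EventuallyEq.rfl] with x hx hx2
      simp only [densityLap, hx, hx2, Finset.sum_neg_distrib, norm_neg]) hB h
  rw [integral_finsetSum _ fun j _ => integrable_norm_sq_L2 _] at key
  simpa only [← norm_sq_L2] using key

theorem norm_sq_lap_le {m : ℕ} (hm : 2 ≤ m) {K : ℝ} (hK : 0 ≤ K) (j : Fin (n + 1))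
    (h : sobolevNormSq m (u j) ≤ ENNReal.ofReal K ^ 2) : ‖∑ c, U₂ c j‖ ^ 2 ≤ 2 * K ^ 2 * 2 := by
  obtain ⟨k, rfl⟩ := Nat.exists_eq_add_of_le' hm
  have h0 : ∀ k (f : Plane → ℂ), eLpNorm f 2 volume ^ 2 ≤ sobolevNormSq k f := fun k f => by
    cases k with
    | zero => exact le_rfl
    | succ k => exact le_self_add
  have hs : ∀ k (f : Plane → ℂ) (c : Fin 2), sobolevNormSq k (weakDeriv (dir c) f) ≤
      sobolevNormSq (k + 1) f := fun k f c =>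
    (Finset.single_le_sum (f := fun c : Fin 2 => sobolevNormSq k (weakDeriv (dir c) f))
      (fun _ _ => zero_le) (Finset.mem_univ c)).trans le_add_self
  have hc : ∀ c, ‖U₂ c j‖ ^ 2 ≤ K ^ 2 := fun c => by
    have h3 := (((h0 k _).trans (hs k _ c)).trans (hs (k + 1) (u j) c)).trans h
    have e : eLpNorm (weakDeriv (dir c) (weakDeriv (dir c) (u j))) 2 volume =
        ENNReal.ofReal ‖U₂ c j‖ := by
      rw [eLpNorm_congr_ae (weakDeriv_weakDeriv_ae hU h₁ h₂ c j), Lp.norm_def,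
        ENNReal.ofReal_toReal (Lp.eLpNorm_ne_top _)]
      exact eLpNorm_neg (U₂ c j) 2 volume
    rw [e, ← ENNReal.ofReal_pow (norm_nonneg _), ← ENNReal.ofReal_pow hK,
      ENNReal.ofReal_le_ofReal_iff (by positivity)] at h3
    exact h3
  refine (norm_sq_sum_le _ _).trans ?_
  have := Finset.sum_le_sum fun c (_ : c ∈ (Finset.univ : Finset (Fin 2))) => hc c
  simp only [Finset.sum_const, Finset.card_univ, Fintype.card_fin, nsmul_eq_mul] at this ⊢
  push_cast at this ⊢
  linarith

end Densities

/-! ### Bounds on admissible orbitals -/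

section BoundsMono

variable {N : ℕ} {K K' : ℝ} {u : Fin N → Plane → ℂ}

theorem BoundsH2.mono (h : BoundsH2 K u) (hK : K ≤ K') : BoundsH2 K' u := by
  have : ENNReal.ofReal (K * N) ≤ ENNReal.ofReal (K' * N) := by gcongr
  exact ⟨h.density.trans this, h.grad.trans this, h.lap.trans this⟩

theorem BoundsHm.mono {m : ℕ} (h : BoundsHm K m u) (hK : K ≤ K') : BoundsHm K' m u := by
  refine ⟨fun p h1 h2 => (h.density p h1 h2).trans ?_, fun p h1 h2 => (h.grad p h1 h2).trans ?_,
    fun j => (h.sobolev j).trans ?_⟩ <;> gcongr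

theorem BoundsHinfty.mono (h : BoundsHinfty K u) (hK : K ≤ K') : BoundsHinfty K' u := by
  refine ⟨h.boundsH2.mono hK, h.density.trans ?_, h.grad.trans ?_⟩ <;> gcongr

end BoundsMono

section Constants

theorem integral_dens {n : ℕ} {U : Fin (n + 1) → L2 Plane} (hO : Orthonormal ℂ U) :
    ∫ x, dens U x = (n + 1 : ℕ) := by
  have := convDens_one hO 0
  simp only [convDens, one_mul] at this
  rw [this]
  push_cast
  rfl

theorem exists_pow_four_bound {s p : ℝ} (hs : 0 ≤ s) (hp : 1 < p)
    (hsp : s < 1 / 2 * (1 - 1 / p)) : ∃ c : ℝ, 0 ≤ c ∧ ∀ (n : ℕ) (U : Fin (n + 1) → L2 Plane),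
      Orthonormal ℂ U → ∀ (R : ℝ), 0 < R → ∀ D : ℝ, Integrable (fun x => dens U x ^ p) →
      ∫ x, dens U x ^ p ≤ D * (n + 1 : ℕ) → ∀ x, ∫ y, ‖vecPot (n + 1) R s (x - y)‖ ^ 4 * dens U y ≤
        (c + D + 1) / ((n + 1 : ℕ) : ℝ) ^ 3 := by
  obtain ⟨c, hc, h⟩ := exists_integral_pow_four_le hs hp hsp
  exact ⟨c, hc, fun n U hO R hR D hi hD => h (n + 1) n.succ_pos R hR _ D (dens_nonneg U)
    (integrable_dens U) (integral_dens hO) hi hD⟩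

variable {s : ℝ} (hs : 0 ≤ s) {K : ℝ} (hK : 1 ≤ K)

include hs hK

/-- The exponent p = 2: the bound on ‖ρ‖₂² is the moment required, and ½(1 - ½) = ¼ is the range of
s. -/
theorem exists_bound_of_boundsH2 (h4 : s < 1 / 4) : ∃ C : ℝ, 0 ≤ C ∧ ∀ (n : ℕ) (R : ℝ), 0 < R →
    ∀ (u : Fin (n + 1) → Plane → ℂ) (U : Fin (n + 1) → L2 Plane)
      (U₁ U₂ : Fin 2 → Fin (n + 1) → L2 Plane), (∀ j, U j =ᵐ[volume] u j) → Orthonormal ℂ U →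
      (∀ c j, HasMom (dir c) (U j) (U₁ c j)) → (∀ c j, HasMom (dir c) (U₁ c j) (U₂ c j)) →
      BoundsH2 K u → OrbitalBounds R s C U U₁ U₂ := by
  obtain ⟨c, hc, hb⟩ := exists_pow_four_bound (s := s) (p := 2) hs (by norm_num) (by linarith)
  refine ⟨c + K + 1, by linarith, fun n R hR u U U₁ U₂ hU hO h₁ h₂ h => ?_⟩
  have hN : (0 : ℝ) < (n + 1 : ℕ) := by positivity
  have hKN : 0 ≤ K * (n + 1 : ℕ) := by positivity
  have hle : K * ((n + 1 : ℕ) : ℝ) ≤ (c + K + 1) * (n + 1) := by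
    push_cast
    gcongr
    linarith
  have hsq : eLpNorm (dens U) (ENNReal.ofReal 2) volume ≤ ENNReal.ofReal √(K * (n + 1 : ℕ)) := by
    have := h.density
    rw [← eLpNorm_congr_ae (density_ae hU), ← Real.sq_sqrt hKN,
      ENNReal.ofReal_pow (Real.sqrt_nonneg _)] at this
    rw [ENNReal.ofReal_ofNat]
    exact le_of_not_gt fun hlt => not_le_of_gt (ENNReal.pow_lt_pow_left two_ne_zero hlt) this
  obtain ⟨hi, hI⟩ := integrable_rpow_of_eLpNorm_le (measurable_dens U) (dens_nonneg U)
    (by norm_num) (Real.sqrt_nonneg _) hsq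
  rw [Real.rpow_two, Real.sq_sqrt hKN] at hI
  exact ⟨hb n U hO R hR K hi hI, fun c => (sum_grad_le hU h₁ hKN h.grad c).trans hle,
    (sum_lap_le hU h₁ h₂ hKN h.lap).trans hle⟩

/-- The exponent p = m. The Laplacians are bounded one orbital at a time through the Sobolev norms,
and summing over the orbitals gives the factor N. -/
theorem exists_bound_of_boundsHm {m : ℕ} (hm : 2 ≤ m) (hsm : s < 1 / 2 * (1 - 1 / (m : ℝ))) :
    ∃ C : ℝ, 0 ≤ C ∧ ∀ (n : ℕ) (R : ℝ), 0 < R →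
    ∀ (u : Fin (n + 1) → Plane → ℂ) (U : Fin (n + 1) → L2 Plane)
      (U₁ U₂ : Fin 2 → Fin (n + 1) → L2 Plane), (∀ j, U j =ᵐ[volume] u j) → Orthonormal ℂ U →
      (∀ c j, HasMom (dir c) (U j) (U₁ c j)) → (∀ c j, HasMom (dir c) (U₁ c j) (U₂ c j)) →
      BoundsHm K m u → OrbitalBounds R s C U U₁ U₂ := by
  have hm1 : (1 : ℝ) < m := by exact_mod_cast hm
  have hm0 : (0 : ℝ) < m := by linarith
  obtain ⟨c, hc, hb⟩ := exists_pow_four_bound hs hm1 hsm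
  have hKm : 0 ≤ K ^ (m : ℝ) := by positivity
  refine ⟨c + K ^ (m : ℝ) + 1 + (K + 2 * K ^ 2 * 2), by positivity,
    fun n R hR u U U₁ U₂ hU hO h₁ h₂ h => ?_⟩
  have hN : (0 : ℝ) < (n + 1 : ℕ) := by positivity
  have hd := h.density m hm1.le (by linarith)
  rw [← eLpNorm_congr_ae (density_ae hU)] at hd
  obtain ⟨hi, hI⟩ := integrable_rpow_of_eLpNorm_le (measurable_dens U) (dens_nonneg U) hm0
    (by positivity) hd
  rw [Real.mul_rpow (by positivity) (by positivity), ← Real.rpow_mul hN.le, one_div,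
    inv_mul_cancel₀ hm0.ne', Real.rpow_one] at hI
  have hg := h.grad 1 le_rfl (by linarith)
  rw [ENNReal.ofReal_one, div_one, Real.rpow_one] at hg
  refine ⟨fun x => (hb n U hO R hR _ hi hI x).trans ?_, fun c' => ?_, ?_⟩
  · have : 0 ≤ K + 2 * K ^ 2 * 2 := by positivity
    exact div_le_div_of_nonneg_right (by linarith) (by positivity)
  · refine (sum_grad_le hU h₁ (by positivity) hg c').trans ?_
    push_cast
    gcongr
    nlinarith
  · refine (Finset.sum_le_sum fun j _ =>
      norm_sq_lap_le hU h₁ h₂ hm (by linarith) j (h.sobolev j)).trans ?_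
    rw [Finset.sum_const, Finset.card_univ, Fintype.card_fin, nsmul_eq_mul, mul_comm]
    push_cast
    gcongr
    linarith

theorem exists_bound_of_boundsHinfty (h2 : s < 1 / 2) : ∃ C : ℝ, 0 ≤ C ∧ ∀ (n : ℕ) (R : ℝ), 0 < R →
    ∀ (u : Fin (n + 1) → Plane → ℂ) (U : Fin (n + 1) → L2 Plane)
      (U₁ U₂ : Fin 2 → Fin (n + 1) → L2 Plane), (∀ j, U j =ᵐ[volume] u j) → Orthonormal ℂ U →
      (∀ c j, HasMom (dir c) (U j) (U₁ c j)) → (∀ c j, HasMom (dir c) (U₁ c j) (U₂ c j)) →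
      BoundsHinfty K u → OrbitalBounds R s C U U₁ U₂ := by
  -- A bounded density of mass N has all moments of order N, so p is free. For this one ½(1 - 1/p) =
  -- ¼ + s/2, which exceeds s exactly because s < ½.
  set p : ℝ := 2 / (1 - 2 * s) with hp
  have h12 : 0 < 1 - 2 * s := by linarith
  have hp1 : 1 < p := by
    rw [hp, lt_div_iff₀ h12]
    linarith
  obtain ⟨c, hc, hb⟩ := exists_pow_four_bound (p := p) hs hp1 (by
    rw [hp, one_div_div]
    linarith)
  have hKp : 0 ≤ K ^ (p - 1) := by positivity
  refine ⟨c + K ^ (p - 1) + 1 + K, by positivity, fun n R hR u U U₁ U₂ hU hO h₁ h₂ h => ?_⟩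
  have hN : (0 : ℝ) < (n + 1 : ℕ) := by positivity
  have hKN : 0 ≤ K * (n + 1 : ℕ) := by positivity
  have hle : K * ((n + 1 : ℕ) : ℝ) ≤ (c + K ^ (p - 1) + 1 + K) * (n + 1) := by
    push_cast
    gcongr
    linarith
  have hae : ∀ᵐ x, dens U x ≤ K := by
    have hd := h.density
    rw [← eLpNorm_congr_ae (density_ae hU), eLpNorm_exponent_top] at hd
    filter_upwards [ae_le_eLpNormEssSup (f := dens U) (μ := volume)] with x hx
    have h3 := hx.trans hd
    rw [← ofReal_norm, ENNReal.ofReal_le_ofReal_iff (by linarith),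
      Real.norm_of_nonneg (dens_nonneg U x)] at h3
    exact h3
  have hpt : ∀ᵐ x, dens U x ^ p ≤ K ^ (p - 1) * dens U x := by
    filter_upwards [hae] with x hx
    rcases (dens_nonneg U x).eq_or_lt with h0 | h0
    · rw [← h0, Real.zero_rpow (by linarith), mul_zero]
    · have e : dens U x ^ p = dens U x ^ (p - 1) * dens U x := by
        rw [← Real.rpow_add_one h0.ne', sub_add_cancel]
      rw [e]
      gcongr
  have hi : Integrable fun x => dens U x ^ p := by
    refine ((integrable_dens U).const_mul (K ^ (p - 1))).mono'
      ((measurable_dens U).pow_const p).aestronglyMeasurable ?_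
    filter_upwards [hpt] with x hx
    rwa [Real.norm_of_nonneg (Real.rpow_nonneg (dens_nonneg U x) p)]
  have hI : ∫ x, dens U x ^ p ≤ K ^ (p - 1) * (n + 1 : ℕ) := by
    rw [← integral_dens hO, ← integral_const_mul]
    exact integral_mono_ae hi ((integrable_dens U).const_mul _) hpt
  refine ⟨fun x => (hb n U hO R hR _ hi hI x).trans ?_,
    fun c => (sum_grad_le hU h₁ hKN h.boundsH2.grad c).trans hle,
    (sum_lap_le hU h₁ h₂ hKN h.boundsH2.lap).trans hle⟩
  exact div_le_div_of_nonneg_right (by linarith) (by positivity)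

omit hK in
theorem exists_orbitalBounds (K : ℝ) {m : ℕ} (hm : 2 ≤ m) : ∃ C : ℝ, 0 ≤ C ∧
    ∀ (r : ℝ), 0 ≤ r → ∀ (n : ℕ) (R : ℝ), 0 < R →
    ∀ (u : Fin (n + 1) → Plane → ℂ) (U : Fin (n + 1) → L2 Plane)
      (U₁ U₂ : Fin 2 → Fin (n + 1) → L2 Plane), (∀ j, U j =ᵐ[volume] u j) → Orthonormal ℂ U →
      (∀ c j, HasMom (dir c) (U j) (U₁ c j)) → (∀ c j, HasMom (dir c) (U₁ c j) (U₂ c j)) →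
      Admissible s r K m u → OrbitalBounds R s C U U₁ U₂ := by
  -- K carries no sign. The bounds are monotone in it, so it is enlarged to at least 1.
  have hK : 1 ≤ max K 1 := le_max_right _ _
  -- The constant must be fixed before r, N and the orbitals, hence before the regime is known. A
  -- regime whose condition on s fails receives the dummy constant 0, and the three constants are
  -- added.
  have e1 : ∃ C : ℝ, 0 ≤ C ∧ (s < 1 / 4 → ∀ (n : ℕ) (R : ℝ), 0 < R →
    ∀ (u : Fin (n + 1) → Plane → ℂ) (U : Fin (n + 1) → L2 Plane)
      (U₁ U₂ : Fin 2 → Fin (n + 1) → L2 Plane), (∀ j, U j =ᵐ[volume] u j) → Orthonormal ℂ U →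
      (∀ c j, HasMom (dir c) (U j) (U₁ c j)) → (∀ c j, HasMom (dir c) (U₁ c j) (U₂ c j)) →
      BoundsH2 (max K 1) u → OrbitalBounds R s C U U₁ U₂) := by
    by_cases h : s < 1 / 4
    · obtain ⟨C, hC, hb⟩ := exists_bound_of_boundsH2 hs hK h
      exact ⟨C, hC, fun _ => hb⟩
    · exact ⟨0, le_rfl, fun h' => absurd h' h⟩
  have e2 : ∃ C : ℝ, 0 ≤ C ∧ (s < 1 / 2 * (1 - 1 / (m : ℝ)) → ∀ (n : ℕ) (R : ℝ), 0 < R →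
    ∀ (u : Fin (n + 1) → Plane → ℂ) (U : Fin (n + 1) → L2 Plane)
      (U₁ U₂ : Fin 2 → Fin (n + 1) → L2 Plane), (∀ j, U j =ᵐ[volume] u j) → Orthonormal ℂ U →
      (∀ c j, HasMom (dir c) (U j) (U₁ c j)) → (∀ c j, HasMom (dir c) (U₁ c j) (U₂ c j)) →
      BoundsHm (max K 1) m u → OrbitalBounds R s C U U₁ U₂) := by
    by_cases h : s < 1 / 2 * (1 - 1 / (m : ℝ))
    · obtain ⟨C, hC, hb⟩ := exists_bound_of_boundsHm hs hK hm h
      exact ⟨C, hC, fun _ => hb⟩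
    · exact ⟨0, le_rfl, fun h' => absurd h' h⟩
  have e3 : ∃ C : ℝ, 0 ≤ C ∧ (s < 1 / 2 → ∀ (n : ℕ) (R : ℝ), 0 < R →
    ∀ (u : Fin (n + 1) → Plane → ℂ) (U : Fin (n + 1) → L2 Plane)
      (U₁ U₂ : Fin 2 → Fin (n + 1) → L2 Plane), (∀ j, U j =ᵐ[volume] u j) → Orthonormal ℂ U →
      (∀ c j, HasMom (dir c) (U j) (U₁ c j)) → (∀ c j, HasMom (dir c) (U₁ c j) (U₂ c j)) →
      BoundsHinfty (max K 1) u → OrbitalBounds R s C U U₁ U₂) := by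
    by_cases h : s < 1 / 2
    · obtain ⟨C, hC, hb⟩ := exists_bound_of_boundsHinfty hs hK h
      exact ⟨C, hC, fun _ => hb⟩
    · exact ⟨0, le_rfl, fun h' => absurd h' h⟩
  obtain ⟨C₁, hC₁, hb₁⟩ := e1
  obtain ⟨C₂, hC₂, hb₂⟩ := e2
  obtain ⟨C₃, hC₃, hb₃⟩ := e3
  refine ⟨C₁ + C₂ + C₃, by linarith, fun r hr n R hR u U U₁ U₂ hU hO h₁ h₂ h => ?_⟩
  rcases h with ⟨hsr, h⟩ | ⟨hsm, h⟩ | ⟨hs2, h⟩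
  · have hs4 : s < 1 / 4 := by nlinarith [mul_nonneg hs hr]
    exact (hb₁ hs4 n R hR u U U₁ U₂ hU hO h₁ h₂ (h.mono (le_max_left _ _))).mono (by linarith)
  · exact (hb₂ hsm n R hR u U U₁ U₂ hU hO h₁ h₂ (h.mono (le_max_left _ _))).mono (by linarith)
  · exact (hb₃ hs2 n R hR u U U₁ U₂ hU hO h₁ h₂ (h.mono (le_max_left _ _))).mono (by linarith)

end Constants

/-! ### Control of the kinetic energy of the excited particles -/

open Classical in
/-- The class in `L²` of a function (zero if the function is not in `L²`). -/
def toL2 {X : Type*} [MeasureSpace X] (f : X → ℂ) : L2 X :=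
  if h : MemLp f 2 volume then h.toLp f else 0

theorem toL2_ae {X : Type*} [MeasureSpace X] {f : X → ℂ} (h : MemLp f 2 volume) :
    toL2 f =ᵐ[volume] f := by
  rw [toL2, dif_pos h]
  exact h.coeFn_toLp

theorem toL2_smul_ae {X : Type*} [MeasureSpace X] {f : X → ℂ} {F : L2 X} (c : ℂ)
    (h : F =ᵐ[volume] f) : ⇑(c • F) =ᵐ[volume] fun x => c * f x := by
  filter_upwards [Lp.coeFn_smul c F, h] with x h1 h2
  rw [h1, Pi.smul_apply, h2, smul_eq_mul]

section Evolution

variable {n : ℕ} {R s β g T : ℝ}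

/-- At each time all orbitals are driven by the same symmetric operator, which depends on them only
through densities and currents, so their inner products are conserved. -/
theorem IsEffectiveSolution.orthonormal_toL2 (hR : 0 < R) (hs : 0 ≤ s) {m : ℕ} (hm : 2 ≤ m)
    {u : ℝ → Fin (n + 1) → Plane → ℂ} (h : IsEffectiveSolution R s β g m T u) {t : ℝ}
    (ht : t ∈ Icc 0 T) : Orthonormal ℂ fun j => toL2 (u t j) := by
  have hrep : ∀ τ ∈ Icc 0 T, ∀ j, toL2 (u τ j) =ᵐ[volume] u τ j := fun τ hτ j =>
    toL2_ae (h.regular τ hτ j).memLp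
  -- Outside [0, T] a dummy value is allowed, so that a function of time can be chosen.
  have hH : ∀ τ, ∃ H : Fin (n + 1) → L2 Plane, τ ∈ Icc 0 T →
      (∀ j, H j =ᵐ[volume] hartreeOp R s β g (u τ) (u τ j)) ∧
      ∀ i j, ⟪H i, toL2 (u τ j)⟫_ℂ = ⟪toL2 (u τ i), H j⟫_ℂ := fun τ => by
    by_cases hτ : τ ∈ Icc 0 T
    · choose U₁ U₂ h₁ h₂ using fun c j =>
        ((h.regular τ hτ j).mono hm).exists_hasMom (hrep τ hτ j) (dir c)
      obtain ⟨H, hH⟩ := exists_hartreeOp (β := β) (g := g) (hrep τ hτ) hR hs h₁ h₂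
      exact ⟨H, fun _ => hH⟩
    · exact ⟨0, fun h' => absurd h' hτ⟩
  choose H hH using hH
  have hder : ∀ j, ∀ τ ∈ Icc 0 T,
      HasDerivWithinAt (fun τ => toL2 (u τ j)) (-Complex.I • H τ j) (Icc 0 T) τ := fun j τ hτ =>
    (h.equation τ hτ j).hasDerivWithinAt hτ (fun r hr => hrep r hr j)
      (toL2_smul_ae _ ((hH τ hτ).1 j))
  have h0 : (0 : ℝ) ∈ Icc 0 T := ⟨le_rfl, ht.1.trans ht.2⟩
  rw [orthonormal_iff_ite]
  intro i j
  have key := inner_eq_of_schrodinger (hder i) (hder j) (fun τ hτ => (hH τ hτ).2 i j) t ht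
  rw [key, inner_L2_of_ae (hrep 0 h0 i) (hrep 0 h0 j), h.orthonormal]

/-- The norm is conserved because the form of `exists_hamiltonian` is real. -/
theorem IsSchrodingerSolution.norm_toL2 (hR : 0 < R) (hs : 0 ≤ s)
    {Ψ : ℝ → Config (n + 1) → ℂ} (h : IsSchrodingerSolution (n + 1) R s β g T Ψ) {t : ℝ}
    (ht : t ∈ Icc 0 T) : ‖toL2 (Ψ t)‖ = ‖toL2 (Ψ 0)‖ := by
  have hrep : ∀ τ ∈ Icc 0 T, toL2 (Ψ τ) =ᵐ[volume] Ψ τ := fun τ hτ =>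
    toL2_ae (h.regular τ hτ).memLp
  have hH : ∀ τ, ∃ H : L2 (Config (n + 1)), τ ∈ Icc 0 T →
      H =ᵐ[volume] hamiltonian (n + 1) R s β g (Ψ τ) ∧
      ⟪H, toL2 (Ψ τ)⟫_ℂ = ⟪toL2 (Ψ τ), H⟫_ℂ := fun τ => by
    by_cases hτ : τ ∈ Icc 0 T
    · choose F₁ F₂ h₁ h₂ using fun j c =>
        (h.regular τ hτ).exists_hasMom (hrep τ hτ) (dirN j c)
      obtain ⟨H, hH, hin⟩ := exists_hamiltonian (β := β) (g := g) hR hs (hrep τ hτ) h₁ h₂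
      refine ⟨H, fun _ => ⟨hH, ?_⟩⟩
      rw [← inner_conj_symm, hin, map_add, inner_conj_symm,
        inner_mulOp_left (isMult_pairEnergy hR hs)]
      simp only [map_sum, inner_conj_symm]
    · exact ⟨0, fun h' => absurd h' hτ⟩
  choose H hH using hH
  have hder : ∀ τ ∈ Icc 0 T,
      HasDerivWithinAt (fun τ => toL2 (Ψ τ)) (-Complex.I • H τ) (Icc 0 T) τ := fun τ hτ =>
    (h.equation τ hτ).hasDerivWithinAt hτ hrep (toL2_smul_ae _ (hH τ hτ).1)
  have key := inner_eq_of_schrodinger hder hder (fun τ hτ => (hH τ hτ).2) t ht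
  have h2 : ‖toL2 (Ψ t)‖ ^ 2 = ‖toL2 (Ψ 0)‖ ^ 2 := by
    rw [← re_inner_self, ← re_inner_self, key]
  exact (sq_eq_sq₀ (norm_nonneg _) (norm_nonneg _)).1 h2

end Evolution

/-- The estimate at a fixed time, from which the dynamics has disappeared: orthonormality of the
orbitals, normalization and antisymmetry of the state are hypotheses. The factor 4 undoes the
fraction ¼ of the kinetic energy that survives, and C₀ + 1 is the constant of `meanField_vecPot`. -/
theorem exists_weakDeriv_qOp_le {n : ℕ} {R s β g C₀ : ℝ} (hR : 0 < R) (hs : 0 ≤ s) (hβ : 0 ≤ β)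
    (hg : 12 * β ^ 2 ≤ g) (hC₀ : 0 ≤ C₀) {u : Fin (n + 1) → Plane → ℂ} {Ψ : Config (n + 1) → ℂ}
    {U : Fin (n + 1) → L2 Plane} {U₁ U₂ : Fin 2 → Fin (n + 1) → L2 Plane}
    (hU : ∀ j, U j =ᵐ[volume] u j) (hO : Orthonormal ℂ U)
    (h₁ : ∀ c j, HasMom (dir c) (U j) (U₁ c j)) (h₂ : ∀ c j, HasMom (dir c) (U₁ c j) (U₂ c j))
    (hB : OrbitalBounds R s C₀ U U₁ U₂) {F : L2 (Config (n + 1))} (hF : F =ᵐ[volume] Ψ)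
    (hreg : MemSobolev 2 Ψ) (hanti : AntisymOn univ F) (hnorm : ‖F‖ = 1) :
    ∃ G : Fin 2 → Config (n + 1) → ℂ,
      (∀ c, MemLp (G c) 2 volume ∧ HasWeakDeriv (dirN 0 c) (qOp u 0 Ψ) (G c)) ∧
      ∑ c, ∫ x, ‖G c x‖ ^ 2 ≤ 4 * (1 + |energyConst β g (C₀ + 1)|) *
        (|manyBodyEnergy (n + 1) R s β g Ψ - hartreeEnergy R s β g u| / (n + 1 : ℕ)
          + alphaM u Ψ + 1 / √((n + 1 : ℕ) : ℝ)) := by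
  have hMF := meanField_vecPot hO hR hs hB.pow_four hC₀ le_rfl h₁ h₂
    (hB.mono (by linarith)).grad (hB.mono (by linarith)).lap
  choose Ψ₁ Ψ₂ hΨ₁ hΨ₂ using fun c => hreg.exists_hasMom hF (dirN 0 c)
  have hmain := hMF.excited_kinetic_le hO (by linarith) hanti hβ hg hnorm hΨ₁
  have hmom : ∀ c, HasMom (dirN 0 c) ((proj hO).q 0 F) (Ψ₁ c - bOp U (U₁ c) 0 F) := fun c => by
    rw [CommProj.q_apply, proj_p]
    exact (hΨ₁ c).sub (HasMom.bOp (h₁ c) 0 F)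
  refine ⟨fun c => ⇑(Complex.I • (Ψ₁ c - bOp U (U₁ c) 0 F)), fun c => ⟨Lp.memLp _, ?_⟩, ?_⟩
  · exact (HasSD.hasWeakDeriv (hmom c)).congr (q_ae hU hO 0 hF) EventuallyEq.rfl
  · simp only [← norm_sq_L2, norm_smul, Complex.norm_I, one_mul]
    have hN : (0 : ℝ) < (n + 1 : ℕ) := by positivity
    have hm := manyBodyEnergy_eq (β := β) (g := g) hanti hR hs hF hreg hΨ₁
    have hh := hartreeEnergy_eq (β := β) (g := g) hU hR hs h₁
    rw [← hh] at hmain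
    have hexc := excitation_le hU hO hF hnorm
    have hexc0 := (proj hO).excitation_nonneg F
    set D := |manyBodyEnergy (n + 1) R s β g Ψ - hartreeEnergy R s β g u| / ((n + 1 : ℕ) : ℝ)
      with hD
    have hD0 : 0 ≤ D := by positivity
    have hdiff : manyBodyEnergy (n + 1) R s β g Ψ / ((n + 1 : ℕ) : ℝ) -
        hartreeEnergy R s β g u / ((n + 1 : ℕ) : ℝ) ≤ D := by
      rw [← sub_div]
      exact div_le_div_of_nonneg_right (le_abs_self _) hN.le
    have e : ((n + 1 : ℕ) : ℝ) = n + 1 := by push_cast; rfl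
    rw [hm, e, mul_div_cancel_left₀ _ (by positivity)] at hdiff
    have hE := mul_le_mul_of_nonneg_right (le_abs_self (energyConst β g (C₀ + 1))) hexc0
    have hE2 := mul_le_mul_of_nonneg_left hexc (abs_nonneg (energyConst β g (C₀ + 1)))
    have hE3 := mul_nonneg (abs_nonneg (energyConst β g (C₀ + 1))) hD0
    nlinarith

end MagneticFermions

end

open MeasureTheory MagneticFermions
theorem lemma7p2 (s β g K : ℝ) (m : ℕ) (hs : 0 ≤ s) (hβ : 0 ≤ β) (hm : 2 ≤ m)
    (hg : 12 * β ^ 2 ≤ g) :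
    ∃ C : ℝ, 0 < C ∧
      ∀ (N : ℕ) (hN : 0 < N) (r T : ℝ), 0 ≤ r →
      ∀ (u : ℝ → Fin N → Plane → ℂ) (Ψ : ℝ → Config N → ℂ),
        IsEffectiveSolution ((N : ℝ) ^ (-r)) s β g m T u →
        IsSchrodingerSolution N ((N : ℝ) ^ (-r)) s β g T Ψ →
        Ψ 0 =ᵐ[volume] slater (u 0) →
        ∀ t ∈ Set.Icc 0 T, Admissible s r K m (u t) →
          ∃ G : Fin 2 → Config N → ℂ,
            (∀ c, MemLp (G c) 2 volume ∧
              HasWeakDeriv (dirN ⟨0, hN⟩ c) (qOp (u t) ⟨0, hN⟩ (Ψ t)) (G c)) ∧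
            ∑ c, ∫ x, ‖G c x‖ ^ 2 ≤
              C * (|manyBodyEnergy N ((N : ℝ) ^ (-r)) s β g (Ψ t)
                      - hartreeEnergy ((N : ℝ) ^ (-r)) s β g (u t)| / N
                    + alphaM (u t) (Ψ t) + 1 / Real.sqrt N) := by
  obtain ⟨C₀, hC₀, hbound⟩ := exists_orbitalBounds hs K hm
  refine ⟨4 * (1 + |energyConst β g (C₀ + 1)|), by positivity, ?_⟩
  intro N hN r T hr u Ψ hu hΨ hinit t ht hadm
  obtain ⟨n, rfl⟩ : ∃ n, N = n + 1 := ⟨N - 1, by omega⟩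
  have hR : 0 < ((n + 1 : ℕ) : ℝ) ^ (-r) := by positivity
  have h0 : (0 : ℝ) ∈ Set.Icc 0 T := ⟨le_rfl, ht.1.trans ht.2⟩
  have hU : ∀ j, toL2 (u t j) =ᵐ[volume] u t j := fun j => toL2_ae (hu.regular t ht j).memLp
  have hO := hu.orthonormal_toL2 hR hs hm ht
  have hF : toL2 (Ψ t) =ᵐ[volume] Ψ t := toL2_ae (hΨ.regular t ht).memLp
  -- The norm is carried back to time 0, where the state is a Slater determinant of orthonormal
  -- orbitals.
  have hnorm : ‖toL2 (Ψ t)‖ = 1 := by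
    rw [hΨ.norm_toL2 hR hs ht]
    exact norm_slater (fun j => toL2_ae (hu.regular 0 h0 j).memLp)
      (hu.orthonormal_toL2 hR hs hm h0) ((toL2_ae (hΨ.regular 0 h0).memLp).trans hinit)
  choose U₁ U₂ h₁ h₂ using fun c j => ((hu.regular t ht j).mono hm).exists_hasMom (hU j) (dir c)
  exact exists_weakDeriv_qOp_le hR hs hβ hg hC₀ hU hO h₁ h₂
    (hbound r hr n _ hR (u t) _ U₁ U₂ hU hO h₁ h₂ hadm) hF (hΨ.regular t ht)
    (antisymOn_of_antisymmetric (hΨ.antisymm t ht) hF) hnorm
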